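/- **Operads.** Let $P$ be an operad in sets (with identity operations) of one of three kinds: coloured planar, coloured symmetric, or cyclic (a one-colour symmetric operad whose $S_n$-actions on $P(n)$ are extended to $S_{n+1}$-actions such that, for $\tau_n=(0\,1\dots n)$, $p\in P(m)$ and $q\in P(n)$: $(p\circ_1 q)^{\tau}=q^{\tau}\circ_n p^{\tau}$ if $n>0$; $(p\circ_1 q)^{\tau}=(p^{\tau})^{\tau}\circ_m q$ if $n=0$; $(p\circ_i q)^{\tau}=p^{\tau}\circ_{i-1}q$ for $i>1$; and $id^{\tau}=id$). Let $\psi$ be a nice grading of $P$, i.e. a map from operations to $\mathbb Z$ with $\psi(p\circ_i q)=\psi(p)+\psi(q)$, $\psi(id_c)=0$, $\psi(p^\sigma)=\psi(p)$ (in the symmetric and cyclic cases) and $\psi\ge -1$, such that operations of grading $-1$ have arity $0$, and units of binary operations (arity-$0$ operations $u$ with $m\circ_i u=id$ for some binary operation $m$ and some $i$) have grading $-1$. Suppose that operations with the same output colour and the same multiset of input colours have the same grading. **Categories.** The objects of the enveloping category $\mathcal U(P)$ are the profiles $(c_1,\dots,c_n;c_0)$ of colours; its morphisms $s\to t$ are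 the expressions of profile $t$ formed by the operad structure from operations of $P$ and exactly one variable, of profile $s$, modulo the axioms of operads and the equalities in $P$; composition is substitution. The objects of the twisted arrow category $\mathrm{Tw}(P)$ are the operations of $P$, and its morphisms $p\to q$ are the morphisms of $\mathcal U(P)$ between their profiles whose evaluation at $p$ is $q$. Let $\mathcal V(P)$ be the image of the canonical discrete opfibration $\mathrm{Tw}(P)\to\mathcal U(P)$ (the full subcategory of $\mathcal U(P)$ on the profiles of operations of $P$). **Classes of morphisms.** A morphism is canonically represented by a tree in which every other vertex is adjacent to the source vertex (marked by the variable), every edge of the source vertex leads to exactly one non-source vertex, and non-source vertices are marked by operations of $P$. Let $R_{\psi=-1}$ be the class of morphisms whose non-source vertices are all marked by identities or by operations of grading $-1$, with trivial permutation on leaves, and let $R_{\psi\ge0}$ be the class of morphisms whose non-source vertices all have grading $\ge0$. Let $R_-$ be the class of morphisms $\theta\circ f$ with $f\in R_{\psi=-1}$ and $\theta$ an isomorphism, and let $R_+=R_{\psi\geq 0}$. The analogous classes in $\mathrm{Tw}(P)$ are defined in the same way, with $R_{\psi=-1}$ and $R_{\psi\ge0}$ there being the preimages of the classes in $\mathcal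 U(P)$. An orthogonal factorization system is a pair of subcategories that contain all isomorphisms, such that every morphism factors as $r\circ l$ with $l$ in the first and $r$ in the second subcategory, uniquely up to unique isomorphism. A generalized Reedy structure is an orthogonal factorization system $(R_-,R_+)$ with a degree map from objects to an ordinal such that non-isomorphisms in $R_-$ decrease the degree, non-isomorphisms in $R_+$ increase it, isomorphisms preserve it, and $\theta\circ f=f$ with $f\in R_-$ and $\theta$ an isomorphism implies $\theta=id$. A map of generalized Reedy categories is a functor that preserves $R_-$, $R_+$ and the degree. **Theorem.** The pair $(R_-,R_+)$ is an orthogonal factorization system on $\mathcal U(P)$ and restricts to an orthogonal factorization system on $\mathcal V(P)$. There is a (unique) degree map on $\mathcal V(P)$, with values in the well-ordered set $\{-1,0,1,\dots\}$, that sends the image of any operation $p$ to $\psi(p)$. With this degree map, $(R_-,R_+)$ is a generalized Reedy structure on $\mathcal V(P)$ if and only if all operations of $P$ of grading $0$ have arity $1$ and the category $P(\psi=0)$ of these operations is a groupoid. In this case $\mathrm{Tw}(P)$, with its classes $R_-$, $R_+$ and with the degree map $\psi$, is a generalized Reedy category, and the discrete opfibration $\mathrm{Tw}(P)\to\mathcal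 V(P)$ is a map of generalized Reedy categories. -/

import Mathlib

universe u v w

open CategoryTheory

namespace EnvReedy

/-! ### Operads in sets -/

/-- A coloured planar operad (with identities) in sets, with colours `C`.  `Op [c₁, …, cₙ] c₀` is
the set of operations with input colours `c₁, …, cₙ` and output colour `c₀`.
`comp l₁ l₂ _ _ p q` is the partial composition `p ∘ᵢ q`, where the `i`-th input is the one
standing between the inputs `l₁` and the inputs `l₂` of `p`.  (The lists `a` and `r` of inputs
of `p` and of `p ∘ᵢ q` are kept as variables, so that the axioms need no transports.) -/
structure PlanarOperad (C : Type u) where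
  Op : List C → C → Type v
  id (c : C) : Op [c] c
  comp {a b r : List C} {c d : C} (l₁ l₂ : List C)
    (ha : a = l₁ ++ c :: l₂) (hr : r = l₁ ++ b ++ l₂) (p : Op a d) (q : Op b c) : Op r d
  id_comp {a : List C} {d : C} (h₁ : [d] = [] ++ d :: []) (h₂ : a = [] ++ a ++ [])
    (q : Op a d) : comp [] [] h₁ h₂ (id d) q = q
  comp_id {a : List C} {c d : C} (l₁ l₂ : List C)
    (h₁ : a = l₁ ++ c :: l₂) (h₂ : a = l₁ ++ [c] ++ l₂)
    (p : Op a d) : comp l₁ l₂ h₁ h₂ p (id c) = p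
  /-- Sequential associativity: `(p ∘ q) ∘ r = p ∘ (q ∘ r)`. -/
  assoc_seq {a b g x y z : List C} {c d e : C} (l₁ l₂ m₁ m₂ : List C)
    (h₁ : a = l₁ ++ c :: l₂) (h₂ : x = l₁ ++ b ++ l₂)
    (h₃ : x = (l₁ ++ m₁) ++ e :: (m₂ ++ l₂)) (h₄ : z = (l₁ ++ m₁) ++ g ++ (m₂ ++ l₂))
    (h₅ : b = m₁ ++ e :: m₂) (h₆ : y = m₁ ++ g ++ m₂) (h₇ : z = l₁ ++ y ++ l₂)
    (p : Op a d) (q : Op b c) (r : Op g e) :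
    comp (l₁ ++ m₁) (m₂ ++ l₂) h₃ h₄ (comp l₁ l₂ h₁ h₂ p q) r =
      comp l₁ l₂ h₁ h₇ p (comp m₁ m₂ h₅ h₆ q r)
  /-- Parallel associativity: compositions at two different inputs of `p` commute. -/
  assoc_par {a b₁ b₂ x y z : List C} {c₁ c₂ d : C} (l₁ l₂ l₃ : List C)
    (h₁ : a = l₁ ++ c₁ :: (l₂ ++ c₂ :: l₃)) (h₂ : x = l₁ ++ b₁ ++ (l₂ ++ c₂ :: l₃))
    (h₃ : x = (l₁ ++ b₁ ++ l₂) ++ c₂ :: l₃) (h₄ : z = (l₁ ++ b₁ ++ l₂) ++ b₂ ++ l₃)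
    (h₅ : a = (l₁ ++ c₁ :: l₂) ++ c₂ :: l₃) (h₆ : y = (l₁ ++ c₁ :: l₂) ++ b₂ ++ l₃)
    (h₇ : y = l₁ ++ c₁ :: (l₂ ++ b₂ ++ l₃)) (h₈ : z = l₁ ++ b₁ ++ (l₂ ++ b₂ ++ l₃))
    (p : Op a d) (q : Op b₁ c₁) (r : Op b₂ c₂) :
    comp (l₁ ++ b₁ ++ l₂) l₃ h₃ h₄ (comp l₁ (l₂ ++ c₂ :: l₃) h₁ h₂ p q) r =
      comp l₁ (l₂ ++ b₂ ++ l₃) h₇ h₈ (comp (l₁ ++ c₁ :: l₂) l₃ h₅ h₆ p r) q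

/-- The ways to reorder a list `a = [a₁, …, aₙ]` of colours into the list `b`:
permutations `σ` with `b = [a_σ(1), …, a_σ(n)]`. -/
def Perms {C : Type u} (a b : List C) : Type :=
  {σ : Fin b.length ≃ Fin a.length // ∀ k, b.get k = a.get (σ k)}

/-- The position in `p ∘ᵢ q` of the `j`-th input of `p`, `j ≠ i`, when `q` has arity `m`
(positions are counted from `0`). -/
def outerSlot (i m j : ℕ) : ℕ := if j < i then j else j + m - 1

/-- `ρ` is the permutation of the inputs of `p ∘ᵢ q` induced by the permutation `σ` of
the inputs of `p`, with `σ i' = i`, and the permutation `τ` of the inputs of `q`, so that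
`p^σ ∘_{i'} q^τ = (p ∘ᵢ q)^ρ`. -/
def IsBlockPerm (i i' : ℕ) {n n' m m' k k' : ℕ} (σ : Fin n' ≃ Fin n) (τ : Fin m' ≃ Fin m)
    (ρ : Fin k' ≃ Fin k) : Prop :=
  (∀ j : Fin n', (j : ℕ) = i' → (σ j : ℕ) = i) ∧
  (∀ (j : Fin n') (x : Fin k'), (j : ℕ) ≠ i' → (x : ℕ) = outerSlot i' m' j →
    (ρ x : ℕ) = outerSlot i m (σ j)) ∧
  (∀ (j : Fin m') (x : Fin k'), (x : ℕ) = i' + j → (ρ x : ℕ) = i + τ j)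

/-- A coloured symmetric operad in sets: symmetric groups act on the right on operations, the
`k`-th input of `p^σ` being the `σ k`-th input of `p`. -/
structure SymmetricOperad (C : Type u) extends PlanarOperad.{u, v} C where
  act {a b : List C} {d : C} (σ : Perms a b) (p : Op a d) : Op b d
  act_one {a : List C} {d : C} (σ : Perms a a) (h : σ.1 = Equiv.refl _) (p : Op a d) : act σ p = p
  act_act {a b c : List C} {d : C} (σ : Perms a b) (τ : Perms b c) (ρ : Perms a c)
    (h : ρ.1 = τ.1.trans σ.1) (p : Op a d) : act τ (act σ p) = act ρ p
  act_comp {a a' b b' r r' : List C} {c d : C} (l₁ l₂ l₁' l₂' : List C)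
    (h₁ : a = l₁ ++ c :: l₂) (h₂ : r = l₁ ++ b ++ l₂)
    (h₁' : a' = l₁' ++ c :: l₂') (h₂' : r' = l₁' ++ b' ++ l₂')
    (σ : Perms a a') (τ : Perms b b') (ρ : Perms r r')
    (h : IsBlockPerm l₁.length l₁'.length σ.1 τ.1 ρ.1) (p : Op a d) (q : Op b c) :
    comp l₁' l₂' h₁' h₂' (act σ p) (act τ q) = act ρ (comp l₁ l₂ h₁ h₂ p q)

/-- The permutations of `{0, …, n}`, where `n` is the length of both lists; `0` stands for the
output and `1, …, n` for the inputs of an operation of a one-colour operad. -/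
def CycPerms (a b : List Unit) : Type := Fin (b.length + 1) ≃ Fin (a.length + 1)

/-- The identity permutation of `{0, …, n}`. -/
def CycPerms.refl (a : List Unit) : CycPerms a a := Equiv.refl (Fin (a.length + 1))

/-- The product `σ τ`, `k ↦ σ (τ k)`, of permutations of `{0, …, n}`. -/
def CycPerms.comp {a b c : List Unit} (σ : CycPerms a b) (τ : CycPerms b c) : CycPerms a c :=
  Equiv.trans (α := Fin (c.length + 1)) (β := Fin (b.length + 1)) (γ := Fin (a.length + 1)) τ σ

/-- A permutation of the inputs `1, …, n`, extended to `{0, …, n}` by `0 ↦ 0`. -/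
def Perms.ext {a b : List Unit} (σ : Perms a b) : CycPerms a b :=
  (finSuccEquiv b.length).trans ((Equiv.optionCongr σ.1).trans (finSuccEquiv a.length).symm)

/-- The cyclic permutation `τₙ = (0 1 … n)`, `0 ↦ 1 ↦ … ↦ n ↦ 0`. -/
def rot (a : List Unit) : CycPerms a a := finRotate (a.length + 1)

/-- A cyclic operad: a one-colour symmetric operad, with the action of `Sₙ` on the operations of
arity `n` extended to an action of `Sₙ₊₁`, such that the actions of the cyclic permutations
satisfy `(p ∘₁ q)^τ = q^τ ∘ₙ p^τ` if `q` has arity `n > 0`, `(p ∘₁ q)^τ = (p^τ)^τ ∘ₘ q` if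
`q` has arity `0` and `p` has arity `m`, `(p ∘ᵢ q)^τ = p^τ ∘ᵢ₋₁ q` for `i > 1`, and
`id^τ = id`. -/
structure CyclicOperad extends SymmetricOperad.{0, v} Unit where
  cact {a b : List Unit} (σ : CycPerms a b) (p : Op a ()) : Op b ()
  cact_one {a : List Unit} (p : Op a ()) : cact (CycPerms.refl a) p = p
  cact_cact {a b c : List Unit} (σ : CycPerms a b) (τ : CycPerms b c) (p : Op a ()) :
    cact τ (cact σ p) = cact (σ.comp τ) p
  cact_ext {a b : List Unit} (σ : Perms a b) (p : Op a ()) : cact σ.ext p = act σ p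
  rot_comp_first {a b r : List Unit} (l₂ m₁ : List Unit)
    (h₁ : a = [] ++ () :: l₂) (h₂ : r = [] ++ b ++ l₂)
    (h₃ : b = m₁ ++ () :: []) (h₄ : r = m₁ ++ a ++ []) (p : Op a ()) (q : Op b ()) :
    cact (rot r) (comp [] l₂ h₁ h₂ p q) = comp m₁ [] h₃ h₄ (cact (rot b) q) (cact (rot a) p)
  rot_comp_first_nullary {a r : List Unit} (l₂ m₁ : List Unit)
    (h₁ : a = [] ++ () :: l₂) (h₂ : r = [] ++ [] ++ l₂)
    (h₃ : a = m₁ ++ () :: []) (h₄ : r = m₁ ++ [] ++ []) (p : Op a ()) (q : Op [] ()) :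
    cact (rot r) (comp [] l₂ h₁ h₂ p q) =
      comp m₁ [] h₃ h₄ (cact (rot a) (cact (rot a) p)) q
  rot_comp_other {a b r : List Unit} (l₁ l₂ : List Unit)
    (h₁ : a = (() :: l₁) ++ () :: l₂) (h₂ : r = (() :: l₁) ++ b ++ l₂)
    (h₃ : a = l₁ ++ () :: (l₂ ++ [()])) (h₄ : r = l₁ ++ b ++ (l₂ ++ [()]))
    (p : Op a ()) (q : Op b ()) :
    cact (rot r) (comp (() :: l₁) l₂ h₁ h₂ p q) =
      comp l₁ (l₂ ++ [()]) h₃ h₄ (cact (rot a) p) q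
  rot_id : cact (rot [()]) (id ()) = id ()

/-! ### Gradings -/

/-- The predicate "is an identity operation". -/
inductive PlanarOperad.IsId {C : Type u} (P : PlanarOperad.{u, v} C) :
    ∀ {a : List C} {d : C}, P.Op a d → Prop
  | mk (c : C) : PlanarOperad.IsId P (P.id c)

/-- Nice gradings of a planar operad. -/
structure NiceGrading {C : Type u} (P : PlanarOperad.{u, v} C) where
  deg {a : List C} {d : C} (p : P.Op a d) : ℤ
  deg_comp {a b r : List C} {c d : C} (l₁ l₂ : List C)
    (ha : a = l₁ ++ c :: l₂) (hr : r = l₁ ++ b ++ l₂) (p : P.Op a d) (q : P.Op b c) :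
    deg (P.comp l₁ l₂ ha hr p q) = deg p + deg q
  deg_id (c : C) : deg (P.id c) = 0
  neg_one_le {a : List C} {d : C} (p : P.Op a d) : -1 ≤ deg p
  /-- Operations of grading `-1` have arity `0`. -/
  arity_eq_zero {a : List C} {d : C} (p : P.Op a d) (h : deg p = -1) : a.length = 0
  /-- Units of binary operations have grading `-1`. -/
  deg_unit {a r : List C} {c d : C} (l₁ l₂ : List C)
    (ha : a = l₁ ++ c :: l₂) (hr : r = l₁ ++ [] ++ l₂) (m : P.Op a d) (q : P.Op [] c)
    (h2 : a.length = 2) (h : P.IsId (P.comp l₁ l₂ ha hr m q)) : deg q = -1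

/-- Nice gradings of a symmetric operad. -/
structure SymNiceGrading {C : Type u} (P : SymmetricOperad.{u, v} C) extends
    NiceGrading P.toPlanarOperad where
  deg_act {a b : List C} {d : C} (σ : Perms a b) (p : P.Op a d) : deg (P.act σ p) = deg p

/-- Operations with the same multiset of input colours and the same output colour have the same
grading. -/
def NiceGrading.DependsOnColours {C : Type u} {P : PlanarOperad.{u, v} C} (ψ : NiceGrading P) :
    Prop :=
  ∀ {a b : List C} {d : C} (p : P.Op a d) (q : P.Op b d), (a : Multiset C) = b → ψ.deg p = ψ.deg q

/-- The colours, as objects of the category `P(ψ = 0)`. -/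
structure GrZero {C : Type u} {P : PlanarOperad.{u, v} C} (ψ : NiceGrading P) where
  colour : C

/-- The category `P(ψ = 0)` of operations of arity `1` and grading `0`. -/
instance {C : Type u} {P : PlanarOperad.{u, v} C} (ψ : NiceGrading P) : Category (GrZero ψ) where
  Hom c d := {p : P.Op [c.colour] d.colour // ψ.deg p = 0}
  id c := ⟨P.id c.colour, ψ.deg_id _⟩
  comp {c d e} f g := ⟨P.comp (a := [d.colour]) (r := [c.colour]) [] [] rfl rfl g.1 f.1, by
    rw [ψ.deg_comp, f.2, g.2, add_zero]⟩
  id_comp f := Subtype.ext (P.comp_id [] [] rfl rfl f.1)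
  comp_id f := Subtype.ext (P.id_comp rfl rfl f.1)
  assoc f g h := Subtype.ext
    (P.assoc_seq [] [] [] [] rfl rfl rfl rfl rfl rfl rfl h.1 g.1 f.1).symm

/-- All operations of grading `0` have arity `1`, and the category of these operations is a
groupoid. -/
def NiceGrading.IsGroupoidal {C : Type u} {P : PlanarOperad.{u, v} C} (ψ : NiceGrading P) :
    Prop :=
  (∀ {a : List C} {d : C} (p : P.Op a d), ψ.deg p = 0 → a.length = 1) ∧ IsGroupoid (GrZero ψ)

/-! ### Enveloping categories

The objects of the enveloping category `U(P)` are the possible profiles `(c₁, …, cₙ; c₀)` of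
operations.  A morphism from `s` to `t` is an expression of profile `t` formed, by means of the
operad structure, of operations of `P` and of exactly one variable `h`, of profile `s`, with
expressions identified according to the axioms of operads and to the equalities that hold in `P`.
After evaluation of the subexpressions without variable such an expression is a string of
elementary expressions `h ∘ᵢ q`, `p ∘ᵢ h` and `h^σ`, and the identifications are
the axioms of operads, where one of the operations is the variable `h` and the others are in `P`. -/

section Env

variable {C : Type u}

/-- Elementary expressions with one variable `h`.  `G a b` is the set of allowed permutations. -/
inductive Move (P : PlanarOperad.{u, v} C) (G : List C → List C → Type) :
    List C × C → List C × C → Type (max u v)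
  /-- `h ∘ᵢ q` -/
  | plug {a b r : List C} {c d : C} (l₁ l₂ : List C) (ha : a = l₁ ++ c :: l₂)
      (hr : r = l₁ ++ b ++ l₂) (q : P.Op b c) : Move P G (a, d) (r, d)
  /-- `p ∘ᵢ h` -/
  | graft {a b r : List C} {c d : C} (l₁ l₂ : List C) (ha : a = l₁ ++ c :: l₂)
      (hr : r = l₁ ++ b ++ l₂) (p : P.Op a d) : Move P G (b, c) (r, d)
  /-- `h^σ` -/
  | perm {a b : List C} {d : C} (σ : G a b) : Move P G (a, d) (b, d)

/-- Evaluation of an elementary expression at an operation of `P`. -/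
def Move.eval {P : PlanarOperad.{u, v} C} {G : List C → List C → Type}
    (actG : ∀ {a b : List C} {d : C}, G a b → P.Op a d → P.Op b d) {s t : List C × C} :
    Move P G s t → P.Op s.1 s.2 → P.Op t.1 t.2
  | .plug l₁ l₂ ha hr q, h => P.comp l₁ l₂ ha hr h q
  | .graft l₁ l₂ ha hr p, h => P.comp l₁ l₂ ha hr p h
  | .perm σ, h => actG σ h

/-- Profiles, as vertices of the quiver of elementary expressions. -/
@[nolint unusedArguments]
def Sig (_P : PlanarOperad.{u, v} C) (_G : List C → List C → Type) : Type u := List C × C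

instance (P : PlanarOperad.{u, v} C) (G : List C → List C → Type) : Quiver (Sig P G) :=
  ⟨Move P G⟩

variable (P : PlanarOperad.{u, v} C) (G : List C → List C → Type)

/-- A profile, as an object of the category of strings of elementary expressions. -/
def prof (a : List C) (d : C) : Paths (Sig P G) := (a, d)

/-- `h ∘ᵢ q` -/
def sPlug {a b r : List C} {c : C} (l₁ l₂ : List C) (ha : a = l₁ ++ c :: l₂)
    (hr : r = l₁ ++ b ++ l₂) (q : P.Op b c) (d : C) : prof P G a d ⟶ prof P G r d :=
  (Paths.of (Sig P G)).map (X := (a, d)) (Y := (r, d)) (Move.plug l₁ l₂ ha hr q)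

/-- `p ∘ᵢ h` -/
def sGraft {a b r : List C} {c d : C} (l₁ l₂ : List C) (ha : a = l₁ ++ c :: l₂)
    (hr : r = l₁ ++ b ++ l₂) (p : P.Op a d) : prof P G b c ⟶ prof P G r d :=
  (Paths.of (Sig P G)).map (X := (b, c)) (Y := (r, d)) (Move.graft l₁ l₂ ha hr p)

variable {G} in
/-- `h^σ` -/
def sPerm {a b : List C} (σ : G a b) (d : C) : prof P G a d ⟶ prof P G b d :=
  (Paths.of (Sig P G)).map (X := (a, d)) (Y := (b, d)) (Move.perm σ)

/-- The axioms of planar operads, with one of the operations being the variable `h`. -/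
inductive PlanarRel : ∀ ⦃s t : Paths (Sig P G)⦄, (s ⟶ t) → (s ⟶ t) → Prop
  /-- `id ∘₁ h = h` -/
  | id_comp {a : List C} {d : C} (h₁ : [d] = [] ++ d :: []) (h₂ : a = [] ++ a ++ []) :
      PlanarRel (sGraft P G [] [] h₁ h₂ (P.id d)) (𝟙 (prof P G a d))
  /-- `h ∘ᵢ id = h` -/
  | comp_id {a : List C} {c d : C} (l₁ l₂ : List C) (h₁ : a = l₁ ++ c :: l₂)
      (h₂ : a = l₁ ++ [c] ++ l₂) :
      PlanarRel (sPlug P G l₁ l₂ h₁ h₂ (P.id c) d) (𝟙 (prof P G a d))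
  /-- `(h ∘ q) ∘ r = h ∘ (q ∘ r)` -/
  | seq_fst {a b g x y z : List C} {c d e : C} (l₁ l₂ m₁ m₂ : List C)
      (h₁ : a = l₁ ++ c :: l₂) (h₂ : x = l₁ ++ b ++ l₂)
      (h₃ : x = (l₁ ++ m₁) ++ e :: (m₂ ++ l₂)) (h₄ : z = (l₁ ++ m₁) ++ g ++ (m₂ ++ l₂))
      (h₅ : b = m₁ ++ e :: m₂) (h₆ : y = m₁ ++ g ++ m₂) (h₇ : z = l₁ ++ y ++ l₂)
      (q : P.Op b c) (r : P.Op g e) :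
      PlanarRel (sPlug P G l₁ l₂ h₁ h₂ q d ≫ sPlug P G (l₁ ++ m₁) (m₂ ++ l₂) h₃ h₄ r d)
        (sPlug P G l₁ l₂ h₁ h₇ (P.comp m₁ m₂ h₅ h₆ q r) d)
  /-- `(p ∘ h) ∘ r = p ∘ (h ∘ r)` -/
  | seq_snd {a b g x y z : List C} {c d e : C} (l₁ l₂ m₁ m₂ : List C)
      (h₁ : a = l₁ ++ c :: l₂) (h₂ : x = l₁ ++ b ++ l₂)
      (h₃ : x = (l₁ ++ m₁) ++ e :: (m₂ ++ l₂)) (h₄ : z = (l₁ ++ m₁) ++ g ++ (m₂ ++ l₂))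
      (h₅ : b = m₁ ++ e :: m₂) (h₆ : y = m₁ ++ g ++ m₂) (h₇ : z = l₁ ++ y ++ l₂)
      (p : P.Op a d) (r : P.Op g e) :
      PlanarRel (sGraft P G l₁ l₂ h₁ h₂ p ≫ sPlug P G (l₁ ++ m₁) (m₂ ++ l₂) h₃ h₄ r d)
        (sPlug P G m₁ m₂ h₅ h₆ r c ≫ sGraft P G l₁ l₂ h₁ h₇ p)
  /-- `(p ∘ q) ∘ h = p ∘ (q ∘ h)` -/
  | seq_trd {a b g x y z : List C} {c d e : C} (l₁ l₂ m₁ m₂ : List C)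
      (h₁ : a = l₁ ++ c :: l₂) (h₂ : x = l₁ ++ b ++ l₂)
      (h₃ : x = (l₁ ++ m₁) ++ e :: (m₂ ++ l₂)) (h₄ : z = (l₁ ++ m₁) ++ g ++ (m₂ ++ l₂))
      (h₅ : b = m₁ ++ e :: m₂) (h₆ : y = m₁ ++ g ++ m₂) (h₇ : z = l₁ ++ y ++ l₂)
      (p : P.Op a d) (q : P.Op b c) :
      PlanarRel (sGraft P G (l₁ ++ m₁) (m₂ ++ l₂) h₃ h₄ (P.comp l₁ l₂ h₁ h₂ p q))
        (sGraft P G m₁ m₂ h₅ h₆ q ≫ sGraft P G l₁ l₂ h₁ h₇ p)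
  /-- `(h ∘ q) ∘ r = (h ∘ r) ∘ q` -/
  | par_fst {a b₁ b₂ x y z : List C} {c₁ c₂ d : C} (l₁ l₂ l₃ : List C)
      (h₁ : a = l₁ ++ c₁ :: (l₂ ++ c₂ :: l₃)) (h₂ : x = l₁ ++ b₁ ++ (l₂ ++ c₂ :: l₃))
      (h₃ : x = (l₁ ++ b₁ ++ l₂) ++ c₂ :: l₃) (h₄ : z = (l₁ ++ b₁ ++ l₂) ++ b₂ ++ l₃)
      (h₅ : a = (l₁ ++ c₁ :: l₂) ++ c₂ :: l₃) (h₆ : y = (l₁ ++ c₁ :: l₂) ++ b₂ ++ l₃)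
      (h₇ : y = l₁ ++ c₁ :: (l₂ ++ b₂ ++ l₃)) (h₈ : z = l₁ ++ b₁ ++ (l₂ ++ b₂ ++ l₃))
      (q : P.Op b₁ c₁) (r : P.Op b₂ c₂) :
      PlanarRel
        (sPlug P G l₁ (l₂ ++ c₂ :: l₃) h₁ h₂ q d ≫ sPlug P G (l₁ ++ b₁ ++ l₂) l₃ h₃ h₄ r d)
        (sPlug P G (l₁ ++ c₁ :: l₂) l₃ h₅ h₆ r d ≫ sPlug P G l₁ (l₂ ++ b₂ ++ l₃) h₇ h₈ q d)
  /-- `(p ∘ h) ∘ r = (p ∘ r) ∘ h` -/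
  | par_snd {a b₁ b₂ x y z : List C} {c₁ c₂ d : C} (l₁ l₂ l₃ : List C)
      (h₁ : a = l₁ ++ c₁ :: (l₂ ++ c₂ :: l₃)) (h₂ : x = l₁ ++ b₁ ++ (l₂ ++ c₂ :: l₃))
      (h₃ : x = (l₁ ++ b₁ ++ l₂) ++ c₂ :: l₃) (h₄ : z = (l₁ ++ b₁ ++ l₂) ++ b₂ ++ l₃)
      (h₅ : a = (l₁ ++ c₁ :: l₂) ++ c₂ :: l₃) (h₆ : y = (l₁ ++ c₁ :: l₂) ++ b₂ ++ l₃)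
      (h₇ : y = l₁ ++ c₁ :: (l₂ ++ b₂ ++ l₃)) (h₈ : z = l₁ ++ b₁ ++ (l₂ ++ b₂ ++ l₃))
      (p : P.Op a d) (r : P.Op b₂ c₂) :
      PlanarRel
        (sGraft P G l₁ (l₂ ++ c₂ :: l₃) h₁ h₂ p ≫ sPlug P G (l₁ ++ b₁ ++ l₂) l₃ h₃ h₄ r d)
        (sGraft P G l₁ (l₂ ++ b₂ ++ l₃) h₇ h₈ (P.comp (l₁ ++ c₁ :: l₂) l₃ h₅ h₆ p r))
  /-- `(p ∘ q) ∘ h = (p ∘ h) ∘ q` -/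
  | par_trd {a b₁ b₂ x y z : List C} {c₁ c₂ d : C} (l₁ l₂ l₃ : List C)
      (h₁ : a = l₁ ++ c₁ :: (l₂ ++ c₂ :: l₃)) (h₂ : x = l₁ ++ b₁ ++ (l₂ ++ c₂ :: l₃))
      (h₃ : x = (l₁ ++ b₁ ++ l₂) ++ c₂ :: l₃) (h₄ : z = (l₁ ++ b₁ ++ l₂) ++ b₂ ++ l₃)
      (h₅ : a = (l₁ ++ c₁ :: l₂) ++ c₂ :: l₃) (h₆ : y = (l₁ ++ c₁ :: l₂) ++ b₂ ++ l₃)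
      (h₇ : y = l₁ ++ c₁ :: (l₂ ++ b₂ ++ l₃)) (h₈ : z = l₁ ++ b₁ ++ (l₂ ++ b₂ ++ l₃))
      (p : P.Op a d) (q : P.Op b₁ c₁) :
      PlanarRel
        (sGraft P G (l₁ ++ b₁ ++ l₂) l₃ h₃ h₄ (P.comp l₁ (l₂ ++ c₂ :: l₃) h₁ h₂ p q))
        (sGraft P G (l₁ ++ c₁ :: l₂) l₃ h₅ h₆ p ≫ sPlug P G l₁ (l₂ ++ b₂ ++ l₃) h₇ h₈ q d)

/-- The axioms of symmetric operads, with one of the operations being the variable `h`. -/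
inductive SymRel (P : SymmetricOperad.{u, v} C) :
    ∀ ⦃s t : Paths (Sig P.toPlanarOperad Perms)⦄, (s ⟶ t) → (s ⟶ t) → Prop
  | planar {s t : Paths (Sig P.toPlanarOperad Perms)} (f g : s ⟶ t)
      (h : PlanarRel P.toPlanarOperad Perms f g) : SymRel P f g
  | act_one {a : List C} (d : C) (σ : Perms a a) (h : σ.1 = Equiv.refl _) :
      SymRel P (sPerm P.toPlanarOperad σ d) (𝟙 _)
  | act_act {a b c : List C} (d : C) (σ : Perms a b) (τ : Perms b c) (ρ : Perms a c)
      (h : ρ.1 = τ.1.trans σ.1) :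
      SymRel P (sPerm P.toPlanarOperad σ d ≫ sPerm P.toPlanarOperad τ d)
        (sPerm P.toPlanarOperad ρ d)
  /-- `h^σ ∘ q^τ = (h ∘ q)^ρ` -/
  | act_comp_fst {a a' b b' r r' : List C} {c d : C} (l₁ l₂ l₁' l₂' : List C)
      (h₁ : a = l₁ ++ c :: l₂) (h₂ : r = l₁ ++ b ++ l₂)
      (h₁' : a' = l₁' ++ c :: l₂') (h₂' : r' = l₁' ++ b' ++ l₂')
      (σ : Perms a a') (τ : Perms b b') (ρ : Perms r r')
      (h : IsBlockPerm l₁.length l₁'.length σ.1 τ.1 ρ.1) (q : P.Op b c) :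
      SymRel P
        (sPerm P.toPlanarOperad σ d ≫ sPlug P.toPlanarOperad Perms l₁' l₂' h₁' h₂' (P.act τ q) d)
        (sPlug P.toPlanarOperad Perms l₁ l₂ h₁ h₂ q d ≫ sPerm P.toPlanarOperad ρ d)
  /-- `p^σ ∘ h^τ = (p ∘ h)^ρ` -/
  | act_comp_snd {a a' b b' r r' : List C} {c d : C} (l₁ l₂ l₁' l₂' : List C)
      (h₁ : a = l₁ ++ c :: l₂) (h₂ : r = l₁ ++ b ++ l₂)
      (h₁' : a' = l₁' ++ c :: l₂') (h₂' : r' = l₁' ++ b' ++ l₂')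
      (σ : Perms a a') (τ : Perms b b') (ρ : Perms r r')
      (h : IsBlockPerm l₁.length l₁'.length σ.1 τ.1 ρ.1) (p : P.Op a d) :
      SymRel P
        (sPerm P.toPlanarOperad τ c ≫ sGraft P.toPlanarOperad Perms l₁' l₂' h₁' h₂' (P.act σ p))
        (sGraft P.toPlanarOperad Perms l₁ l₂ h₁ h₂ p ≫ sPerm P.toPlanarOperad ρ d)

/-- The axioms of cyclic operads, with one of the operations being the variable `h`. -/
inductive CycRel (P : CyclicOperad.{v}) :
    ∀ ⦃s t : Paths (Sig P.toPlanarOperad CycPerms)⦄, (s ⟶ t) → (s ⟶ t) → Prop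
  | planar {s t : Paths (Sig P.toPlanarOperad CycPerms)} (f g : s ⟶ t)
      (h : PlanarRel P.toPlanarOperad CycPerms f g) : CycRel P f g
  | act_one (a : List Unit) :
      CycRel P (sPerm P.toPlanarOperad (CycPerms.refl a) ()) (𝟙 _)
  | act_act {a b c : List Unit} (σ : CycPerms a b) (τ : CycPerms b c) :
      CycRel P (sPerm P.toPlanarOperad σ () ≫ sPerm P.toPlanarOperad τ ())
        (sPerm P.toPlanarOperad (σ.comp τ) ())
  /-- `h^σ ∘ q^τ = (h ∘ q)^ρ` -/
  | act_comp_fst {a a' b b' r r' : List Unit} (l₁ l₂ l₁' l₂' : List Unit)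
      (h₁ : a = l₁ ++ () :: l₂) (h₂ : r = l₁ ++ b ++ l₂)
      (h₁' : a' = l₁' ++ () :: l₂') (h₂' : r' = l₁' ++ b' ++ l₂')
      (σ : Perms a a') (τ : Perms b b') (ρ : Perms r r')
      (h : IsBlockPerm l₁.length l₁'.length σ.1 τ.1 ρ.1) (q : P.Op b ()) :
      CycRel P
        (sPerm P.toPlanarOperad σ.ext () ≫
          sPlug P.toPlanarOperad CycPerms l₁' l₂' h₁' h₂' (P.act τ q) ())
        (sPlug P.toPlanarOperad CycPerms l₁ l₂ h₁ h₂ q () ≫ sPerm P.toPlanarOperad ρ.ext ())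
  /-- `p^σ ∘ h^τ = (p ∘ h)^ρ` -/
  | act_comp_snd {a a' b b' r r' : List Unit} (l₁ l₂ l₁' l₂' : List Unit)
      (h₁ : a = l₁ ++ () :: l₂) (h₂ : r = l₁ ++ b ++ l₂)
      (h₁' : a' = l₁' ++ () :: l₂') (h₂' : r' = l₁' ++ b' ++ l₂')
      (σ : Perms a a') (τ : Perms b b') (ρ : Perms r r')
      (h : IsBlockPerm l₁.length l₁'.length σ.1 τ.1 ρ.1) (p : P.Op a ()) :
      CycRel P
        (sPerm P.toPlanarOperad τ.ext () ≫
          sGraft P.toPlanarOperad CycPerms l₁' l₂' h₁' h₂' (P.act σ p))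
        (sGraft P.toPlanarOperad CycPerms l₁ l₂ h₁ h₂ p ≫ sPerm P.toPlanarOperad ρ.ext ())
  /-- `(h ∘₁ q)^τ = q^τ ∘ₙ h^τ` -/
  | rot_comp_first_fst {a b r : List Unit} (l₂ m₁ : List Unit)
      (h₁ : a = [] ++ () :: l₂) (h₂ : r = [] ++ b ++ l₂)
      (h₃ : b = m₁ ++ () :: []) (h₄ : r = m₁ ++ a ++ []) (q : P.Op b ()) :
      CycRel P
        (sPlug P.toPlanarOperad CycPerms [] l₂ h₁ h₂ q () ≫ sPerm P.toPlanarOperad (rot r) ())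
        (sPerm P.toPlanarOperad (rot a) () ≫
          sGraft P.toPlanarOperad CycPerms m₁ [] h₃ h₄ (P.cact (rot b) q))
  /-- `(p ∘₁ h)^τ = h^τ ∘ₙ p^τ` -/
  | rot_comp_first_snd {a b r : List Unit} (l₂ m₁ : List Unit)
      (h₁ : a = [] ++ () :: l₂) (h₂ : r = [] ++ b ++ l₂)
      (h₃ : b = m₁ ++ () :: []) (h₄ : r = m₁ ++ a ++ []) (p : P.Op a ()) :
      CycRel P
        (sGraft P.toPlanarOperad CycPerms [] l₂ h₁ h₂ p ≫ sPerm P.toPlanarOperad (rot r) ())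
        (sPerm P.toPlanarOperad (rot b) () ≫
          sPlug P.toPlanarOperad CycPerms m₁ [] h₃ h₄ (P.cact (rot a) p) ())
  /-- `(h ∘₁ q)^τ = (h^τ)^τ ∘ₘ q`, for `q` of arity `0` -/
  | rot_comp_first_nullary_fst {a r : List Unit} (l₂ m₁ : List Unit)
      (h₁ : a = [] ++ () :: l₂) (h₂ : r = [] ++ [] ++ l₂)
      (h₃ : a = m₁ ++ () :: []) (h₄ : r = m₁ ++ [] ++ []) (q : P.Op [] ()) :
      CycRel P
        (sPlug P.toPlanarOperad CycPerms [] l₂ h₁ h₂ q () ≫ sPerm P.toPlanarOperad (rot r) ())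
        (sPerm P.toPlanarOperad (rot a) () ≫ sPerm P.toPlanarOperad (rot a) () ≫
          sPlug P.toPlanarOperad CycPerms m₁ [] h₃ h₄ q ())
  /-- `(p ∘₁ h)^τ = (p^τ)^τ ∘ₘ h`, for `h` of arity `0` -/
  | rot_comp_first_nullary_snd {a r : List Unit} (l₂ m₁ : List Unit)
      (h₁ : a = [] ++ () :: l₂) (h₂ : r = [] ++ [] ++ l₂)
      (h₃ : a = m₁ ++ () :: []) (h₄ : r = m₁ ++ [] ++ []) (p : P.Op a ()) :
      CycRel P
        (sGraft P.toPlanarOperad CycPerms [] l₂ h₁ h₂ p ≫ sPerm P.toPlanarOperad (rot r) ())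
        (sGraft P.toPlanarOperad CycPerms m₁ [] h₃ h₄ (P.cact (rot a) (P.cact (rot a) p)))
  /-- `(h ∘ᵢ q)^τ = h^τ ∘ᵢ₋₁ q` for `i > 1` -/
  | rot_comp_other_fst {a b r : List Unit} (l₁ l₂ : List Unit)
      (h₁ : a = (() :: l₁) ++ () :: l₂) (h₂ : r = (() :: l₁) ++ b ++ l₂)
      (h₃ : a = l₁ ++ () :: (l₂ ++ [()])) (h₄ : r = l₁ ++ b ++ (l₂ ++ [()])) (q : P.Op b ()) :
      CycRel P
        (sPlug P.toPlanarOperad CycPerms (() :: l₁) l₂ h₁ h₂ q () ≫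
          sPerm P.toPlanarOperad (rot r) ())
        (sPerm P.toPlanarOperad (rot a) () ≫
          sPlug P.toPlanarOperad CycPerms l₁ (l₂ ++ [()]) h₃ h₄ q ())
  /-- `(p ∘ᵢ h)^τ = p^τ ∘ᵢ₋₁ h` for `i > 1` -/
  | rot_comp_other_snd {a b r : List Unit} (l₁ l₂ : List Unit)
      (h₁ : a = (() :: l₁) ++ () :: l₂) (h₂ : r = (() :: l₁) ++ b ++ l₂)
      (h₃ : a = l₁ ++ () :: (l₂ ++ [()])) (h₄ : r = l₁ ++ b ++ (l₂ ++ [()])) (p : P.Op a ()) :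
      CycRel P
        (sGraft P.toPlanarOperad CycPerms (() :: l₁) l₂ h₁ h₂ p ≫
          sPerm P.toPlanarOperad (rot r) ())
        (sGraft P.toPlanarOperad CycPerms l₁ (l₂ ++ [()]) h₃ h₄ (P.cact (rot a) p))

/-- Strings of elementary expressions act on operations of `P`. -/
def evalPaths (actG : ∀ {a b : List C} {d : C}, G a b → P.Op a d → P.Op b d) :
    Paths (Sig P G) ⥤ Type v :=
  Paths.lift
    { obj := fun s : List C × C => P.Op s.1 s.2
      map := fun {s t} (m : Move P G s t) => ↾(Move.eval actG m) }

end Env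

section EnvCategories

/-- There are no permutations in planar operads. -/
def NoPerms {C : Type u} (_ _ : List C) : Type := Empty

/-- The relations that define the enveloping category of a planar operad. -/
def PlanarOperad.rel {C : Type u} (P : PlanarOperad.{u, v} C) : HomRel (Paths (Sig P NoPerms)) :=
  PlanarRel P NoPerms

/-- The relations that define the enveloping category of a symmetric operad. -/
def SymmetricOperad.rel {C : Type u} (P : SymmetricOperad.{u, v} C) :
    HomRel (Paths (Sig P.toPlanarOperad Perms)) :=
  SymRel P

/-- The relations that define the enveloping category of a cyclic operad. -/
def CyclicOperad.rel (P : CyclicOperad.{v}) : HomRel (Paths (Sig P.toPlanarOperad CycPerms)) :=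
  CycRel P

/-- The enveloping category `U(P)` of a planar operad. -/
abbrev PlanarOperad.Env {C : Type u} (P : PlanarOperad.{u, v} C) : Type u :=
  CategoryTheory.Quotient P.rel

/-- The enveloping category `U(P)` of a symmetric operad. -/
abbrev SymmetricOperad.Env {C : Type u} (P : SymmetricOperad.{u, v} C) : Type u :=
  CategoryTheory.Quotient P.rel

/-- The enveloping category `U(P)` of a cyclic operad. -/
abbrev CyclicOperad.Env (P : CyclicOperad.{v}) : Type :=
  CategoryTheory.Quotient P.rel

section Eval

variable {C : Type u} (P : PlanarOperad.{u, v} C) (G : List C → List C → Type)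
  (actG : ∀ {a b : List C} {d : C}, G a b → P.Op a d → P.Op b d)

theorem evalPaths_sPlug {a b r : List C} {c : C} (l₁ l₂ : List C) (ha : a = l₁ ++ c :: l₂)
    (hr : r = l₁ ++ b ++ l₂) (q : P.Op b c) (d : C) :
    (evalPaths P G actG).map (sPlug P G l₁ l₂ ha hr q d) =
      ↾(fun h : P.Op a d => P.comp l₁ l₂ ha hr h q) :=
  Paths.lift_toPath _ _

theorem evalPaths_sGraft {a b r : List C} {c d : C} (l₁ l₂ : List C) (ha : a = l₁ ++ c :: l₂)
    (hr : r = l₁ ++ b ++ l₂) (p : P.Op a d) :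
    (evalPaths P G actG).map (sGraft P G l₁ l₂ ha hr p) =
      ↾(fun h : P.Op b c => P.comp l₁ l₂ ha hr p h) :=
  Paths.lift_toPath _ _

theorem evalPaths_sPerm {a b : List C} (σ : G a b) (d : C) :
    (evalPaths P G actG).map (sPerm P σ d) = ↾(fun h : P.Op a d => actG σ h) :=
  Paths.lift_toPath _ _

theorem evalPaths_planarRel (s t : Paths (Sig P G)) (f g : s ⟶ t) (h : PlanarRel P G f g) :
    (evalPaths P G actG).map f = (evalPaths P G actG).map g := by
  cases h <;> simp only [Functor.map_comp, evalPaths_sPlug, evalPaths_sGraft] <;>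
    ext h
  case id_comp => exact P.id_comp _ _ h
  case comp_id => exact P.comp_id _ _ _ _ h
  case seq_fst => exact P.assoc_seq _ _ _ _ _ _ _ _ _ _ _ h _ _
  case seq_snd => exact P.assoc_seq _ _ _ _ _ _ _ _ _ _ _ _ h _
  case seq_trd => exact P.assoc_seq _ _ _ _ _ _ _ _ _ _ _ _ _ h
  case par_fst => exact P.assoc_par _ _ _ _ _ _ _ _ _ _ _ h _ _
  case par_snd => exact P.assoc_par _ _ _ _ _ _ _ _ _ _ _ _ h _
  case par_trd => exact P.assoc_par _ _ _ _ _ _ _ _ _ _ _ _ _ h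

end Eval

/-- The action of `U(P)` on the operations of a planar operad `P`. -/
def PlanarOperad.eval {C : Type u} (P : PlanarOperad.{u, v} C) : P.Env ⥤ Type v :=
  CategoryTheory.Quotient.lift _ (evalPaths P NoPerms (fun σ => Empty.elim σ))
    (evalPaths_planarRel P NoPerms _)

/-- The action of `U(P)` on the operations of a symmetric operad `P`. -/
def SymmetricOperad.eval {C : Type u} (P : SymmetricOperad.{u, v} C) : P.Env ⥤ Type v :=
  CategoryTheory.Quotient.lift _ (evalPaths P.toPlanarOperad Perms P.act) (by
    intro s t f g h
    cases h
    case planar h => exact evalPaths_planarRel P.toPlanarOperad Perms _ _ _ _ _ h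
    all_goals
      simp only [Functor.map_comp, evalPaths_sPlug, evalPaths_sGraft, evalPaths_sPerm]
      ext x
    case act_one h => exact P.act_one _ h x
    case act_act h => exact P.act_act _ _ _ h x
    case act_comp_fst h _ => exact P.act_comp _ _ _ _ _ _ _ _ _ _ _ h x _
    case act_comp_snd h _ => exact P.act_comp _ _ _ _ _ _ _ _ _ _ _ h _ x)

/-- The action of permutations of `{0, …, n}` on the operations of a cyclic operad. -/
def CyclicOperad.cact' (P : CyclicOperad.{v}) {a b : List Unit} {d : Unit} (σ : CycPerms a b)
    (p : P.Op a d) : P.Op b d := P.cact σ p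

/-- The action of `U(P)` on the operations of a cyclic operad `P`. -/
def CyclicOperad.eval (P : CyclicOperad.{v}) : P.Env ⥤ Type v :=
  CategoryTheory.Quotient.lift _ (evalPaths P.toPlanarOperad CycPerms P.cact') (by
    intro s t f g h
    cases h
    case planar h => exact evalPaths_planarRel P.toPlanarOperad CycPerms _ _ _ _ _ h
    all_goals
      simp only [Functor.map_comp, evalPaths_sPlug, evalPaths_sGraft, evalPaths_sPerm]
      ext x
    case act_one => exact P.cact_one x
    case act_act => exact P.cact_cact _ _ x
    case act_comp_fst l₂' _ _ h₁' h₂' _ _ _ h _ =>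
      refine Eq.trans ?_ ((P.act_comp _ _ _ l₂' _ _ h₁' h₂' _ _ _ h x _).trans (P.cact_ext _ _).symm)
      exact congrArg (fun y => P.comp _ _ _ _ y _) (P.cact_ext _ x)
    case act_comp_snd l₂' _ _ h₁' h₂' _ _ _ h _ =>
      refine Eq.trans ?_ ((P.act_comp _ _ _ l₂' _ _ h₁' h₂' _ _ _ h _ x).trans (P.cact_ext _ _).symm)
      exact congrArg (fun y => P.comp _ _ _ _ _ y) (P.cact_ext _ x)
    case rot_comp_first_fst => exact P.rot_comp_first _ _ _ _ _ _ x _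
    case rot_comp_first_snd => exact P.rot_comp_first _ _ _ _ _ _ _ x
    case rot_comp_first_nullary_fst => exact P.rot_comp_first_nullary _ _ _ _ _ _ x _
    case rot_comp_first_nullary_snd => exact P.rot_comp_first_nullary _ _ _ _ _ _ _ x
    case rot_comp_other_fst => exact P.rot_comp_other _ _ _ _ _ _ x _
    case rot_comp_other_snd => exact P.rot_comp_other _ _ _ _ _ _ _ x)

end EnvCategories

/-! ### Classes of morphisms of enveloping categories -/

section Classes

variable {C : Type u} (P : PlanarOperad.{u, v} C) (G : List C → List C → Type)
  (rel : HomRel (Paths (Sig P G)))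

/-- A profile, as an object of the enveloping category. -/
abbrev obj (a : List C) (d : C) : CategoryTheory.Quotient rel := ⟨prof P G a d⟩

/-- The morphism `h ∘ᵢ q`. -/
abbrev plug {a b r : List C} {c : C} (l₁ l₂ : List C) (ha : a = l₁ ++ c :: l₂)
    (hr : r = l₁ ++ b ++ l₂) (q : P.Op b c) (d : C) : obj P G rel a d ⟶ obj P G rel r d :=
  (CategoryTheory.Quotient.functor rel).map (sPlug P G l₁ l₂ ha hr q d)

/-- The morphism `p ∘ᵢ h`. -/
abbrev graft {a b r : List C} {c d : C} (l₁ l₂ : List C) (ha : a = l₁ ++ c :: l₂)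
    (hr : r = l₁ ++ b ++ l₂) (p : P.Op a d) : obj P G rel b c ⟶ obj P G rel r d :=
  (CategoryTheory.Quotient.functor rel).map (sGraft P G l₁ l₂ ha hr p)

/-- The morphism `h^σ`. -/
abbrev perm {a b : List C} (σ : G a b) (d : C) : obj P G rel a d ⟶ obj P G rel b d :=
  (CategoryTheory.Quotient.functor rel).map (sPerm P σ d)

/-- `Upper Φ pre todo f`: the morphism `f`, with source of profile `(pre ++ todo; d)`, is
represented by a tree that consists of the source vertex and, for each input of the source vertex
in `todo`, of exactly one vertex grafted to this input and marked by an operation that satisfies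
`Φ`.  The inputs in `pre` are left intact, and the leaves of the tree are in planar order. -/
inductive Upper (Φ : ∀ (b : List C) (c : C), P.Op b c → Prop) (d : C) :
    ∀ (_pre _todo : List C) {a t : List C}, (obj P G rel a d ⟶ obj P G rel t d) → Prop
  | nil (pre : List C) : Upper Φ d pre [] (𝟙 (obj P G rel pre d))
  | cons {a a' b t : List C} {c : C} (pre todo : List C) (q : P.Op b c) (hq : Φ b c q)
      (ha : a = pre ++ c :: todo) (ha' : a' = pre ++ b ++ todo)
      (g : obj P G rel a' d ⟶ obj P G rel t d) (hg : Upper Φ d (pre ++ b) todo g) :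
      Upper Φ d pre (c :: todo) (plug P G rel pre todo ha ha' q d ≫ g)

/-- The morphism `f` is represented by a tree that consists of the source vertex, of one vertex
grafted to each input of the source vertex, and of one vertex (the lowest one) to one of the
inputs of which the source vertex is grafted, with all the non-source vertices marked by operations
that satisfy `Φ`, and with the leaves in planar order. -/
inductive RootedTree (Φ : ∀ (b : List C) (c : C), P.Op b c → Prop) :
    ∀ ⦃X Y : CategoryTheory.Quotient rel⦄, (X ⟶ Y) → Prop
  | mk {a t b r : List C} {c d : C} (f : obj P G rel a c ⟶ obj P G rel t c)
      (hf : Upper P G rel Φ c [] a f) (l₁ l₂ : List C) (h₁ : b = l₁ ++ c :: l₂)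
      (h₂ : r = l₁ ++ t ++ l₂) (p : P.Op b d) (hp : Φ b d p) :
      RootedTree Φ (f ≫ graft P G rel l₁ l₂ h₁ h₂ p)

/-- As `RootedTree`, with the leaves in any allowed order. -/
inductive PermutedRootedTree (Φ : ∀ (b : List C) (c : C), P.Op b c → Prop) :
    ∀ ⦃X Y : CategoryTheory.Quotient rel⦄, (X ⟶ Y) → Prop
  | mk {X : CategoryTheory.Quotient rel} {a b : List C} {d : C} (f : X ⟶ obj P G rel a d)
      (hf : RootedTree P G rel Φ f) (σ : G a b) :
      PermutedRootedTree Φ (f ≫ perm P G rel σ d)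

/-- The morphism `f` is represented by a tree as in `RootedTree`, but where the lowest vertex is
marked by an identity operation, i.e. may be omitted. -/
inductive UpperTree (Φ : ∀ (b : List C) (c : C), P.Op b c → Prop) :
    ∀ ⦃X Y : CategoryTheory.Quotient rel⦄, (X ⟶ Y) → Prop
  | mk {a t : List C} {c : C} (f : obj P G rel a c ⟶ obj P G rel t c)
      (hf : Upper P G rel Φ c [] a f) : UpperTree Φ f

end Classes

section Classes

/-- Being of grading `-1` or an identity operation. -/
def NiceGrading.NegOneOrId {C : Type u} {P : PlanarOperad.{u, v} C} (ψ : NiceGrading P)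
    (a : List C) (d : C) (p : P.Op a d) : Prop := P.IsId p ∨ ψ.deg p = -1

/-- Being of grading at least `0`. -/
def NiceGrading.Nonneg {C : Type u} {P : PlanarOperad.{u, v} C} (ψ : NiceGrading P)
    (a : List C) (d : C) (p : P.Op a d) : Prop := 0 ≤ ψ.deg p

/-- The class `R_{ψ = -1}` for a planar operad: all non-source vertices are marked by identities or
by operations of grading `-1`.  The lowest vertex has non-zero arity, thus it is marked by an
identity. -/
def PlanarOperad.rNeg {C : Type u} (P : PlanarOperad.{u, v} C) (ψ : NiceGrading P) :
    MorphismProperty P.Env :=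
  UpperTree P NoPerms P.rel ψ.NegOneOrId

/-- The class `R_{ψ ≥ 0}` for a planar operad: all non-source vertices have grading `≥ 0`. -/
def PlanarOperad.rNonneg {C : Type u} (P : PlanarOperad.{u, v} C) (ψ : NiceGrading P) :
    MorphismProperty P.Env :=
  RootedTree P NoPerms P.rel ψ.Nonneg

/-- The class `R_{ψ = -1}` for a symmetric operad: the permutation on leaves is trivial, and all
non-source vertices are marked by identities or by operations of grading `-1`.  The lowest vertex
has non-zero arity, thus it is marked by an identity. -/
def SymmetricOperad.rNeg {C : Type u} (P : SymmetricOperad.{u, v} C) (ψ : SymNiceGrading P) :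
    MorphismProperty P.Env :=
  UpperTree P.toPlanarOperad Perms P.rel ψ.NegOneOrId

/-- The class `R_{ψ ≥ 0}` for a symmetric operad: all non-source vertices have grading `≥ 0`. -/
def SymmetricOperad.rNonneg {C : Type u} (P : SymmetricOperad.{u, v} C) (ψ : SymNiceGrading P) :
    MorphismProperty P.Env :=
  PermutedRootedTree P.toPlanarOperad Perms P.rel ψ.Nonneg

/-- For a cyclic operad, the morphism that grafts the operation `q` of arity `0` to the edge `0` of
the source vertex of arity `n + 1`; the edges `1, …, n + 1` are then renumbered as `0, …, n`. -/
abbrev CyclicOperad.cap (P : CyclicOperad.{v}) {a r : List Unit} (ha : a = r ++ () :: [])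
    (hr : r = r ++ [] ++ []) (q : P.Op [] ()) :
    obj P.toPlanarOperad CycPerms P.rel a () ⟶ obj P.toPlanarOperad CycPerms P.rel r () :=
  perm P.toPlanarOperad CycPerms P.rel (rot a) () ≫
    plug P.toPlanarOperad CycPerms P.rel r [] ha hr q ()

/-- The class `R_{ψ = -1}` for a cyclic operad: the permutation on leaves is trivial, and all
non-source vertices are marked by identities or by operations of grading `-1`.  Either the vertex
grafted to the edge `0` of the source vertex is marked by an identity, i.e. may be omitted, or it is
marked by an operation of grading `-1`, and thus of arity `0`. -/
inductive CyclicOperad.RNeg (P : CyclicOperad.{v}) (ψ : SymNiceGrading P.toSymmetricOperad) :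
    ∀ ⦃X Y : P.Env⦄, (X ⟶ Y) → Prop
  | upper {X Y : P.Env} (f : X ⟶ Y)
      (hf : UpperTree P.toPlanarOperad CycPerms P.rel ψ.NegOneOrId f) : RNeg P ψ f
  | cap {X : P.Env} {a r : List Unit} (f : X ⟶ obj P.toPlanarOperad CycPerms P.rel a ())
      (hf : UpperTree P.toPlanarOperad CycPerms P.rel ψ.NegOneOrId f)
      (ha : a = r ++ () :: []) (hr : r = r ++ [] ++ []) (q : P.Op [] ()) (hq : ψ.deg q = -1) :
      RNeg P ψ (f ≫ P.cap ha hr q)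

/-- The class `R_{ψ = -1}` for a cyclic operad. -/
def CyclicOperad.rNeg (P : CyclicOperad.{v}) (ψ : SymNiceGrading P.toSymmetricOperad) :
    MorphismProperty P.Env := CyclicOperad.RNeg P ψ

/-- The class `R_{ψ ≥ 0}` for a cyclic operad: all non-source vertices have grading `≥ 0`.  The
vertex grafted to the edge `0` of the source vertex may have non-zero arity (`rooted`: then one of
its inputs may be assumed to be grafted to the source vertex), or arity `0` (`cap`). -/
inductive CyclicOperad.RNonneg (P : CyclicOperad.{v}) (ψ : SymNiceGrading P.toSymmetricOperad) :
    ∀ ⦃X Y : P.Env⦄, (X ⟶ Y) → Prop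
  | rooted {X Y : P.Env} (f : X ⟶ Y)
      (hf : PermutedRootedTree P.toPlanarOperad CycPerms P.rel ψ.Nonneg f) :
      RNonneg P ψ f
  | cap {X : P.Env} {a r b : List Unit} (f : X ⟶ obj P.toPlanarOperad CycPerms P.rel a ())
      (hf : UpperTree P.toPlanarOperad CycPerms P.rel ψ.Nonneg f)
      (ha : a = r ++ () :: []) (hr : r = r ++ [] ++ []) (q : P.Op [] ()) (hq : 0 ≤ ψ.deg q)
      (σ : CycPerms r b) :
      RNonneg P ψ (f ≫ P.cap ha hr q ≫ perm P.toPlanarOperad CycPerms P.rel σ ())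

/-- The class `R_{ψ ≥ 0}` for a cyclic operad. -/
def CyclicOperad.rNonneg (P : CyclicOperad.{v}) (ψ : SymNiceGrading P.toSymmetricOperad) :
    MorphismProperty P.Env := CyclicOperad.RNonneg P ψ

end Classes

/-! ### Generalized Reedy categories -/

section Reedy

/-- Orthogonal factorization systems `(L, R)`. -/
structure IsOrthogonalFactorizationSystem {D : Type u} [Category.{v} D]
    (L R : MorphismProperty D) : Prop where
  iso_left ⦃X Y : D⦄ (f : X ⟶ Y) : IsIso f → L f
  iso_right ⦃X Y : D⦄ (f : X ⟶ Y) : IsIso f → R f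
  comp_left ⦃X Y Z : D⦄ (f : X ⟶ Y) (g : Y ⟶ Z) : L f → L g → L (f ≫ g)
  comp_right ⦃X Y Z : D⦄ (f : X ⟶ Y) (g : Y ⟶ Z) : R f → R g → R (f ≫ g)
  exists_factorization ⦃X Y : D⦄ (f : X ⟶ Y) :
    ∃ (Z : D) (l : X ⟶ Z) (r : Z ⟶ Y), L l ∧ R r ∧ l ≫ r = f
  existsUnique_iso ⦃X Y Z Z' : D⦄ (l : X ⟶ Z) (r : Z ⟶ Y) (l' : X ⟶ Z') (r' : Z' ⟶ Y) :
    L l → R r → L l' → R r' → l ≫ r = l' ≫ r' →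
      ∃! e : Z ≅ Z', l ≫ e.hom = l' ∧ e.hom ≫ r' = r

/-- Generalized Reedy structures, with the degree map to a well-ordered set `α`. -/
structure IsGeneralizedReedy {D : Type u} [Category.{v} D] {α : Type w} [LinearOrder α]
    [WellFoundedLT α] (L R : MorphismProperty D) (deg : D → α) : Prop where
  factorization : IsOrthogonalFactorizationSystem L R
  deg_left ⦃X Y : D⦄ (f : X ⟶ Y) : L f → ¬ IsIso f → deg Y < deg X
  deg_right ⦃X Y : D⦄ (f : X ⟶ Y) : R f → ¬ IsIso f → deg X < deg Y
  deg_iso ⦃X Y : D⦄ (f : X ⟶ Y) : IsIso f → deg X = deg Y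
  eq_id ⦃X Y : D⦄ (f : X ⟶ Y) (θ : Y ⟶ Y) : L f → IsIso θ → f ≫ θ = f → θ = 𝟙 Y

/-- Maps of generalized Reedy categories: functors between generalized Reedy categories that
preserve the two classes of morphisms and the degree. -/
structure IsMapOfGeneralizedReedy {D : Type*} [Category* D] {E : Type*} [Category* E]
    {α : Type w} [LinearOrder α] [WellFoundedLT α] (F : D ⥤ E)
    (L R : MorphismProperty D) (deg : D → α) (L' R' : MorphismProperty E) (deg' : E → α) :
    Prop where
  source : IsGeneralizedReedy L R deg
  target : IsGeneralizedReedy L' R' deg'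
  map_left ⦃X Y : D⦄ (f : X ⟶ Y) : L f → L' (F.map f)
  map_right ⦃X Y : D⦄ (f : X ⟶ Y) : R f → R' (F.map f)
  map_deg (X : D) : deg' (F.obj X) = deg X

/-- The class of all morphisms `θ ∘ f` with `f` in `W` and with `θ` an isomorphism. -/
def isoComp {D : Type*} [Category* D] (W : MorphismProperty D) : MorphismProperty D :=
  fun X Y f => ∃ (Z : D) (g : X ⟶ Z) (θ : Z ≅ Y), W g ∧ f = g ≫ θ.hom

/-- Discrete opfibrations of categories. -/
def IsDiscreteOpfibration {D : Type*} [Category* D] {E : Type*} [Category* E] (F : D ⥤ E) : Prop :=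
  ∀ (X : D) (Y : E) (f : F.obj X ⟶ Y),
    ∃! g : Σ Y' : D, (X ⟶ Y'), ∃ h : F.obj g.1 = Y, F.map g.2 ≫ eqToHom h = f

/-- The set of possible values `-1, 0, 1, …` of nice gradings, a well-ordered set of order
type `ω`. -/
abbrev Degree : Type := {n : ℤ // -1 ≤ n}

instance : WellFoundedLT Degree where
  wf := (measure fun n : Degree => (n.1 + 1).toNat).wf.mono (by
    rintro ⟨a, ha⟩ ⟨b, hb⟩ h
    have h' : a < b := h
    change (a + 1).toNat < (b + 1).toNat
    omega)

variable {U : Type u} [Category.{v} U] (F : U ⥤ Type w)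

/-- The twisted arrow category, where `F` is the action of the enveloping category `U = U(P)` on
the operations of `P`: the objects are the operations of `P`, and the morphisms from `p` to `q` are
the morphisms `f` in `U(P)`, from the profile of `p` to the profile of `q`, such that the evaluation
of `f` at `p` is equal to `q`. -/
abbrev Tw : Type _ := F.Elements

/-- The canonical functor `Tw(P) → U(P)`. -/
abbrev twToEnv : Tw F ⥤ U := CategoryOfElements.π F

/-- The image `V(P)` of `Tw(P) → U(P)`: the full subcategory on the images of the objects. -/
abbrev EnvImage : Type _ :=
  ObjectProperty.FullSubcategory (C := U) (fun X => ∃ p : Tw F, (twToEnv F).obj p = X)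

/-- The inclusion `V(P) → U(P)`. -/
abbrev envImageInclusion : EnvImage F ⥤ U := ObjectProperty.ι _

/-- The canonical functor `Tw(P) → V(P)`. -/
abbrev twToImage : Tw F ⥤ EnvImage F :=
  ObjectProperty.lift _ (twToEnv F) (fun p => ⟨p, rfl⟩)

/-- The statement for an operad with the enveloping category `U`, with the action `F` of `U` on
operations, with grading `ψ`, and with the classes `rNeg = R_{ψ = -1}` and
`rNonneg = R_{ψ ≥ 0}` of morphisms in `U`, so that `R₋ = I ∘ R_{ψ = -1}` and `R₊ = R_{ψ ≥ 0}`, where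
`I` is the class of all isomorphisms.  The corresponding classes in `Tw(P)` are defined by the
preimages of `R_{ψ = -1}` and of `R_{ψ ≥ 0}`. -/
structure EnvelopingImageReedy (ψ : Tw F → Degree) (rNeg rNonneg : MorphismProperty U)
    (IsGroupoidal : Prop) : Prop where
  /-- `Tw(P) → V(P)` is a discrete opfibration. -/
  opfibration : IsDiscreteOpfibration (twToImage F)
  /-- `V(P)` is the image of `Tw(P)`. -/
  image_obj (X : EnvImage F) : ∃ p : Tw F, (twToImage F).obj p = X
  image_hom ⦃X Y : U⦄ (f : X ⟶ Y) : (∃ p : Tw F, (twToEnv F).obj p = X) →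
    ∃ (p q : Tw F) (g : p ⟶ q) (hp : (twToEnv F).obj p = X) (hq : (twToEnv F).obj q = Y),
      eqToHom hp ≫ f ≫ eqToHom hq.symm = (twToEnv F).map g
  /-- `(R₋, R₊)` is an orthogonal factorization system on `U(P)`. -/
  env_factorization : IsOrthogonalFactorizationSystem (isoComp rNeg) rNonneg
  /-- It restricts to an orthogonal factorization system on `V(P)`. -/
  image_factorization : IsOrthogonalFactorizationSystem
    ((isoComp rNeg).inverseImage (envImageInclusion F)) (rNonneg.inverseImage (envImageInclusion F))
  /-- The degree map on `V(P)`, defined by the grading, and the main equivalence. -/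
  reedy : ∃ deg : EnvImage F → Degree,
    (∀ p : Tw F, deg ((twToImage F).obj p) = ψ p) ∧
    (IsGeneralizedReedy ((isoComp rNeg).inverseImage (envImageInclusion F))
      (rNonneg.inverseImage (envImageInclusion F)) deg ↔ IsGroupoidal) ∧
    (IsGroupoidal → IsMapOfGeneralizedReedy (twToImage F)
      (isoComp (rNeg.inverseImage (twToEnv F))) (rNonneg.inverseImage (twToEnv F)) ψ
      ((isoComp rNeg).inverseImage (envImageInclusion F))
      (rNonneg.inverseImage (envImageInclusion F)) deg)

end Reedy

section Gradings

/-- The grading of a planar operad, as a map from objects of `Tw(P)`. -/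
def NiceGrading.onTw {C : Type u} {P : PlanarOperad.{u, v} C} (ψ : NiceGrading P)
    (p : Tw P.eval) : Degree := ⟨ψ.deg (a := p.1.as.1) (d := p.1.as.2) p.2, ψ.neg_one_le _⟩

/-- The grading of a symmetric operad, as a map from objects of `Tw(P)`. -/
def SymNiceGrading.onTw {C : Type u} {P : SymmetricOperad.{u, v} C} (ψ : SymNiceGrading P)
    (p : Tw P.eval) : Degree := ⟨ψ.deg (a := p.1.as.1) (d := p.1.as.2) p.2, ψ.neg_one_le _⟩

/-- The grading of a cyclic operad, as a map from objects of `Tw(P)`. -/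
def CyclicOperad.onTw {P : CyclicOperad.{v}} (ψ : SymNiceGrading P.toSymmetricOperad)
    (p : Tw P.eval) : Degree := ⟨ψ.deg (a := p.1.as.1) (d := p.1.as.2) p.2, ψ.neg_one_le _⟩

end Gradings

end EnvReedy

/-! The enveloping category is given by generators and relations, so the difficulty is to recover
data from its morphisms. Two facts carry the theorem: every morphism is represented by a tree around
the source vertex, and the vertices of grading $-1$ in a factorization are determined by the
composite.

Abstractly, let `W` contain identities, be closed under composition, consist of epimorphisms and
contain no split monomorphism except identities. Suppose that every morphism factors through `W`
followed by `R`, with a left factor that is unique on the nose, and that `R` is closed under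
composition. Then `isoComp W` and `R` form an orthogonal factorization system
(`FactorizationData.isOrthogonalFactorizationSystem`). Morphisms in `W` are isomorphisms or lower
the grading, and morphisms in `R` do not lower it. Thus the Reedy axioms amount to saying that
morphisms in `R` which preserve the grading of some operation are invertible
(`ReedyData.envelopingImageReedy`). Such a morphism has all its vertices of grading $0$, hence is a
composite of isomorphisms if these operations form a groupoid. Conversely, plugging an operation of
grading $0$ into a unary source vertex is a test morphism, and its invertibility gives a one-sided
inverse of the operation (`Kind.Coherent.exists_comp_eq_id`). The condition on $\theta$ is
cancellation of an epimorphism.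

To read off vertices one needs invariants that respect all relations. They come from operations
whose edges have distinct names, taken up to the allowed permutations and glued along common names.
The planar axioms then reduce to `GlueLaws.glue_glue_seq`, `GlueLaws.glue_glue_comm` and the
behaviour of identities. A family that assigns to each naming of a profile a class of named
elements, compatibly with renaming, is acted on by the enveloping category: an operation is glued to
the class if the class has the relevant edge, and the class is left alone otherwise. A class may
therefore carry fewer edges than the profile, and this makes the action informative. The family
`Fam.unit` recovers an element. The family `Fam.skip` ignores one input and shows that plugging an
operation of arity $0$ is epi (`Kind.Coherent.epi_plug`). The family `Fam.track` is a wire with one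
end at a chosen edge and the other end under a reserved name that is never glued: when an operation
of arity $0$ is grafted to the chosen edge, the family becomes the constant family of this
operation. Trees with vertices of grading at least $0$ keep families of nonnegative grading
nonnegative. Hence, in a composite of the two classes, tracked edges detect exactly the vertices of
grading $-1$ (`Kind.Coherent.upper_unique`, `Kind.Coherent.upper_eqToHom`).

Existence of trees is an induction: one more operation is absorbed by the lowest vertex or by the
part above (`IsTree.glue`). Vertices at different inputs commute, so those of grading $-1$ can be
applied first (`Upper.exists_fac`). A lowest vertex that has an input has grading at least $0$ and
belongs to the right factor.

In a cyclic operad any edge may serve as output, and only one phenomenon is new: an operation of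
arity $0$ at the edge $0$, called a cap. Caps can be pulled in front of other vertices
(`CyclicOperad.exists_plug_cap`), which gives factorizations by induction on the arity of the
source. Uniqueness looks at the edge $0$ first and then at the remaining edges
(`CyclicOperad.RNeg.unique`). -/

open CategoryTheory

namespace EnvReedy

/-! ### Factorization systems and Reedy structures from strictly unique left factors. -/

section Abstract

variable {U : Type u} [Category.{v} U]

/-- Conditions on two classes of morphisms that imply that, up to isomorphisms, they form an
orthogonal factorization system. -/
structure FactorizationData (W R : MorphismProperty U) : Prop where
  id_left (X : U) : W (𝟙 X)
  comp_left ⦃X Y Z : U⦄ (f : X ⟶ Y) (g : Y ⟶ Z) : W f → W g → W (f ≫ g)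
  comp_right ⦃X Y Z : U⦄ (f : X ⟶ Y) (g : Y ⟶ Z) : R f → R g → R (f ≫ g)
  exists_fac ⦃X Y : U⦄ (f : X ⟶ Y) : ∃ (Z : U) (l : X ⟶ Z) (r : Z ⟶ Y), W l ∧ R r ∧ l ≫ r = f
  epi_left ⦃X Y : U⦄ (f : X ⟶ Y) : W f → Epi f
  left_unique ⦃X Y Z Z' : U⦄ (l : X ⟶ Z) (r : Z ⟶ Y) (l' : X ⟶ Z') (r' : Z' ⟶ Y) :
    W l → R r → W l' → R r' → l ≫ r = l' ≫ r' → ∃ h : Z = Z', l ≫ eqToHom h = l'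
  left_split ⦃X Y : U⦄ (l : X ⟶ Y) (s : Y ⟶ X) : W l → l ≫ s = 𝟙 X → ∃ h : X = Y, l = eqToHom h

namespace FactorizationData

variable {W R : MorphismProperty U} (hD : FactorizationData W R)
include hD

/-- The left factor of an isomorphism is a split monomorphism, hence an identity, so that nothing
but the right factor remains. -/
theorem iso_right {X Y : U} (f : X ⟶ Y) (hf : IsIso f) : R f := by
  obtain ⟨Z, l, r, hl, hr, rfl⟩ := hD.exists_fac f
  obtain ⟨h, rfl⟩ := hD.left_split l (r ≫ inv (l ≫ r)) hl (by
    rw [← Category.assoc, IsIso.hom_inv_id])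
  subst h
  simpa using hr

/-- Isomorphisms can be moved from the front of `W` to its back, which makes `isoComp W` closed
under composition. The right factor `r` of `θ ≫ g` turns out to be invertible, because its inverse
appears when the left factor is transported back along `θ` and factored again. -/
theorem exists_swap {A B D : U} (θ : A ⟶ B) (hθ : IsIso θ) (g : B ⟶ D) (hg : W g) :
    ∃ (Z : U) (l : A ⟶ Z) (e : Z ≅ D), W l ∧ l ≫ e.hom = θ ≫ g := by
  obtain ⟨Z, l, r, hl, hr, h⟩ := hD.exists_fac (θ ≫ g)
  obtain ⟨Z', l', r', hl', hr', h'⟩ := hD.exists_fac (inv θ ≫ l)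
  -- Both sides factor `g`, so strict uniqueness identifies `l'` with `g`. After that, cancellation
  -- of `l'` and of `l` shows that `r` and `r'` are inverse to each other.
  have e1 : l' ≫ (r' ≫ r) = g ≫ 𝟙 _ := by
    rw [← Category.assoc, h', Category.assoc, h]; simp
  obtain ⟨hZ, rfl⟩ := hD.left_unique l' _ g _ hl' (hD.comp_right _ _ hr' hr) hg
    (hD.iso_right _ inferInstance) e1
  subst hZ
  simp only [eqToHom_refl, Category.comp_id] at e1 h hg
  have := hD.epi_left _ hl'
  have := hD.epi_left _ hl
  have e2 : r' ≫ r = 𝟙 _ := by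
    rw [← cancel_epi l', e1, Category.comp_id]
  have e3 : r ≫ r' = 𝟙 _ := by
    rw [← cancel_epi l, ← Category.assoc, h]
    simp [h']
  exact ⟨Z, l, ⟨r, r', e3, e2⟩, hl, by simpa using h⟩

/-- Isomorphisms at the end of a left factor can be absorbed into the right factor, since `R`
contains them. Two factorizations then share their `W`-part strictly, and the comparison isomorphism
is forced because `W` consists of epimorphisms. -/
theorem isOrthogonalFactorizationSystem : IsOrthogonalFactorizationSystem (isoComp W) R where
  iso_left X Y f hf := ⟨X, 𝟙 X, asIso f, hD.id_left X, by simp⟩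
  iso_right X Y f hf := hD.iso_right f hf
  comp_left := by
    rintro X Y Z _ _ ⟨A, w, θ, hw, rfl⟩ ⟨B, w', θ', hw', rfl⟩
    obtain ⟨D, l, e, hl, h⟩ := hD.exists_swap θ.hom inferInstance w' hw'
    refine ⟨D, w ≫ l, e ≪≫ θ', hD.comp_left _ _ hw hl, ?_⟩
    simp only [Iso.trans_hom, Category.assoc]
    rw [← Category.assoc l, h]
    simp
  comp_right := hD.comp_right
  exists_factorization X Y f := by
    obtain ⟨Z, l, r, hl, hr, h⟩ := hD.exists_fac f
    exact ⟨Z, l, r, ⟨Z, l, Iso.refl _, hl, by simp⟩, hr, h⟩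
  existsUnique_iso := by
    rintro X Y Z Z' _ r _ r' ⟨A, w, θ, hw, rfl⟩ hr ⟨B, w', θ', hw', rfl⟩ hr' h
    simp only [Category.assoc] at h
    obtain ⟨hA, rfl⟩ := hD.left_unique w _ w' _ hw
      (hD.comp_right _ _ (hD.iso_right θ.hom inferInstance) hr) hw'
      (hD.comp_right _ _ (hD.iso_right θ'.hom inferInstance) hr') h
    subst hA
    have := hD.epi_left _ hw
    simp only [eqToHom_refl, Category.comp_id, cancel_epi] at h
    refine ⟨θ.symm ≪≫ θ', ⟨by simp, by simp [← h]⟩, ?_⟩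
    rintro e ⟨he, -⟩
    ext
    simp only [Category.assoc, eqToHom_refl, Category.comp_id, cancel_epi] at he
    simp [← he]

theorem epi_isoComp {X Y : U} (f : X ⟶ Y) (hf : isoComp W f) : Epi f := by
  obtain ⟨A, w, θ, hw, rfl⟩ := hf
  have := hD.epi_left _ hw
  infer_instance

end FactorizationData

/-- An orthogonal factorization system restricts to a full subcategory that is closed under
targets of morphisms. -/
theorem IsOrthogonalFactorizationSystem.restrict {L R : MorphismProperty U}
    (h : IsOrthogonalFactorizationSystem L R) (Q : ObjectProperty U)
    (hQ : ∀ ⦃X Y : U⦄ (_ : X ⟶ Y), Q X → Q Y) :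
    IsOrthogonalFactorizationSystem (L.inverseImage Q.ι) (R.inverseImage Q.ι) where
  iso_left X Y f hf := h.iso_left _ inferInstance
  iso_right X Y f hf := h.iso_right _ inferInstance
  comp_left X Y Z f g hf hg := by
    simpa [MorphismProperty.inverseImage] using! h.comp_left _ _ hf hg
  comp_right X Y Z f g hf hg := by
    simpa [MorphismProperty.inverseImage] using! h.comp_right _ _ hf hg
  exists_factorization X Y f := by
    obtain ⟨Z, l, r, hl, hr, e⟩ := h.exists_factorization f.hom
    exact ⟨⟨Z, hQ l X.2⟩, ObjectProperty.homMk l, ObjectProperty.homMk r, hl, hr,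
      ObjectProperty.hom_ext _ e⟩
  existsUnique_iso X Y Z Z' l r l' r' hl hr hl' hr' e := by
    obtain ⟨θ, ⟨h1, h2⟩, hu⟩ := h.existsUnique_iso l.hom r.hom l'.hom r'.hom hl hr hl' hr'
      (congrArg (·.hom) e)
    refine ⟨⟨ObjectProperty.homMk θ.hom, ObjectProperty.homMk θ.inv,
      ObjectProperty.hom_ext _ θ.hom_inv_id, ObjectProperty.hom_ext _ θ.inv_hom_id⟩,
      ⟨ObjectProperty.hom_ext _ h1, ObjectProperty.hom_ext _ h2⟩, ?_⟩
    · rintro η ⟨h3, h4⟩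
      have := hu (Q.ι.mapIso η) ⟨congrArg (·.hom) h3, congrArg (·.hom) h4⟩
      apply Iso.ext
      apply ObjectProperty.hom_ext
      exact congrArg Iso.hom this

variable (F : U ⥤ Type w)

/-- A morphism of elements is determined by its source and by the underlying morphism: its target
has to be the image of the element. -/
theorem isDiscreteOpfibration_twToImage : IsDiscreteOpfibration (twToImage F) := by
  rintro X Y f
  refine ⟨⟨⟨Y.1, F.map f.hom X.2⟩, ⟨f.hom, rfl⟩⟩, ⟨rfl, ?_⟩, ?_⟩
  · exact Category.comp_id _
  · rintro ⟨⟨Y', q⟩, ⟨g, hg⟩⟩ ⟨h, e⟩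
    obtain ⟨Y, hY⟩ := Y
    have h' : Y' = Y := congrArg (·.obj) h
    subst h'
    have e' : g = f.hom := by
      rw [← e]
      exact (Category.comp_id g).symm
    subst e'
    change F.map f.hom X.2 = q at hg
    subst hg
    rfl

variable {F}

/-- The conditions on the classes of morphisms and on the grading that imply the theorem. -/
structure ReedyData (F : U ⥤ Type w) (ψ : Tw F → Degree) (W R : MorphismProperty U) (Gpd : Prop) :
    Prop extends FactorizationData W R where
  deg_left ⦃X Y : U⦄ (l : X ⟶ Y) : W l → ∀ p : F.obj X,
    IsIso l ∨ ψ (F.elementsMk Y (F.map l p)) < ψ (F.elementsMk X p)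
  deg_right ⦃X Y : U⦄ (r : X ⟶ Y) : R r → ∀ p : F.obj X,
    ψ (F.elementsMk X p) ≤ ψ (F.elementsMk Y (F.map r p))
  isIso_of_deg_eq ⦃X Y : U⦄ (r : X ⟶ Y) : Gpd → R r → ∀ p : F.obj X,
    ψ (F.elementsMk X p) = ψ (F.elementsMk Y (F.map r p)) → IsIso r
  gpd_of_isIso : (∀ ⦃X Y : U⦄ (r : X ⟶ Y) (p : F.obj X), R r →
    ψ (F.elementsMk X p) = ψ (F.elementsMk Y (F.map r p)) → IsIso r) → Gpd
  deg_congr ⦃X : U⦄ (p q : F.obj X) : ψ (F.elementsMk X p) = ψ (F.elementsMk X q)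

/-- The intermediate object of a factorization in the base lifts by evaluating the first factor at
the source element, and the isomorphism lifts with it. -/
theorem isoComp_tw_iff {W : MorphismProperty U} {X Y : Tw F} (f : X ⟶ Y) :
    isoComp (W.inverseImage (twToEnv F)) f ↔ isoComp W f.1 := by
  constructor
  · rintro ⟨Z, g, θ, hg, rfl⟩
    exact ⟨Z.1, g.1, (twToEnv F).mapIso θ, hg, rfl⟩
  · obtain ⟨f, hf⟩ := f
    rintro ⟨Z, g, θ, hg, hfg⟩
    change f = _ at hfg
    subst hfg
    refine ⟨⟨Z, F.map g X.2⟩, ⟨g, rfl⟩, CategoryOfElements.isoMk _ _ θ ?_, hg, ?_⟩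
    · rw [← hf]; simp
    · rfl

theorem isIso_tw_iff {X Y : Tw F} (f : X ⟶ Y) : IsIso f ↔ IsIso f.1 :=
  ⟨fun _ => inferInstanceAs (IsIso ((twToEnv F).map f)),
    fun h => @isIso_of_reflects_iso _ _ _ _ _ _ f (CategoryOfElements.π F) h _⟩

/-- An orthogonal factorization system lifts to the category of elements of a functor. -/
theorem IsOrthogonalFactorizationSystem.lift_tw {W R : MorphismProperty U}
    (h : IsOrthogonalFactorizationSystem (isoComp W) R) :
    IsOrthogonalFactorizationSystem (isoComp (W.inverseImage (twToEnv F)))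
      (R.inverseImage (twToEnv F)) where
  iso_left X Y f hf := (isoComp_tw_iff f).2 (h.iso_left _ ((isIso_tw_iff f).1 hf))
  iso_right X Y f hf := h.iso_right _ ((isIso_tw_iff f).1 hf)
  comp_left X Y Z f g hf hg := (isoComp_tw_iff _).2
    (h.comp_left _ _ ((isoComp_tw_iff f).1 hf) ((isoComp_tw_iff g).1 hg))
  comp_right X Y Z f g hf hg := h.comp_right _ _ hf hg
  exists_factorization X Y f := by
    obtain ⟨Z, l, r, hl, hr, e⟩ := h.exists_factorization f.1
    refine ⟨⟨Z, F.map l X.2⟩, ⟨l, rfl⟩, ⟨r, ?_⟩, (isoComp_tw_iff _).2 hl, hr, Subtype.ext e⟩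
    rw [← Functor.map_comp_apply, e, f.2]
  existsUnique_iso X Y Z Z' l r l' r' hl hr hl' hr' e := by
    obtain ⟨θ, ⟨h1, h2⟩, hu⟩ := h.existsUnique_iso l.1 r.1 l'.1 r'.1 ((isoComp_tw_iff _).1 hl) hr
      ((isoComp_tw_iff _).1 hl') hr' (congrArg Subtype.val e)
    refine ⟨CategoryOfElements.isoMk _ _ θ ?_, ⟨Subtype.ext h1, Subtype.ext h2⟩, ?_⟩
    · rw [← l.2, ← l'.2, ← h1, Functor.map_comp_apply]
    · rintro η ⟨h3, h4⟩
      have := hu ((twToEnv F).mapIso η) ⟨congrArg Subtype.val h3, congrArg Subtype.val h4⟩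
      apply Iso.ext
      apply Subtype.ext
      exact congrArg Iso.hom this

/-- The classes depend only on underlying morphisms, so the factorization system passes to the
image, which is closed under targets, and to the category of elements. The degree inequalities in
both places are the same statements about evaluation at an operation. -/
theorem ReedyData.envelopingImageReedy {ψ : Tw F → Degree} {W R : MorphismProperty U}
    {Gpd : Prop} (hD : ReedyData F ψ W R Gpd) : EnvelopingImageReedy F ψ W R Gpd := by
  have hU := hD.isOrthogonalFactorizationSystem
  have hV := hU.restrict (fun X => ∃ p : Tw F, (twToEnv F).obj p = X) (by
    rintro X Y f ⟨⟨X', p⟩, h⟩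
    change X' = X at h
    subst h
    exact ⟨⟨Y, F.map f p⟩, rfl⟩)
  have hdeg : ∀ (p q : Tw F), p.1 = q.1 → ψ p = ψ q := by
    rintro ⟨X, p⟩ ⟨Y, q⟩ h
    change X = Y at h
    subst h
    exact hD.deg_congr p q
  have iso_deg : ∀ ⦃X Y : U⦄ (f : X ⟶ Y) (p : F.obj X), IsIso f →
      ψ (F.elementsMk X p) = ψ (F.elementsMk Y (F.map f p)) := by
    intro X Y f p hf
    -- An isomorphism and its inverse both belong to `R`, and neither of them lowers the grading.
    refine le_antisymm (hD.deg_right f (hD.iso_right f hf) p) ?_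
    refine (hD.deg_right (inv f) (hD.iso_right _ inferInstance) _).trans_eq ?_
    rw [← Functor.map_comp_apply, IsIso.hom_inv_id, Functor.map_id_apply]
  have left_deg : ∀ ⦃X Y : U⦄ (f : X ⟶ Y) (p : F.obj X), isoComp W f → ¬ IsIso f →
      ψ (F.elementsMk Y (F.map f p)) < ψ (F.elementsMk X p) := by
    rintro X Y _ p ⟨Z, w, θ, hw, rfl⟩ hf
    rcases hD.deg_left w hw p with h | h
    · exact absurd (inferInstanceAs (IsIso (w ≫ θ.hom))) hf
    · refine lt_of_eq_of_lt ?_ h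
      rw [Functor.map_comp_apply]
      exact (iso_deg θ.hom (F.map w p) inferInstance).symm
  -- An arbitrary operation of the profile is chosen; `deg_congr` makes the value independent of it.
  let deg : EnvImage F → Degree := fun X => ψ X.2.choose
  have deg_eq : ∀ (X : EnvImage F) (p : F.obj X.1), deg X = ψ (F.elementsMk X.1 p) :=
    fun X p => hdeg _ _ X.2.choose_spec
  have el : ∀ X : EnvImage F, ∃ p : F.obj X.1, True := by
    rintro ⟨X, ⟨X', p⟩, h⟩
    change X' = X at h
    subst h
    exact ⟨p, trivial⟩
  have iso_iff : ∀ {X Y : EnvImage F} (f : X ⟶ Y), IsIso f ↔ IsIso f.hom := fun f =>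
    ⟨fun _ => inferInstanceAs (IsIso ((envImageInclusion F).map f)),
      fun h => @isIso_of_reflects_iso _ _ _ _ _ _ f (envImageInclusion F) h _⟩
  have reedyV : Gpd → IsGeneralizedReedy ((isoComp W).inverseImage (envImageInclusion F))
      (R.inverseImage (envImageInclusion F)) deg := by
    intro hG
    refine ⟨hV, ?_, ?_, ?_, ?_⟩
    · intro X Y f hf hn
      obtain ⟨p, -⟩ := el X
      rw [deg_eq X p, deg_eq Y (F.map f.hom p)]
      exact left_deg _ _ hf (fun h => hn ((iso_iff f).2 h))
    · intro X Y f hf hn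
      obtain ⟨p, -⟩ := el X
      rw [deg_eq X p, deg_eq Y (F.map f.hom p)]
      refine lt_of_le_of_ne (hD.deg_right _ hf p) (fun h => hn ((iso_iff f).2 ?_))
      exact hD.isIso_of_deg_eq _ hG hf p h
    · intro X Y f hf
      obtain ⟨p, -⟩ := el X
      rw [deg_eq X p, deg_eq Y (F.map f.hom p)]
      exact iso_deg _ _ ((iso_iff f).1 hf)
    · intro X Y f θ hf _ e
      -- The rigidity axiom of Reedy structures is the cancellation of an epimorphism.
      have : Epi f.hom := hD.epi_isoComp _ hf
      apply ObjectProperty.hom_ext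
      rw [← cancel_epi f.hom]
      refine (congrArg (·.hom) e).trans ?_
      exact (Category.comp_id f.hom).symm
  refine ⟨isDiscreteOpfibration_twToImage F, ?_, ?_, hU, hV, deg, ?_, ⟨?_, reedyV⟩, ?_⟩
  · rintro ⟨X, p, h⟩
    subst h
    exact ⟨p, rfl⟩
  · rintro X Y f ⟨⟨X', p⟩, h⟩
    change X' = X at h
    subst h
    exact ⟨⟨X', p⟩, ⟨Y, F.map f p⟩, ⟨f, rfl⟩, rfl, rfl,
      (Category.id_comp _).trans (Category.comp_id f)⟩
  · intro p
    exact deg_eq ((twToImage F).obj p) p.2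
  · intro h
    apply hD.gpd_of_isIso
    intro X Y r p hr e
    by_contra hn
    -- The element `p` and its image place `r` in the image subcategory, where the Reedy axiom would
    -- make a noninvertible `r` raise the degree strictly.
    let X' : EnvImage F := ⟨X, ⟨X, p⟩, rfl⟩
    let Y' : EnvImage F := ⟨Y, ⟨Y, F.map r p⟩, rfl⟩
    let r' : X' ⟶ Y' := ObjectProperty.homMk r
    have := h.deg_right r' hr (fun h' => hn ((iso_iff r').1 h'))
    rw [deg_eq X' p, deg_eq Y' (F.map r p)] at this
    exact this.ne e
  · intro hG
    refine ⟨⟨hU.lift_tw, ?_, ?_, ?_, ?_⟩, reedyV hG, ?_, ?_, ?_⟩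
    · intro X Y f hf hn
      have := left_deg f.1 X.2 ((isoComp_tw_iff f).1 hf) (fun h => hn ((isIso_tw_iff f).2 h))
      rw [f.2] at this
      exact this
    · intro X Y f hf hn
      have h1 := hD.deg_right f.1 hf X.2
      have h2 := hD.isIso_of_deg_eq f.1 hG hf X.2
      rw [f.2] at h1 h2
      exact lt_of_le_of_ne h1 (fun h => hn ((isIso_tw_iff f).2 (h2 h)))
    · intro X Y f hf
      have := iso_deg f.1 X.2 ((isIso_tw_iff f).1 hf)
      rw [f.2] at this
      exact this
    · intro X Y f θ hf _ e
      have := hD.epi_isoComp _ ((isoComp_tw_iff f).1 hf)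
      apply Subtype.ext
      rw [← cancel_epi f.1]
      refine (congrArg Subtype.val e).trans ?_
      exact (Category.comp_id f.1).symm
    · intro X Y f hf
      exact (isoComp_tw_iff f).1 hf
    · intro X Y f hf
      exact hf
    · intro p
      exact deg_eq ((twToImage F).obj p) p.2

end Abstract

end EnvReedy

namespace EnvReedy

/-! ### Kinds of operads -/

/-- An operad of one of the three kinds: `edge` is the action of the allowed permutations on the
set `{0, …, n}`, where `0` stands for the output. -/
structure Kind (C : Type u) where
  P : PlanarOperad.{u, v} C
  G : List C → List C → Type
  act {a b : List C} {d : C} : G a b → P.Op a d → P.Op b d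
  rel : HomRel (Paths (Sig P G))
  planar ⦃s t : Paths (Sig P G)⦄ (f g : s ⟶ t) : PlanarRel P G f g → rel f g
  eval_rel (s t : Paths (Sig P G)) (f g : s ⟶ t) : rel f g →
    (evalPaths P G act).map f = (evalPaths P G act).map g
  edge {a b : List C} : G a b → (Fin (b.length + 1) ≃ Fin (a.length + 1))
  edge_colour {a b : List C} (σ : G a b) (d : C) (i : Fin (b.length + 1)) :
    (d :: b)[(i : ℕ)]? = (d :: a)[(edge σ i : ℕ)]?
  inv {a b : List C} : G a b → G b a
  comp {a b c : List C} : G a b → G b c → G a c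
  edge_inv {a b : List C} (σ : G a b) : edge (inv σ) = (edge σ).symm
  edge_comp {a b c : List C} (σ : G a b) (τ : G b c) :
    edge (comp σ τ) = (edge τ).trans (edge σ)
  perm_comp {a b c : List C} (σ : G a b) (τ : G b c) (d : C) :
    perm P G rel σ d ≫ perm P G rel τ d = perm P G rel (comp σ τ) d
  perm_id {a : List C} (σ : G a a) (d : C) : edge σ = Equiv.refl _ → perm P G rel σ d = 𝟙 _

namespace Kind

variable {C : Type u} (K : Kind.{u, v} C)

/-- The enveloping category. -/
abbrev Env : Type u := CategoryTheory.Quotient K.rel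

/-- A profile, as an object of the enveloping category. -/
abbrev ob (a : List C) (d : C) : K.Env := obj K.P K.G K.rel a d

/-- The morphism `h ∘ᵢ q`. -/
abbrev mPlug {a b r : List C} {c : C} (l₁ l₂ : List C) (ha : a = l₁ ++ c :: l₂)
    (hr : r = l₁ ++ b ++ l₂) (q : K.P.Op b c) (d : C) : K.ob a d ⟶ K.ob r d :=
  plug K.P K.G K.rel l₁ l₂ ha hr q d

/-- The morphism `p ∘ᵢ h`. -/
abbrev mGraft {a b r : List C} {c d : C} (l₁ l₂ : List C) (ha : a = l₁ ++ c :: l₂)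
    (hr : r = l₁ ++ b ++ l₂) (p : K.P.Op a d) : K.ob b c ⟶ K.ob r d :=
  graft K.P K.G K.rel l₁ l₂ ha hr p

/-- The morphism `h^σ`. -/
abbrev mPerm {a b : List C} (σ : K.G a b) (d : C) : K.ob a d ⟶ K.ob b d :=
  perm K.P K.G K.rel σ d

/-- The action of the enveloping category on operations. -/
def eval : K.Env ⥤ Type v :=
  CategoryTheory.Quotient.lift _ (evalPaths K.P K.G K.act) K.eval_rel

theorem sound {s t : Paths (Sig K.P K.G)} {f g : s ⟶ t} (h : K.rel f g) :
    (CategoryTheory.Quotient.functor K.rel).map f = (CategoryTheory.Quotient.functor K.rel).map g :=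
  CategoryTheory.Quotient.sound _ h

theorem sound_planar {s t : Paths (Sig K.P K.G)} {f g : s ⟶ t} (h : PlanarRel K.P K.G f g) :
    (CategoryTheory.Quotient.functor K.rel).map f = (CategoryTheory.Quotient.functor K.rel).map g :=
  K.sound (K.planar _ _ h)

section Relations

variable {K}

theorem mGraft_id {a : List C} {d : C} (h₁ : [d] = [] ++ d :: []) (h₂ : a = [] ++ a ++ []) :
    K.mGraft [] [] h₁ h₂ (K.P.id d) = 𝟙 (K.ob a d) :=
  (K.sound_planar (PlanarRel.id_comp h₁ h₂)).trans (CategoryTheory.Functor.map_id _ _)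

theorem mPlug_id {a : List C} {c d : C} (l₁ l₂ : List C) (h₁ : a = l₁ ++ c :: l₂)
    (h₂ : a = l₁ ++ [c] ++ l₂) : K.mPlug l₁ l₂ h₁ h₂ (K.P.id c) d = 𝟙 (K.ob a d) :=
  (K.sound_planar (PlanarRel.comp_id l₁ l₂ h₁ h₂)).trans (CategoryTheory.Functor.map_id _ _)

theorem plug_plug_seq {a b g x y z : List C} {c d e : C} (l₁ l₂ m₁ m₂ : List C)
    (h₁ : a = l₁ ++ c :: l₂) (h₂ : x = l₁ ++ b ++ l₂)
    (h₃ : x = (l₁ ++ m₁) ++ e :: (m₂ ++ l₂)) (h₄ : z = (l₁ ++ m₁) ++ g ++ (m₂ ++ l₂))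
    (h₅ : b = m₁ ++ e :: m₂) (h₆ : y = m₁ ++ g ++ m₂) (h₇ : z = l₁ ++ y ++ l₂)
    (q : K.P.Op b c) (r : K.P.Op g e) :
    K.mPlug l₁ l₂ h₁ h₂ q d ≫ K.mPlug (l₁ ++ m₁) (m₂ ++ l₂) h₃ h₄ r d =
      K.mPlug l₁ l₂ h₁ h₇ (K.P.comp m₁ m₂ h₅ h₆ q r) d :=
  ((CategoryTheory.Quotient.functor K.rel).map_comp _ _).symm.trans
    (K.sound_planar (PlanarRel.seq_fst l₁ l₂ m₁ m₂ h₁ h₂ h₃ h₄ h₅ h₆ h₇ q r))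

theorem graft_plug_seq {a b g x y z : List C} {c d e : C} (l₁ l₂ m₁ m₂ : List C)
    (h₁ : a = l₁ ++ c :: l₂) (h₂ : x = l₁ ++ b ++ l₂)
    (h₃ : x = (l₁ ++ m₁) ++ e :: (m₂ ++ l₂)) (h₄ : z = (l₁ ++ m₁) ++ g ++ (m₂ ++ l₂))
    (h₅ : b = m₁ ++ e :: m₂) (h₆ : y = m₁ ++ g ++ m₂) (h₇ : z = l₁ ++ y ++ l₂)
    (p : K.P.Op a d) (r : K.P.Op g e) :
    K.mGraft l₁ l₂ h₁ h₂ p ≫ K.mPlug (l₁ ++ m₁) (m₂ ++ l₂) h₃ h₄ r d =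
      K.mPlug m₁ m₂ h₅ h₆ r c ≫ K.mGraft l₁ l₂ h₁ h₇ p :=
  ((CategoryTheory.Quotient.functor K.rel).map_comp _ _).symm.trans
    ((K.sound_planar (PlanarRel.seq_snd l₁ l₂ m₁ m₂ h₁ h₂ h₃ h₄ h₅ h₆ h₇ p r)).trans
      ((CategoryTheory.Quotient.functor K.rel).map_comp _ _))

theorem graft_graft_seq {a b g x y z : List C} {c d e : C} (l₁ l₂ m₁ m₂ : List C)
    (h₁ : a = l₁ ++ c :: l₂) (h₂ : x = l₁ ++ b ++ l₂)
    (h₃ : x = (l₁ ++ m₁) ++ e :: (m₂ ++ l₂)) (h₄ : z = (l₁ ++ m₁) ++ g ++ (m₂ ++ l₂))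
    (h₅ : b = m₁ ++ e :: m₂) (h₆ : y = m₁ ++ g ++ m₂) (h₇ : z = l₁ ++ y ++ l₂)
    (p : K.P.Op a d) (q : K.P.Op b c) :
    K.mGraft (l₁ ++ m₁) (m₂ ++ l₂) h₃ h₄ (K.P.comp l₁ l₂ h₁ h₂ p q) =
      K.mGraft m₁ m₂ h₅ h₆ q ≫ K.mGraft l₁ l₂ h₁ h₇ p :=
  (K.sound_planar (PlanarRel.seq_trd l₁ l₂ m₁ m₂ h₁ h₂ h₃ h₄ h₅ h₆ h₇ p q)).trans
      ((CategoryTheory.Quotient.functor K.rel).map_comp _ _)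

theorem plug_plug_par {a b₁ b₂ x y z : List C} {c₁ c₂ d : C} (l₁ l₂ l₃ : List C)
    (h₁ : a = l₁ ++ c₁ :: (l₂ ++ c₂ :: l₃)) (h₂ : x = l₁ ++ b₁ ++ (l₂ ++ c₂ :: l₃))
    (h₃ : x = (l₁ ++ b₁ ++ l₂) ++ c₂ :: l₃) (h₄ : z = (l₁ ++ b₁ ++ l₂) ++ b₂ ++ l₃)
    (h₅ : a = (l₁ ++ c₁ :: l₂) ++ c₂ :: l₃) (h₆ : y = (l₁ ++ c₁ :: l₂) ++ b₂ ++ l₃)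
    (h₇ : y = l₁ ++ c₁ :: (l₂ ++ b₂ ++ l₃)) (h₈ : z = l₁ ++ b₁ ++ (l₂ ++ b₂ ++ l₃))
    (q : K.P.Op b₁ c₁) (r : K.P.Op b₂ c₂) :
    K.mPlug l₁ (l₂ ++ c₂ :: l₃) h₁ h₂ q d ≫ K.mPlug (l₁ ++ b₁ ++ l₂) l₃ h₃ h₄ r d =
      K.mPlug (l₁ ++ c₁ :: l₂) l₃ h₅ h₆ r d ≫ K.mPlug l₁ (l₂ ++ b₂ ++ l₃) h₇ h₈ q d :=
  ((CategoryTheory.Quotient.functor K.rel).map_comp _ _).symm.trans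
    ((K.sound_planar (PlanarRel.par_fst l₁ l₂ l₃ h₁ h₂ h₃ h₄ h₅ h₆ h₇ h₈ q r)).trans
      ((CategoryTheory.Quotient.functor K.rel).map_comp _ _))

theorem graft_plug_right {a b₁ b₂ x y z : List C} {c₁ c₂ d : C} (l₁ l₂ l₃ : List C)
    (h₁ : a = l₁ ++ c₁ :: (l₂ ++ c₂ :: l₃)) (h₂ : x = l₁ ++ b₁ ++ (l₂ ++ c₂ :: l₃))
    (h₃ : x = (l₁ ++ b₁ ++ l₂) ++ c₂ :: l₃) (h₄ : z = (l₁ ++ b₁ ++ l₂) ++ b₂ ++ l₃)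
    (h₅ : a = (l₁ ++ c₁ :: l₂) ++ c₂ :: l₃) (h₆ : y = (l₁ ++ c₁ :: l₂) ++ b₂ ++ l₃)
    (h₇ : y = l₁ ++ c₁ :: (l₂ ++ b₂ ++ l₃)) (h₈ : z = l₁ ++ b₁ ++ (l₂ ++ b₂ ++ l₃))
    (p : K.P.Op a d) (r : K.P.Op b₂ c₂) :
    K.mGraft l₁ (l₂ ++ c₂ :: l₃) h₁ h₂ p ≫ K.mPlug (l₁ ++ b₁ ++ l₂) l₃ h₃ h₄ r d =
      K.mGraft l₁ (l₂ ++ b₂ ++ l₃) h₇ h₈ (K.P.comp (l₁ ++ c₁ :: l₂) l₃ h₅ h₆ p r) :=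
  ((CategoryTheory.Quotient.functor K.rel).map_comp _ _).symm.trans
    (K.sound_planar (PlanarRel.par_snd l₁ l₂ l₃ h₁ h₂ h₃ h₄ h₅ h₆ h₇ h₈ p r))

theorem graft_plug_left {a b₁ b₂ x y z : List C} {c₁ c₂ d : C} (l₁ l₂ l₃ : List C)
    (h₁ : a = l₁ ++ c₁ :: (l₂ ++ c₂ :: l₃)) (h₂ : x = l₁ ++ b₁ ++ (l₂ ++ c₂ :: l₃))
    (h₃ : x = (l₁ ++ b₁ ++ l₂) ++ c₂ :: l₃) (h₄ : z = (l₁ ++ b₁ ++ l₂) ++ b₂ ++ l₃)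
    (h₅ : a = (l₁ ++ c₁ :: l₂) ++ c₂ :: l₃) (h₆ : y = (l₁ ++ c₁ :: l₂) ++ b₂ ++ l₃)
    (h₇ : y = l₁ ++ c₁ :: (l₂ ++ b₂ ++ l₃)) (h₈ : z = l₁ ++ b₁ ++ (l₂ ++ b₂ ++ l₃))
    (p : K.P.Op a d) (q : K.P.Op b₁ c₁) :
    K.mGraft (l₁ ++ b₁ ++ l₂) l₃ h₃ h₄ (K.P.comp l₁ (l₂ ++ c₂ :: l₃) h₁ h₂ p q) =
      K.mGraft (l₁ ++ c₁ :: l₂) l₃ h₅ h₆ p ≫ K.mPlug l₁ (l₂ ++ b₂ ++ l₃) h₇ h₈ q d :=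
  (K.sound_planar (PlanarRel.par_trd l₁ l₂ l₃ h₁ h₂ h₃ h₄ h₅ h₆ h₇ h₈ p q)).trans
      ((CategoryTheory.Quotient.functor K.rel).map_comp _ _)

end Relations

/-! ### Actions of the enveloping category -/

/-- A functor from the enveloping category to sets, given by plain maps. -/
structure Act where
  obj : List C → C → Type w
  map {a b : List C} {d e : C} : (K.ob a d ⟶ K.ob b e) → obj a d → obj b e
  map_id {a : List C} {d : C} (x : obj a d) : map (𝟙 (K.ob a d)) x = x
  map_comp {a b c : List C} {d e f : C} (g : K.ob a d ⟶ K.ob b e) (h : K.ob b e ⟶ K.ob c f)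
    (x : obj a d) : map (g ≫ h) x = map h (map g x)

/-- The action on operations. -/
abbrev opAct : K.Act where
  obj := K.P.Op
  map g x := K.eval.map g x
  map_id {a d} x := congrArg (fun f : K.P.Op a d ⟶ K.P.Op a d => f x) (K.eval.map_id (K.ob a d))
  map_comp {a _ c d _ f} g h x :=
    congrArg (fun f : K.P.Op a d ⟶ K.P.Op c f => f x) (K.eval.map_comp g h)

/-- The action on morphisms with a fixed source. -/
abbrev homAct (X : K.Env) : K.Act where
  obj a d := X ⟶ K.ob a d
  map g x := x ≫ g
  map_id x := Category.comp_id x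
  map_comp g h x := (Category.assoc x g h).symm

theorem opAct_plug {a b r : List C} {c d : C} (l₁ l₂ : List C) (ha : a = l₁ ++ c :: l₂)
    (hr : r = l₁ ++ b ++ l₂) (q : K.P.Op b c) (x : K.P.Op a d) :
    K.opAct.map (K.mPlug l₁ l₂ ha hr q d) x = K.P.comp l₁ l₂ ha hr x q :=
  congrArg (fun f : K.P.Op a d ⟶ K.P.Op r d => f x)
    (evalPaths_sPlug K.P K.G K.act l₁ l₂ ha hr q d)

theorem opAct_graft {a b r : List C} {c d : C} (l₁ l₂ : List C) (ha : a = l₁ ++ c :: l₂)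
    (hr : r = l₁ ++ b ++ l₂) (p : K.P.Op a d) (x : K.P.Op b c) :
    K.opAct.map (K.mGraft l₁ l₂ ha hr p) x = K.P.comp l₁ l₂ ha hr p x :=
  congrArg (fun f : K.P.Op b c ⟶ K.P.Op r d => f x)
    (evalPaths_sGraft K.P K.G K.act l₁ l₂ ha hr p)

theorem opAct_perm {a b : List C} (σ : K.G a b) (d : C) (x : K.P.Op a d) :
    K.opAct.map (K.mPerm σ d) x = K.act σ x :=
  congrArg (fun f : K.P.Op a d ⟶ K.P.Op b d => f x) (evalPaths_sPerm K.P K.G K.act σ d)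

end Kind
end EnvReedy

namespace EnvReedy

/-! ### Labelled elements -/

/-- The list `T'` is obtained from the list `T` by the reordering `ε` of positions. -/
def Matches {α : Type*} {m n : ℕ} (ε : Fin m ≃ Fin n) (T T' : List α) : Prop :=
  ∀ i : Fin m, T'[(i : ℕ)]? = T[(ε i : ℕ)]?

/-- Grafting replaces the name of one edge by the block of names of the grafted inputs, and
splitting does the converse; names have to stay distinct in both cases. -/
theorem nodup_replace {α : Type*} {A B D M : List α} (h : (A ++ M ++ D).Nodup) (hB : B.Nodup)
    (hd : ∀ b ∈ B, b ∉ A ∧ b ∉ D) : (A ++ B ++ D).Nodup := by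
  simp only [List.nodup_append', List.disjoint_left, List.mem_append] at *
  grind

theorem Matches.refl {α : Type*} {n : ℕ} (T : List α) : Matches (Equiv.refl (Fin n)) T T :=
  fun _ => rfl

theorem Matches.symm {α : Type*} {m n : ℕ} {ε : Fin m ≃ Fin n} {T T' : List α}
    (h : Matches ε T T') : Matches ε.symm T' T := fun i => by
  rw [h (ε.symm i), Equiv.apply_symm_apply]

theorem Matches.trans {α : Type*} {l m n : ℕ} {ε : Fin m ≃ Fin n} {ε' : Fin l ≃ Fin m}
    {T T' T'' : List α} (h : Matches ε T T') (h' : Matches ε' T' T'') :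
    Matches (ε'.trans ε) T T'' := fun i => by
  rw [h' i, h (ε' i)]; rfl

theorem Matches.map {α β : Type*} {m n : ℕ} {ε : Fin m ≃ Fin n} {T T' : List α}
    (h : Matches ε T T') (f : α → β) : Matches ε (T.map f) (T'.map f) := fun i => by
  rw [List.getElem?_map, List.getElem?_map, h i]

theorem Matches.eq {α : Type*} {m n : ℕ} {ε : Fin m ≃ Fin n} {T T' T'' : List α}
    (h : Matches ε T T') (h' : Matches ε T T'') (hl : T'.length = m) (hl' : T''.length = m) :
    T' = T'' := by
  apply List.ext_getElem?
  intro i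
  by_cases hi : i < m
  · rw [h ⟨i, hi⟩, h' ⟨i, hi⟩]
  · rw [List.getElem?_eq_none (by omega), List.getElem?_eq_none (by omega)]

theorem Matches.mem_iff {α : Type*} {m n : ℕ} {ε : Fin m ≃ Fin n} {T T' : List α}
    (h : Matches ε T T') (hl : T.length = n) (hl' : T'.length = m) (t : α) : t ∈ T' ↔ t ∈ T := by
  simp only [List.mem_iff_getElem?]
  constructor
  · rintro ⟨i, hi⟩
    obtain ⟨hi', -⟩ := List.getElem?_eq_some_iff.1 hi
    exact ⟨_, (h ⟨i, by omega⟩).symm.trans hi⟩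
  · rintro ⟨i, hi⟩
    obtain ⟨hi', -⟩ := List.getElem?_eq_some_iff.1 hi
    exact ⟨_, (h.symm ⟨i, by omega⟩).symm.trans hi⟩

/-- Distinct labels kill all automorphisms. This is the reason to put labels on edges at all. -/
theorem Matches.eq_refl {α : Type*} {n : ℕ} {ε : Fin n ≃ Fin n} {T : List α}
    (h : Matches ε T T) (hl : T.length = n) (hn : T.Nodup) : ε = Equiv.refl _ := by
  ext i
  have := h i
  rw [List.getElem?_eq_getElem (by omega), List.getElem?_eq_getElem (by omega)] at this
  exact ((hn.getElem_inj_iff).1 (Option.some.inj this)).symm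

/-- Nodup lists with the same elements are matched by a bijection between positions. -/
theorem exists_matches {α : Type*} [DecidableEq α] {T T' : List α} (hn : T.Nodup) (hn' : T'.Nodup)
    (h : ∀ t, t ∈ T' ↔ t ∈ T) {m n : ℕ} (hl : T.length = n) (hl' : T'.length = m) :
    ∃ ε : Fin m ≃ Fin n, Matches ε T T' := by
  subst hl hl'
  refine ⟨(hn'.getEquiv T').trans ((Equiv.subtypeEquivRight h).trans (hn.getEquiv T).symm),
    fun i => ?_⟩
  have h1 : T.get ((hn.getEquiv T).symm (Equiv.subtypeEquivRight h (hn'.getEquiv T' i))) =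
      T'.get i := by
    have := (hn.getEquiv T).apply_symm_apply (Equiv.subtypeEquivRight h (hn'.getEquiv T' i))
    exact congrArg Subtype.val this
  simp only [Equiv.trans_apply]
  rw [List.getElem?_eq_getElem i.2, List.getElem?_eq_getElem (Fin.is_lt _)]
  exact congrArg some h1.symm

theorem Matches.cons {α : Type*} {m n : ℕ} {ε : Fin (m + 1) ≃ Fin (n + 1)} {z : α} {L L' : List α}
    (h : ∀ i : Fin m, L'[(i : ℕ)]? = (z :: L)[(ε i.succ : ℕ)]?) (h0 : ε 0 = 0) :
    Matches ε (z :: L) (z :: L') := by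
  intro i
  refine Fin.cases ?_ (fun i => ?_) i
  · simp [h0]
  · simpa using h i

variable {C : Type u} {K : Kind.{u, v} C}

/-- An element of `H` with labels from `ℕ × C` on its output and on its inputs; the second
component of a label is the colour. -/
structure LState (H : K.Act) where
  z : ℕ × C
  L : List (ℕ × C)
  a : List C
  d : C
  ha : a = L.map Prod.snd
  hd : d = z.2
  nodup : (z :: L).Nodup
  x : H.obj a d

namespace LState

variable {H : K.Act.{u, v, w}}

/-- Reordering of the labels by an allowed permutation. -/
inductive Step : LState H → LState H → Prop
  | mk {z z' : ℕ × C} {L L' : List (ℕ × C)} {a a' : List C} {d : C} (ha : a = L.map Prod.snd)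
      (ha' : a' = L'.map Prod.snd) (hd : d = z.2) (hd' : d = z'.2) (hn : (z :: L).Nodup)
      (hn' : (z' :: L').Nodup) (x : H.obj a d) (σ : K.G a a')
      (hm : Matches (K.edge σ) (z :: L) (z' :: L')) :
      Step ⟨z, L, a, d, ha, hd, hn, x⟩ ⟨z', L', a', d, ha', hd', hn', H.map (K.mPerm σ d) x⟩

theorem mPerm_comp {a b c : List C} (σ : K.G a b) (τ : K.G b c) (d : C) :
    K.mPerm σ d ≫ K.mPerm τ d = K.mPerm (K.comp σ τ) d := K.perm_comp σ τ d

theorem mPerm_refl {a : List C} (σ : K.G a a) (d : C) (h : K.edge σ = Equiv.refl _) :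
    K.mPerm σ d = 𝟙 _ := K.perm_id σ d h

theorem mPerm_inv {a b : List C} (σ : K.G a b) (d : C) :
    K.mPerm σ d ≫ K.mPerm (K.inv σ) d = 𝟙 _ := by
  rw [mPerm_comp]
  apply mPerm_refl
  rw [K.edge_comp, K.edge_inv]
  simp

theorem map_mPerm_inv {a b : List C} (σ : K.G a b) (d : C) (x : H.obj a d) :
    H.map (K.mPerm (K.inv σ) d) (H.map (K.mPerm σ d) x) = x := by
  rw [← H.map_comp, mPerm_inv, H.map_id]

theorem Step.symm {S S' : LState H} (h : Step S S') : Step S' S := by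
  obtain ⟨ha, ha', hd, hd', hn, hn', x, σ, hm⟩ := h
  have := Step.mk ha' ha hd' hd hn' hn (H.map (K.mPerm σ _) x) (K.inv σ) (by
    rw [K.edge_inv]; exact hm.symm)
  rwa [map_mPerm_inv] at this

theorem Step.trans {S S' S'' : LState H} (h : Step S S') (h' : Step S' S'') : Step S S'' := by
  obtain ⟨ha, ha', hd, hd', hn, hn', x, σ, hm⟩ := h
  obtain ⟨_, ha'', _, hd'', _, hn'', _, τ, hm'⟩ := h'
  rw [← H.map_comp, mPerm_comp]
  exact Step.mk ha ha'' hd hd'' hn hn'' x (K.comp σ τ) (by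
    rw [K.edge_comp]; exact hm.trans hm')

/-- Labelled elements that differ by an allowed permutation are identified. -/
instance setoid (H : K.Act.{u, v, w}) : Setoid (LState H) where
  r S S' := S = S' ∨ Step S S'
  iseqv := {
    refl := fun _ => Or.inl rfl
    symm := by
      rintro S S' (rfl | h)
      · exact Or.inl rfl
      · exact Or.inr h.symm
    trans := by
      rintro S S' S'' (rfl | h) (rfl | h')
      · exact Or.inl rfl
      · exact Or.inr h'
      · exact Or.inr h
      · exact Or.inr (h.trans h') }

theorem Step.equiv {S S' : LState H} (h : Step S S') : S ≈ S' := Or.inr h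

theorem mem_iff_of_equiv {S S' : LState H} (h : S ≈ S') (t : ℕ × C) :
    t ∈ S.z :: S.L ↔ t ∈ S'.z :: S'.L := by
  rcases h with rfl | h
  · rfl
  · obtain ⟨ha, ha', hd, hd', hn, hn', x, σ, hm⟩ := h
    exact (hm.mem_iff (by rw [ha]; simp) (by rw [ha']; simp) t).symm

/-- An allowed permutation that preserves the distinct labels is the identity, so passage to classes
loses nothing once the labels are fixed. -/
theorem eq_of_equiv {z : ℕ × C} {L : List (ℕ × C)} {a : List C} {d : C} {ha : a = L.map Prod.snd}
    {hd : d = z.2} {hn : (z :: L).Nodup} {x y : H.obj a d}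
    (h : (⟨z, L, a, d, ha, hd, hn, x⟩ : LState H) ≈ ⟨z, L, a, d, ha, hd, hn, y⟩) : x = y := by
  rcases h with h | h
  · injection h
  · generalize hS' : (⟨z, L, a, d, ha, hd, hn, y⟩ : LState H) = S' at h
    obtain ⟨_, _, _, _, _, _, _, σ, hm⟩ := h
    injection hS' with h1 h2 h3 h4 h5
    subst h1 h2 h3
    simp only [heq_eq_eq] at h5
    rw [h5, mPerm_refl σ _ (hm.eq_refl (by simp [ha]) hn), H.map_id]

/-- Renaming of labels. -/
def relabel (f : ℕ × C ≃ ℕ × C) (hf : ∀ l, (f l).2 = l.2) (S : LState H) : LState H where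
  z := f S.z
  L := S.L.map f
  a := S.a
  d := S.d
  ha := by
    rw [S.ha, List.map_map]
    exact List.map_congr_left (fun l _ => (hf l).symm)
  hd := by rw [hf, S.hd]
  nodup := by
    have := (List.nodup_map_iff f.injective).2 S.nodup
    simpa using this
  x := S.x

theorem relabel_equiv (f : ℕ × C ≃ ℕ × C) (hf : ∀ l, (f l).2 = l.2) {S S' : LState H}
    (h : S ≈ S') : S.relabel f hf ≈ S'.relabel f hf := by
  rcases h with rfl | h
  · exact Setoid.refl _
  · obtain ⟨ha, ha', hd, hd', hn, hn', x, σ, hm⟩ := h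
    exact Or.inr (Step.mk _ _ _ _ _ _ _ σ (by simpa using hm.map f))

end LState

/-- Gluing of an operation `Q` to a labelled element `S` along the edge `k`. -/
inductive GlueRel {H : K.Act.{u, v, w}} (k : ℕ × C) :
    LState H → LState K.opAct → LState H → Prop
  | plug (S : LState H) (Q : LState K.opAct) (L₁ L₂ N : List (ℕ × C)) (hL : S.L = L₁ ++ k :: L₂)
      (hz : Q.z = k) (hN : N = L₁ ++ Q.L ++ L₂) (l₁ l₂ r : List C) (hl₁ : l₁ = L₁.map Prod.snd)
      (hl₂ : l₂ = L₂.map Prod.snd) (h₁ : S.a = l₁ ++ Q.d :: l₂) (h₂ : r = l₁ ++ Q.a ++ l₂)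
      (hr : r = N.map Prod.snd) (hn : (S.z :: N).Nodup) (x : H.obj r S.d)
      (hx : H.map (K.mPlug l₁ l₂ h₁ h₂ Q.x S.d) S.x = x) :
      GlueRel k S Q ⟨S.z, N, r, S.d, hr, S.hd, hn, x⟩
  | graft (S : LState H) (Q : LState K.opAct) (N₁ N₂ N : List (ℕ × C)) (hL : Q.L = N₁ ++ k :: N₂)
      (hz : S.z = k) (hN : N = N₁ ++ S.L ++ N₂) (l₁ l₂ r : List C) (hl₁ : l₁ = N₁.map Prod.snd)
      (hl₂ : l₂ = N₂.map Prod.snd) (h₁ : Q.a = l₁ ++ S.d :: l₂) (h₂ : r = l₁ ++ S.a ++ l₂)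
      (hr : r = N.map Prod.snd) (hn : (Q.z :: N).Nodup) (x : H.obj r Q.d)
      (hx : H.map (K.mGraft l₁ l₂ h₁ h₂ Q.x) S.x = x) :
      GlueRel k S Q ⟨Q.z, N, r, Q.d, hr, Q.hd, hn, x⟩

/-! ### Gluing of representatives: uniqueness, associativity and commutation. -/

namespace GlueRel

variable {H : K.Act.{u, v, w}} {k e : ℕ × C}

theorem exists_plug (S : LState H) (Q : LState K.opAct) (L₁ L₂ : List (ℕ × C))
    (hL : S.L = L₁ ++ k :: L₂) (hz : Q.z = k) (hn : (S.z :: (L₁ ++ Q.L ++ L₂)).Nodup) :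
    ∃ W, GlueRel k S Q W ∧ W.z = S.z ∧ W.L = L₁ ++ Q.L ++ L₂ :=
  ⟨_, plug S Q L₁ L₂ _ hL hz rfl _ _ _ rfl rfl (by simp [S.ha, hL, Q.hd, hz]) (by simp [Q.ha])
    rfl hn _ rfl, rfl, rfl⟩

theorem exists_graft (S : LState H) (Q : LState K.opAct) (N₁ N₂ : List (ℕ × C))
    (hL : Q.L = N₁ ++ k :: N₂) (hz : S.z = k) (hn : (Q.z :: (N₁ ++ S.L ++ N₂)).Nodup) :
    ∃ W, GlueRel k S Q W ∧ W.z = Q.z ∧ W.L = N₁ ++ S.L ++ N₂ :=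
  ⟨_, graft S Q N₁ N₂ _ hL hz rfl _ _ _ rfl rfl (by simp [Q.ha, hL, S.hd, hz]) (by simp [S.ha])
    rfl hn _ rfl, rfl, rfl⟩

theorem mem_left {S : LState H} {Q : LState K.opAct} {W : LState H} (h : GlueRel k S Q W) :
    k ∈ S.z :: S.L := by
  cases h with
  | plug L₁ L₂ N hL hz => simp [hL]
  | graft N₁ N₂ N hL hz => simp [hz]

theorem mem_right {S : LState H} {Q : LState K.opAct} {W : LState H} (h : GlueRel k S Q W) :
    k ∈ Q.z :: Q.L := by
  cases h with
  | plug L₁ L₂ N hL hz => simp [hz]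
  | graft N₁ N₂ N hL hz => simp [hL]

theorem mem_iff {S : LState H} {Q : LState K.opAct} {W : LState H} (h : GlueRel k S Q W)
    (hSQ : ∀ l ∈ S.z :: S.L, l ∈ Q.z :: Q.L → l = k)
    (t : ℕ × C) :
    t ∈ W.z :: W.L ↔ (t ∈ S.z :: S.L ∨ t ∈ Q.z :: Q.L) ∧ t ≠ k := by
  have hS := S.nodup
  have hQ := Q.nodup
  cases h with
  | plug L₁ L₂ N hL hz hN =>
    subst hN
    rw [hL] at hS hSQ
    rw [hz] at hQ hSQ
    simp only [hL, hz]
    grind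
  | graft N₁ N₂ N hL hz hN =>
    subst hN
    rw [hL] at hQ hSQ
    rw [hz] at hS hSQ
    simp only [hL, hz]
    grind

theorem relabel (f : ℕ × C ≃ ℕ × C) (hf : ∀ l, (f l).2 = l.2) {S : LState H}
    {Q : LState K.opAct} {W : LState H} (h : GlueRel k S Q W) :
    GlueRel (f k) (S.relabel f hf) (Q.relabel f hf) (W.relabel f hf) := by
  cases h with
  | plug L₁ L₂ N hL hz hN l₁ l₂ r hl₁ hl₂ h₁ h₂ hr hn x hx =>
    subst hN
    exact plug (k := f k) (S.relabel f hf) (Q.relabel f hf) (L₁.map f) (L₂.map f) _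
      (by simp [LState.relabel, hL]) (by simp [LState.relabel, hz]) (by simp [LState.relabel])
      l₁ l₂ r (by rw [hl₁]; simp [Function.comp_def, hf]) (by rw [hl₂]; simp [Function.comp_def, hf])
      h₁ h₂ _ _ _ hx
  | graft N₁ N₂ N hL hz hN l₁ l₂ r hl₁ hl₂ h₁ h₂ hr hn x hx =>
    subst hN
    exact graft (k := f k) (S.relabel f hf) (Q.relabel f hf) (N₁.map f) (N₂.map f) _
      (by simp [LState.relabel, hL]) (by simp [LState.relabel, hz]) (by simp [LState.relabel])
      l₁ l₂ r (by rw [hl₁]; simp [Function.comp_def, hf]) (by rw [hl₂]; simp [Function.comp_def, hf])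
      h₁ h₂ _ _ _ hx

/-- The result of gluing is unique. -/
theorem unique {S : LState H} {Q : LState K.opAct} {W W' : LState H} (h : GlueRel k S Q W)
    (h' : GlueRel k S Q W') : W = W' := by
  have hS := S.nodup
  have hQ := Q.nodup
  cases h with
  | plug L₁ L₂ N hL hz hN l₁ l₂ r hl₁ hl₂ h₁ h₂ hr hn x hx =>
    cases h' with
    | plug L₁' L₂' N' hL' hz' hN' l₁' l₂' r' hl₁' hl₂' h₁' h₂' hr' hn' x' hx' =>
      have : L₁ = L₁' ∧ L₂ = L₂' := by
        rw [hL] at hS hL'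
        have h1 : k ∉ L₁ := by grind
        have h2 : k ∉ L₂ := by grind
        exact ((List.append_cons_inj_of_notMem h1 h2).1 hL').imp_right And.right
      obtain ⟨rfl, rfl⟩ := this
      subst hN hN' hl₁ hl₂ hl₁' hl₂' h₂ h₂' hx hx'
      rfl
    | graft N₁ N₂ N hL' hz' => grind
  | graft N₁ N₂ N hL hz hN l₁ l₂ r hl₁ hl₂ h₁ h₂ hr hn x hx =>
    cases h' with
    | plug L₁ L₂ N hL' hz' => grind
    | graft L₁' L₂' N' hL' hz' hN' l₁' l₂' r' hl₁' hl₂' h₁' h₂' hr' hn' x' hx' =>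
      have : N₁ = L₁' ∧ N₂ = L₂' := by
        rw [hL] at hQ hL'
        have h1 : k ∉ N₁ := by grind
        have h2 : k ∉ N₂ := by grind
        exact ((List.append_cons_inj_of_notMem h1 h2).1 hL').imp_right And.right
      obtain ⟨rfl, rfl⟩ := this
      subst hN hN' hl₁ hl₂ hl₁' hl₂' h₂ h₂' hx hx'
      rfl

/-- Associativity of gluing. -/
theorem assoc {S : LState H} {Q R QR : LState K.opAct} {W : LState H} (hk : GlueRel k S Q W)
    (he : GlueRel e Q R QR) (hSe : e ∉ S.z :: S.L)
    (hSR : ∀ l ∈ S.z :: S.L, l ∉ R.z :: R.L) :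
    ∃ V, GlueRel e W R V ∧ GlueRel k S QR V := by
  have hS := S.nodup
  have hQ := Q.nodup
  have hR := R.nodup
  have hke : k ≠ e := by rintro rfl; exact hSe hk.mem_left
  cases hk with
  | plug L₁ L₂ N hL hz hN l₁ l₂ r hl₁ hl₂ h₁ h₂ hr hn x hx =>
    cases he with
    | plug M₁ M₂ N' hL' hz' hN' m₁ m₂ r' hm₁ hm₂ h₁' h₂' hr' hn' x' hx' =>
      subst hN hN' hl₁ hl₂ hm₁ hm₂ hx hx'
      refine ⟨⟨S.z, L₁ ++ (M₁ ++ R.L ++ M₂) ++ L₂, _, S.d, rfl, S.hd, ?_, _⟩,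
        plug (k := e) _ R (L₁ ++ M₁) (M₂ ++ L₂) _ (by simp [hL']) hz' (by simp)
          (L₁.map Prod.snd ++ M₁.map Prod.snd) (M₂.map Prod.snd ++ L₂.map Prod.snd) _ (by simp)
          (by simp) (by simp [h₂, h₁']) (by simp [R.ha]) _ _ _ rfl,
        plug (k := k) S _ L₁ L₂ _ hL (by exact hz) (by dsimp only) _ _ _ rfl rfl (by exact h₁)
          (by simp [h₂', R.ha]) _ _ _ ?_⟩
      · have := nodup_replace (A := S.z :: L₁ ++ M₁) (B := R.L) (D := M₂ ++ L₂) (M := [e])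
          (by simpa [hL'] using hn) (by grind) (by grind)
        simpa using this
      · dsimp only
        rw [Kind.opAct_plug, ← H.map_comp]
        congr 1
        exact (Kind.plug_plug_seq _ _ _ _ _ _ _ _ _ _ _ _ _).symm
    | graft M₁ M₂ N' hL' hz' hN' m₁ m₂ r' hm₁ hm₂ h₁' h₂' hr' hn' x' hx' =>
      exact absurd (hz.symm.trans hz') hke
  | graft N₁ N₂ N hL hz hN l₁ l₂ r hl₁ hl₂ h₁ h₂ hr hn x hx =>
    cases he with
    | plug M₁ M₂ N' hL' hz' hN' m₁ m₂ r' hm₁ hm₂ h₁' h₂' hr' hn' x' hx' =>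
      have hd1 : k.2 = S.d := by rw [S.hd, hz]
      have hd2 : e.2 = R.d := by rw [R.hd, hz']
      subst hN hN' hx hx'
      -- Both `S` and `R` are grafted to inputs of `Q`. Which of the two inputs stands first decides
      -- which form of the parallel axiom applies.
      rcases List.append_eq_append_iff.1 (hL.symm.trans hL') with ⟨A, hA, hA'⟩ | ⟨A, hA, hA'⟩
      · obtain _ | ⟨k', A⟩ := A
        · grind
        simp only [List.cons_append, List.cons.injEq] at hA'
        obtain ⟨rfl, rfl⟩ := hA'
        obtain rfl : l₂ = A.map Prod.snd ++ R.d :: M₂.map Prod.snd := by simp [hl₂, hd2]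
        obtain rfl : m₁ = N₁.map Prod.snd ++ S.d :: A.map Prod.snd := by simp [hm₁, hA, hd1]
        subst hA hl₁ hm₂
        refine ⟨⟨Q.z, N₁ ++ S.L ++ A ++ R.L ++ M₂, _, Q.d, rfl, Q.hd, ?_, _⟩,
          plug (k := e) _ R (N₁ ++ S.L ++ A) M₂ _ (by simp) hz' (by simp)
            (N₁.map Prod.snd ++ S.a ++ A.map Prod.snd) (M₂.map Prod.snd) _ (by simp [S.ha])
            (by simp) (by simp [h₂]) (by simp [R.ha, S.ha]) _ _ _ rfl,
          graft (k := k) S _ N₁ (A ++ R.L ++ M₂) _ (by simp) hz (by simp)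
            (N₁.map Prod.snd) (A.map Prod.snd ++ R.a ++ M₂.map Prod.snd) _ rfl (by simp [R.ha])
            (by simp [h₂']) (by simp [R.ha, S.ha]) _ _ _ ?_⟩
        · have := nodup_replace (A := Q.z :: N₁ ++ S.L ++ A) (B := R.L) (D := M₂) (M := [e])
            (by simpa using hn) (by grind) (by grind)
          simpa using this
        · dsimp only
          rw [Kind.opAct_plug, ← H.map_comp]
          congr 1
          exact (Kind.graft_plug_right _ _ _ _ _ _ _ _ _ _ _ _ _).symm
      · obtain _ | ⟨k', A⟩ := A
        · grind
        simp only [List.cons_append, List.cons.injEq] at hA'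
        obtain ⟨rfl, rfl⟩ := hA'
        obtain rfl : m₂ = A.map Prod.snd ++ S.d :: N₂.map Prod.snd := by simp [hm₂, hd1]
        obtain rfl : l₁ = M₁.map Prod.snd ++ R.d :: A.map Prod.snd := by simp [hl₁, hA, hd2]
        subst hA hl₂ hm₁
        refine ⟨⟨Q.z, M₁ ++ R.L ++ A ++ S.L ++ N₂, _, Q.d, rfl, Q.hd, ?_, _⟩,
          plug (k := e) _ R M₁ (A ++ S.L ++ N₂) _ (by simp) hz' (by simp)
            (M₁.map Prod.snd) (A.map Prod.snd ++ S.a ++ N₂.map Prod.snd) _ rfl (by simp [S.ha])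
            (by simp [h₂]) (by simp [R.ha, S.ha]) _ _ _ rfl,
          graft (k := k) S _ (M₁ ++ R.L ++ A) N₂ _ (by simp) hz (by simp)
            (M₁.map Prod.snd ++ R.a ++ A.map Prod.snd) (N₂.map Prod.snd) _ (by simp [R.ha]) rfl
            (by simp [h₂']) (by simp [R.ha, S.ha]) _ _ _ ?_⟩
        · have := nodup_replace (A := Q.z :: M₁) (B := R.L) (D := A ++ S.L ++ N₂) (M := [e])
            (by simpa using hn) (by grind) (by grind)
          simpa using this
        · dsimp only
          rw [Kind.opAct_plug, ← H.map_comp]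
          congr 1
          exact Kind.graft_plug_left _ _ _ _ _ _ _ _ _ _ _ _ _
    | graft M₁ M₂ N' hL' hz' hN' m₁ m₂ r' hm₁ hm₂ h₁' h₂' hr' hn' x' hx' =>
      subst hN hN' hl₁ hl₂ hm₁ hm₂ hx hx'
      refine ⟨⟨R.z, M₁ ++ (N₁ ++ S.L ++ N₂) ++ M₂, _, R.d, rfl, R.hd, ?_, _⟩,
        graft (k := e) _ R M₁ M₂ _ hL' (by exact hz') (by dsimp only) _ _ _ rfl rfl (by exact h₁')
          (by simp [h₂, S.ha]) _ _ _ rfl,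
        graft (k := k) S _ (M₁ ++ N₁) (N₂ ++ M₂) _ (by simp [hL]) hz (by simp)
          (M₁.map Prod.snd ++ N₁.map Prod.snd) (N₂.map Prod.snd ++ M₂.map Prod.snd) _ (by simp)
          (by simp) (by simp [h₂', h₁]) (by simp [S.ha]) _ _ _ ?_⟩
      · have := nodup_replace (A := R.z :: M₁ ++ N₁) (B := S.L) (D := N₂ ++ M₂) (M := [k])
          (by simpa [hL] using hn') (by grind) (by grind)
        simpa using this
      · rw [Kind.opAct_graft, ← H.map_comp]
        congr 1
        exact Kind.graft_graft_seq _ _ _ _ _ _ _ _ _ _ _ _ _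

/-- The case of two inputs of `S`, with that of `Q` standing first; it is the parallel axiom with
the variable as the lowest operation. -/
theorem comm_plug {S : LState H} {Q R : LState K.opAct} (A B D : List (ℕ × C))
    (hL : S.L = A ++ k :: (B ++ e :: D)) (hk : Q.z = k) (he : R.z = e)
    (hQ : (S.z :: (A ++ Q.L ++ (B ++ e :: D))).Nodup)
    (hR : (S.z :: (A ++ k :: (B ++ R.L ++ D))).Nodup) (hQR : ∀ l ∈ Q.L, l ∉ R.L) :
    ∃ W W' V, GlueRel k S Q W ∧ GlueRel e S R W' ∧ GlueRel e W R V ∧ GlueRel k W' Q V := by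
  have hd1 : k.2 = Q.d := by rw [Q.hd, hk]
  have hd2 : e.2 = R.d := by rw [R.hd, he]
  refine ⟨_, _, ⟨S.z, A ++ Q.L ++ B ++ R.L ++ D, _, S.d, rfl, S.hd, ?_, _⟩,
    plug (k := k) S Q A (B ++ e :: D) _ (by exact hL) hk rfl (A.map Prod.snd)
      (B.map Prod.snd ++ R.d :: D.map Prod.snd)
      (A.map Prod.snd ++ Q.a ++ (B.map Prod.snd ++ R.d :: D.map Prod.snd)) rfl (by simp [hd2])
      (by simp [S.ha, hL, hd1, hd2]) rfl (by simp [Q.ha, hd2]) hQ _ rfl,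
    plug (k := e) S R (A ++ k :: B) D (A ++ k :: (B ++ R.L ++ D)) (by simpa using hL) he (by simp)
      (A.map Prod.snd ++ Q.d :: B.map Prod.snd) (D.map Prod.snd)
      ((A.map Prod.snd ++ Q.d :: B.map Prod.snd) ++ R.a ++ D.map Prod.snd) (by simp [hd1]) rfl
      (by simp [S.ha, hL, hd1, hd2]) rfl (by simp [R.ha, hd1]) hR _ rfl,
    plug (k := e) _ R (A ++ Q.L ++ B) D _ (by simp) he (by simp)
      (A.map Prod.snd ++ Q.a ++ B.map Prod.snd) (D.map Prod.snd) _ (by simp [Q.ha]) rfl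
      (by simp) (by simp [Q.ha, R.ha]) _ _ _ rfl,
    plug (k := k) _ Q A (B ++ R.L ++ D) _ (by simp) hk (by simp)
      (A.map Prod.snd) (B.map Prod.snd ++ R.a ++ D.map Prod.snd) _ rfl (by simp [R.ha])
      (by simp) (by simp [Q.ha, R.ha]) _ _ _ ?_⟩
  · have h := R.nodup
    have := nodup_replace (A := S.z :: A ++ Q.L ++ B) (B := R.L) (D := D) (M := [e])
      (by simpa using hQ) (by grind) (by grind)
    simpa using this
  · dsimp only
    rw [← H.map_comp, ← H.map_comp]
    congr 1
    exact (Kind.plug_plug_par _ _ _ _ _ _ _ _ _ _ _ _ _).symm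

/-- Here one operation lies below `S` and the other above it, and the sequential axiom with the
variable in the middle applies. -/
theorem comm_graft {S : LState H} {Q R : LState K.opAct} {W W' : LState H} (hk : GlueRel k S Q W)
    (he : GlueRel e S R W') (hQR : ∀ l ∈ Q.z :: Q.L, l ∉ R.z :: R.L) (hz : S.z = k)
    (hz' : R.z = e) : ∃ V, GlueRel e W R V ∧ GlueRel k W' Q V := by
  have hS := S.nodup
  have hR := R.nodup
  cases hk with
  | plug L₁ L₂ N hL => grind
  | graft N₁ N₂ N hL _ hN l₁ l₂ r hl₁ hl₂ h₁ h₂ hr hn x hx =>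
    cases he with
    | graft M₁ M₂ N' hL' => grind
    | plug M₁ M₂ N' hL' _ hN' m₁ m₂ r' hm₁ hm₂ h₁' h₂' hr' hn' x' hx' =>
      subst hN hN' hl₁ hl₂ hm₁ hm₂ hx hx'
      refine ⟨⟨Q.z, N₁ ++ (M₁ ++ R.L ++ M₂) ++ N₂, _, Q.d, rfl, Q.hd, ?_, _⟩,
        plug (k := e) _ R (N₁ ++ M₁) (M₂ ++ N₂) _ (by simp [hL']) hz' (by simp)
          (N₁.map Prod.snd ++ M₁.map Prod.snd) (M₂.map Prod.snd ++ N₂.map Prod.snd) _ (by simp)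
          (by simp) (by simp [h₂, h₁']) (by simp [R.ha]) _ _ _ rfl,
        graft (k := k) _ Q N₁ N₂ _ hL (by exact hz) (by dsimp only) (N₁.map Prod.snd)
          (N₂.map Prod.snd) _ rfl rfl (by exact h₁)
          (by simp [h₂', R.ha]) _ _ _ ?_⟩
      · have := nodup_replace (A := Q.z :: N₁ ++ M₁) (B := R.L) (D := M₂ ++ N₂) (M := [e])
          (by simpa [hL'] using hn) (by grind) (by grind)
        simpa using this
      · rw [← H.map_comp, ← H.map_comp]
        congr 1
        exact (Kind.graft_plug_seq _ _ _ _ _ _ _ _ _ _ _ _ _).symm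

/-- Gluings at different edges commute. -/
theorem comm {S : LState H} {Q R : LState K.opAct} {W W' : LState H} (hk : GlueRel k S Q W)
    (he : GlueRel e S R W') (hke : k ≠ e) (hQR : ∀ l ∈ Q.z :: Q.L, l ∉ R.z :: R.L) :
    ∃ V, GlueRel e W R V ∧ GlueRel k W' Q V := by
  by_cases hz : S.z = k
  · cases he with
    | graft N₁ N₂ N _ hz' => exact absurd (hz.symm.trans hz') hke
    | plug M₁ M₂ N' hL' hz' =>
      exact comm_graft hk (.plug _ _ _ _ _ hL' hz' ‹_› _ _ _ ‹_› ‹_› _ ‹_› _ _ _ ‹_›) hQR hz hz'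
  · have hk' := hk
    cases hk with
    | graft N₁ N₂ N _ hz' => exact absurd hz' hz
    | plug L₁ L₂ N hL hQz hN l₁ l₂ r hl₁ hl₂ h₁ h₂ hr hn x hx =>
      by_cases hz' : S.z = e
      · obtain ⟨V, h1, h2⟩ := comm_graft he hk' (fun l h h' => hQR l h' h) hz' hQz
        exact ⟨V, h2, h1⟩
      · have he' := he
        cases he with
        | graft N₁ N₂ N _ hz'' => exact absurd hz'' hz'
        | plug M₁ M₂ N' hL' hRz hN' m₁ m₂ r' hm₁ hm₂ h₁' h₂' hr' hn' x' hx' =>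
          subst hN hN'
          rcases List.append_eq_append_iff.1 (hL.symm.trans hL') with ⟨A, hA, hA'⟩ | ⟨A, hA, hA'⟩
          · obtain _ | ⟨k', A⟩ := A
            · grind
            simp only [List.cons_append, List.cons.injEq] at hA'
            obtain ⟨rfl, rfl⟩ := hA'
            subst hA
            obtain ⟨W, W', V, h1, h2, h3, h4⟩ := comm_plug (k := k) (e := e) (S := S) (Q := Q)
              (R := R) L₁ A M₂ hL hQz hRz hn (by simpa using hn') (by grind)
            rw [hk'.unique h1, he'.unique h2]
            exact ⟨V, h3, h4⟩
          · obtain _ | ⟨k', A⟩ := A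
            · grind
            simp only [List.cons_append, List.cons.injEq] at hA'
            obtain ⟨rfl, rfl⟩ := hA'
            subst hA
            obtain ⟨W, W', V, h1, h2, h3, h4⟩ := comm_plug (k := e) (e := k) (S := S) (Q := R)
              (R := Q) M₁ A L₂ hL' hRz hQz hn' (by simpa using hn) (by grind)
            rw [hk'.unique h2, he'.unique h1]
            exact ⟨V, h4, h3⟩

end GlueRel

end EnvReedy

/-! ### Rooted and free kinds, and gluing of classes. -/

namespace EnvReedy

variable {C : Type u} {K : Kind.{u, v} C}

/-- The allowed permutations fix the output. -/
def Kind.Rooted (K : Kind.{u, v} C) : Prop := ∀ (a b : List C) (σ : K.G a b), K.edge σ 0 = 0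

/-- All permutations of the inputs and of the output are allowed. -/
def Kind.Free (K : Kind.{u, v} C) : Prop :=
  Subsingleton C ∧ ∀ (a b : List C) (ε : Fin (b.length + 1) ≃ Fin (a.length + 1)),
    ∃ σ : K.G a b, K.edge σ = ε

namespace LState

variable {H : K.Act.{u, v, w}}

/-- The allowed permutations fix the position $0$, so being an output is a property of a label in
the class, not only in a representative. -/
theorem equiv_rooted (hK : K.Rooted) {S S' : LState H} (h : S ≈ S') :
    S.z = S'.z ∧ ∀ l, l ∈ S.L ↔ l ∈ S'.L := by
  have hS := S.nodup
  have hS' := S'.nodup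
  have hz : S.z = S'.z := by
    rcases h with rfl | h
    · rfl
    · obtain ⟨ha, ha', hd, hd', hn, hn', x, σ, hm⟩ := h
      have := hm 0
      rw [hK _ _ σ] at this
      simpa using this.symm
  refine ⟨hz, fun l => ?_⟩
  have := mem_iff_of_equiv h l
  grind

theorem exists_rep (hK : K.Free) (S : LState H) {z : ℕ × C} {L : List (ℕ × C)}
    (hn : (z :: L).Nodup) (h : ∀ l, l ∈ z :: L ↔ l ∈ S.z :: S.L) :
    ∃ S' : LState H, S' ≈ S ∧ S'.z = z ∧ S'.L = L := by
  classical
  obtain ⟨z₀, L₀, a, d, ha, hd, hn₀, x⟩ := S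
  have := hK.1
  obtain ⟨ε, hε⟩ := exists_matches hn₀ hn h (m := (L.map Prod.snd).length + 1) (n := a.length + 1)
    (by simp [ha]) (by simp)
  obtain ⟨σ, rfl⟩ := hK.2 a (L.map Prod.snd) ε
  exact ⟨_, Setoid.symm (Step.mk ha rfl hd (Subsingleton.elim _ _) hn₀ hn x σ hε).equiv, rfl, rfl⟩

/-- In a free kind any edge can be made the output. All polarity requirements of gluing are met by
such choices, as long as enough edges are present. -/
theorem exists_rep_out (hK : K.Free) (S : LState H) {z : ℕ × C} (hz : z ∈ S.z :: S.L) :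
    ∃ S' : LState H, S' ≈ S ∧ S'.z = z ∧ ∀ l ∈ S.z :: S.L, l ≠ z → l ∈ S'.L := by
  classical
  have hp := List.perm_cons_erase hz
  obtain ⟨S', h1, h2, h3⟩ := exists_rep hK S (z := z) (L := (S.z :: S.L).erase z)
    (hp.nodup_iff.1 S.nodup) (fun l => hp.mem_iff.symm)
  refine ⟨S', h1, h2, fun l hl hlz => ?_⟩
  rw [h3]
  exact (List.mem_erase_of_ne hlz).2 hl

end LState

namespace GlueRel

variable {H : K.Act.{u, v, w}} {k e : ℕ × C}

theorem polarity {S : LState H} {Q : LState K.opAct} {W : LState H} (h : GlueRel k S Q W) :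
    (S.z = k ∧ k ∈ Q.L) ∨ (k ∈ S.L ∧ Q.z = k) := by
  cases h with
  | plug L₁ L₂ N hL hz => simp [hL, hz]
  | graft L₁ L₂ N hL hz => simp [hL, hz]

/-- The only obstruction to gluing given representatives with no other common label is polarity: the
edge must be the output on one side and an input on the other. -/
theorem exists_of_polarity {S : LState H} {Q : LState K.opAct}
    (h : (S.z = k ∧ k ∈ Q.L) ∨ (k ∈ S.L ∧ Q.z = k))
    (hSQ : ∀ l ∈ S.z :: S.L, l ∈ Q.z :: Q.L → l = k) : ∃ W, GlueRel k S Q W := by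
  have hS := S.nodup
  have hQ := Q.nodup
  rcases h with ⟨hz, hk⟩ | ⟨hk, hz⟩
  · obtain ⟨L₁, L₂, hL⟩ := List.append_of_mem hk
    obtain ⟨W, h, -⟩ := exists_graft S Q L₁ L₂ hL hz (by
      rw [hL] at hQ
      have := nodup_replace (A := Q.z :: L₁) (B := S.L) (D := L₂) (M := [k])
        (by simpa using hQ) (by grind) (by grind)
      simpa using this)
    exact ⟨W, h⟩
  · obtain ⟨L₁, L₂, hL⟩ := List.append_of_mem hk
    obtain ⟨W, h, -⟩ := exists_plug S Q L₁ L₂ hL hz (by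
      rw [hL] at hS
      have := nodup_replace (A := S.z :: L₁) (B := Q.L) (D := L₂) (M := [k])
        (by simpa using hS) (by grind) (by grind)
      simpa using this)
    exact ⟨W, h⟩

/-- All other labels survive in the result, where they are required to be distinct. -/
theorem disjoint {S : LState H} {Q : LState K.opAct} {W : LState H} (h : GlueRel k S Q W) :
    ∀ l ∈ S.z :: S.L, l ∈ Q.z :: Q.L → l = k := by
  have hS := S.nodup
  have hQ := Q.nodup
  cases h with
  | plug L₁ L₂ N hL hz hN l₁ l₂ r hl₁ hl₂ h₁ h₂ hr hn =>
    subst hN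
    rw [hL, hz]
    rw [hz] at hQ
    simp only [List.nodup_cons, List.nodup_append', List.disjoint_left, List.mem_append] at hn
    grind
  | graft N₁ N₂ N hL hz hN l₁ l₂ r hl₁ hl₂ h₁ h₂ hr hn =>
    subst hN
    rw [hL, hz]
    rw [hz] at hS
    simp only [List.nodup_cons, List.nodup_append', List.disjoint_left, List.mem_append] at hn
    grind

end GlueRel

/-- The identity operation, with the label `k` on the output and the label `m` on the input. -/
def idState (k m : ℕ × C) (h : k ≠ m) (hc : k.2 = m.2) : LState K.opAct where
  z := k
  L := [m]
  a := [k.2]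
  d := k.2
  ha := by simp [hc]
  hd := rfl
  nodup := by simpa using h
  x := K.P.id k.2

/-- The properties of an action of the enveloping category that permit to define gluing of classes
of labelled elements. -/
structure GlueLaws (H : K.Act.{u, v, w}) : Prop where
  kind : K.Rooted ∨ K.Free
  congr {k : ℕ × C} {S S' : LState H} {Q Q' : LState K.opAct} {W W' : LState H} :
    S ≈ S' → Q ≈ Q' → GlueRel k S Q W → GlueRel k S' Q' W' → W ≈ W'
  id_equiv : K.Free → ∀ (k m : ℕ × C) (h : k ≠ m) (hc : k.2 = m.2),
    (idState k m h hc : LState K.opAct) ≈ idState m k h.symm hc.symm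

/-- Classes of labelled elements, with the undefined class added. -/
abbrev Cls (H : K.Act.{u, v, w}) : Type _ := Option (Quotient (LState.setoid H))

section Cls

variable {H : K.Act.{u, v, w}}

/-- The class of a labelled element. -/
def LState.cls (S : LState H) : Cls H := some ⟦S⟧

theorem LState.cls_eq {S S' : LState H} : S.cls = S'.cls ↔ S ≈ S' := by
  simp [LState.cls, Quotient.eq]

/-- The label `k` occurs in the class `s`. -/
def Cls.Has (s : Cls H) (k : ℕ × C) : Prop := ∃ S : LState H, s = S.cls ∧ k ∈ S.z :: S.L

theorem Cls.has_cls {S : LState H} {k : ℕ × C} : Cls.Has S.cls k ↔ k ∈ S.z :: S.L := by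
  constructor
  · rintro ⟨S', h, hk⟩
    exact (LState.mem_iff_of_equiv (LState.cls_eq.1 h) k).2 hk
  · exact fun h => ⟨S, rfl, h⟩

theorem Cls.eq_none_or (s : Cls H) : s = none ∨ ∃ S : LState H, s = S.cls := by
  rcases s with _ | ⟨⟨S⟩⟩
  · exact Or.inl rfl
  · exact Or.inr ⟨S, rfl⟩

theorem Cls.not_has_none (k : ℕ × C) : ¬ Cls.Has (none : Cls H) k := by
  rintro ⟨S, h, -⟩
  cases h

open Classical in
/-- Gluing of an operation to a class of labelled elements along the edge `k`; this changes nothing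
if `k` is not a label of the class. -/
noncomputable def glue (k : ℕ × C) (s : Cls H) (Q : LState K.opAct) : Cls H :=
  -- A class without the edge `k` is returned unchanged, instead of becoming undefined. Families
  -- that see only a part of the edges rely on this.
  if s.Has k then
    -- Representatives may fail to fit: the polarity can be wrong in a rooted kind, and in a free
    -- kind `k` can be the only edge on both sides, so that no edge would be left to serve as
    -- output.
    if h : ∃ (W S : LState H) (Q' : LState K.opAct), s = S.cls ∧ Q' ≈ Q ∧ GlueRel k S Q' W then
      h.choose.cls
    else none
  else s

theorem glue_of_not_has {k : ℕ × C} {s : Cls H} {Q : LState K.opAct} (h : ¬ s.Has k) :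
    glue k s Q = s := if_neg h

theorem glue_eq_none {k : ℕ × C} {s : Cls H} {Q : LState K.opAct} (hk : s.Has k)
    (h : ¬ ∃ (W S : LState H) (Q' : LState K.opAct), s = S.cls ∧ Q' ≈ Q ∧ GlueRel k S Q' W) :
    glue k s Q = none := by
  rw [glue, if_pos hk, dif_neg h]

/-- The chosen witness depends only on the predicate that it satisfies, and this predicate sees `Q`
through its class. Hence even the choice is the same, and no gluing law is needed. -/
theorem glue_congr {k : ℕ × C} {s : Cls H} {Q Q' : LState K.opAct} (hQ : Q ≈ Q') :
    glue k s Q = glue k s Q' := by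
  have : ∀ Q'' : LState K.opAct, Q'' ≈ Q ↔ Q'' ≈ Q' := fun Q'' =>
    ⟨fun h => Setoid.trans h hQ, fun h => Setoid.trans h (Setoid.symm hQ)⟩
  have h : (fun W => ∃ (S : LState H) (Q'' : LState K.opAct),
      s = S.cls ∧ Q'' ≈ Q ∧ GlueRel k S Q'' W) = fun W => ∃ (S : LState H) (Q'' : LState K.opAct),
      s = S.cls ∧ Q'' ≈ Q' ∧ GlueRel k S Q'' W := by
    simp only [this]
  classical
  exact congrArg (fun p : LState H → Prop =>
    if s.Has k then if h : ∃ W, p W then h.choose.cls else none else s) h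

theorem glue_cases (k : ℕ × C) (s : Cls H) (Q : LState K.opAct) (hk : s.Has k) :
    glue k s Q = none ∨ ∃ (W S : LState H) (Q' : LState K.opAct),
      s = S.cls ∧ Q' ≈ Q ∧ GlueRel k S Q' W ∧ glue k s Q = W.cls := by
  by_cases h : ∃ (W S : LState H) (Q' : LState K.opAct), s = S.cls ∧ Q' ≈ Q ∧ GlueRel k S Q' W
  · right
    obtain ⟨S, Q', h1, h2, h3⟩ := h.choose_spec
    exact ⟨_, S, Q', h1, h2, h3, by rw [glue, if_pos hk, dif_pos h]⟩
  · exact Or.inl (glue_eq_none hk h)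

theorem has_glue {k t : ℕ × C} {s : Cls H} {Q : LState K.opAct} (hk : s.Has k)
    (ht : (glue k s Q).Has t) : (s.Has t ∨ t ∈ Q.z :: Q.L) ∧ t ≠ k := by
  rcases glue_cases k s Q hk with h | ⟨W, S, Q', rfl, hQ, hW, h⟩
  · rw [h] at ht
    exact absurd ht (Cls.not_has_none _)
  · rw [h, Cls.has_cls, hW.mem_iff hW.disjoint] at ht
    rwa [Cls.has_cls, ← LState.mem_iff_of_equiv hQ]

section Relabel

variable (f : ℕ × C ≃ ℕ × C) (hf : ∀ l, (f l).2 = l.2)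

/-- Renaming of labels. -/
def Cls.relabel : Cls H → Cls H :=
  Option.map (Quotient.map (LState.relabel f hf) (fun _ _ h => LState.relabel_equiv f hf h))

theorem Cls.relabel_cls (S : LState H) : Cls.relabel f hf S.cls = (S.relabel f hf).cls := rfl

include hf in
theorem symm_snd (l : ℕ × C) : (f.symm l).2 = l.2 := by
  rw [← hf (f.symm l), f.apply_symm_apply]

theorem Cls.relabel_symm_relabel (s : Cls H) :
    Cls.relabel f.symm (symm_snd f hf) (Cls.relabel f hf s) = s := by
  rcases s.eq_none_or with rfl | ⟨S, rfl⟩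
  · rfl
  · rw [Cls.relabel_cls, Cls.relabel_cls]
    congr 1
    cases S
    simp [LState.relabel]

theorem Cls.has_relabel {s : Cls H} {k : ℕ × C} :
    (Cls.relabel f hf s).Has (f k) ↔ s.Has k := by
  rcases s.eq_none_or with rfl | ⟨S, rfl⟩
  · exact iff_of_false (Cls.not_has_none _) (Cls.not_has_none _)
  · rw [Cls.relabel_cls, Cls.has_cls, Cls.has_cls]
    simp [LState.relabel]

theorem Cls.relabel_eq_self {s : Cls H} (h : ∀ l, s.Has l → f l = l) :
    Cls.relabel f hf s = s := by
  rcases s.eq_none_or with rfl | ⟨S, rfl⟩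
  · rfl
  · rw [Cls.relabel_cls]
    congr 1
    simp only [Cls.has_cls] at h
    obtain ⟨z, L, a, d, ha, hd, hn, x⟩ := S
    have h1 : f z = z := h z (by simp)
    have h2 : L.map f = L := by
      conv_rhs => rw [← List.map_id L]
      exact List.map_congr_left fun l hl => h l (by simp [hl])
    simp [LState.relabel, h1, h2]

variable {f hf}

end Relabel

section Identity

variable [DecidableEq C]

theorem swap_snd {k m : ℕ × C} (hc : k.2 = m.2) (l : ℕ × C) : (Equiv.swap k m l).2 = l.2 := by
  rw [Equiv.swap_apply_def]
  split_ifs with h1 h2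
  · rw [h1, hc]
  · rw [h2, hc]
  · rfl

theorem map_swap {k m : ℕ × C} {A B : List (ℕ × C)} (hA : k ∉ A) (hB : k ∉ B) (hA' : m ∉ A)
    (hB' : m ∉ B) : (A ++ k :: B).map (Equiv.swap k m) = A ++ m :: B := by
  have : ∀ L : List (ℕ × C), k ∉ L → m ∉ L → L.map (Equiv.swap k m) = L := by
    intro L h h'
    conv_rhs => rw [← List.map_id L]
    exact List.map_congr_left fun l hl => Equiv.swap_apply_of_ne_of_ne
      (fun h1 => h (h1 ▸ hl)) (fun h1 => h' (h1 ▸ hl))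
  simp [this A hA hA', this B hB hB']

/-- An identity glued to an edge only renames this edge, from the name of one end of the identity to
the name of the other. -/
theorem glueRel_id_in {S : LState H} {k m : ℕ × C} (h : k ≠ m) (hc : k.2 = m.2) (hk : k ∈ S.L)
    (hm : m ∉ S.z :: S.L) :
    GlueRel k S (idState k m h hc) (S.relabel (Equiv.swap k m) (swap_snd hc)) := by
  have hn := S.nodup
  obtain ⟨A, B, hL⟩ := List.append_of_mem hk
  rw [hL] at hn hm
  have hmap := map_swap (k := k) (m := m) (A := A) (B := B) (by grind) (by grind) (by grind)
    (by grind)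
  have hn' := (S.relabel (Equiv.swap k m) (swap_snd hc)).nodup
  have hz : Equiv.swap k m S.z = S.z := Equiv.swap_apply_of_ne_of_ne (by grind) (by grind)
  have := GlueRel.plug (k := k) S (idState k m h hc) A B ((S.L).map (Equiv.swap k m)) hL rfl
    (by rw [hL, hmap]; simp [idState]) (A.map Prod.snd) (B.map Prod.snd) S.a rfl rfl
    (by simp [S.ha, hL, idState]) (by simp [S.ha, hL, idState])
    (S.relabel (Equiv.swap k m) (swap_snd hc)).ha (by
      have := hn'
      simp only [LState.relabel, hz] at this
      exact this) S.x (by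
      refine (congrArg (fun f => H.map f S.x) (Kind.mPlug_id _ _ _ _)).trans (H.map_id _))
  convert this using 1
  simp [LState.relabel, hz]

theorem glueRel_id_out {S : LState H} {k m : ℕ × C} (h : k ≠ m) (hc : k.2 = m.2) (hk : S.z = k)
    (hm : m ∉ S.z :: S.L) :
    GlueRel k S (idState m k h.symm hc.symm) (S.relabel (Equiv.swap k m) (swap_snd hc)) := by
  have hn := S.nodup
  rw [hk] at hn
  have hL : S.L.map (Equiv.swap k m) = S.L := by
    conv_rhs => rw [← List.map_id S.L]
    exact List.map_congr_left fun l hl => Equiv.swap_apply_of_ne_of_ne (by grind) (by grind)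
  have hn' := (S.relabel (Equiv.swap k m) (swap_snd hc)).nodup
  have hz : Equiv.swap k m S.z = m := by rw [hk]; exact Equiv.swap_apply_left k m
  obtain ⟨z, L, a, d, ha, hd, hn₀, x⟩ := S
  obtain rfl : d = m.2 := by rw [hd, ← hc, ← hk]
  have := GlueRel.graft (k := k) (⟨z, L, a, m.2, ha, hd, hn₀, x⟩ : LState H)
    (idState m k h.symm hc.symm) [] [] L (by simp [idState]) hk (by simp) [] [] a rfl rfl
    (by simp [idState]) (by simp) ha (by
      have := hn'
      simp only [LState.relabel, hz, hL] at this
      exact this) x (by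
      refine (congrArg (fun f => H.map f x) (Kind.mGraft_id _ _)).trans (H.map_id _))
  convert this using 1
  simp only [LState.relabel]
  simp only at hz hL
  simp [hz, hL, idState]

end Identity

/-! ### The laws of gluing for classes. -/

namespace GlueLaws

variable (hH : GlueLaws H)
include hH

/-- Any fitting pair of representatives computes the gluing, because `GlueLaws.congr` makes the
chosen witness irrelevant up to equivalence. -/
theorem glue_eq {k : ℕ × C} {S S' W : LState H} {Q Q' : LState K.opAct}
    (hS : S' ≈ S) (hQ : Q' ≈ Q) (h : GlueRel k S' Q' W) : glue k S.cls Q = W.cls := by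
  have hk : S.cls.Has k := Cls.has_cls.2 ((LState.mem_iff_of_equiv hS k).1 h.mem_left)
  have hex : ∃ (W S₁ : LState H) (Q' : LState K.opAct),
    S.cls = S₁.cls ∧ Q' ≈ Q ∧ GlueRel k S₁ Q' W := ⟨W, S', Q', (LState.cls_eq.2 hS).symm, hQ, h⟩
  rw [glue, if_pos hk, dif_pos hex, LState.cls_eq]
  obtain ⟨S₁, Q₁, h1, h2, h3⟩ := hex.choose_spec
  exact hH.congr (Setoid.trans (Setoid.symm (LState.cls_eq.1 h1)) (Setoid.symm hS))
    (Setoid.trans h2 (Setoid.symm hQ)) h3 h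

theorem glue_relabel_of_eq (f : ℕ × C ≃ ℕ × C) (hf : ∀ l, (f l).2 = l.2) {k : ℕ × C} {s : Cls H}
    {Q : LState K.opAct} : glue (f k) (s.relabel f hf) (Q.relabel f hf) =
      (glue k s Q).relabel f hf := by
  by_cases hk : s.Has k
  · rcases glue_cases k s Q hk with h | ⟨W, S, Q', rfl, hQ, hW, h⟩
    · rw [h]
      -- A gluing that exists after renaming can be renamed back, so undefinedness is invariant as
      -- well.
      apply glue_eq_none ((Cls.has_relabel f hf).2 hk)
      rintro ⟨W, S', Q', h1, h2, h3⟩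
      have h4 := h3.relabel f.symm (symm_snd f hf)
      rw [f.symm_apply_apply] at h4
      have h5 := Cls.relabel_symm_relabel f hf s
      rw [h1, Cls.relabel_cls] at h5
      rw [← h5, hH.glue_eq (Setoid.refl _) (Setoid.trans (LState.relabel_equiv _ _ h2) ?_) h4] at h
      · cases h
      · apply Or.inl
        cases Q
        simp [LState.relabel]
    · rw [h, Cls.relabel_cls, Cls.relabel_cls]
      exact hH.glue_eq (Setoid.refl _) (LState.relabel_equiv f hf hQ) (hW.relabel f hf)
  · rw [glue_of_not_has hk, glue_of_not_has]
    rwa [Cls.has_relabel]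

omit hH in
-- In a rooted kind another representative cannot repair a wrong polarity.
theorem glue_none_of_rooted (hK : K.Rooted) {k : ℕ × C} {S : LState H} {Q : LState K.opAct}
    (hk : k ∈ S.z :: S.L) (h : ¬ ((S.z = k ∧ k ∈ Q.L) ∨ (k ∈ S.L ∧ Q.z = k))) :
    glue k S.cls Q = none := by
  apply glue_eq_none (Cls.has_cls.2 hk)
  rintro ⟨W, S', Q', h1, h2, h3⟩
  apply h
  have h4 := LState.equiv_rooted hK (LState.cls_eq.1 h1)
  have h5 := LState.equiv_rooted hK h2
  have := h3.polarity
  rwa [← h4.1, ← h4.2, h5.1, h5.2] at this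

omit hH in
-- Every representative on either side has `k` as its output and no input, so one of the two edges
-- to be glued can never be an input.
theorem glue_none_of_singleton {k : ℕ × C} {s : Cls H} {Q : LState K.opAct} (hk : s.Has k)
    (h : ∀ l, s.Has l → l = k) (hQ : ∀ l ∈ Q.z :: Q.L, l = k) : glue k s Q = none := by
  apply glue_eq_none hk
  rintro ⟨W, S, Q', rfl, h2, h3⟩
  simp only [Cls.has_cls] at h
  have hS := S.nodup
  have hQn := Q'.nodup
  have hQ' : ∀ l ∈ Q'.z :: Q'.L, l = k := fun l hl => hQ l ((LState.mem_iff_of_equiv h2 l).1 hl)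
  have h4 := hQ' Q'.z (by simp)
  have h5 := h S.z (by simp)
  rw [h4] at hQn
  rw [h5] at hS
  rcases h3.polarity with h6 | h6
  · exact (List.nodup_cons.1 hQn).1 h6.2
  · exact (List.nodup_cons.1 hS).1 h6.1

/-- Gluing of two operations one after another is gluing of their composition. -/
theorem glue_glue_seq (hO : GlueLaws K.opAct) {k e : ℕ × C} {s : Cls H} {Q R QR : LState K.opAct}
    (he : GlueRel e Q R QR) (hkQ : k ∈ Q.z :: Q.L) (hes : ¬ s.Has e) (hke : k ≠ e)
    (hsQ : ∀ l, s.Has l → l ∈ Q.z :: Q.L → l = k)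
    (hsR : ∀ l, s.Has l → l ∉ R.z :: R.L) :
    glue e (glue k s Q) R = glue k s QR := by
  by_cases hk : s.Has k
  swap
  · rw [glue_of_not_has hk, glue_of_not_has hk, glue_of_not_has hes]
  obtain rfl | ⟨S, rfl⟩ := s.eq_none_or
  · exact absurd hk (Cls.not_has_none _)
  simp only [Cls.has_cls] at hk hes hsQ hsR
  -- It suffices to find representatives of the three elements that fit simultaneously;
  -- `GlueRel.assoc` then compares the two orders of gluing.
  have main : ∀ {S' : LState H} {Q' R' QR' : LState K.opAct} {W : LState H}, S' ≈ S → Q' ≈ Q →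
      R' ≈ R → GlueRel k S' Q' W → GlueRel e Q' R' QR' →
      glue e (glue k S.cls Q) R = glue k S.cls QR := by
    intro S' Q' R' QR' W hS hQ hR h1 h2
    obtain ⟨V, h3, h4⟩ := h1.assoc h2
      (fun h => hes ((LState.mem_iff_of_equiv hS e).1 h))
      (fun l h h' => hsR l ((LState.mem_iff_of_equiv hS l).1 h) ((LState.mem_iff_of_equiv hR l).1 h'))
    rw [hH.glue_eq hS hQ h1, hH.glue_eq (Setoid.refl _) hR h3,
      hH.glue_eq hS (hO.congr hQ hR h2 he) h4]
  have hkR := hsR k hk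
  have hQRd := he.disjoint
  have hQn := Q.nodup
  have hRn := R.nodup
  have hSn := S.nodup
  have heQ := he.mem_left
  have heR := he.mem_right
  rcases hH.kind with hK | hK
  · by_cases hp : (S.z = k ∧ k ∈ Q.L) ∨ (k ∈ S.L ∧ Q.z = k)
    · obtain ⟨W, hW⟩ := GlueRel.exists_of_polarity hp hsQ
      exact main (Setoid.refl _) (Setoid.refl _) (Setoid.refl _) hW he
    · rw [glue_none_of_rooted hK hk hp, glue_of_not_has (Cls.not_has_none _),
        glue_none_of_rooted hK hk]
      contrapose! hp
      have : QR.z = k → Q.z = k := by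
        intro h
        cases he with
        | plug L₁ L₂ N hL hz hN => exact h
        | graft L₁ L₂ N hL hz hN => grind
      have : k ∈ QR.L → k ∈ Q.L := by
        intro h
        cases he with
        | plug L₁ L₂ N hL hz hN => grind
        | graft L₁ L₂ N hL hz hN => grind
      tauto
  -- The composite needs an output, which must be an edge other than `k` and `e`. It is looked for
  -- in `Q`, then in `R`, then in `S`; its place determines the direction of the two inner edges.
  · by_cases h3 : ∃ m ∈ Q.z :: Q.L, m ≠ k ∧ m ≠ e
    · obtain ⟨m, hm, hmk, hme⟩ := h3
      obtain ⟨Q', hQ', hQz, hQL⟩ := LState.exists_rep_out hK Q hm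
      obtain ⟨S', hS', hSz, -⟩ := LState.exists_rep_out hK S hk
      obtain ⟨R', hR', hRz, -⟩ := LState.exists_rep_out hK R heR
      obtain ⟨W, hW⟩ := GlueRel.exists_of_polarity (S := S') (Q := Q')
        (Or.inl ⟨hSz, hQL k hkQ hmk.symm⟩) (fun l hl hl' => hsQ l
          ((LState.mem_iff_of_equiv hS' l).1 hl) ((LState.mem_iff_of_equiv hQ' l).1 hl'))
      obtain ⟨QR', hQR'⟩ := GlueRel.exists_of_polarity (S := Q') (Q := R')
        (Or.inr ⟨hQL e heQ hme.symm, hRz⟩) (fun l hl hl' => hQRd l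
          ((LState.mem_iff_of_equiv hQ' l).1 hl) ((LState.mem_iff_of_equiv hR' l).1 hl'))
      exact main hS' hQ' hR' hW hQR'
    push Not at h3
    by_cases h4 : ∃ m ∈ R.z :: R.L, m ≠ e
    · obtain ⟨m, hm, hme⟩ := h4
      obtain ⟨Q', hQ', hQz, hQL⟩ := LState.exists_rep_out hK Q heQ
      obtain ⟨S', hS', hSz, -⟩ := LState.exists_rep_out hK S hk
      obtain ⟨R', hR', hRz, hRL⟩ := LState.exists_rep_out hK R hm
      obtain ⟨W, hW⟩ := GlueRel.exists_of_polarity (S := S') (Q := Q')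
        (Or.inl ⟨hSz, hQL k hkQ hke⟩) (fun l hl hl' => hsQ l
          ((LState.mem_iff_of_equiv hS' l).1 hl) ((LState.mem_iff_of_equiv hQ' l).1 hl'))
      obtain ⟨QR', hQR'⟩ := GlueRel.exists_of_polarity (S := Q') (Q := R')
        (Or.inl ⟨hQz, hRL e heR hme.symm⟩) (fun l hl hl' => hQRd l
          ((LState.mem_iff_of_equiv hQ' l).1 hl) ((LState.mem_iff_of_equiv hR' l).1 hl'))
      exact main hS' hQ' hR' hW hQR'
    push Not at h4
    by_cases h5 : ∃ m ∈ S.z :: S.L, m ≠ k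
    · obtain ⟨m, hm, hmk⟩ := h5
      obtain ⟨Q', hQ', hQz, hQL⟩ := LState.exists_rep_out hK Q hkQ
      obtain ⟨S', hS', hSz, hSL⟩ := LState.exists_rep_out hK S hm
      obtain ⟨R', hR', hRz, -⟩ := LState.exists_rep_out hK R heR
      obtain ⟨W, hW⟩ := GlueRel.exists_of_polarity (S := S') (Q := Q')
        (Or.inr ⟨hSL k hk hmk.symm, hQz⟩) (fun l hl hl' => hsQ l
          ((LState.mem_iff_of_equiv hS' l).1 hl) ((LState.mem_iff_of_equiv hQ' l).1 hl'))
      obtain ⟨QR', hQR'⟩ := GlueRel.exists_of_polarity (S := Q') (Q := R')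
        (Or.inr ⟨hQL e heQ hke.symm, hRz⟩) (fun l hl hl' => hQRd l
          ((LState.mem_iff_of_equiv hQ' l).1 hl) ((LState.mem_iff_of_equiv hR' l).1 hl'))
      exact main hS' hQ' hR' hW hQR'
    push Not at h5
    -- No edge remains besides the two inner ones, so both sides have to be undefined.
    rw [glue_none_of_singleton (s := S.cls) (Q := QR) (Cls.has_cls.2 hk)
      (fun l hl => h5 l (Cls.has_cls.1 hl))]
    · by_cases h6 : (glue k S.cls Q).Has e
      · refine glue_none_of_singleton h6 (fun l hl => ?_) h4
        obtain ⟨h7, h8⟩ := has_glue (Cls.has_cls.2 hk) hl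
        rw [Cls.has_cls] at h7
        by_contra h9
        rcases h7 with h7 | h7
        · exact h8 (h5 l h7)
        · exact h9 (h3 l h7 h8)
      · rw [glue_of_not_has h6]
        rcases glue_cases k S.cls Q (Cls.has_cls.2 hk) with h | ⟨W, S', Q', h, hQ', hW, h'⟩
        · exact h
        · refine absurd ?_ h6
          rw [h', Cls.has_cls, hW.mem_iff hW.disjoint]
          exact ⟨Or.inr ((LState.mem_iff_of_equiv hQ' e).2 heQ), hke.symm⟩
    · intro l hl
      rw [he.mem_iff hQRd] at hl
      obtain ⟨h | h, h'⟩ := hl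
      · by_contra h6
        exact h' (h3 l h h6)
      · exact absurd (h4 l h) h'

theorem glue_glue_comm_of_rel {k e : ℕ × C} {S : LState H} {Q R : LState K.opAct} (hke : k ≠ e)
    (hQR : ∀ l ∈ Q.z :: Q.L, l ∉ R.z :: R.L) {S' : LState H} {Q' R' : LState K.opAct}
    {W W' : LState H} (hS : S' ≈ S) (hQ : Q' ≈ Q) (hR : R' ≈ R) (h1 : GlueRel k S' Q' W)
    (h2 : GlueRel e S' R' W') :
    glue e (glue k S.cls Q) R = glue k (glue e S.cls R) Q := by
  obtain ⟨V, h3, h4⟩ := h1.comm h2 hke (fun l h h' => hQR l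
    ((LState.mem_iff_of_equiv hQ l).1 h) ((LState.mem_iff_of_equiv hR l).1 h'))
  rw [hH.glue_eq hS hQ h1, hH.glue_eq hS hR h2, hH.glue_eq (Setoid.refl _) hR h3,
    hH.glue_eq (Setoid.refl _) hQ h4]

omit hH in
-- Gluing at another edge does not change the direction of `k`, so undefinedness at `k` persists.
-- Without this the two orders of gluing could differ in being defined.
theorem glue_glue_none_of_rooted (hK : K.Rooted) {k e : ℕ × C} {S : LState H}
    {Q R : LState K.opAct} (hk : k ∈ S.z :: S.L)
    (hkR : k ∉ R.z :: R.L) (hke : k ≠ e) (he : e ∈ S.z :: S.L)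
    (h : ¬ ((S.z = k ∧ k ∈ Q.L) ∨ (k ∈ S.L ∧ Q.z = k))) :
    glue k (glue e S.cls R) Q = none := by
  rcases glue_cases e S.cls R (Cls.has_cls.2 he) with h' | ⟨W, S', R', h1, hR', hW, h'⟩
  · rw [h', glue_of_not_has (Cls.not_has_none _)]
  · rw [h']
    have hS := LState.equiv_rooted hK (LState.cls_eq.1 h1)
    have hkR' : k ∉ R'.z :: R'.L := fun h => hkR ((LState.mem_iff_of_equiv hR' k).1 h)
    rw [hS.1, hS.2] at h
    have hk' : k ∈ S'.z :: S'.L := (LState.mem_iff_of_equiv (LState.cls_eq.1 h1) k).1 hk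
    refine glue_none_of_rooted hK ((hW.mem_iff hW.disjoint k).2 ⟨Or.inl hk', hke⟩) ?_
    contrapose! h
    have hSn := S'.nodup
    have hRn := R'.nodup
    cases hW with
    | plug L₁ L₂ N hL hz hN =>
      subst hN
      simp only [hL, List.mem_append, List.mem_cons] at h hk' hkR' ⊢
      tauto
    | graft L₁ L₂ N hL hz hN =>
      subst hN
      simp only [hL, List.mem_append, List.mem_cons] at h hk' hkR' ⊢
      have : R'.z ≠ k := fun h => hkR' (Or.inl h.symm)
      tauto

/-- Gluings of two operations at different edges commute. -/
theorem glue_glue_comm {k e : ℕ × C} {s : Cls H} {Q R : LState K.opAct}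
    (hkQ : k ∈ Q.z :: Q.L) (heR : e ∈ R.z :: R.L) (hke : k ≠ e)
    (hsQ : ∀ l, s.Has l → l ∈ Q.z :: Q.L → l = k)
    (hsR : ∀ l, s.Has l → l ∈ R.z :: R.L → l = e)
    (hQR : ∀ l ∈ Q.z :: Q.L, l ∉ R.z :: R.L) :
    glue e (glue k s Q) R = glue k (glue e s R) Q := by
  have hkR := hQR k hkQ
  have heQ : e ∉ Q.z :: Q.L := fun h => hQR e h heR
  by_cases hk : s.Has k
  swap
  · rw [glue_of_not_has hk, glue_of_not_has (k := k)]
    intro h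
    by_cases he : s.Has e
    · have := has_glue he h
      tauto
    · exact hk (glue_of_not_has he ▸ h)
  by_cases he : s.Has e
  swap
  · rw [glue_of_not_has he, glue_of_not_has (k := e)]
    intro h
    have := has_glue hk h
    tauto
  obtain rfl | ⟨S, rfl⟩ := s.eq_none_or
  · exact absurd hk (Cls.not_has_none _)
  simp only [Cls.has_cls] at hk he hsQ hsR
  rcases hH.kind with hK | hK
  · by_cases hp : (S.z = k ∧ k ∈ Q.L) ∨ (k ∈ S.L ∧ Q.z = k)
    · by_cases hp' : (S.z = e ∧ e ∈ R.L) ∨ (e ∈ S.L ∧ R.z = e)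
      · obtain ⟨W, hW⟩ := GlueRel.exists_of_polarity hp hsQ
        obtain ⟨W', hW'⟩ := GlueRel.exists_of_polarity hp' hsR
        exact hH.glue_glue_comm_of_rel hke hQR (Setoid.refl _) (Setoid.refl _) (Setoid.refl _) hW hW'
      · rw [glue_none_of_rooted hK he hp', glue_of_not_has (Cls.not_has_none _),
          glue_glue_none_of_rooted hK he heQ hke.symm hk hp']
    · rw [glue_none_of_rooted hK hk hp, glue_of_not_has (Cls.not_has_none _),
          glue_glue_none_of_rooted hK hk hkR hke he hp]
  -- Again fitting representatives are sufficient. They are obtained from an edge that survives in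
  -- `Q`, in `R` or in `S`, and that is directed outwards.
  · have aux : ∀ {S' : LState H} {Q' R' : LState K.opAct}, S' ≈ S → Q' ≈ Q → R' ≈ R →
        ((S'.z = k ∧ k ∈ Q'.L) ∨ (k ∈ S'.L ∧ Q'.z = k)) →
        ((S'.z = e ∧ e ∈ R'.L) ∨ (e ∈ S'.L ∧ R'.z = e)) →
        glue e (glue k S.cls Q) R = glue k (glue e S.cls R) Q := by
      intro S' Q' R' hS' hQ' hR' h1 h2
      obtain ⟨W, hW⟩ := GlueRel.exists_of_polarity h1 (fun l hl hl' => hsQ l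
        ((LState.mem_iff_of_equiv hS' l).1 hl) ((LState.mem_iff_of_equiv hQ' l).1 hl'))
      obtain ⟨W', hW'⟩ := GlueRel.exists_of_polarity h2 (fun l hl hl' => hsR l
        ((LState.mem_iff_of_equiv hS' l).1 hl) ((LState.mem_iff_of_equiv hR' l).1 hl'))
      exact hH.glue_glue_comm_of_rel hke hQR hS' hQ' hR' hW hW'
    obtain ⟨Sk, hSk, hSkz, hSkL⟩ := LState.exists_rep_out hK S hk
    obtain ⟨Se, hSe, hSez, hSeL⟩ := LState.exists_rep_out hK S he
    obtain ⟨Qk, hQk, hQkz, -⟩ := LState.exists_rep_out hK Q hkQ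
    obtain ⟨Re, hRe, hRez, -⟩ := LState.exists_rep_out hK R heR
    by_cases h3 : ∃ m ∈ Q.z :: Q.L, m ≠ k
    · obtain ⟨m, hm, hmk⟩ := h3
      obtain ⟨Q', hQ', hQz, hQL⟩ := LState.exists_rep_out hK Q hm
      exact aux hSk hQ' hRe (Or.inl ⟨hSkz, hQL k hkQ hmk.symm⟩)
        (Or.inr ⟨hSkL e he hke.symm, hRez⟩)
    by_cases h4 : ∃ m ∈ R.z :: R.L, m ≠ e
    · obtain ⟨m, hm, hme⟩ := h4
      obtain ⟨R', hR', hRz, hRL⟩ := LState.exists_rep_out hK R hm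
      exact aux hSe hQk hR' (Or.inr ⟨hSeL k hk hke, hQkz⟩) (Or.inl ⟨hSez, hRL e heR hme.symm⟩)
    by_cases h5 : ∃ m ∈ S.z :: S.L, m ≠ k ∧ m ≠ e
    · obtain ⟨m, hm, hmk, hme⟩ := h5
      obtain ⟨S', hS', hSz, hSL⟩ := LState.exists_rep_out hK S hm
      exact aux hS' hQk hRe (Or.inr ⟨hSL k hk hmk.symm, hQkz⟩) (Or.inr ⟨hSL e he hme.symm, hRez⟩)
    push Not at h3 h4 h5
    -- When no edge survives, the first gluing is undefined or leaves a single edge, and then the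
    -- second one is undefined. This form is used for both orders.
    have none_of : ∀ {k e : ℕ × C} {Q R : LState K.opAct}, k ∈ S.z :: S.L → e ∈ S.z :: S.L →
        k ≠ e → (∀ l ∈ Q.z :: Q.L, l = k) → (∀ l ∈ R.z :: R.L, l = e) →
        (∀ l ∈ S.z :: S.L, l ≠ k → l = e) → glue e (glue k S.cls Q) R = none := by
      intro k e Q R hk he hke h3 h4 h5
      rcases glue_cases k S.cls Q (Cls.has_cls.2 hk) with h' | ⟨W, S', Q', h1, hQ', hW, h'⟩
      · rw [h', glue_of_not_has (Cls.not_has_none _)]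
      · rw [h']
        have hS' := LState.mem_iff_of_equiv (LState.cls_eq.1 h1)
        apply glue_none_of_singleton
        · rw [Cls.has_cls, hW.mem_iff hW.disjoint]
          exact ⟨Or.inl ((hS' e).1 he), hke.symm⟩
        · intro l hl
          rw [Cls.has_cls, hW.mem_iff hW.disjoint] at hl
          obtain ⟨hl | hl, hl'⟩ := hl
          · exact h5 l ((hS' l).2 hl) hl'
          · exact absurd (h3 l ((LState.mem_iff_of_equiv hQ' l).1 hl)) hl'
        · exact h4
    rw [none_of hk he hke h3 h4 h5, none_of he hk hke.symm h4 h3]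
    intro l hl hle
    by_contra hlk
    exact hle (h5 l hl hlk)

section Identity

variable [DecidableEq C]

/-- The polarity hypothesis is needed in a rooted kind only, where an identity with the output `k`
cannot be glued to the output `k` of an element. -/
theorem glue_id_in {s : Cls H} {k m : ℕ × C} (h : k ≠ m) (hc : k.2 = m.2)
    (hm : ¬ s.Has m) (hp : K.Rooted → ∀ S : LState H, s = S.cls → S.z ≠ k) :
    glue k s (idState k m h hc) = s.relabel (Equiv.swap k m) (swap_snd hc) := by
  by_cases hk : s.Has k
  swap
  · rw [glue_of_not_has hk, Cls.relabel_eq_self]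
    exact fun l hl => Equiv.swap_apply_of_ne_of_ne (fun h => hk (h ▸ hl)) (fun h => hm (h ▸ hl))
  obtain rfl | ⟨S, rfl⟩ := s.eq_none_or
  · exact absurd hk (Cls.not_has_none _)
  rw [Cls.has_cls] at hk hm
  have aux : ∀ S' : LState H, S' ≈ S → k ∈ S'.L →
      glue k S.cls (idState k m h hc) = Cls.relabel (Equiv.swap k m) (swap_snd hc) S.cls := by
    intro S' hS' hk'
    rw [hH.glue_eq hS' (Setoid.refl _) (glueRel_id_in h hc hk'
      (fun h => hm ((LState.mem_iff_of_equiv hS' m).1 h))), Cls.relabel_cls, LState.cls_eq]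
    exact LState.relabel_equiv _ _ hS'
  rcases hH.kind with hK | hK
  · have := hp hK S rfl
    refine aux S (Setoid.refl _) ?_
    rcases List.mem_cons.1 hk with h | h
    · exact absurd h.symm this
    · exact h
  · by_cases h1 : ∃ l ∈ S.z :: S.L, l ≠ k
    · obtain ⟨l, hl, hlk⟩ := h1
      obtain ⟨S', hS', -, hSL⟩ := LState.exists_rep_out hK S hl
      exact aux S' hS' (hSL k hk hlk.symm)
    -- If `k` is the only edge it has to be the output, and the identity must be turned around; in a
    -- free kind this does not change its class.
    · obtain ⟨S', hS', hSz, -⟩ := LState.exists_rep_out hK S hk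
      rw [hH.glue_eq hS' (hH.id_equiv hK m k h.symm hc.symm) (glueRel_id_out h hc hSz
        (fun h => hm ((LState.mem_iff_of_equiv hS' m).1 h))), Cls.relabel_cls, LState.cls_eq]
      exact LState.relabel_equiv _ _ hS'

theorem glue_id_out {s : Cls H} {k m : ℕ × C} (h : k ≠ m) (hc : k.2 = m.2)
    (hm : ¬ s.Has m) (hp : K.Rooted → ∀ S : LState H, s = S.cls → k ∉ S.L) :
    glue k s (idState m k h.symm hc.symm) = s.relabel (Equiv.swap k m) (swap_snd hc) := by
  rcases hH.kind with hK | hK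
  · by_cases hk : s.Has k
    swap
    · rw [glue_of_not_has hk, Cls.relabel_eq_self]
      exact fun l hl => Equiv.swap_apply_of_ne_of_ne (fun h => hk (h ▸ hl)) (fun h => hm (h ▸ hl))
    obtain rfl | ⟨S, rfl⟩ := s.eq_none_or
    · exact absurd hk (Cls.not_has_none _)
    rw [Cls.has_cls] at hk hm
    have := hp hK S rfl
    rw [hH.glue_eq (Setoid.refl _) (Setoid.refl _) (glueRel_id_out h hc ?_ hm), Cls.relabel_cls]
    rcases List.mem_cons.1 hk with h | h
    · exact h.symm
    · exact absurd h this
  · rw [glue_congr (hH.id_equiv hK m k h.symm hc.symm)]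
    -- The two alternatives of `GlueLaws.kind` are not assumed to exclude each other, and
    -- `glue_id_in` would ask for a different polarity if the kind were also rooted.
    by_cases hK' : K.Rooted
    · by_cases hk : s.Has k
      swap
      · rw [glue_of_not_has hk, Cls.relabel_eq_self]
        exact fun l hl => Equiv.swap_apply_of_ne_of_ne (fun h => hk (h ▸ hl)) (fun h => hm (h ▸ hl))
      obtain rfl | ⟨S, rfl⟩ := s.eq_none_or
      · exact absurd hk (Cls.not_has_none _)
      rw [Cls.has_cls] at hk hm
      rw [hH.glue_eq (Setoid.refl _) (hH.id_equiv hK m k h.symm hc.symm)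
        (glueRel_id_out h hc ?_ hm), Cls.relabel_cls]
      rcases List.mem_cons.1 hk with h | h
      · exact h.symm
      · exact absurd h (hp hK' S rfl)
    · exact hH.glue_id_in h hc hm (fun h => absurd h hK')

end Identity

end GlueLaws

end Cls

end EnvReedy

namespace EnvReedy

variable {C : Type u} {K : Kind.{u, v} C}

/-! ### Labellings of profiles and families of classes -/

/-- Labellings of the output and of the inputs of a profile; the name `0` is reserved. -/
@[ext]
structure Lab (a : List C) (d : C) where
  z : ℕ × C
  L : List (ℕ × C)
  hz : z.2 = d
  hL : L.map Prod.snd = a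
  nodup : (z :: L).Nodup
  pos : ∀ l ∈ z :: L, l.1 ≠ 0

namespace Lab

variable {a b r : List C} {c d : C}

/-- An operation with labels. -/
def op (μ : Lab a d) (q : K.P.Op a d) : LState K.opAct :=
  ⟨μ.z, μ.L, a, d, μ.hL.symm, μ.hz.symm, μ.nodup, q⟩

/-- Renaming of labels. -/
def relabel (f : ℕ × C ≃ ℕ × C) (hf : ∀ l, (f l).2 = l.2) (h0 : ∀ l, l.1 = 0 → f l = l)
    (μ : Lab a d) : Lab a d where
  z := f μ.z
  L := μ.L.map f
  hz := by rw [hf, μ.hz]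
  hL := by
    rw [List.map_map]
    exact (List.map_congr_left (fun l _ => hf l)).trans μ.hL
  nodup := by
    have := (List.nodup_map_iff f.injective).2 μ.nodup
    simpa using this
  pos := by
    have key : ∀ l, (f l).1 = 0 → l.1 = 0 := fun l hl => by
      have := f.injective (h0 _ hl)
      rwa [this] at hl
    intro l hl h
    rw [← List.map_cons (f := f)] at hl
    obtain ⟨l', hl', rfl⟩ := List.mem_map.1 hl
    exact μ.pos l' hl' (key l' h)

theorem exists_fresh (c : C) (T : List (ℕ × C)) : ∃ k : ℕ × C, k.1 ≠ 0 ∧ k.2 = c ∧ k ∉ T := by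
  obtain ⟨n, hn⟩ := Infinite.exists_notMem_finset ((0 :: T.map Prod.fst).toFinset)
  refine ⟨(n, c), ?_, rfl, ?_⟩
  · rintro rfl
    simp at hn
  · intro h
    apply hn
    simp only [List.toFinset_cons, Finset.mem_insert, List.mem_toFinset, List.mem_map]
    exact Or.inr ⟨_, h, rfl⟩

theorem exists_lab (a : List C) (d : C) : Nonempty (Lab a d) := by
  induction a with
  | nil => exact ⟨⟨(1, d), [], rfl, rfl, by simp, by simp⟩⟩
  | cons c a ih =>
    obtain ⟨μ⟩ := ih
    obtain ⟨k, h1, h2, h3⟩ := exists_fresh c (μ.z :: μ.L)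
    have := μ.nodup
    have hp := μ.pos
    exact ⟨⟨μ.z, k :: μ.L, μ.hz, by simp [μ.hL, h2], by grind, by grind⟩⟩

/-- The labelling `ρ` of the profile of `p ∘ q` is obtained from the labellings `μ` and `ν` of
the profiles of `p` and of `q`. -/
def Split (l₁ : List C) (μ : Lab a d) (ν : Lab b c) (ρ : Lab r d) : Prop :=
  ∃ W₁ W₂ : List (ℕ × C), μ.z = ρ.z ∧ μ.L = W₁ ++ ν.z :: W₂ ∧ ρ.L = W₁ ++ ν.L ++ W₂ ∧
    W₁.map Prod.snd = l₁ ∧ ν.z ∉ ρ.z :: ρ.L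

theorem exists_split {l₁ l₂ : List C} (ha : a = l₁ ++ c :: l₂) (hr : r = l₁ ++ b ++ l₂)
    (ρ : Lab r d) (k : ℕ × C) (h0 : k.1 ≠ 0) (hc : k.2 = c) (hk : k ∉ ρ.z :: ρ.L) :
    ∃ (μ : Lab a d) (ν : Lab b c), ν.z = k ∧ Split l₁ μ ν ρ := by
  obtain ⟨z, L, hz, hL, hn, hp⟩ := ρ
  rw [hr] at hL
  obtain ⟨W, W₂, rfl, hW, h2⟩ := List.map_eq_append_iff.1 hL
  obtain ⟨W₁, M, rfl, h1, h3⟩ := List.map_eq_append_iff.1 hW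
  dsimp only at hk
  refine ⟨⟨z, W₁ ++ k :: W₂, hz, by simp [ha, h1, h2, hc], ?_, ?_⟩,
    ⟨k, M, hc, h3, ?_, ?_⟩, rfl, W₁, W₂, rfl, rfl, rfl, h1, hk⟩
  · have := nodup_replace (A := z :: W₁) (B := [k]) (D := W₂) (M := M)
      (by simpa using hn) (by simp) (by grind)
    simpa using this
  · simp only [List.mem_cons, List.mem_append] at hp ⊢
    grind
  · have h : (z :: W₁ ++ M ++ W₂).Nodup := by simpa using hn
    have := (List.nodup_append'.1 (List.nodup_append'.1 h).1).2.1
    grind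
  · simp only [List.mem_cons, List.mem_append] at hp ⊢
    grind

namespace Split

theorem mem_iff {l₁ : List C} {μ : Lab a d} {ν : Lab b c} {ρ : Lab r d} (h : Split l₁ μ ν ρ)
    (l : ℕ × C) : l ∈ ρ.z :: ρ.L ↔ (l ∈ μ.z :: μ.L ∨ l ∈ ν.z :: ν.L) ∧ l ≠ ν.z := by
  have h1 := μ.nodup
  have h2 := ν.nodup
  obtain ⟨W₁, W₂, hz, hμ, hρ, -, hk⟩ := h
  rw [hρ] at hk ⊢
  rw [hμ] at h1 ⊢
  rw [hz] at h1 ⊢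
  grind

theorem disjoint {l₁ : List C} {μ : Lab a d} {ν : Lab b c} {ρ : Lab r d} (h : Split l₁ μ ν ρ)
    (l : ℕ × C) (hl : l ∈ μ.z :: μ.L) (hl' : l ∈ ν.z :: ν.L) : l = ν.z := by
  have h1 := μ.nodup
  have h2 := ν.nodup
  have h3 := ρ.nodup
  obtain ⟨W₁, W₂, hz, hμ, hρ, -, hk⟩ := h
  rw [hρ] at hk h3
  rw [hμ] at h1 hl
  rw [hz] at h1 hl
  simp only [List.nodup_cons, List.nodup_append', List.disjoint_left, List.mem_append] at h3
  grind

theorem mem_left {l₁ : List C} {μ : Lab a d} {ν : Lab b c} {ρ : Lab r d} (h : Split l₁ μ ν ρ) :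
    ν.z ∈ μ.L := by
  obtain ⟨W₁, W₂, hz, hμ, hρ, -, hk⟩ := h
  simp [hμ]

theorem plugRel {l₁ l₂ : List C} {μ : Lab a d} {ν : Lab b c} {ρ : Lab r d} (h : Split l₁ μ ν ρ)
    (ha : a = l₁ ++ c :: l₂) (hr : r = l₁ ++ b ++ l₂) (p : K.P.Op a d) (q : K.P.Op b c) :
    GlueRel ν.z (μ.op p) (ν.op q) (ρ.op (K.P.comp l₁ l₂ ha hr p q)) := by
  obtain ⟨W₁, W₂, hz, hμ, hρ, h1, hk⟩ := h
  have h2 : W₂.map Prod.snd = l₂ := by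
    have := μ.hL
    rw [hμ, ha, List.map_append, List.map_cons] at this
    have h3 := List.append_inj this (by rw [h1])
    exact (List.cons.inj h3.2).2
  have := GlueRel.plug (μ.op p) (ν.op q) W₁ W₂ ρ.L hμ rfl hρ l₁ l₂ r h1.symm h2.symm ha hr
    ρ.hL.symm (by simpa [op, hz] using ρ.nodup) _ (K.opAct_plug l₁ l₂ ha hr q p)
  simpa [op, hz] using this

theorem graftRel {l₁ l₂ : List C} {μ : Lab a d} {ν : Lab b c} {ρ : Lab r d} (h : Split l₁ μ ν ρ)
    (ha : a = l₁ ++ c :: l₂) (hr : r = l₁ ++ b ++ l₂) (p : K.P.Op a d) (q : K.P.Op b c) :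
    GlueRel ν.z (ν.op q) (μ.op p) (ρ.op (K.P.comp l₁ l₂ ha hr p q)) := by
  obtain ⟨W₁, W₂, hz, hμ, hρ, h1, hk⟩ := h
  have h2 : W₂.map Prod.snd = l₂ := by
    have := μ.hL
    rw [hμ, ha, List.map_append, List.map_cons] at this
    have h3 := List.append_inj this (by rw [h1])
    exact (List.cons.inj h3.2).2
  have := GlueRel.graft (ν.op q) (μ.op p) W₁ W₂ ρ.L hμ rfl hρ l₁ l₂ r h1.symm h2.symm ha hr
    ρ.hL.symm (by simpa [op, hz] using ρ.nodup) _ (K.opAct_graft l₁ l₂ ha hr p q)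
  simpa [op, hz] using this

/-- Splittings of a labelling at the same place differ by the name of the inner edge. -/
theorem swap [DecidableEq C] {l₁ : List C}
    {μ μ' : Lab a d} {ν ν' : Lab b c} {ρ : Lab r d} (h : Split l₁ μ ν ρ) (h' : Split l₁ μ' ν' ρ) :
    ∃ (hf : ∀ l, (Equiv.swap ν.z ν'.z l).2 = l.2) (h0 : ∀ l, l.1 = 0 → Equiv.swap ν.z ν'.z l = l),
      μ' = μ.relabel _ hf h0 ∧ ν' = ν.relabel _ hf h0 := by
  have hn := μ.nodup
  have hn' := μ'.nodup
  obtain ⟨W₁, W₂, hz, hμ, hρ, h1, hk⟩ := h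
  obtain ⟨W₁', W₂', hz', hμ', hρ', h1', hk'⟩ := h'
  have h2 : W₁ = W₁' ∧ ν.L = ν'.L ∧ W₂ = W₂' := by
    have e1 : W₁.length = W₁'.length := by simpa using congrArg List.length (h1.trans h1'.symm)
    have e2 : ν.L.length = ν'.L.length := by
      simpa using congrArg List.length (ν.hL.trans ν'.hL.symm)
    have h3 := List.append_inj (hρ.symm.trans hρ') (by simp [e1, e2])
    have h4 := List.append_inj h3.1 e1
    exact ⟨h4.1, h4.2, h3.2⟩
  obtain ⟨rfl, h3, rfl⟩ := h2
  have hc : ν.z.2 = ν'.z.2 := ν.hz.trans ν'.hz.symm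
  have h0 : ∀ l : ℕ × C, l.1 = 0 → Equiv.swap ν.z ν'.z l = l := by
    intro l hl
    refine Equiv.swap_apply_of_ne_of_ne ?_ ?_
    · rintro rfl
      exact ν.pos _ (by simp) hl
    · rintro rfl
      exact ν'.pos _ (by simp) hl
  refine ⟨swap_snd hc, h0, ?_, ?_⟩
  · ext1
    · rw [relabel, hz', ← hz]
      refine (Equiv.swap_apply_of_ne_of_ne ?_ ?_).symm
      · rw [hz]; rintro h; exact hk (by simp [h])
      · rw [hz]; rintro h; exact hk' (by simp [h])
    · simp only [relabel]
      rw [hμ', hμ]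
      rw [hμ] at hn
      rw [hμ'] at hn'
      refine (map_swap ?_ ?_ ?_ ?_).symm <;> grind
  · ext1
    · simp [relabel]
    · simp only [relabel]
      rw [← h3]
      conv_lhs => rw [← List.map_id ν.L]
      refine List.map_congr_left fun l hl => (Equiv.swap_apply_of_ne_of_ne ?_ ?_).symm
      · rintro rfl; exact hk (by simp [hρ, hl])
      · rintro rfl; exact hk' (by simp [hρ, hl])

/-- A naming for $p\circ(q\circ r)$ with both inner edges named can also be read as a naming for
$(p\circ q)\circ r$; `σ` names the profile of $p\circ q$. -/
theorem assoc {b g y z x : List C} {e : C} {l₁ m₁ l₂ : List C} {μ : Lab a d} {ν : Lab y c}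
    {ρ : Lab z d} {α : Lab b c} {β : Lab g e} (h : Split l₁ μ ν ρ) (h' : Split m₁ α β ν)
    (hβ : β.z ∉ ρ.z :: ρ.L) (hx : x = l₁ ++ b ++ l₂) (hy : z = l₁ ++ y ++ l₂) (hαβ : α.z ≠ β.z) :
    ∃ σ : Lab x d, Split (l₁ ++ m₁) σ β ρ ∧ Split l₁ μ α σ := by
  have hn := ρ.nodup
  have hαn := α.nodup
  obtain ⟨W₁, W₂, hz, hμ, hρ, h1, hk⟩ := h
  obtain ⟨M₁, M₂, hz', hα, hν, h1', hk'⟩ := h'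
  have h2 : W₂.map Prod.snd = l₂ := by
    have := ρ.hL
    rw [hρ, hy, List.map_append, List.map_append, h1, ν.hL] at this
    exact List.append_cancel_left this
  have hρ' : ρ.L = (W₁ ++ M₁) ++ β.L ++ (M₂ ++ W₂) := by rw [hρ, hν]; simp
  have hpos := ρ.pos
  have hpos' := α.pos
  refine ⟨⟨ρ.z, W₁ ++ α.L ++ W₂, ρ.hz, by simp [hx, h1, h2, α.hL], ?_, ?_⟩,
    ⟨W₁ ++ M₁, M₂ ++ W₂, rfl, by simp [hα], hρ', by simp [h1, h1'], hβ⟩,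
    ⟨W₁, W₂, hz, by rw [hμ, hz'], rfl, h1, ?_⟩⟩
  · rw [hρ'] at hn hβ
    have := nodup_replace (A := ρ.z :: W₁ ++ M₁) (B := [β.z]) (D := M₂ ++ W₂) (M := β.L)
      (by simpa using hn) (by simp) (by simp only [List.mem_cons, List.mem_append] at hβ ⊢; grind)
    simpa [hα] using this
  · rw [hρ'] at hpos
    rw [hα] at hpos' ⊢
    simp only [List.mem_cons, List.mem_append] at hpos hpos' ⊢
    grind
  · rw [hρ'] at hk
    rw [hα, hz'] at hαn
    rw [hz'] at hαβ
    dsimp only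
    rw [hα, hz']
    simp only [List.mem_cons, List.mem_append] at hk ⊢
    grind

theorem par {b₁ b₂ x y z l₁ l₂ l₃ : List C} {c₁ c₂ : C}
    (h₁ : a = l₁ ++ c₁ :: (l₂ ++ c₂ :: l₃)) (hx : x = l₁ ++ b₁ ++ (l₂ ++ c₂ :: l₃))
    (hy : y = (l₁ ++ c₁ :: l₂) ++ b₂ ++ l₃) (hz : z = (l₁ ++ b₁ ++ l₂) ++ b₂ ++ l₃)
    (ρ : Lab z d) (k e : ℕ × C) (hk : k.1 ≠ 0) (he : e.1 ≠ 0) (hkc : k.2 = c₁) (hec : e.2 = c₂)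
    (hke : k ≠ e) (hkρ : k ∉ ρ.z :: ρ.L) (heρ : e ∉ ρ.z :: ρ.L) :
    ∃ (μ : Lab a d) (α : Lab b₁ c₁) (β : Lab b₂ c₂) (σ : Lab x d) (τ : Lab y d), α.z = k ∧ β.z = e ∧
      Split l₁ μ α σ ∧ Split (l₁ ++ b₁ ++ l₂) σ β ρ ∧ Split (l₁ ++ c₁ :: l₂) μ β τ ∧
      Split l₁ τ α ρ ∧ (∀ l ∈ α.z :: α.L, l ∉ β.z :: β.L) := by
  obtain ⟨w, L, hw, hL, hn, hp⟩ := ρ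
  rw [hz] at hL
  obtain ⟨W, D, rfl, hW, h5⟩ := List.map_eq_append_iff.1 hL
  obtain ⟨W, N, rfl, hW, h4⟩ := List.map_eq_append_iff.1 hW
  obtain ⟨W, B, rfl, hW, h3⟩ := List.map_eq_append_iff.1 hW
  obtain ⟨A, M, rfl, h1, h2⟩ := List.map_eq_append_iff.1 hW
  clear hW
  dsimp only at hkρ heρ
  have hnσ : (w :: (A ++ M ++ (B ++ e :: D))).Nodup := by
    have := nodup_replace (A := w :: A ++ M ++ B) (B := [e]) (D := D) (M := N)
      (by simpa using hn) (by simp)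
      (by simp only [List.mem_cons, List.mem_append] at heρ ⊢; grind)
    simpa using this
  have hnτ : (w :: (A ++ k :: (B ++ N ++ D))).Nodup := by
    have := nodup_replace (A := w :: A) (B := [k]) (D := B ++ N ++ D) (M := M)
      (by simpa using hn) (by simp)
      (by simp only [List.mem_cons, List.mem_append] at hkρ ⊢; grind)
    simpa using this
  have hnμ : (w :: (A ++ k :: (B ++ e :: D))).Nodup := by
    have := nodup_replace (A := w :: A) (B := [k]) (D := B ++ e :: D) (M := M)
      (by simpa using hnσ) (by simp)
      (by simp only [List.mem_cons, List.mem_append] at hkρ ⊢; grind)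
    simpa using this
  simp only [List.mem_cons, List.mem_append] at hp hkρ heρ
  simp only [List.nodup_cons, List.nodup_append', List.disjoint_left, List.mem_append] at hn
  refine ⟨⟨w, A ++ k :: (B ++ e :: D), hw, by simp [h₁, h1, h3, h5, hkc, hec], hnμ, ?_⟩,
    ⟨k, M, hkc, h2, ?_, ?_⟩, ⟨e, N, hec, h4, ?_, ?_⟩,
    ⟨w, A ++ M ++ (B ++ e :: D), hw, by simp [hx, h1, h2, h3, h5, hec], hnσ, ?_⟩,
    ⟨w, A ++ k :: (B ++ N ++ D), hw, by simp [hy, h1, h3, h4, h5, hkc], hnτ, ?_⟩, rfl, rfl,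
    ⟨A, B ++ e :: D, rfl, rfl, rfl, h1, ?_⟩,
    ⟨A ++ M ++ B, D, rfl, by simp, rfl, by simp [h1, h2, h3], ?_⟩,
    ⟨A ++ k :: B, D, rfl, by simp, by simp, by simp [h1, h3, hkc], ?_⟩,
    ⟨A, B ++ N ++ D, rfl, rfl, by simp, h1, ?_⟩, ?_⟩ <;>
  simp only [List.mem_cons, List.mem_append, List.nodup_cons] <;> grind

end Split

end Lab

end EnvReedy

namespace EnvReedy

variable {C : Type u} {K : Kind.{u, v} C}

/-- The labels of the class `s` are labels of `μ` or have the reserved name `0`. -/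
def Cls.Adm {H : K.Act.{u, v, w}} {a : List C} {d : C} (μ : Lab a d) (s : Cls H) : Prop :=
  ∀ S : LState H, s = S.cls → (∀ l ∈ S.z :: S.L, l ∈ μ.z :: μ.L ∨ l.1 = 0) ∧
    (K.Rooted → (S.z = μ.z ∨ S.z.1 = 0) ∧ ∀ l ∈ S.L, l ∈ μ.L ∨ l.1 = 0)

/-- Families of classes of labelled elements, indexed by the labellings of a profile. -/
@[ext]
structure Fam (H : K.Act.{u, v, w}) (a : List C) (d : C) where
  val : Lab a d → Cls H
  val_relabel (f : ℕ × C ≃ ℕ × C) (hf : ∀ l, (f l).2 = l.2) (h0 : ∀ l, l.1 = 0 → f l = l)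
    (μ : Lab a d) : val (μ.relabel f hf h0) = (val μ).relabel f hf
  adm (μ : Lab a d) : (val μ).Adm μ

theorem Cls.Adm.has {H : K.Act.{u, v, w}} {a : List C} {d : C} {μ : Lab a d} {s : Cls H}
    (h : s.Adm μ) {l : ℕ × C} (hl : s.Has l) : l ∈ μ.z :: μ.L ∨ l.1 = 0 := by
  obtain ⟨S, rfl, hl⟩ := hl
  exact (h S rfl).1 l hl

namespace Fam

variable {H : K.Act.{u, v, w}} {a b r : List C} {c d : C}

theorem not_has (φ : Fam H a d) {μ : Lab a d} {l : ℕ × C} (hl : l ∉ μ.z :: μ.L) (h0 : l.1 ≠ 0) :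
    ¬ (φ.val μ).Has l := fun h => (φ.adm μ).has h |>.elim hl h0

section Glue

variable {l₁ : List C} {μ : Lab a d} {ν : Lab b c} {ρ : Lab r d}

theorem disjoint_left (φ : Fam H a d) (h : Lab.Split l₁ μ ν ρ) (l : ℕ × C)
    (hl : (φ.val μ).Has l) (hl' : l ∈ ν.z :: ν.L) : l = ν.z := by
  rcases (φ.adm μ).has hl with h1 | h1
  · exact h.disjoint l h1 hl'
  · exact absurd h1 (ν.pos l hl')

theorem disjoint_right (φ : Fam H b c) (h : Lab.Split l₁ μ ν ρ) (l : ℕ × C)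
    (hl : (φ.val ν).Has l) (hl' : l ∈ μ.z :: μ.L) : l = ν.z := by
  rcases (φ.adm ν).has hl with h1 | h1
  · exact h.disjoint l hl' h1
  · exact absurd h1 (μ.pos l hl')

/-- Gluing consumes the inner name and adds the names of `q`, so the admissible names for `μ` become
those for `ρ`. If the class lacks the inner edge, its names are admissible for `ρ` already. -/
theorem adm_plug (φ : Fam H a d) (h : Lab.Split l₁ μ ν ρ) (q : K.P.Op b c) :
    (glue ν.z (φ.val μ) (ν.op q)).Adm ρ := by
  intro S hS
  have hA := φ.adm μ
  have hmem := h.mem_iff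
  by_cases hk : (φ.val μ).Has ν.z
  · rcases glue_cases ν.z (φ.val μ) (ν.op q) hk with h1 | ⟨W, S', Q', h1, h2, h3, h4⟩
    · rw [h1] at hS; cases hS
    have hWS := LState.cls_eq.1 (h4.symm.trans hS)
    refine ⟨fun l hl => ?_, fun hK => ?_⟩
    · rw [← LState.mem_iff_of_equiv hWS, h3.mem_iff h3.disjoint] at hl
      rw [hmem]
      obtain ⟨hl | hl, hl'⟩ := hl
      · rcases (hA S' h1).1 l hl with h5 | h5
        · exact Or.inl ⟨Or.inl h5, hl'⟩
        · exact Or.inr h5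
      · exact Or.inl ⟨Or.inr ((LState.mem_iff_of_equiv h2 l).1 hl), hl'⟩
    · obtain ⟨hA1, hA2⟩ := (hA S' h1).2 hK
      obtain ⟨hz, hL⟩ := LState.equiv_rooted hK hWS
      rw [← hz]
      simp only [← hL]
      have hQ := LState.equiv_rooted hK h2
      have hn := μ.nodup
      have hleft := h.mem_left
      obtain ⟨W₁, W₂, hρz, hμ, hρ, -, hk'⟩ := h
      cases h3 with
      | plug L₁ L₂ N hSL hQz hN =>
        refine ⟨by rw [← hρz]; exact hA1, fun l hl => ?_⟩
        dsimp only at hl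
        rw [hN] at hl
        have hS'n := S'.nodup
        rw [hSL] at hS'n
        have hl' : (l ∈ S'.L ∧ l ≠ ν.z) ∨ l ∈ Q'.L := by
          rw [hSL]
          simp only [List.mem_append, List.mem_cons, List.nodup_cons, List.nodup_append',
            List.disjoint_left] at hl hS'n ⊢
          grind
        rw [hρ]
        rcases hl' with ⟨hl', hne⟩ | hl'
        · rcases hA2 l hl' with h5 | h5
          · rw [hμ] at h5
            simp only [List.mem_append, List.mem_cons] at h5 ⊢
            tauto
          · exact Or.inr h5
        · have h6 : l ∈ ν.L := (hQ.2 l).1 hl'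
          simp [h6]
      | graft N₁ N₂ N hSL hSz hN =>
        -- Grafting in the opposite direction would make the inner edge an output of the class, but
        -- an admissible output in a rooted kind is the output of `μ` or has the reserved name.
        exfalso
        rcases hA1 with h5 | h5
        · rw [hSz] at h5
          exact (List.nodup_cons.1 hn).1 (h5 ▸ hleft)
        · rw [hSz] at h5
          exact ν.pos ν.z (by simp) h5
  · rw [glue_of_not_has hk] at hS
    have hA' := hA S hS
    have hk' : ν.z ∉ S.z :: S.L := by rwa [hS, Cls.has_cls] at hk
    refine ⟨fun l hl => ?_, fun hK => ?_⟩
    · rw [hmem]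
      rcases hA'.1 l hl with h5 | h5
      · exact Or.inl ⟨Or.inl h5, fun h => hk' (h ▸ hl)⟩
      · exact Or.inr h5
    · obtain ⟨W₁, W₂, hρz, hμ, hρ, -, -⟩ := h
      refine ⟨hρz ▸ (hA'.2 hK).1, fun l hl => ?_⟩
      rcases (hA'.2 hK).2 l hl with h5 | h5
      · rw [hμ] at h5
        rw [hρ]
        have : l ≠ ν.z := fun h => hk' (h ▸ List.mem_cons_of_mem _ hl)
        simp only [List.mem_append, List.mem_cons] at h5 ⊢
        tauto
      · exact Or.inr h5

theorem adm_graft (φ : Fam H b c) (h : Lab.Split l₁ μ ν ρ) (p : K.P.Op a d) :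
    (glue ν.z (φ.val ν) (μ.op p)).Adm ρ := by
  intro S hS
  have hA := φ.adm ν
  have hmem := h.mem_iff
  by_cases hk : (φ.val ν).Has ν.z
  · rcases glue_cases ν.z (φ.val ν) (μ.op p) hk with h1 | ⟨W, S', Q', h1, h2, h3, h4⟩
    · rw [h1] at hS; cases hS
    have hWS := LState.cls_eq.1 (h4.symm.trans hS)
    refine ⟨fun l hl => ?_, fun hK => ?_⟩
    · rw [← LState.mem_iff_of_equiv hWS, h3.mem_iff h3.disjoint] at hl
      rw [hmem]
      obtain ⟨hl | hl, hl'⟩ := hl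
      · rcases (hA S' h1).1 l hl with h5 | h5
        · exact Or.inl ⟨Or.inr h5, hl'⟩
        · exact Or.inr h5
      · exact Or.inl ⟨Or.inl ((LState.mem_iff_of_equiv h2 l).1 hl), hl'⟩
    · obtain ⟨hA1, hA2⟩ := (hA S' h1).2 hK
      obtain ⟨hz, hL⟩ := LState.equiv_rooted hK hWS
      rw [← hz]
      simp only [← hL]
      have hQ := LState.equiv_rooted hK h2
      have hn := ν.nodup
      have hμn := μ.nodup
      have hleft := h.mem_left
      obtain ⟨W₁, W₂, hρz, hμ, hρ, -, hk'⟩ := h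
      cases h3 with
      | graft N₁ N₂ N hSL hSz hN =>
        refine ⟨Or.inl (hQ.1.trans hρz), fun l hl => ?_⟩
        dsimp only at hl
        rw [hN] at hl
        have hQn := Q'.nodup
        rw [hSL] at hQn
        have hl' : (l ∈ Q'.L ∧ l ≠ ν.z) ∨ l ∈ S'.L := by
          rw [hSL]
          simp only [List.mem_append, List.mem_cons, List.nodup_cons, List.nodup_append',
            List.disjoint_left] at hl hQn ⊢
          grind
        rw [hρ]
        rcases hl' with ⟨hl', hne⟩ | hl'
        · have h6 : l ∈ μ.L := (hQ.2 l).1 hl'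
          rw [hμ] at h6
          simp only [List.mem_append, List.mem_cons] at h6 ⊢
          tauto
        · rcases hA2 l hl' with h5 | h5
          · simp [h5]
          · exact Or.inr h5
      | plug L₁ L₂ N hSL hQz hN =>
        exfalso
        have : μ.z = ν.z := hQ.1.symm.trans hQz
        rw [← this] at hleft
        exact (List.nodup_cons.1 hμn).1 hleft
  · rw [glue_of_not_has hk] at hS
    have hA' := hA S hS
    have hk' : ν.z ∉ S.z :: S.L := by rwa [hS, Cls.has_cls] at hk
    refine ⟨fun l hl => ?_, fun hK => ?_⟩
    · rw [hmem]
      rcases hA'.1 l hl with h5 | h5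
      · exact Or.inl ⟨Or.inr h5, fun h => hk' (h ▸ hl)⟩
      · exact Or.inr h5
    · obtain ⟨W₁, W₂, hρz, hμ, hρ, -, -⟩ := h
      refine ⟨?_, fun l hl => ?_⟩
      · rcases (hA'.2 hK).1 with h5 | h5
        · exact absurd (h5 ▸ List.mem_cons_self) hk'
        · exact Or.inr h5
      rcases (hA'.2 hK).2 l hl with h5 | h5
      · rw [hρ]
        simp [h5]
      · exact Or.inr h5

end Glue

-- The name of the inner edge is immaterial: two splittings differ by a transposition of two names,
-- neither of which occurs in the result by admissibility.
open Classical in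
theorem glue_eq_of_split (hH : GlueLaws H) {l₁ : List C}
    {μ μ' : Lab a d} {ν ν' : Lab b c} {ρ : Lab r d} (h : Lab.Split l₁ μ ν ρ)
    (h' : Lab.Split l₁ μ' ν' ρ) {s s' : Cls H} {Q Q' : LState K.opAct}
    (hs : ∀ (f : ℕ × C ≃ ℕ × C) (hf : ∀ l, (f l).2 = l.2) (h0 : ∀ l, l.1 = 0 → f l = l),
      μ' = μ.relabel f hf h0 → ν' = ν.relabel f hf h0 → s' = s.relabel f hf)
    (hQ : ∀ (f : ℕ × C ≃ ℕ × C) (hf : ∀ l, (f l).2 = l.2) (h0 : ∀ l, l.1 = 0 → f l = l),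
      μ' = μ.relabel f hf h0 → ν' = ν.relabel f hf h0 → Q' = Q.relabel f hf)
    (hA : (glue ν.z s Q).Adm ρ) : glue ν'.z s' Q' = glue ν.z s Q := by
  obtain ⟨hf, h0, h1, h2⟩ := h.swap h'
  rw [hs _ hf h0 h1 h2, hQ _ hf h0 h1 h2]
  have h3 := hH.glue_relabel_of_eq (Equiv.swap ν.z ν'.z) hf (k := ν.z) (s := s) (Q := Q)
  rw [Equiv.swap_apply_left] at h3
  rw [h3, Cls.relabel_eq_self]
  obtain ⟨W₁, W₂, -, -, -, -, hk⟩ := h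
  obtain ⟨W₁', W₂', -, -, -, -, hk'⟩ := h'
  intro l hl
  have := hA.has hl
  refine Equiv.swap_apply_of_ne_of_ne ?_ ?_
  · rintro rfl
    exact this.elim hk (ν.pos _ (by simp))
  · rintro rfl
    exact this.elim hk' (ν'.pos _ (by simp))

theorem _root_.EnvReedy.Lab.Split.relabel {l₁ : List C} {μ : Lab a d} {ν : Lab b c} {ρ : Lab r d}
    (h : Lab.Split l₁ μ ν ρ) (f : ℕ × C ≃ ℕ × C) (hf : ∀ l, (f l).2 = l.2)
    (h0 : ∀ l, l.1 = 0 → f l = l) :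
    Lab.Split l₁ (μ.relabel f hf h0) (ν.relabel f hf h0) (ρ.relabel f hf h0) := by
  obtain ⟨W₁, W₂, hz, hμ, hρ, h1, hk⟩ := h
  refine ⟨W₁.map f, W₂.map f, by simp [Lab.relabel, hz], by simp [Lab.relabel, hμ],
    by simp [Lab.relabel, hρ], ?_, ?_⟩
  · rw [List.map_map, ← h1]
    exact List.map_congr_left fun l _ => hf l
  · simpa [Lab.relabel] using hk

/-- Splitting of a labelling with an arbitrary name of the inner edge. -/
theorem exists_split' {l₁ l₂ : List C} (ha : a = l₁ ++ c :: l₂) (hr : r = l₁ ++ b ++ l₂)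
    (ρ : Lab r d) : ∃ p : Lab a d × Lab b c, Lab.Split l₁ p.1 p.2 ρ := by
  obtain ⟨k, h1, h2, h3⟩ := Lab.exists_fresh c (ρ.z :: ρ.L)
  obtain ⟨μ, ν, -, h⟩ := Lab.exists_split ha hr ρ k h1 h2 h3
  exact ⟨(μ, ν), h⟩

/-- The family `φ ∘ᵢ q`. -/
noncomputable def plug (hH : GlueLaws H) {l₁ l₂ : List C} (ha : a = l₁ ++ c :: l₂)
    (hr : r = l₁ ++ b ++ l₂) (q : K.P.Op b c) (φ : Fam H a d) : Fam H r d where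
  val ρ := glue (exists_split' ha hr ρ).choose.2.z (φ.val (exists_split' ha hr ρ).choose.1)
    ((exists_split' ha hr ρ).choose.2.op q)
  val_relabel f hf h0 ρ := by
    have h1 := (exists_split' ha hr ρ).choose_spec
    have h2 := (exists_split' ha hr (ρ.relabel f hf h0)).choose_spec
    refine (glue_eq_of_split hH (h1.relabel f hf h0) h2 (s := (φ.val _).relabel f hf)
      (Q := ((exists_split' ha hr ρ).choose.2.op q).relabel f hf) ?_ ?_ ?_).trans
      (hH.glue_relabel_of_eq f hf)
    · intro g hg hg0 h3 h4
      rw [h3, φ.val_relabel, φ.val_relabel]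
    · intro g hg hg0 h3 h4
      rw [h4]; rfl
    · have := φ.adm_plug (h1.relabel f hf h0) q
      rwa [φ.val_relabel] at this
  adm ρ := φ.adm_plug (exists_split' ha hr ρ).choose_spec q

/-- Permits one to compute with the splitting that is convenient, in place of the chosen one;
several families can then be evaluated with compatible names of inner edges. -/
theorem plug_val (hH : GlueLaws H) {l₁ l₂ : List C} (ha : a = l₁ ++ c :: l₂)
    (hr : r = l₁ ++ b ++ l₂) (q : K.P.Op b c) (φ : Fam H a d) {μ : Lab a d} {ν : Lab b c}
    {ρ : Lab r d} (h : Lab.Split l₁ μ ν ρ) :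
    (plug hH ha hr q φ).val ρ = glue ν.z (φ.val μ) (ν.op q) := by
  refine glue_eq_of_split hH h (exists_split' ha hr ρ).choose_spec ?_ ?_ (φ.adm_plug h q)
  · intro g hg hg0 h3 h4
    rw [h3, φ.val_relabel]
  · intro g hg hg0 h3 h4
    rw [h4]; rfl

/-- The family `p ∘ᵢ φ`. -/
noncomputable def graft (hH : GlueLaws H) {l₁ l₂ : List C} (ha : a = l₁ ++ c :: l₂)
    (hr : r = l₁ ++ b ++ l₂) (p : K.P.Op a d) (φ : Fam H b c) : Fam H r d where
  val ρ := glue (exists_split' ha hr ρ).choose.2.z (φ.val (exists_split' ha hr ρ).choose.2)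
    ((exists_split' ha hr ρ).choose.1.op p)
  val_relabel f hf h0 ρ := by
    have h1 := (exists_split' ha hr ρ).choose_spec
    have h2 := (exists_split' ha hr (ρ.relabel f hf h0)).choose_spec
    refine (glue_eq_of_split hH (h1.relabel f hf h0) h2 (s := (φ.val _).relabel f hf)
      (Q := ((exists_split' ha hr ρ).choose.1.op p).relabel f hf) ?_ ?_ ?_).trans
      (hH.glue_relabel_of_eq f hf)
    · intro g hg hg0 h3 h4
      rw [h4, φ.val_relabel, φ.val_relabel]
    · intro g hg hg0 h3 h4
      rw [h3]; rfl
    · have := φ.adm_graft (h1.relabel f hf h0) p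
      rwa [φ.val_relabel] at this
  adm ρ := φ.adm_graft (exists_split' ha hr ρ).choose_spec p

theorem graft_val (hH : GlueLaws H) {l₁ l₂ : List C} (ha : a = l₁ ++ c :: l₂)
    (hr : r = l₁ ++ b ++ l₂) (p : K.P.Op a d) (φ : Fam H b c) {μ : Lab a d} {ν : Lab b c}
    {ρ : Lab r d} (h : Lab.Split l₁ μ ν ρ) :
    (graft hH ha hr p φ).val ρ = glue ν.z (φ.val ν) (μ.op p) := by
  refine glue_eq_of_split hH h (exists_split' ha hr ρ).choose_spec ?_ ?_ (φ.adm_graft h p)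
  · intro g hg hg0 h3 h4
    rw [h4, φ.val_relabel]
  · intro g hg hg0 h3 h4
    rw [h3]; rfl

theorem _root_.EnvReedy.Lab.exists_permute (σ : K.G a b) (ρ : Lab b d) :
    ∃ μ : Lab a d, Matches (K.edge σ) (μ.z :: μ.L) (ρ.z :: ρ.L) := by
  have hlen : (ρ.z :: ρ.L).length = b.length + 1 := by
    simpa using congrArg List.length ρ.hL
  have hcol : (ρ.z :: ρ.L).map Prod.snd = d :: b := by simp [ρ.hL, ρ.hz]
  let f : Fin (a.length + 1) → ℕ × C := fun i => (ρ.z :: ρ.L)[((K.edge σ).symm i : ℕ)]'(by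
    rw [hlen]; exact ((K.edge σ).symm i).2)
  have hf : ∀ i, some (f i) = (ρ.z :: ρ.L)[((K.edge σ).symm i : ℕ)]? := fun i => by
    rw [List.getElem?_eq_getElem]
  have hinj : Function.Injective f := by
    intro i j hij
    have := (ρ.nodup.getElem_inj_iff).1 hij
    exact (K.edge σ).symm.injective (Fin.ext this)
  have hget : ∀ i : Fin (a.length + 1), (List.ofFn f)[(i : ℕ)]? = some (f i) := fun i => by
    rw [List.getElem?_ofFn, dif_pos i.2]
  have hcolT : (List.ofFn f).map Prod.snd = d :: a := by
    apply List.ext_getElem?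
    intro i
    by_cases hi : i < a.length + 1
    · have h1 := hget ⟨i, hi⟩
      dsimp only at h1
      rw [List.getElem?_map, h1, hf, ← List.getElem?_map, hcol, K.edge_colour σ d]
      simp
    · rw [List.getElem?_eq_none (by simp; omega), List.getElem?_eq_none (by simp; omega)]
  have hn : (List.ofFn f).Nodup := List.nodup_ofFn.2 hinj
  have hpos : ∀ l ∈ List.ofFn f, l.1 ≠ 0 := by
    intro l hl
    obtain ⟨i, rfl⟩ := (List.mem_ofFn' f l).1 hl
    exact ρ.pos _ (List.getElem_mem _)
  have hm : Matches (K.edge σ) (List.ofFn f) (ρ.z :: ρ.L) := by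
    intro i
    rw [hget, hf, Equiv.symm_apply_apply]
  generalize List.ofFn f = T at *
  cases T with
  | nil => simp at hcolT
  | cons z L =>
    simp only [List.map_cons, List.cons.injEq] at hcolT
    exact ⟨⟨z, L, hcolT.1, hcolT.2, hn, hpos⟩, hm⟩

theorem _root_.EnvReedy.Lab.permute_unique {σ : K.G a b} {ρ : Lab b d} {μ μ' : Lab a d}
    (h : Matches (K.edge σ) (μ.z :: μ.L) (ρ.z :: ρ.L))
    (h' : Matches (K.edge σ) (μ'.z :: μ'.L) (ρ.z :: ρ.L)) : μ = μ' := by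
  have := h.symm.eq h'.symm (by simpa using congrArg List.length μ.hL)
    (by simpa using congrArg List.length μ'.hL)
  exact Lab.ext (List.cons.inj this).1 (List.cons.inj this).2

/-- The family `φ^σ`. -/
noncomputable def perm (σ : K.G a b) (φ : Fam H a d) : Fam H b d where
  val ρ := φ.val (Lab.exists_permute σ ρ).choose
  val_relabel f hf h0 ρ := by
    rw [← φ.val_relabel f hf h0]
    congr 1
    refine Lab.permute_unique (Lab.exists_permute σ _).choose_spec ?_
    simpa [Lab.relabel] using (Lab.exists_permute σ ρ).choose_spec.map f
  adm ρ := by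
    have h := (Lab.exists_permute σ ρ).choose_spec
    generalize (Lab.exists_permute σ ρ).choose = μ at h
    intro S hS
    have hA := φ.adm μ S hS
    have hmem := h.mem_iff (by simpa using congrArg List.length μ.hL)
      (by simpa using congrArg List.length ρ.hL)
    refine ⟨fun l hl => ?_, fun hK => ?_⟩
    · rw [hmem]
      exact hA.1 l hl
    · have h0 := h 0
      rw [hK _ _ σ] at h0
      have hz : ρ.z = μ.z := by simpa using h0
      have hn := ρ.nodup
      have hn' := μ.nodup
      refine ⟨hz ▸ (hA.2 hK).1, fun l hl => ?_⟩
      rcases (hA.2 hK).2 l hl with h5 | h5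
      · left
        have := (hmem l).2 (List.mem_cons_of_mem _ h5)
        rcases List.mem_cons.1 this with h6 | h6
        · rw [h6, hz] at h5
          exact absurd h5 (List.nodup_cons.1 hn').1
        · exact h6
      · exact Or.inr h5

theorem perm_val (σ : K.G a b) (φ : Fam H a d) {μ : Lab a d} {ρ : Lab b d}
    (h : Matches (K.edge σ) (μ.z :: μ.L) (ρ.z :: ρ.L)) : (perm σ φ).val ρ = φ.val μ := by
  have := Lab.permute_unique (Lab.exists_permute σ ρ).choose_spec h
  change φ.val _ = _
  rw [this]

/-! ### The action of elementary expressions on families, and the planar axioms. -/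

section Paths

variable (hH : GlueLaws H)

/-- Families of classes, as a functor on strings of elementary expressions. -/
noncomputable def paths : Paths (Sig K.P K.G) ⥤ Type (max u w) :=
  Paths.lift
    { obj := fun s : List C × C => Fam H s.1 s.2
      map := fun {s t} (m : Move K.P K.G s t) => match s, t, m with
        | _, _, .plug _ _ ha hr q => ↾(plug hH ha hr q)
        | _, _, .graft _ _ ha hr p => ↾(graft hH ha hr p)
        | _, _, .perm σ => ↾(perm σ) }

theorem paths_sPlug {l₁ l₂ : List C} (ha : a = l₁ ++ c :: l₂) (hr : r = l₁ ++ b ++ l₂)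
    (q : K.P.Op b c) :
    (paths hH).map (sPlug K.P K.G l₁ l₂ ha hr q d) = ↾(plug (H := H) hH ha hr q) :=
  Paths.lift_toPath _ _

theorem paths_sGraft {l₁ l₂ : List C} (ha : a = l₁ ++ c :: l₂) (hr : r = l₁ ++ b ++ l₂)
    (p : K.P.Op a d) :
    (paths hH).map (sGraft K.P K.G l₁ l₂ ha hr p) = ↾(graft (H := H) hH ha hr p) :=
  Paths.lift_toPath _ _

theorem paths_sPerm (σ : K.G a b) :
    (paths hH).map (sPerm K.P σ d) = ↾(perm (H := H) (d := d) σ) :=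
  Paths.lift_toPath _ _

theorem exists_fresh₂ (c e : C) (T : List (ℕ × C)) : ∃ k m : ℕ × C, k.1 ≠ 0 ∧ m.1 ≠ 0 ∧ k.2 = c ∧
    m.2 = e ∧ k ≠ m ∧ k ∉ T ∧ m ∉ T := by
  obtain ⟨k, h1, h2, h3⟩ := Lab.exists_fresh c T
  obtain ⟨m, h4, h5, h6⟩ := Lab.exists_fresh e (k :: T)
  exact ⟨k, m, h1, h4, h2, h5, fun h => h6 (by simp [h]), h3, fun h => h6 (by simp [h])⟩

/-- The three labelled operations of `p ∘ (q ∘ r)`. -/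
theorem exists_seq {b g x y z : List C} {e : C} {l₁ l₂ m₁ m₂ : List C}
    (h₁ : a = l₁ ++ c :: l₂) (h₂ : x = l₁ ++ b ++ l₂) (h₅ : b = m₁ ++ e :: m₂)
    (h₆ : y = m₁ ++ g ++ m₂) (h₇ : z = l₁ ++ y ++ l₂) (ρ : Lab z d) :
    ∃ (μ : Lab a d) (α : Lab b c) (β : Lab g e) (σ : Lab x d) (ν : Lab y c),
      α.z ≠ β.z ∧ ν.z = α.z ∧ Lab.Split l₁ μ α σ ∧ Lab.Split (l₁ ++ m₁) σ β ρ ∧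
      Lab.Split m₁ α β ν ∧ Lab.Split l₁ μ ν ρ ∧ (∀ l ∈ μ.z :: μ.L, l ∉ β.z :: β.L) := by
  obtain ⟨k, m, hk0, hm0, hkc, hme, hkm, hk, hm⟩ := exists_fresh₂ c e (ρ.z :: ρ.L)
  obtain ⟨μ, ν, rfl, hs⟩ := Lab.exists_split h₁ h₇ ρ k hk0 hkc hk
  have hmem := hs.mem_iff
  have hmν : m ∉ ν.z :: ν.L := by
    intro h
    exact hm ((hmem m).2 ⟨Or.inr h, hkm.symm⟩)
  obtain ⟨α, β, rfl, hs'⟩ := Lab.exists_split h₅ h₆ ν m hm0 hme hmν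
  have hαz : α.z = ν.z := hs'.choose_spec.choose_spec.1
  obtain ⟨σ, h3, h4⟩ := hs.assoc hs' hm h₂ h₇ (hαz ▸ hkm)
  refine ⟨μ, α, β, σ, ν, hαz ▸ hkm, hαz.symm, h4, h3, hs', hs, fun l hl hl' => ?_⟩
  have h5 := hs'.mem_iff l
  by_cases hlm : l = β.z
  · rw [hlm] at hl
    exact hm ((hmem _).2 ⟨Or.inl hl, hkm.symm⟩)
  · have h6 := hs.disjoint l hl (h5.2 ⟨Or.inr hl', hlm⟩)
    have h7 := hs'.disjoint l (by rw [h6, ← hαz]; simp) hl'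
    exact hlm h7

theorem not_has_of_disjoint (φ : Fam H a d) {μ : Lab a d} {ν : Lab b c}
    (h : ∀ l ∈ μ.z :: μ.L, l ∉ ν.z :: ν.L) (l : ℕ × C) (hl : (φ.val μ).Has l) :
    l ∉ ν.z :: ν.L := fun hl' =>
  ((φ.adm μ).has hl).elim (fun h1 => h l h1 hl') (ν.pos l hl')

/-- The identity renames the inner edge, and this renaming is absorbed by the equivariance of `φ`.
The polarity condition comes from admissibility. -/
theorem glue_id_op_out [DecidableEq C] (hH : GlueLaws H) (φ : Fam H a d) {μ : Lab [d] d}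
    {ρ ν : Lab a d} (hz : μ.z = ρ.z) (hL : μ.L = [ν.z]) (hν : ν.L = ρ.L)
    (hk : ν.z ∉ ρ.z :: ρ.L) : glue ν.z (φ.val ν) (μ.op (K.P.id d)) = φ.val ρ := by
  have hn := ρ.nodup
  have hne : ν.z ≠ ρ.z := fun h => hk (by simp [h])
  have hc : ν.z.2 = ρ.z.2 := ν.hz.trans ρ.hz.symm
  have hop : (μ.op (K.P.id d)) = idState ρ.z ν.z hne.symm hc.symm := by
    have key : ∀ (z m : ℕ × C) (h : z ≠ m) (hc : z.2 = m.2) (d : C) (μ : Lab [d] d), μ.z = z →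
        μ.L = [m] → μ.op (K.P.id d) = idState z m h hc := by
      rintro z m h hc d ⟨_, _, rfl, hμL, hμn, hμp⟩ rfl rfl
      rfl
    exact key _ _ _ _ d μ hz hL
  have h0 : ∀ l : ℕ × C, l.1 = 0 → Equiv.swap ν.z ρ.z l = l := fun l hl =>
    Equiv.swap_apply_of_ne_of_ne (fun h => ν.pos ν.z (by simp) (h ▸ hl))
      (fun h => ρ.pos ρ.z (by simp) (h ▸ hl))
  rw [hop, hH.glue_id_out hne hc, ← φ.val_relabel _ _ h0]
  · congr 1
    refine Lab.ext (Equiv.swap_apply_left _ _) ?_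
    simp only [Lab.relabel]
    rw [hν]
    conv_rhs => rw [← List.map_id ρ.L]
    refine List.map_congr_left fun l hl => Equiv.swap_apply_of_ne_of_ne ?_ ?_
    · rintro rfl
      exact hk (by simp [hl])
    · rintro rfl
      exact (List.nodup_cons.1 hn).1 hl
  · refine φ.not_has ?_ (ρ.pos _ (by simp))
    rw [hν, List.mem_cons, not_or]
    exact ⟨hne.symm, (List.nodup_cons.1 hn).1⟩
  · intro hK S hS hl
    rcases ((φ.adm ν S hS).2 hK).2 _ hl with h | h
    · exact (List.nodup_cons.1 ν.nodup).1 h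
    · exact ν.pos _ (by simp) h

theorem glue_id_op_in [DecidableEq C] (hH : GlueLaws H) (φ : Fam H a d) {l₁ : List C}
    {μ ρ : Lab a d} {ν : Lab [c] c} (h : Lab.Split l₁ μ ν ρ) :
    glue ν.z (φ.val μ) (ν.op (K.P.id c)) = φ.val ρ := by
  have hn := ρ.nodup
  have hnμ := μ.nodup
  have hpos := μ.pos
  have hposν := ν.pos
  have hnν := ν.nodup
  obtain ⟨W₁, W₂, hz, hμ, hρ, h1, hk⟩ := h
  obtain ⟨k, L, rfl, hL, hn', hp⟩ := ν
  obtain ⟨m, rfl⟩ : ∃ m, L = [m] := List.length_eq_one_iff.1 (by simpa using congrArg List.length hL)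
  have hc : k.2 = m.2 := by simpa using hL.symm
  dsimp only at hk hρ hμ hnν hposν
  have hne : k ≠ m := by simpa using hnν
  have hop : ((⟨k, [m], rfl, hL, hn', hp⟩ : Lab [k.2] k.2).op (K.P.id k.2)) =
    idState k m hne hc := rfl
  have h0 : ∀ l : ℕ × C, l.1 = 0 → Equiv.swap k m l = l := fun l hl =>
    Equiv.swap_apply_of_ne_of_ne (fun h => hposν k (by simp) (h ▸ hl))
      (fun h => hposν m (by simp) (h ▸ hl))
  have hkρ : k ≠ ρ.z := fun h => hk (by simp [h])
  have hmρ : m ≠ ρ.z := fun h => by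
    rw [hρ, ← h] at hn
    simp at hn
  rw [hρ] at hk hn
  rw [hμ, hz] at hnμ
  simp only [List.mem_cons, List.mem_append, List.nodup_cons, List.nodup_append',
    List.disjoint_left] at hk hn hnμ
  rw [hop]
  dsimp only
  rw [hH.glue_id_in hne hc, ← φ.val_relabel _ _ h0]
  · congr 1
    refine Lab.ext ?_ ?_
    · simp only [Lab.relabel]
      rw [hz]
      exact Equiv.swap_apply_of_ne_of_ne hkρ.symm hmρ.symm
    · simp only [Lab.relabel]
      rw [hμ, hρ, map_swap] <;> grind
  · refine φ.not_has ?_ (hposν m (by simp))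
    rw [hμ, hz]
    simp only [List.mem_cons, List.mem_append]
    grind
  · intro hK S hS hl
    rcases ((φ.adm μ S hS).2 hK).1 with h | h
    · exact hkρ (hl.symm.trans (h.trans hz))
    · exact hposν k (by simp) (hl ▸ h)

theorem graft_id (h₁ : [d] = [] ++ d :: []) (h₂ : a = [] ++ a ++ []) (φ : Fam H a d) :
    graft hH h₁ h₂ (K.P.id d) φ = φ := by
  classical
  ext1
  funext ρ
  obtain ⟨k, hk0, hkd, hk⟩ := Lab.exists_fresh d (ρ.z :: ρ.L)
  obtain ⟨μ, ν, rfl, hs⟩ := Lab.exists_split h₁ h₂ ρ k hk0 hkd hk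
  refine (graft_val hH h₁ h₂ _ φ hs).trans ?_
  obtain ⟨W₁, W₂, hz, hμ, hρ, h1, hk⟩ := hs
  obtain rfl : W₁ = [] := List.map_eq_nil_iff.1 h1
  obtain rfl : W₂ = [] := by
    have := congrArg List.length μ.hL
    rw [hμ] at this
    exact List.length_eq_zero_iff.1 (by simpa using this)
  exact glue_id_op_out hH φ hz hμ (by simpa using hρ.symm) hk

theorem plug_id {l₁ l₂ : List C} (h₁ : a = l₁ ++ c :: l₂) (h₂ : a = l₁ ++ [c] ++ l₂)
    (φ : Fam H a d) : plug hH h₁ h₂ (K.P.id c) φ = φ := by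
  classical
  ext1
  funext ρ
  exact (plug_val hH h₁ h₂ _ φ (exists_split' h₁ h₂ ρ).choose_spec).trans
    (glue_id_op_in hH φ (exists_split' h₁ h₂ ρ).choose_spec)

section Seq

variable {b g x y z : List C} {e : C} {l₁ l₂ m₁ m₂ : List C}
  (h₁ : a = l₁ ++ c :: l₂) (h₂ : x = l₁ ++ b ++ l₂)
  (h₃ : x = (l₁ ++ m₁) ++ e :: (m₂ ++ l₂)) (h₄ : z = (l₁ ++ m₁) ++ g ++ (m₂ ++ l₂))
  (h₅ : b = m₁ ++ e :: m₂) (h₆ : y = m₁ ++ g ++ m₂) (h₇ : z = l₁ ++ y ++ l₂)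

theorem plug_plug_seq (hO : GlueLaws K.opAct) (q : K.P.Op b c) (r : K.P.Op g e) (φ : Fam H a d) :
    plug hH h₃ h₄ r (plug hH h₁ h₂ q φ) = plug hH h₁ h₇ (K.P.comp m₁ m₂ h₅ h₆ q r) φ := by
  ext1
  funext ρ
  obtain ⟨μ, α, β, σ, ν, hne, hz, s1, s2, s3, s4, hd⟩ := exists_seq h₁ h₂ h₅ h₆ h₇ ρ
  rw [plug_val hH h₃ h₄ _ _ s2, plug_val hH h₁ h₂ _ _ s1, plug_val hH h₁ h₇ _ _ s4, hz]
  exact hH.glue_glue_seq hO (s3.plugRel h₅ h₆ q r) (by simp [Lab.op])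
    (fun h => φ.not_has_of_disjoint hd _ h (by simp)) hne
    (fun l h => φ.disjoint_left s1 l h) (fun l h => φ.not_has_of_disjoint hd l h)

theorem plug_graft_seq (p : K.P.Op a d) (r : K.P.Op g e) (φ : Fam H b c) :
    plug hH h₃ h₄ r (graft hH h₁ h₂ p φ) = graft hH h₁ h₇ p (plug hH h₅ h₆ r φ) := by
  ext1
  funext ρ
  obtain ⟨μ, α, β, σ, ν, hne, hz, s1, s2, s3, s4, hd⟩ := exists_seq h₁ h₂ h₅ h₆ h₇ ρ
  rw [plug_val hH h₃ h₄ _ _ s2, graft_val hH h₁ h₂ _ _ s1, graft_val hH h₁ h₇ _ _ s4,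
    plug_val hH h₅ h₆ _ _ s3, hz]
  exact hH.glue_glue_comm (List.mem_cons_of_mem _ s1.mem_left) (by simp [Lab.op]) hne
    (fun l h => φ.disjoint_right s1 l h) (fun l h => φ.disjoint_left s3 l h) hd

theorem graft_graft_seq (hO : GlueLaws K.opAct) (p : K.P.Op a d) (q : K.P.Op b c)
    (φ : Fam H g e) :
    graft hH h₃ h₄ (K.P.comp l₁ l₂ h₁ h₂ p q) φ = graft hH h₁ h₇ p (graft hH h₅ h₆ q φ) := by
  ext1
  funext ρ
  obtain ⟨μ, α, β, σ, ν, hne, hz, s1, s2, s3, s4, hd⟩ := exists_seq h₁ h₂ h₅ h₆ h₇ ρ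
  rw [graft_val hH h₃ h₄ _ _ s2, graft_val hH h₁ h₇ _ _ s4, graft_val hH h₅ h₆ _ _ s3, hz]
  have hd' : ∀ l ∈ β.z :: β.L, l ∉ μ.z :: μ.L := fun l h h' => hd l h' h
  exact (hH.glue_glue_seq hO (s1.graftRel h₁ h₂ p q) (List.mem_cons_of_mem _ s3.mem_left)
    (fun h => φ.not_has_of_disjoint hd' _ h (List.mem_cons_of_mem _ s1.mem_left)) hne.symm
    (fun l h => φ.disjoint_right s3 l h) (fun l h => φ.not_has_of_disjoint hd' l h)).symm

end Seq

section Par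

variable {b₁ b₂ x y z : List C} {c₁ c₂ : C} {l₁ l₂ l₃ : List C}
  (h₁ : a = l₁ ++ c₁ :: (l₂ ++ c₂ :: l₃)) (h₂ : x = l₁ ++ b₁ ++ (l₂ ++ c₂ :: l₃))
  (h₃ : x = (l₁ ++ b₁ ++ l₂) ++ c₂ :: l₃) (h₄ : z = (l₁ ++ b₁ ++ l₂) ++ b₂ ++ l₃)
  (h₅ : a = (l₁ ++ c₁ :: l₂) ++ c₂ :: l₃) (h₆ : y = (l₁ ++ c₁ :: l₂) ++ b₂ ++ l₃)
  (h₇ : y = l₁ ++ c₁ :: (l₂ ++ b₂ ++ l₃)) (h₈ : z = l₁ ++ b₁ ++ (l₂ ++ b₂ ++ l₃))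

theorem plug_plug_par (q : K.P.Op b₁ c₁) (r : K.P.Op b₂ c₂) (φ : Fam H a d) :
    plug hH h₃ h₄ r (plug hH h₁ h₂ q φ) = plug hH h₇ h₈ q (plug hH h₅ h₆ r φ) := by
  ext1
  funext ρ
  obtain ⟨k, e, hk0, he0, hkc, hec, hke, hk, he⟩ := exists_fresh₂ c₁ c₂ (ρ.z :: ρ.L)
  obtain ⟨μ, α, β, σ, τ, rfl, rfl, s1, s2, s3, s4, hd⟩ :=
    Lab.Split.par h₁ h₂ h₆ h₄ ρ k e hk0 he0 hkc hec hke hk he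
  rw [plug_val hH h₃ h₄ _ _ s2, plug_val hH h₁ h₂ _ _ s1, plug_val hH h₇ h₈ _ _ s4,
    plug_val hH h₅ h₆ _ _ s3]
  exact hH.glue_glue_comm (by simp [Lab.op]) (by simp [Lab.op]) hke
    (fun l h => φ.disjoint_left s1 l h) (fun l h => φ.disjoint_left s3 l h) hd

theorem plug_graft_par (hO : GlueLaws K.opAct) (p : K.P.Op a d) (r : K.P.Op b₂ c₂)
    (φ : Fam H b₁ c₁) : plug hH h₃ h₄ r (graft hH h₁ h₂ p φ) =
      graft hH h₇ h₈ (K.P.comp (l₁ ++ c₁ :: l₂) l₃ h₅ h₆ p r) φ := by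
  ext1
  funext ρ
  obtain ⟨k, e, hk0, he0, hkc, hec, hke, hk, he⟩ := exists_fresh₂ c₁ c₂ (ρ.z :: ρ.L)
  obtain ⟨μ, α, β, σ, τ, rfl, rfl, s1, s2, s3, s4, hd⟩ :=
    Lab.Split.par h₁ h₂ h₆ h₄ ρ k e hk0 he0 hkc hec hke hk he
  rw [plug_val hH h₃ h₄ _ _ s2, graft_val hH h₁ h₂ _ _ s1, graft_val hH h₇ h₈ _ _ s4]
  exact hH.glue_glue_seq hO (s3.plugRel h₅ h₆ p r) (List.mem_cons_of_mem _ s1.mem_left)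
    (fun h => φ.not_has_of_disjoint hd _ h (by simp)) hke
    (fun l h => φ.disjoint_right s1 l h) (fun l h => φ.not_has_of_disjoint hd l h)

theorem graft_plug_par (hO : GlueLaws K.opAct) (p : K.P.Op a d) (q : K.P.Op b₁ c₁)
    (φ : Fam H b₂ c₂) : graft hH h₃ h₄ (K.P.comp l₁ (l₂ ++ c₂ :: l₃) h₁ h₂ p q) φ =
      plug hH h₇ h₈ q (graft hH h₅ h₆ p φ) := by
  ext1
  funext ρ
  obtain ⟨k, e, hk0, he0, hkc, hec, hke, hk, he⟩ := exists_fresh₂ c₁ c₂ (ρ.z :: ρ.L)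
  obtain ⟨μ, α, β, σ, τ, rfl, rfl, s1, s2, s3, s4, hd⟩ :=
    Lab.Split.par h₁ h₂ h₆ h₄ ρ k e hk0 he0 hkc hec hke hk he
  rw [graft_val hH h₃ h₄ _ _ s2, plug_val hH h₇ h₈ _ _ s4, graft_val hH h₅ h₆ _ _ s3]
  have hd' : ∀ l ∈ β.z :: β.L, l ∉ α.z :: α.L := fun l h h' => hd l h' h
  exact (hH.glue_glue_seq hO (s1.plugRel h₁ h₂ p q) (List.mem_cons_of_mem _ s3.mem_left)
    (fun h => φ.not_has_of_disjoint hd' _ h (by simp)) hke.symm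
    (fun l h => φ.disjoint_right s3 l h) (fun l h => φ.not_has_of_disjoint hd' l h)).symm

end Par

/-- If both operations of an associativity axiom are attached directly to the variable, the axiom
becomes commutation of two gluings. Otherwise one operation is attached to the other, and the axiom
becomes gluing of their composition. The unit axioms are renamings. -/
theorem paths_planarRel (hO : GlueLaws K.opAct) (s t : Paths (Sig K.P K.G)) (f g : s ⟶ t)
    (h : PlanarRel K.P K.G f g) : (paths hH).map f = (paths hH).map g := by
  cases h with
  | id_comp h₁ h₂ =>
    simp only [CategoryTheory.Functor.map_id, paths_sGraft]
    refine ConcreteCategory.hom_ext _ _ fun φ => ?_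
    exact graft_id hH h₁ h₂ φ
  | comp_id _ _ h₁ h₂ =>
    simp only [CategoryTheory.Functor.map_id, paths_sPlug]
    refine ConcreteCategory.hom_ext _ _ fun φ => ?_
    exact plug_id hH h₁ h₂ φ
  | seq_fst _ _ _ _ h₁ h₂ h₃ h₄ h₅ h₆ h₇ q r =>
    simp only [Functor.map_comp, paths_sPlug]
    refine ConcreteCategory.hom_ext _ _ fun φ => ?_
    exact plug_plug_seq hH h₁ h₂ h₃ h₄ h₅ h₆ h₇ hO q r φ
  | seq_snd _ _ _ _ h₁ h₂ h₃ h₄ h₅ h₆ h₇ q r =>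
    simp only [Functor.map_comp, paths_sPlug, paths_sGraft]
    refine ConcreteCategory.hom_ext _ _ fun φ => ?_
    exact plug_graft_seq hH h₁ h₂ h₃ h₄ h₅ h₆ h₇ q r φ
  | seq_trd _ _ _ _ h₁ h₂ h₃ h₄ h₅ h₆ h₇ q r =>
    simp only [Functor.map_comp, paths_sGraft]
    refine ConcreteCategory.hom_ext _ _ fun φ => ?_
    exact graft_graft_seq hH h₁ h₂ h₃ h₄ h₅ h₆ h₇ hO q r φ
  | par_fst _ _ _ h₁ h₂ h₃ h₄ h₅ h₆ h₇ h₈ q r =>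
    simp only [Functor.map_comp, paths_sPlug]
    refine ConcreteCategory.hom_ext _ _ fun φ => ?_
    exact plug_plug_par hH h₁ h₂ h₃ h₄ h₅ h₆ h₇ h₈ q r φ
  | par_snd _ _ _ h₁ h₂ h₃ h₄ h₅ h₆ h₇ h₈ q r =>
    simp only [Functor.map_comp, paths_sPlug, paths_sGraft]
    refine ConcreteCategory.hom_ext _ _ fun φ => ?_
    exact plug_graft_par hH h₁ h₂ h₃ h₄ h₅ h₆ h₇ h₈ hO q r φ
  | par_trd _ _ _ h₁ h₂ h₃ h₄ h₅ h₆ h₇ h₈ q r =>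
    simp only [Functor.map_comp, paths_sPlug, paths_sGraft]
    refine ConcreteCategory.hom_ext _ _ fun φ => ?_
    exact graft_plug_par hH h₁ h₂ h₃ h₄ h₅ h₆ h₇ h₈ hO q r φ

end Paths

end Fam

end EnvReedy

namespace EnvReedy

variable {C : Type u} {K : Kind.{u, v} C}

/-! ### Functors of families -/

namespace Fam

variable {H : K.Act.{u, v, w}} {a b r : List C} {c d : C}

section Functor

variable (hH : GlueLaws H)
  (hrel : ∀ (s t : Paths (Sig K.P K.G)) (f g : s ⟶ t), K.rel f g →
    (paths hH).map f = (paths hH).map g)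

/-- The functor of families of classes on the enveloping category. -/
noncomputable def functor : K.Env ⥤ Type (max u w) :=
  CategoryTheory.Quotient.lift _ (paths hH) hrel

/-- The action of the enveloping category on families. -/
noncomputable abbrev act : K.Act where
  obj := Fam H
  map g φ := (functor hH hrel).map g φ
  map_id {a d} x :=
    congrArg (fun f : Fam H a d ⟶ Fam H a d => f x) ((functor hH hrel).map_id (K.ob a d))
  map_comp {a _ c d _ f} g h x :=
    congrArg (fun f : Fam H a d ⟶ Fam H c f => f x) ((functor hH hrel).map_comp g h)

theorem act_plug {l₁ l₂ : List C} (ha : a = l₁ ++ c :: l₂) (hr : r = l₁ ++ b ++ l₂)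
    (q : K.P.Op b c) (φ : Fam H a d) :
    (act hH hrel).map (K.mPlug l₁ l₂ ha hr q d) φ = plug hH ha hr q φ :=
  congrArg (fun f : Fam H a d ⟶ Fam H r d => f φ) (paths_sPlug hH ha hr q)

theorem act_graft {l₁ l₂ : List C} (ha : a = l₁ ++ c :: l₂) (hr : r = l₁ ++ b ++ l₂)
    (p : K.P.Op a d) (φ : Fam H b c) :
    (act hH hrel).map (K.mGraft l₁ l₂ ha hr p) φ = graft hH ha hr p φ :=
  congrArg (fun f : Fam H b c ⟶ Fam H r d => f φ) (paths_sGraft hH ha hr p)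

theorem act_perm (σ : K.G a b) (φ : Fam H a d) :
    (act hH hrel).map (K.mPerm σ d) φ = perm σ φ :=
  congrArg (fun f : Fam H a d ⟶ Fam H b d => f φ) (paths_sPerm hH σ)

end Functor

theorem perm_refl (σ : K.G a a) (h : K.edge σ = Equiv.refl _) (φ : Fam H a d) :
    perm σ φ = φ := by
  ext1
  funext ρ
  exact perm_val σ φ (h ▸ Matches.refl _)

theorem perm_perm (σ : K.G a b) (τ : K.G b r) (υ : K.G a r)
    (h : K.edge υ = (K.edge τ).trans (K.edge σ)) (φ : Fam H a d) :
    perm τ (perm σ φ) = perm υ φ := by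
  ext1
  funext ρ
  obtain ⟨μ, hμ⟩ := Lab.exists_permute τ ρ
  obtain ⟨ν, hν⟩ := Lab.exists_permute σ μ
  rw [perm_val τ _ hμ, perm_val σ _ hν, perm_val υ φ (h ▸ hν.trans hμ)]

theorem op_equiv {τ : K.G a b} {μ : Lab a d} {ν : Lab b d}
    (h : Matches (K.edge τ) (μ.z :: μ.L) (ν.z :: ν.L)) (p : K.P.Op a d) :
    μ.op p ≈ ν.op (K.act τ p) := by
  have := LState.Step.mk (H := K.opAct) μ.hL.symm ν.hL.symm μ.hz.symm ν.hz.symm μ.nodup ν.nodup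
    p τ h
  rw [Kind.opAct_perm] at this
  exact this.equiv

end Fam

/-! ### Permutations of inputs -/

namespace Perms

variable {a b r a' b' r' : List C}

/-- A permutation of the inputs, extended to the set `{0, …, n}`. -/
def edge (σ : Perms a b) : Fin (b.length + 1) ≃ Fin (a.length + 1) :=
  (finSuccEquiv b.length).trans ((Equiv.optionCongr σ.1).trans (finSuccEquiv a.length).symm)

@[simp]
theorem edge_zero (σ : Perms a b) : σ.edge 0 = 0 := by
  simp [edge]

@[simp]
theorem edge_succ (σ : Perms a b) (i : Fin b.length) : σ.edge i.succ = (σ.1 i).succ := by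
  simp [edge]

theorem edge_colour (σ : Perms a b) (d : C) (i : Fin (b.length + 1)) :
    (d :: b)[(i : ℕ)]? = (d :: a)[(σ.edge i : ℕ)]? := by
  refine Fin.cases ?_ (fun i => ?_) i
  · simp
  · have := σ.2 i
    simpa using this

/-- The inverse permutation. -/
def inv (σ : Perms a b) : Perms b a :=
  ⟨σ.1.symm, fun k => by rw [σ.2, Equiv.apply_symm_apply]⟩

/-- The product of permutations. -/
def comp (σ : Perms a b) (τ : Perms b r) : Perms a r :=
  ⟨τ.1.trans σ.1, fun k => by rw [τ.2, σ.2]; rfl⟩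

@[simp]
theorem inv_val (σ : Perms a b) : σ.inv.1 = σ.1.symm := rfl

@[simp]
theorem comp_val (σ : Perms a b) (τ : Perms b r) : (σ.comp τ).1 = τ.1.trans σ.1 := rfl

theorem edge_inv (σ : Perms a b) : σ.inv.edge = σ.edge.symm := by
  symm
  rw [Equiv.symm_eq_iff_trans_eq_refl]
  ext i
  refine Fin.cases ?_ (fun i => ?_) i <;> simp

theorem edge_comp (σ : Perms a b) (τ : Perms b r) :
    (σ.comp τ).edge = τ.edge.trans σ.edge := by
  ext i
  refine Fin.cases ?_ (fun i => ?_) i <;> simp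

theorem eq_refl_of_edge {σ : Perms a a} (h : σ.edge = Equiv.refl _) : σ.1 = Equiv.refl _ := by
  ext i
  have := congrArg (fun e => ((e i.succ : Fin (a.length + 1)) : ℕ)) h
  simpa using this

/-- The identity permutation. -/
def refl (a : List C) : Perms a a := ⟨Equiv.refl _, fun _ => rfl⟩

@[simp]
theorem refl_val (a : List C) : (refl a).1 = Equiv.refl _ := rfl

theorem edge_refl (a : List C) : (refl a).edge = Equiv.refl _ := by
  ext i
  refine Fin.cases ?_ (fun i => ?_) i <;> simp

theorem matches_tail {α : Type*} {σ : Perms a b} {z : α} {L L' : List α}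
    (h : Matches σ.edge (z :: L) (z :: L')) : Matches σ.1 L L' := by
  intro i
  have := h i.succ
  simpa using this

end Perms

/-! ### Block permutations expressed through labels. -/

section Block

variable {α : Type*} {n n' m m' k k' : ℕ}

/-- The subtraction of one in `outerSlot` accounts for the input `e` that disappears when the block
`M` is inserted. -/
theorem getElem?_outerSlot (L₁ L₂ M : List α) (e : α) (j : ℕ) (hj : j ≠ L₁.length) :
    (L₁ ++ M ++ L₂)[outerSlot L₁.length M.length j]? = (L₁ ++ e :: L₂)[j]? := by
  unfold outerSlot
  split_ifs with h
  · rw [List.append_assoc, List.getElem?_append_left h, List.getElem?_append_left h]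
  · obtain ⟨i, rfl⟩ : ∃ i, j = L₁.length + (i + 1) := ⟨j - L₁.length - 1, by omega⟩
    rw [List.getElem?_append_right (by simp; omega), List.getElem?_append_right (by omega)]
    have : L₁.length + (i + 1) - L₁.length = i + 1 := by omega
    rw [this, List.getElem?_cons_succ]
    congr 1
    simp
    omega

theorem getElem?_inner (L₁ L₂ M : List α) (j : ℕ) (hj : j < M.length) :
    (L₁ ++ M ++ L₂)[L₁.length + j]? = M[j]? := by
  rw [List.getElem?_append_left (by simp; omega), List.getElem?_append_right (by omega)]
  simp

theorem index_unique {L : List α} (hn : L.Nodup) {i j : ℕ} (hi : i < L.length)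
    (h : L[i]? = L[j]?) : i = j := by
  rw [List.getElem?_eq_getElem hi] at h
  obtain ⟨hj, h⟩ := List.getElem?_eq_some_iff.1 h.symm
  exact ((hn.getElem_inj_iff).1 h).symm

/-- Positions of distinct labels are unique, so once labels match before and after the substitution
of a block, the permutation of the result has no freedom left. -/
theorem isBlockPerm_of_matches {L₁ L₂ M L₁' L₂' M' : List α} {e : α}
    {σ : Fin n' ≃ Fin n} {τ : Fin m' ≃ Fin m} {ρ : Fin k' ≃ Fin k}
    (hn : (L₁ ++ e :: L₂).Nodup) (hN : (L₁ ++ M ++ L₂).Nodup)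
    (hn' : (L₁' ++ e :: L₂').Nodup)
    (hm : M.length = m) (hm' : M'.length = m') (hk : (L₁ ++ M ++ L₂).length = k)
    (hσ : Matches σ (L₁ ++ e :: L₂) (L₁' ++ e :: L₂')) (hτ : Matches τ M M')
    (hρ : Matches ρ (L₁ ++ M ++ L₂) (L₁' ++ M' ++ L₂')) :
    IsBlockPerm L₁.length L₁'.length σ τ ρ := by
  have h1 : ∀ j : Fin n', (j : ℕ) = L₁'.length ↔ (σ j : ℕ) = L₁.length := by
    intro j
    have hj := hσ j
    constructor
    · intro h
      rw [h] at hj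
      refine (index_unique hn (by simp) ?_).symm
      rw [← hj]
      simp
    · intro h
      rw [h] at hj
      refine (index_unique hn' (by simp) ?_).symm
      rw [hj]
      simp
  refine ⟨fun j h => (h1 j).1 h, fun j x hj hx => ?_, fun j x hx => ?_⟩
  · have hj' : (σ j : ℕ) ≠ L₁.length := fun h => hj ((h1 j).2 h)
    refine index_unique hN (by rw [hk]; exact (ρ x).2) ?_
    rw [← hρ x, hx, ← hm', ← hm, getElem?_outerSlot L₁' L₂' M' e _ hj,
      getElem?_outerSlot L₁ L₂ M e _ hj']
    exact hσ j
  · refine index_unique hN (by rw [hk]; exact (ρ x).2) ?_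
    rw [← hρ x, hx, getElem?_inner _ _ _ _ (hm' ▸ j.2), getElem?_inner _ _ _ _ (hm ▸ (τ j).2)]
    exact hτ j

/-- The converse direction, which transports a splitting of labels along the permutations in an
equivariance axiom. -/
theorem matches_of_isBlockPerm {L₁ L₂ M L₁' L₂' M' : List α} {e : α}
    {σ : Fin n' ≃ Fin n} {τ : Fin m' ≃ Fin m} {ρ : Fin k' ≃ Fin k}
    (hl' : (L₁' ++ e :: L₂').length = n')
    (hm : M.length = m) (hm' : M'.length = m') (hk' : (L₁' ++ M' ++ L₂').length = k')
    (h : IsBlockPerm L₁.length L₁'.length σ τ ρ)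
    (hσ : Matches σ (L₁ ++ e :: L₂) (L₁' ++ e :: L₂')) (hτ : Matches τ M M') :
    Matches ρ (L₁ ++ M ++ L₂) (L₁' ++ M' ++ L₂') := by
  intro x
  obtain ⟨h1, h2, h3⟩ := h
  have hi' : L₁'.length < n' := by rw [← hl']; simp
  have hlen : L₁'.length + (L₂'.length + 1) = n' := by rw [← hl']; simp
  have hlen' : L₁'.length + (M'.length + L₂'.length) = k' := by rw [← hk']; simp
  have hx := x.2
  -- Positions before and after the block are handled together here; the remaining positions lie
  -- inside the block.
  have outer : ∀ j : Fin n', (j : ℕ) ≠ L₁'.length → (x : ℕ) = outerSlot L₁'.length m' j →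
      (L₁' ++ M' ++ L₂')[(x : ℕ)]? = (L₁ ++ M ++ L₂)[(ρ x : ℕ)]? := by
    intro j hj hxj
    have hj' : (σ j : ℕ) ≠ L₁.length := by
      intro h
      have h4 := h1 ⟨L₁'.length, hi'⟩ rfl
      have := σ.injective (Fin.ext (h.trans h4.symm))
      exact hj (congrArg Fin.val this)
    rw [h2 j x hj hxj, hxj, ← hm', ← hm, getElem?_outerSlot L₁' L₂' M' e _ hj,
      getElem?_outerSlot L₁ L₂ M e _ hj']
    exact hσ j
  by_cases hx1 : (x : ℕ) < L₁'.length
  · exact outer ⟨x, by omega⟩ (by simp; omega) (by simp [outerSlot, hx1])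
  · by_cases hx2 : (x : ℕ) < L₁'.length + m'
    · obtain ⟨j, hj⟩ : ∃ j, (x : ℕ) = L₁'.length + j := ⟨x - L₁'.length, by omega⟩
      rw [h3 ⟨j, by omega⟩ x hj, hj, getElem?_inner _ _ _ _ (by omega),
        getElem?_inner _ _ _ _ (by rw [hm]; exact (τ _).2)]
      exact hτ ⟨j, by omega⟩
    · refine outer ⟨x + 1 - m', by omega⟩ (by simp; omega) ?_
      simp only [outerSlot]
      rw [if_neg (by omega)]
      omega

end Block

end EnvReedy

/-! ### Equivariance of gluing under permutations of inputs. -/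

namespace EnvReedy

variable {C : Type u} {K : Kind.{u, v} C}

theorem Matches.unique {α : Type*} {m n : ℕ} {ε ε' : Fin m ≃ Fin n} {T T' : List α}
    (h : Matches ε T T') (h' : Matches ε' T T') (hl : T.length = n) (hn : T.Nodup) : ε = ε' := by
  ext i
  exact index_unique hn (by rw [hl]; exact (ε i).2) ((h i).symm.trans (h' i))

/-- A kind is not required to have its permutations determined by their action on edges, but the
morphisms they induce are: `σ` followed by the inverse of `τ` acts as the identity. -/
theorem LState.mPerm_congr {a b : List C} {σ τ : K.G a b} (h : K.edge σ = K.edge τ) (d : C) :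
    K.mPerm σ d = K.mPerm τ d := by
  have h1 : K.mPerm σ d ≫ K.mPerm (K.inv τ) d = 𝟙 _ := by
    rw [LState.mPerm_comp]
    apply LState.mPerm_refl
    rw [K.edge_comp, K.edge_inv, h]
    simp
  have h2 : K.mPerm (K.inv τ) d ≫ K.mPerm τ d = 𝟙 _ := by
    rw [LState.mPerm_comp]
    apply LState.mPerm_refl
    rw [K.edge_comp, K.edge_inv]
    simp
  calc K.mPerm σ d = (K.mPerm σ d ≫ K.mPerm (K.inv τ) d) ≫ K.mPerm τ d := by
        rw [Category.assoc, h2, Category.comp_id]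
    _ = K.mPerm τ d := by rw [h1, Category.id_comp]

/-- Permutations of inputs, with the equivariance of compositions. -/
structure BlockLaws (K : Kind.{u, v} C) where
  root {a b : List C} : Perms a b → K.G a b
  edge_root {a b : List C} (σ : Perms a b) : K.edge (root σ) = σ.edge
  perm_plug {a a' b b' r r' : List C} {c d : C} (l₁ l₂ l₁' l₂' : List C)
    (h₁ : a = l₁ ++ c :: l₂) (h₂ : r = l₁ ++ b ++ l₂)
    (h₁' : a' = l₁' ++ c :: l₂') (h₂' : r' = l₁' ++ b' ++ l₂')
    (σ : Perms a a') (τ : Perms b b') (ρ : Perms r r')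
    (h : IsBlockPerm l₁.length l₁'.length σ.1 τ.1 ρ.1) (q : K.P.Op b c) :
    K.mPerm (root σ) d ≫ K.mPlug l₁' l₂' h₁' h₂' (K.act (root τ) q) d =
      K.mPlug l₁ l₂ h₁ h₂ q d ≫ K.mPerm (root ρ) d
  perm_graft {a a' b b' r r' : List C} {c d : C} (l₁ l₂ l₁' l₂' : List C)
    (h₁ : a = l₁ ++ c :: l₂) (h₂ : r = l₁ ++ b ++ l₂)
    (h₁' : a' = l₁' ++ c :: l₂') (h₂' : r' = l₁' ++ b' ++ l₂')
    (σ : Perms a a') (τ : Perms b b') (ρ : Perms r r')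
    (h : IsBlockPerm l₁.length l₁'.length σ.1 τ.1 ρ.1) (p : K.P.Op a d) :
    K.mPerm (root τ) c ≫ K.mGraft l₁' l₂' h₁' h₂' (K.act (root σ) p) =
      K.mGraft l₁ l₂ h₁ h₂ p ≫ K.mPerm (root ρ) d

/-- Lists of labels with the same elements differ by a permutation of their colours. -/
theorem Perms.exists_matches {L L' : List (ℕ × C)} (hn : L.Nodup) (hn' : L'.Nodup)
    (h : ∀ t, t ∈ L' ↔ t ∈ L) {a a' : List C} (ha : a = L.map Prod.snd)
    (ha' : a' = L'.map Prod.snd) : ∃ σ : Perms a a', Matches σ.1 L L' := by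
  classical
  obtain ⟨ε, hε⟩ := EnvReedy.exists_matches hn hn' h (m := a'.length) (n := a.length)
    (by simp [ha]) (by simp [ha'])
  refine ⟨⟨ε, fun i => ?_⟩, hε⟩
  have h1 := congrArg (Option.map Prod.snd) (hε i)
  rw [← List.getElem?_map, ← List.getElem?_map, ← ha, ← ha'] at h1
  simpa using h1

theorem Perms.matches_edge {α : Type*} {a b : List C} {σ : Perms a b} {z : α} {L L' : List α}
    (h : Matches σ.1 L L') : Matches σ.edge (z :: L) (z :: L') :=
  Matches.cons (fun i => by rw [Perms.edge_succ]; simpa using h i) (Perms.edge_zero σ)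

namespace BlockLaws

variable (B : BlockLaws K) {H : K.Act.{u, v, w}}

/-- Reordering of the labels of inputs. -/
inductive Step : LState H → LState H → Prop
  | mk {z : ℕ × C} {L L' : List (ℕ × C)} {a a' : List C} {d : C} (ha : a = L.map Prod.snd)
      (ha' : a' = L'.map Prod.snd) (hd : d = z.2) (hn : (z :: L).Nodup)
      (hn' : (z :: L').Nodup) (x : H.obj a d) (σ : Perms a a')
      (hm : Matches σ.1 L L') :
      Step ⟨z, L, a, d, ha, hd, hn, x⟩
        ⟨z, L', a', d, ha', hd, hn', H.map (K.mPerm (B.root σ) d) x⟩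

/-- If the output label is the same, a permutation that matches distinct labels fixes the position
$0$ and is therefore induced by a permutation of inputs. -/
theorem step_of_equiv {S S' : LState H} (h : S ≈ S') (hz : S.z = S'.z) : B.Step S S' := by
  rcases h with rfl | h
  · obtain ⟨z, L, a, d, ha, hd, hn, x⟩ := S
    have := Step.mk (B := B) (H := H) ha ha hd hn hn x (Perms.refl a) (Matches.refl _)
    rwa [LState.mPerm_refl _ _ ((B.edge_root _).trans (Perms.edge_refl a)), H.map_id] at this
  · obtain ⟨ha, ha', hd, hd', hn, hn', x, σ, hm⟩ := h
    dsimp only at hz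
    subst hz
    have hmem := hm.mem_iff (by simp [ha]) (by simp [ha'])
    obtain ⟨τ, hτ⟩ := Perms.exists_matches (List.nodup_cons.1 hn).2 (List.nodup_cons.1 hn').2
      (fun t => by
        have := hmem t
        grind) ha ha'
    have := Step.mk (B := B) (H := H) ha ha' hd hn hn' x τ hτ
    rwa [LState.mPerm_congr (τ := σ) ((B.edge_root τ).trans
      ((Perms.matches_edge hτ).unique hm (by simp [ha]) hn))] at this

variable {B} in
theorem Step.equiv {S S' : LState H} (h : B.Step S S') : S ≈ S' := by
  obtain ⟨ha, ha', hd, hn, hn', x, σ, hm⟩ := h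
  exact (LState.Step.mk ha ha' hd hd hn hn' x (B.root σ)
    (by rw [B.edge_root]; exact Perms.matches_edge hm)).equiv

include B in
-- With the outputs of both factors kept, only inputs are reordered, and the results differ by the
-- corresponding block permutation. This is all of `GlueLaws.congr` for symmetric operads, and for
-- cyclic operads the case in which outputs do not move.
theorem congr_of_eq {k : ℕ × C} {S S' : LState H} {Q Q' : LState K.opAct} {W W' : LState H}
    (hS : S ≈ S') (hQ : Q ≈ Q') (hSz : S.z = S'.z) (hQz : Q.z = Q'.z)
    (h : GlueRel k S Q W) (h' : GlueRel k S' Q' W') : W ≈ W' := by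
  have hdS := h.disjoint
  have hdS' := h'.disjoint
  have hWm := h.mem_iff hdS
  have hWm' := h'.mem_iff hdS'
  have hmem : ∀ t, t ∈ W'.z :: W'.L ↔ t ∈ W.z :: W.L := fun t => by
    rw [hWm, hWm', LState.mem_iff_of_equiv hS, LState.mem_iff_of_equiv hQ]
  have hS' := B.step_of_equiv hS hSz
  have hQ' := B.step_of_equiv hQ hQz
  clear hS hQ hSz hQz hdS hdS' hWm hWm'
  obtain @⟨_, _, _, _, _, d, ha, ha', hd, hn, hn', x, σ, hσ⟩ := hS'
  obtain ⟨hb, hb', hd₂, hn₂, hn₂', q, τ, hτ⟩ := hQ'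
  have hk₁ := h.mem_left
  have hk₂ := h.mem_right
  cases h with
  | plug L₁ L₂ N hL hz hN l₁ l₂ r hl₁ hl₂ h₁ h₂ hr hn y hy =>
    cases h' with
    | graft M₁ M₂ N' hL' hz' => grind
    | plug M₁ M₂ N' hL' hz' hN' m₁ m₂ r' hm₁ hm₂ h₁' h₂' hr' hn' y' hy' =>
      dsimp only at *
      obtain ⟨ρ, hρ⟩ := Perms.exists_matches (List.nodup_cons.1 hn).2 (List.nodup_cons.1 hn').2
        (fun t => by
          have := hmem t
          grind) hr hr'
      subst hL hL' hN hN' hy hy'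
      have hblock := isBlockPerm_of_matches (List.nodup_cons.1 ‹_›).2 (List.nodup_cons.1 hn).2
        (List.nodup_cons.1 ‹_›).2 (by simp [hb]) (by simp [hb']) (by rw [hr, List.length_map])
        hσ hτ hρ
      have key := B.perm_plug l₁ l₂ m₁ m₂ h₁ h₂ h₁' h₂' σ τ ρ (by simpa [hl₁, hm₁] using hblock) q
        (d := d)
      have := Step.mk (B := B) hr hr' hd hn hn' (H.map (K.mPlug l₁ l₂ h₁ h₂ q d) x) ρ hρ
      rw [← H.map_comp, ← key, H.map_comp] at this
      rw [← Kind.opAct_perm] at this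
      exact this.equiv
  | graft L₁ L₂ N hL hz hN l₁ l₂ r hl₁ hl₂ h₁ h₂ hr hn y hy =>
    cases h' with
    | plug M₁ M₂ N' hL' hz' => grind
    | graft M₁ M₂ N' hL' hz' hN' m₁ m₂ r' hm₁ hm₂ h₁' h₂' hr' hn' y' hy' =>
      dsimp only at *
      obtain ⟨ρ, hρ⟩ := Perms.exists_matches (List.nodup_cons.1 hn).2 (List.nodup_cons.1 hn').2
        (fun t => by
          have := hmem t
          grind) hr hr'
      subst hL hL' hN hN' hy hy'
      have hblock := isBlockPerm_of_matches (List.nodup_cons.1 ‹_›).2 (List.nodup_cons.1 hn).2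
        (List.nodup_cons.1 ‹_›).2 (by simp [ha]) (by simp [ha']) (by rw [hr, List.length_map])
        hτ hσ hρ
      have key := B.perm_graft l₁ l₂ m₁ m₂ h₁ h₂ h₁' h₂' τ σ ρ (by simpa [hl₁, hm₁] using hblock) q
      have := Step.mk (B := B) hr hr' hd₂ hn hn' (H.map (K.mGraft l₁ l₂ h₁ h₂ q) x) ρ hρ
      rw [← H.map_comp, ← key, H.map_comp] at this
      rw [← Kind.opAct_perm] at this
      exact this.equiv

/-- Names are chosen on the permuted side and pulled back. The block condition guarantees that the
pulled back namings again form a splitting, with the same inner edge. -/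
theorem exists_block_split {a a' b b' r r' : List C} {c d : C}
    {l₁ l₂ l₁' l₂' : List C}
    (h₁ : a = l₁ ++ c :: l₂) (h₂ : r = l₁ ++ b ++ l₂)
    (h₁' : a' = l₁' ++ c :: l₂') (h₂' : r' = l₁' ++ b' ++ l₂')
    {σ : Perms a a'} {τ : Perms b b'} {ρ : Perms r r'}
    (h : IsBlockPerm l₁.length l₁'.length σ.1 τ.1 ρ.1) (ω' : Lab r' d) :
    ∃ (μ : Lab a d) (μ' : Lab a' d) (ν : Lab b c) (ν' : Lab b' c) (ω : Lab r d),
      Lab.Split l₁ μ ν ω ∧ Lab.Split l₁' μ' ν' ω' ∧ ν.z = ν'.z ∧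
      Matches (K.edge (B.root σ)) (μ.z :: μ.L) (μ'.z :: μ'.L) ∧
      Matches (K.edge (B.root τ)) (ν.z :: ν.L) (ν'.z :: ν'.L) ∧
      Matches (K.edge (B.root ρ)) (ω.z :: ω.L) (ω'.z :: ω'.L) := by
  obtain ⟨k, hk0, hkc, hk⟩ := Lab.exists_fresh c (ω'.z :: ω'.L)
  obtain ⟨μ', ν', hz', hs'⟩ := Lab.exists_split h₁' h₂' ω' k hk0 hkc hk
  obtain ⟨μ, hμ⟩ := Lab.exists_permute (B.root σ) μ'
  obtain ⟨ν, hν⟩ := Lab.exists_permute (B.root τ) ν'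
  obtain ⟨ω, hω⟩ := Lab.exists_permute (B.root ρ) ω'
  have hzz : ∀ {x x' : List C} {e : C} {ξ : Lab x e} {ξ' : Lab x' e} {χ : Perms x x'},
      Matches (K.edge (B.root χ)) (ξ.z :: ξ.L) (ξ'.z :: ξ'.L) →
        ξ.z = ξ'.z ∧ Matches χ.1 ξ.L ξ'.L := by
    intro x x' e ξ ξ' χ h
    rw [B.edge_root] at h
    have h0 := h 0
    rw [Perms.edge_zero] at h0
    have hz : ξ.z = ξ'.z := by simpa using h0.symm
    rw [hz] at h
    exact ⟨hz, Perms.matches_tail h⟩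
  obtain ⟨hμz, hμt⟩ := hzz hμ
  obtain ⟨hνz, hνt⟩ := hzz hν
  obtain ⟨hωz, hωt⟩ := hzz hω
  refine ⟨μ, μ', ν, ν', ω, ?_, hs', hνz, hμ, hν, hω⟩
  obtain ⟨W₁, W₂, hz, hμL, hωL, h1, hk'⟩ := hs'
  have hL := μ.hL.trans h₁
  obtain ⟨L₁, L₂, hμL', hL₁, hL₂⟩ := List.map_eq_append_iff.1 hL
  obtain ⟨e, L₂, rfl, -, hL₂⟩ := List.map_eq_cons_iff.1 hL₂
  have hlen := congrArg List.length hL₁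
  have hlen' := congrArg List.length h1
  rw [List.length_map] at hlen hlen'
  have ha' := congrArg List.length μ'.hL
  have hb := congrArg List.length ν.hL
  have hb' := congrArg List.length ν'.hL
  have hr := congrArg List.length ω.hL
  have hr' := congrArg List.length ω'.hL
  rw [List.length_map] at ha' hb hb' hr hr'
  obtain rfl : e = ν'.z := by
    have hi : W₁.length < a'.length := by rw [← ha', hμL]; simp
    have h3 := hμt ⟨W₁.length, hi⟩
    rw [h.1 ⟨W₁.length, hi⟩ hlen', hμL, hμL', ← hlen] at h3
    simpa using h3.symm
  rw [hμL, hμL'] at hμt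
  have hm := matches_of_isBlockPerm (by rw [← ha', hμL]) hb hb' (by rw [← hωL, hr'])
    (by rwa [hlen, hlen']) hμt hνt
  rw [← hωL] at hm
  have hωL' : ω.L = L₁ ++ ν.L ++ L₂ := by
    refine hωt.symm.eq hm.symm hr ?_
    have := congrArg List.length hL₂
    simp only [List.length_map, List.length_cons, Nat.add_right_cancel_iff] at this
    rw [h₂]
    simp [hb, hlen, this]
  refine ⟨L₁, L₂, by rw [hμz, hz, hωz], by rw [hμL', hνz], hωL', hL₁, ?_⟩
  rw [hνz, ← hω.mem_iff (by simp [← hr]) (by simp [← hr'])]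
  exact hk'

section Fam

variable {hH : GlueLaws H} {a a' b b' r r' : List C} {c d : C} {l₁ l₂ l₁' l₂' : List C}
  (h₁ : a = l₁ ++ c :: l₂) (h₂ : r = l₁ ++ b ++ l₂)
  (h₁' : a' = l₁' ++ c :: l₂') (h₂' : r' = l₁' ++ b' ++ l₂')
  (σ : Perms a a') (τ : Perms b b') (ρ : Perms r r')
  (h : IsBlockPerm l₁.length l₁'.length σ.1 τ.1 ρ.1)

include h

theorem plug_perm (q : K.P.Op b c) (φ : Fam H a d) :
    Fam.plug hH h₁' h₂' (K.act (B.root τ) q) (Fam.perm (B.root σ) φ) =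
      Fam.perm (B.root ρ) (Fam.plug hH h₁ h₂ q φ) := by
  ext1
  funext ω'
  obtain ⟨μ, μ', ν, ν', ω, hs, hs', hz, hμ, hν, hω⟩ := B.exists_block_split h₁ h₂ h₁' h₂' h ω'
  rw [Fam.plug_val hH h₁' h₂' _ _ hs', Fam.perm_val _ _ hμ, Fam.perm_val _ _ hω,
    Fam.plug_val hH h₁ h₂ _ _ hs, hz]
  exact (glue_congr (Fam.op_equiv hν q)).symm

theorem graft_perm (p : K.P.Op a d) (φ : Fam H b c) :
    Fam.graft hH h₁' h₂' (K.act (B.root σ) p) (Fam.perm (B.root τ) φ) =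
      Fam.perm (B.root ρ) (Fam.graft hH h₁ h₂ p φ) := by
  ext1
  funext ω'
  obtain ⟨μ, μ', ν, ν', ω, hs, hs', hz, hμ, hν, hω⟩ := B.exists_block_split h₁ h₂ h₁' h₂' h ω'
  rw [Fam.graft_val hH h₁' h₂' _ _ hs', Fam.perm_val _ _ hν, Fam.perm_val _ _ hω,
    Fam.graft_val hH h₁ h₂ _ _ hs, hz]
  exact (glue_congr (Fam.op_equiv hμ p)).symm

end Fam

end BlockLaws

end EnvReedy

namespace EnvReedy

variable {C : Type u}

/-! ### Planar and symmetric operads -/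

namespace PlanarOperad

variable (P : PlanarOperad.{u, v} C)

/-- A planar operad, as an operad of one of the three kinds. -/
abbrev kind : Kind.{u, v} C where
  P := P
  G := NoPerms
  act σ := Empty.elim σ
  rel := P.rel
  planar _ _ _ _ h := h
  eval_rel := evalPaths_planarRel P NoPerms _
  edge σ := Empty.elim σ
  edge_colour σ := Empty.elim σ
  inv σ := Empty.elim σ
  comp σ := Empty.elim σ
  edge_inv σ := Empty.elim σ
  edge_comp σ := Empty.elim σ
  perm_comp σ := Empty.elim σ
  perm_id σ := Empty.elim σ

theorem rooted : P.kind.Rooted := fun _ _ σ => Empty.elim σ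

/-- There are no permutations to identify different labelled elements. -/
theorem lstate_eq {H : Kind.Act.{u, v, w} P.kind} {S S' : LState H} (h : S ≈ S') : S = S' := by
  rcases h with h | h
  · exact h
  · obtain ⟨ha, ha', hd, hd', hn, hn', x, σ, hm⟩ := h
    exact Empty.elim σ

theorem glueLaws (H : Kind.Act.{u, v, w} P.kind) : GlueLaws H where
  kind := Or.inl P.rooted
  congr := by
    intro k S S' Q Q' W W' hS hQ h h'
    obtain rfl := P.lstate_eq hS
    obtain rfl := P.lstate_eq hQ
    obtain rfl := h.unique h'
    exact Setoid.refl _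
  id_equiv h k m _ _ := by
    have := h.1
    exact Empty.elim (h.2 [] [] (Equiv.refl _)).choose

theorem paths_rel {H : Kind.Act.{u, v, w} P.kind} (s t : Paths (Sig P NoPerms)) (f g : s ⟶ t)
    (h : P.rel f g) : (Fam.paths (P.glueLaws H)).map f = (Fam.paths (P.glueLaws H)).map g :=
  Fam.paths_planarRel (P.glueLaws H) (P.glueLaws _) s t f g h

end PlanarOperad

namespace SymmetricOperad

variable (P : SymmetricOperad.{u, v} C)

/-- A symmetric operad, as an operad of one of the three kinds. -/
abbrev kind : Kind.{u, v} C where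
  P := P.toPlanarOperad
  G := Perms
  act := P.act
  rel := P.rel
  planar _ _ _ _ h := .planar _ _ h
  eval_rel _ _ _ _ h := congrArg P.eval.map (CategoryTheory.Quotient.sound _ h)
  edge := Perms.edge
  edge_colour := Perms.edge_colour
  inv := Perms.inv
  comp := Perms.comp
  edge_inv := Perms.edge_inv
  edge_comp := Perms.edge_comp
  perm_comp σ τ d := ((CategoryTheory.Quotient.functor P.rel).map_comp _ _).symm.trans
    (CategoryTheory.Quotient.sound _ (.act_act d σ τ _ rfl))
  perm_id σ d h := (CategoryTheory.Quotient.sound _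
    (.act_one d σ (Perms.eq_refl_of_edge h))).trans (CategoryTheory.Functor.map_id _ _)

theorem rooted : P.kind.Rooted := fun _ _ => Perms.edge_zero

/-- The equivariance of compositions. -/
def blockLaws : BlockLaws P.kind where
  root σ := σ
  edge_root _ := rfl
  perm_plug l₁ l₂ l₁' l₂' h₁ h₂ h₁' h₂' σ τ ρ h q :=
    ((CategoryTheory.Quotient.functor P.rel).map_comp _ _).symm.trans
      ((CategoryTheory.Quotient.sound _
        (.act_comp_fst l₁ l₂ l₁' l₂' h₁ h₂ h₁' h₂' σ τ ρ h q)).trans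
        ((CategoryTheory.Quotient.functor P.rel).map_comp _ _))
  perm_graft l₁ l₂ l₁' l₂' h₁ h₂ h₁' h₂' σ τ ρ h p :=
    ((CategoryTheory.Quotient.functor P.rel).map_comp _ _).symm.trans
      ((CategoryTheory.Quotient.sound _
        (.act_comp_snd l₁ l₂ l₁' l₂' h₁ h₂ h₁' h₂' σ τ ρ h p)).trans
        ((CategoryTheory.Quotient.functor P.rel).map_comp _ _))

theorem glueLaws (H : Kind.Act.{u, v, w} P.kind) : GlueLaws H where
  kind := Or.inl P.rooted
  congr hS hQ h h' := P.blockLaws.congr_of_eq hS hQ (LState.equiv_rooted P.rooted hS).1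
    (LState.equiv_rooted P.rooted hQ).1 h h'
  id_equiv h k m hkm hc := by
    -- A free kind would allow the exchange of input and output, which no permutation of inputs
    -- does; so the condition is vacuous.
    obtain ⟨σ, hσ⟩ := h.2 [k.2] [k.2] (Equiv.swap 0 1)
    have h0 := P.rooted _ _ σ
    rw [hσ] at h0
    simp at h0

theorem paths_rel {H : Kind.Act.{u, v, w} P.kind}
    (s t : Paths (Sig P.toPlanarOperad Perms)) (f g : s ⟶ t)
    (h : P.rel f g) : (Fam.paths (P.glueLaws H)).map f = (Fam.paths (P.glueLaws H)).map g := by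
  cases h with
  | planar _ _ h => exact Fam.paths_planarRel (P.glueLaws H) (P.glueLaws _) s t f g h
  | act_one d σ h =>
    refine (Fam.paths_sPerm (P.glueLaws H) σ).trans ?_
    rw [CategoryTheory.Functor.map_id]
    refine ConcreteCategory.hom_ext _ _ fun φ => ?_
    refine Fam.perm_refl (K := P.kind) σ ?_ φ
    change Perms.edge _ = _
    rw [← Perms.edge_refl]
    exact congrArg Perms.edge (Subtype.ext h)
  | act_act d σ τ ρ h =>
    rw [Functor.map_comp]
    refine ConcreteCategory.hom_ext _ _ fun φ => ?_
    refine Fam.perm_perm (K := P.kind) σ τ ρ ?_ φ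
    change Perms.edge _ = _
    rw [← Perms.edge_comp]
    exact congrArg Perms.edge (Subtype.ext h)
  | act_comp_fst l₁ l₂ l₁' l₂' h₁ h₂ h₁' h₂' σ τ ρ h q =>
    rw [Functor.map_comp, Functor.map_comp]
    refine ConcreteCategory.hom_ext _ _ fun φ => ?_
    exact P.blockLaws.plug_perm (hH := P.glueLaws H) h₁ h₂ h₁' h₂' σ τ ρ h q φ
  | act_comp_snd l₁ l₂ l₁' l₂' h₁ h₂ h₁' h₂' σ τ ρ h p =>
    rw [Functor.map_comp, Functor.map_comp]
    refine ConcreteCategory.hom_ext _ _ fun φ => ?_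
    exact P.blockLaws.graft_perm (hH := P.glueLaws H) h₁ h₂ h₁' h₂' σ τ ρ h p φ

end SymmetricOperad

end EnvReedy

namespace EnvReedy

/-! ### Cyclic operads -/

/-- The rotation promotes the first input to the output and moves the old output behind the
remaining inputs. -/
theorem matches_rot {α : Type*} {a : List Unit} {z : α} {L : List α} (h : L.length = a.length) :
    Matches (rot a) (z :: L) (L ++ [z]) := by
  intro i
  unfold rot
  refine Fin.lastCases ?_ (fun i => ?_) i
  · rw [finRotate_last]
    simp [← h]
  · have h1 : finRotate (a.length + 1) i.castSucc = i.succ := finRotate_of_lt i.2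
    rw [h1, List.getElem?_append_left (by simp [h])]
    simp

theorem eq_of_length_eq {a b : List Unit} (h : a.length = b.length) : a = b :=
  List.ext_getElem h fun _ _ _ => rfl

namespace CyclicOperad

variable (P : CyclicOperad.{v})

/-- A cyclic operad, as an operad of one of the three kinds. -/
abbrev kind : Kind.{0, v} Unit where
  P := P.toPlanarOperad
  G := CycPerms
  act := P.cact'
  rel := P.rel
  planar _ _ _ _ h := .planar _ _ h
  eval_rel _ _ _ _ h := congrArg P.eval.map (CategoryTheory.Quotient.sound _ h)
  edge σ := σ
  edge_colour {a b} σ d i := by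
    have hi : ((show Fin (b.length + 1) ≃ Fin (a.length + 1) from σ) i : ℕ) < (d :: a).length :=
      Fin.is_lt _
    exact (List.getElem?_eq_getElem (l := d :: b) i.2).trans (List.getElem?_eq_getElem hi).symm
  inv {a b} σ := Equiv.symm (α := Fin (b.length + 1)) (β := Fin (a.length + 1)) σ
  comp := CycPerms.comp
  edge_inv _ := rfl
  edge_comp _ _ := rfl
  perm_comp σ τ _ := ((CategoryTheory.Quotient.functor P.rel).map_comp _ _).symm.trans
    (CategoryTheory.Quotient.sound _ (.act_act σ τ))
  perm_id := by
    rintro a σ d rfl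
    exact (CategoryTheory.Quotient.sound _ (.act_one a)).trans (CategoryTheory.Functor.map_id _ _)

theorem free : P.kind.Free := ⟨inferInstance, fun _ _ ε => ⟨ε, rfl⟩⟩

/-- The equivariance of compositions. -/
def blockLaws : BlockLaws P.kind where
  root σ := σ.ext
  edge_root _ := rfl
  perm_plug l₁ l₂ l₁' l₂' h₁ h₂ h₁' h₂' σ τ ρ h q := by
    refine Eq.trans ?_ (((CategoryTheory.Quotient.functor P.rel).map_comp _ _).symm.trans
      ((CategoryTheory.Quotient.sound _
        (.act_comp_fst l₁ l₂ l₁' l₂' h₁ h₂ h₁' h₂' σ τ ρ h q)).trans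
        ((CategoryTheory.Quotient.functor P.rel).map_comp _ _)))
    rw [← P.cact_ext]
    rfl
  perm_graft l₁ l₂ l₁' l₂' h₁ h₂ h₁' h₂' σ τ ρ h p := by
    refine Eq.trans ?_ (((CategoryTheory.Quotient.functor P.rel).map_comp _ _).symm.trans
      ((CategoryTheory.Quotient.sound _
        (.act_comp_snd l₁ l₂ l₁' l₂' h₁ h₂ h₁' h₂' σ τ ρ h p)).trans
        ((CategoryTheory.Quotient.functor P.rel).map_comp _ _)))
    rw [← P.cact_ext]
    rfl

section Rot

variable {P} {a b r : List Unit}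

theorem plug_rot_first {l₂ m₁ : List Unit}
    (h₁ : a = [] ++ () :: l₂) (h₂ : r = [] ++ b ++ l₂)
    (h₃ : b = m₁ ++ () :: []) (h₄ : r = m₁ ++ a ++ []) (q : P.Op b ()) :
    P.kind.mPlug [] l₂ h₁ h₂ q () ≫ P.kind.mPerm (rot r) () =
      P.kind.mPerm (rot a) () ≫ P.kind.mGraft m₁ [] h₃ h₄ (P.cact (rot b) q) :=
  ((CategoryTheory.Quotient.functor P.rel).map_comp _ _).symm.trans
    ((CategoryTheory.Quotient.sound _ (.rot_comp_first_fst l₂ m₁ h₁ h₂ h₃ h₄ q)).trans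
      ((CategoryTheory.Quotient.functor P.rel).map_comp _ _))

theorem plug_rot_other {l₁ l₂ : List Unit} (h₁ : a = (() :: l₁) ++ () :: l₂)
    (h₂ : r = (() :: l₁) ++ b ++ l₂)
    (h₃ : a = l₁ ++ () :: (l₂ ++ [()])) (h₄ : r = l₁ ++ b ++ (l₂ ++ [()])) (q : P.Op b ()) :
    P.kind.mPlug (() :: l₁) l₂ h₁ h₂ q () ≫ P.kind.mPerm (rot r) () =
      P.kind.mPerm (rot a) () ≫ P.kind.mPlug l₁ (l₂ ++ [()]) h₃ h₄ q () :=
  ((CategoryTheory.Quotient.functor P.rel).map_comp _ _).symm.trans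
    ((CategoryTheory.Quotient.sound _ (.rot_comp_other_fst l₁ l₂ h₁ h₂ h₃ h₄ q)).trans
      ((CategoryTheory.Quotient.functor P.rel).map_comp _ _))

theorem graft_rot_other {l₁ l₂ : List Unit} (h₁ : a = (() :: l₁) ++ () :: l₂)
    (h₂ : r = (() :: l₁) ++ b ++ l₂)
    (h₃ : a = l₁ ++ () :: (l₂ ++ [()])) (h₄ : r = l₁ ++ b ++ (l₂ ++ [()])) (p : P.Op a ()) :
    P.kind.mGraft (() :: l₁) l₂ h₁ h₂ p ≫ P.kind.mPerm (rot r) () =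
      P.kind.mGraft l₁ (l₂ ++ [()]) h₃ h₄ (P.cact (rot a) p) :=
  ((CategoryTheory.Quotient.functor P.rel).map_comp _ _).symm.trans
    (CategoryTheory.Quotient.sound _ (.rot_comp_other_snd l₁ l₂ h₁ h₂ h₃ h₄ p))

end Rot

/-! ### Gluing in a cyclic operad does not depend on the choice of outputs. -/

section Congr

variable {P} {H : Kind.Act.{0, v, w} P.kind}

/-- Rotation of the labels. -/
def rotState (S : LState H) (y : ℕ × Unit) (A : List (ℕ × Unit)) (h : S.L = y :: A) :
    LState H where
  z := y
  L := A ++ [S.z]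
  a := S.a
  d := S.d
  ha := eq_of_length_eq (by simp [S.ha, h])
  hd := rfl
  nodup := by
    have := S.nodup
    rw [h] at this
    exact (List.perm_append_singleton S.z (y :: A)).nodup_iff.2 this
  x := H.map (P.kind.mPerm (rot S.a) S.d) S.x

theorem rotState_equiv (S : LState H) (y : ℕ × Unit) (A : List (ℕ × Unit)) (h : S.L = y :: A) :
    S ≈ rotState S y A h := by
  have := LState.Step.mk S.ha (rotState S y A h).ha S.hd (rotState S y A h).hd S.nodup
    (rotState S y A h).nodup S.x (rot S.a)
    (by rw [h]; exact matches_rot (z := S.z) (L := y :: A) (by simp [S.ha, h]))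
  exact this.equiv

/-- The first input differs from the glued edge, so the axiom for $i>1$ lets the rotation pass
through the composition. -/
theorem rot_plug {k y : ℕ × Unit} {S W : LState H} {Q : LState P.kind.opAct}
    {A : List (ℕ × Unit)} (h : GlueRel k S Q W) (hQ : Q.z = k) (hy : y ≠ k) (hS : S.L = y :: A) :
    ∃ W' : LState H, W ≈ W' ∧ GlueRel k (rotState S y A hS) Q W' := by
  have hn := Q.nodup
  cases h with
  | graft N₁ N₂ N hL => grind
  | plug L₁ L₂ N hL hz hN l₁ l₂ r hl₁ hl₂ h₁ h₂ hr hn x hx =>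
    obtain _ | ⟨y', L₁⟩ := L₁
    · grind
    obtain ⟨rfl, rfl⟩ : y' = y ∧ A = L₁ ++ k :: L₂ := by
      rw [hS] at hL
      simpa [eq_comm] using hL
    subst hl₁ hl₂ hN hx
    refine ⟨_, rotState_equiv _ y' (L₁ ++ Q.L ++ L₂) (by simp), ?_⟩
    refine GlueRel.plug _ _ L₁ (L₂ ++ [S.z]) _ (by simp [rotState]) hz (by simp)
      (L₁.map Prod.snd) (L₂.map Prod.snd ++ [()]) _ rfl (by simp)
      (eq_of_length_eq (by simp [rotState, h₁]; omega))
      (eq_of_length_eq (by simp [h₂]; omega)) _ _ _ ?_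
    dsimp only [rotState]
    rw [← H.map_comp, ← H.map_comp]
    congr 1
    exact (plug_rot_other _ _ _ _ _).symm

theorem rot_graft {k y : ℕ × Unit} {S W : LState H} {Q : LState P.kind.opAct}
    {A : List (ℕ × Unit)} (h : GlueRel k S Q W) (hSz : S.z = k) (hy : y ≠ k) (hQ : Q.L = y :: A) :
    ∃ W' : LState H, W ≈ W' ∧ GlueRel k S (rotState Q y A hQ) W' := by
  have hn := S.nodup
  cases h with
  | plug N₁ N₂ N hL => grind
  | graft L₁ L₂ N hL hz hN l₁ l₂ r hl₁ hl₂ h₁ h₂ hr hn x hx =>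
    obtain _ | ⟨y', L₁⟩ := L₁
    · grind
    obtain ⟨rfl, rfl⟩ : y' = y ∧ A = L₁ ++ k :: L₂ := by
      rw [hQ] at hL
      simpa [eq_comm] using hL
    subst hl₁ hl₂ hN hx
    refine ⟨_, rotState_equiv _ y' (L₁ ++ S.L ++ L₂) (by simp), ?_⟩
    refine GlueRel.graft _ _ L₁ (L₂ ++ [Q.z]) _ (by simp [rotState]) hz (by simp)
      (L₁.map Prod.snd) (L₂.map Prod.snd ++ [()]) _ rfl (by simp)
      (eq_of_length_eq (by simp [rotState, h₁]; omega))
      (eq_of_length_eq (by simp [h₂]; omega)) _ _ _ ?_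
    dsimp only [rotState]
    rw [← H.map_comp]
    congr 1
    exact (congrArg (fun p => P.kind.mGraft _ _ _ _ p)
      (Kind.opAct_perm (K := P.kind) _ _ _)).trans (graft_rot_other _ _ _ _ _).symm

/-- Here the glued edge is the first input itself. The rotation reverses its direction, and the
axiom for $i=1$ with $n>0$ turns plugging `Q` into `S` into grafting `S` to `Q`. -/
theorem rot_switch {k y : ℕ × Unit} {S W : LState H} {Q : LState P.kind.opAct}
    {A B : List (ℕ × Unit)} (h : GlueRel k S Q W) (hQz : Q.z = k) (hS : S.L = k :: A)
    (hQ : Q.L = y :: B) :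
    ∃ W' : LState H, W ≈ W' ∧ GlueRel k (rotState S k A hS) (rotState Q y B hQ) W' := by
  have hn := Q.nodup
  have hn' := S.nodup
  cases h with
  | graft N₁ N₂ N hL => grind
  | plug L₁ L₂ N hL hz hN l₁ l₂ r hl₁ hl₂ h₁ h₂ hr hn x hx =>
    obtain ⟨rfl, rfl⟩ : L₁ = [] ∧ A = L₂ := by
      rw [hS] at hL
      obtain _ | ⟨y', L₁⟩ := L₁
      · simpa using hL
      · grind
    subst hl₁ hl₂ hN hx
    refine ⟨_, rotState_equiv _ y (B ++ A) (by simp [hQ]), ?_⟩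
    refine GlueRel.graft _ _ B [] _ (by simp [rotState, hQz]) (by rfl) (by simp [rotState])
      (B.map Prod.snd) [] _ rfl rfl
      (eq_of_length_eq (by simp [rotState, Q.ha, hQ]))
      (eq_of_length_eq (by simp [rotState, h₂, Q.ha, hQ, S.ha, hS]; omega)) _ _ _ ?_
    dsimp only [rotState]
    rw [← H.map_comp, ← H.map_comp]
    congr 1
    exact (congrArg (fun p => P.kind.mPerm (rot S.a) S.d ≫ P.kind.mGraft _ [] _ _ p)
      (Kind.opAct_perm (K := P.kind) _ _ _)).trans (plug_rot_first _ _ _ _ _).symm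

theorem exists_rep_cons (S : LState H) {y : ℕ × Unit} (hy : y ∈ S.L) :
    ∃ (S' : LState H) (A : List (ℕ × Unit)), S' ≈ S ∧ S'.z = S.z ∧ S'.L = y :: A := by
  have hp := List.perm_cons_erase hy
  have hp' := hp.cons S.z
  obtain ⟨S', h1, h2, h3⟩ := LState.exists_rep P.free S (hp'.nodup_iff.1 S.nodup)
    (fun l => hp'.mem_iff.symm)
  exact ⟨S', _, h1, h2, h3⟩

/-- The two representatives direct the glued edge oppositely. Permutations of inputs bring this edge
to the front in `S`, and the future output to the front in `Q`; one simultaneous rotation then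
reverses the edge, and the rest only permutes inputs. -/
theorem congr_plug_graft {k : ℕ × Unit} {S S' W W' : LState H} {Q Q' : LState P.kind.opAct}
    (hS : S ≈ S') (hQ : Q ≈ Q') (h : GlueRel k S Q W) (h' : GlueRel k S' Q' W')
    (hk : k ∈ S.L) (hQz : Q.z = k) (hSz : S'.z = k) (hk' : k ∈ Q'.L) : W ≈ W' := by
  have hnQ := Q'.nodup
  obtain ⟨S₁, A, h1, h2, h3⟩ := exists_rep_cons S hk
  obtain ⟨Q₁, B, h4, h5, h6⟩ := exists_rep_cons Q (y := Q'.z) (by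
    have := LState.mem_iff_of_equiv hQ Q'.z
    grind)
  have hd : ∀ l ∈ S₁.z :: S₁.L, l ∈ Q₁.z :: Q₁.L → l = k := fun l hl hl' =>
    h.disjoint l ((LState.mem_iff_of_equiv h1 l).1 hl) ((LState.mem_iff_of_equiv h4 l).1 hl')
  obtain ⟨W₁, hW₁⟩ := GlueRel.exists_of_polarity
    (Or.inr ⟨by simp [h3], h5.trans hQz⟩) hd
  obtain ⟨W₂, h7, h8⟩ := rot_switch hW₁ (h5.trans hQz) h3 h6
  exact Setoid.trans (P.blockLaws.congr_of_eq (Setoid.symm h1) (Setoid.symm h4) h2.symm h5.symm h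
    hW₁) (Setoid.trans h7 (P.blockLaws.congr_of_eq
      (Setoid.trans (Setoid.symm (rotState_equiv _ _ _ _)) (Setoid.trans h1 hS))
      (Setoid.trans (Setoid.symm (rotState_equiv _ _ _ _)) (Setoid.trans h4 hQ)) hSz.symm rfl h8 h'))

/-- The direction of the glued edge agrees, but the outputs of `S` and `S'` may differ. The new
output is brought to the front of the inputs and made the output by one rotation, which does not
disturb the glued edge. -/
theorem congr_plug_plug {k : ℕ × Unit} {S S' W W' : LState H} {Q Q' : LState P.kind.opAct}
    (hS : S ≈ S') (hQ : Q ≈ Q') (h : GlueRel k S Q W) (h' : GlueRel k S' Q' W')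
    (hk : k ∈ S.L) (hQz : Q.z = k) (hk' : k ∈ S'.L) (hQz' : Q'.z = k) : W ≈ W' := by
  by_cases hz : S.z = S'.z
  · exact P.blockLaws.congr_of_eq hS hQ hz (hQz.trans hQz'.symm) h h'
  have hnS := S'.nodup
  have hk'' : S'.z ≠ k := by grind
  obtain ⟨S₁, A, h1, h2, h3⟩ := exists_rep_cons S (y := S'.z) (by
    have := LState.mem_iff_of_equiv hS S'.z
    grind)
  have hd : ∀ l ∈ S₁.z :: S₁.L, l ∈ Q.z :: Q.L → l = k := fun l hl hl' =>
    h.disjoint l ((LState.mem_iff_of_equiv h1 l).1 hl) hl'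
  have hk₁ : k ∈ S₁.L := by
    have := LState.mem_iff_of_equiv h1 k
    have hn := S.nodup
    grind
  obtain ⟨W₁, hW₁⟩ := GlueRel.exists_of_polarity (Or.inr ⟨hk₁, hQz⟩) hd
  obtain ⟨W₂, h7, h8⟩ := rot_plug hW₁ hQz hk'' h3
  exact Setoid.trans (P.blockLaws.congr_of_eq (Setoid.symm h1) (Setoid.refl _) h2.symm rfl h
    hW₁) (Setoid.trans h7 (P.blockLaws.congr_of_eq
      (Setoid.trans (Setoid.symm (rotState_equiv _ _ _ _)) (Setoid.trans h1 hS))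
      hQ rfl (hQz.trans hQz'.symm) h8 h'))

theorem congr_graft_graft {k : ℕ × Unit} {S S' W W' : LState H} {Q Q' : LState P.kind.opAct}
    (hS : S ≈ S') (hQ : Q ≈ Q') (h : GlueRel k S Q W) (h' : GlueRel k S' Q' W')
    (hk : k ∈ Q.L) (hSz : S.z = k) (hk' : k ∈ Q'.L) (hSz' : S'.z = k) : W ≈ W' := by
  by_cases hz : Q.z = Q'.z
  · exact P.blockLaws.congr_of_eq hS hQ (hSz.trans hSz'.symm) hz h h'
  have hnQ := Q'.nodup
  have hk'' : Q'.z ≠ k := by grind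
  obtain ⟨Q₁, A, h1, h2, h3⟩ := exists_rep_cons Q (y := Q'.z) (by
    have := LState.mem_iff_of_equiv hQ Q'.z
    grind)
  have hd : ∀ l ∈ S.z :: S.L, l ∈ Q₁.z :: Q₁.L → l = k := fun l hl hl' =>
    h.disjoint l hl ((LState.mem_iff_of_equiv h1 l).1 hl')
  have hk₁ : k ∈ Q₁.L := by
    have := LState.mem_iff_of_equiv h1 k
    have hn := Q.nodup
    grind
  obtain ⟨W₁, hW₁⟩ := GlueRel.exists_of_polarity (Or.inl ⟨hSz, hk₁⟩) hd
  obtain ⟨W₂, h7, h8⟩ := rot_graft hW₁ hSz hk'' h3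
  exact Setoid.trans (P.blockLaws.congr_of_eq (Setoid.refl _) (Setoid.symm h1) rfl h2.symm h
    hW₁) (Setoid.trans h7 (P.blockLaws.congr_of_eq hS
      (Setoid.trans (Setoid.symm (rotState_equiv _ _ _ _)) (Setoid.trans h1 hQ))
      (hSz.trans hSz'.symm) rfl h8 h'))

variable (P)

theorem glueLaws (H : Kind.Act.{0, v, w} P.kind) : GlueLaws H where
  kind := Or.inr P.free
  congr hS hQ h h' := by
    rcases h.polarity with ⟨h1, h2⟩ | ⟨h1, h2⟩ <;> rcases h'.polarity with ⟨h3, h4⟩ | ⟨h3, h4⟩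
    · exact congr_graft_graft hS hQ h h' h2 h1 h4 h3
    · exact Setoid.symm
        (congr_plug_graft (Setoid.symm hS) (Setoid.symm hQ) h' h h3 h4 h1 h2)
    · exact congr_plug_graft hS hQ h h' h1 h2 h3 h4
    · exact congr_plug_plug hS hQ h h' h1 h2 h3 h4
  -- The axiom that the rotation fixes the identity says that a wire has no direction.
  id_equiv _ k m h hc := by
    refine Setoid.trans (rotState_equiv _ m [] rfl) (Or.inl ?_)
    simp only [idState, rotState]
    congr 1
    exact (Kind.opAct_perm (K := P.kind) (rot [()]) () (P.id ())).trans P.rot_id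

end Congr

/-! ### The cyclic axioms for families. -/

section Fam

variable {P} {H : Kind.Act.{0, v, w} P.kind} {a b r : List Unit}

theorem exists_rot (μ : Lab a ()) : ∃ μ' : Lab a (), μ'.z :: μ'.L = μ.L ++ [μ.z] ∧
    Matches (rot a) (μ.z :: μ.L) (μ'.z :: μ'.L) := by
  have hlen : μ.L.length = a.length := by simpa using congrArg List.length μ.hL
  have hm := matches_rot (z := μ.z) hlen
  have hn := (List.perm_append_singleton μ.z μ.L).nodup_iff.2 μ.nodup
  have hp : ∀ l ∈ μ.L ++ [μ.z], l.1 ≠ 0 := fun l hl =>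
    μ.pos l ((List.perm_append_singleton μ.z μ.L).mem_iff.1 hl)
  have hl : (μ.L ++ [μ.z]).length = a.length + 1 := by simp [hlen]
  generalize μ.L ++ [μ.z] = T at *
  obtain _ | ⟨z, L⟩ := T
  · simp at hl
  · exact ⟨⟨z, L, rfl, eq_of_length_eq (by simpa using hl), hn, hp⟩, rfl, hm⟩

theorem exists_rot_symm (ω' : Lab a ()) : ∃ ω : Lab a (), ω'.z :: ω'.L = ω.L ++ [ω.z] ∧
    Matches (rot a) (ω.z :: ω.L) (ω'.z :: ω'.L) := by
  have hlen : ω'.L.length = a.length := by simpa using congrArg List.length ω'.hL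
  obtain h | ⟨L, z, h⟩ := List.eq_nil_or_concat (ω'.z :: ω'.L)
  · simp at h
  rw [List.concat_eq_append] at h
  have hl := congrArg List.length h
  simp only [List.length_cons, List.length_append, List.length_nil, hlen] at hl
  have hp := List.perm_append_singleton z L
  refine ⟨⟨z, L, rfl, eq_of_length_eq (by simp; omega), ?_, fun l hl => ?_⟩, h, ?_⟩
  · exact hp.nodup_iff.1 (h ▸ ω'.nodup)
  · exact ω'.pos l (h ▸ hp.mem_iff.2 hl)
  · intro i
    exact (congrArg (fun T : List (ℕ × Unit) => T[(i : ℕ)]?) h).trans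
      (matches_rot (a := a) (z := z) (L := L) (by omega) i)

theorem op_rot_equiv {ν ν' : Lab b ()} (h : Matches (rot b) (ν.z :: ν.L) (ν'.z :: ν'.L))
    (q : P.Op b ()) :
    (ν.op (K := P.kind) q) ≈ ν'.op (K := P.kind) (P.cact (rot b) q) :=
  Fam.op_equiv (K := P.kind) h q

/-- After rotation of all three namings the composition at the first input becomes a composition at
the last input with the roles exchanged: the inner edge, formerly the output of `ν`, is now the
output of `μ'`. -/
theorem exists_split_first {l₂ m₁ : List Unit}
    (h₁ : a = [] ++ () :: l₂) (h₂ : r = [] ++ b ++ l₂)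
    (h₃ : b = m₁ ++ () :: []) (ω' : Lab r ()) :
    ∃ (μ μ' : Lab a ()) (ν ν' : Lab b ()) (ω : Lab r ()),
      Lab.Split [] μ ν ω ∧ Lab.Split m₁ ν' μ' ω' ∧ μ'.z = ν.z ∧
      Matches (rot a) (μ.z :: μ.L) (μ'.z :: μ'.L) ∧
      Matches (rot b) (ν.z :: ν.L) (ν'.z :: ν'.L) ∧
      Matches (rot r) (ω.z :: ω.L) (ω'.z :: ω'.L) := by
  obtain ⟨ω, hω, hωm⟩ := exists_rot_symm ω'
  obtain ⟨⟨μ, ν⟩, hs⟩ := Fam.exists_split' h₁ h₂ ω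
  obtain ⟨μ', hμ', hμ⟩ := exists_rot μ
  obtain ⟨ν', hν', hν⟩ := exists_rot ν
  have hs' := hs
  obtain ⟨W₁, W₂, hz, hμL, hωL, h1, hk⟩ := hs'
  obtain rfl : W₁ = [] := List.map_eq_nil_iff.1 h1
  rw [hμL] at hμ'
  rw [hωL] at hω
  dsimp only at *
  have hνlen : ν.L.length = m₁.length + 1 := by
    simpa [h₃] using congrArg List.length ν.hL
  obtain ⟨y, B, hyB⟩ : ∃ y B, ν.L = y :: B := by
    generalize ν.L = L at hνlen
    obtain _ | ⟨y, B⟩ := L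
    · simp at hνlen
    · exact ⟨y, B, rfl⟩
  rw [hyB] at hν' hω hνlen
  simp only [List.nil_append, List.cons_append, List.cons.injEq] at hμ' hν' hω
  refine ⟨μ, μ', ν, ν', ω, hs, ⟨B, [], hν'.1.trans hω.1.symm, ?_, ?_, ?_, ?_⟩, hμ'.1, hμ, hν, hωm⟩
  · rw [hν'.2, hμ'.1]
  · rw [hω.2, hμ'.2, hz]
    simp
  · exact eq_of_length_eq (by simpa using hνlen)
  · rw [hμ'.1]
    exact fun h => hk ((hωm.mem_iff (by simpa using congrArg List.length ω.hL)
      (by simpa using congrArg List.length ω'.hL) _).1 h)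

/-- If the second operation has arity $0$, it has no input to become the new output, and the first
operation is rotated twice: the inner edge goes from the first input through the output to the last
input. -/
theorem exists_split_nullary {l₂ m₁ : List Unit}
    (h₁ : a = [] ++ () :: l₂) (h₂ : r = [] ++ [] ++ l₂) (h₄ : r = m₁ ++ [] ++ []) (ω' : Lab r ()) :
    ∃ (μ μ' μ'' : Lab a ()) (ν : Lab [] ()) (ω : Lab r ()),
      Lab.Split [] μ ν ω ∧ Lab.Split m₁ μ'' ν ω' ∧
      Matches (rot a) (μ.z :: μ.L) (μ'.z :: μ'.L) ∧
      Matches (rot a) (μ'.z :: μ'.L) (μ''.z :: μ''.L) ∧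
      Matches (rot r) (ω.z :: ω.L) (ω'.z :: ω'.L) := by
  obtain ⟨ω, hω, hωm⟩ := exists_rot_symm ω'
  obtain ⟨⟨μ, ν⟩, hs⟩ := Fam.exists_split' h₁ h₂ ω
  obtain ⟨μ', hμ', hμ⟩ := exists_rot μ
  obtain ⟨μ'', hμ'', hμm⟩ := exists_rot μ'
  have hs' := hs
  obtain ⟨W₁, W₂, hz, hμL, hωL, h1, hk⟩ := hs'
  obtain rfl : W₁ = [] := List.map_eq_nil_iff.1 h1
  have hνL : ν.L = [] := List.map_eq_nil_iff.1 ν.hL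
  dsimp only at *
  rw [hμL] at hμ'
  rw [hωL, hνL] at hω
  simp only [List.nil_append, List.cons_append, List.cons.injEq] at hμ' hω
  rw [hμ'.1, hμ'.2, hz, ← hω, List.cons_append, List.cons.injEq] at hμ''
  refine ⟨μ, μ', μ'', ν, ω, hs, ⟨ω'.L, [], hμ''.1, hμ''.2, by simp [hνL], ?_, ?_⟩, hμ, hμm, hωm⟩
  · exact eq_of_length_eq (by simpa [h₄] using congrArg List.length ω'.hL)
  · exact fun h => hk ((hωm.mem_iff (by simpa using congrArg List.length ω.hL)
      (by simpa using congrArg List.length ω'.hL) _).1 h)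

theorem exists_split_other {l₁ l₂ : List Unit} (h₁ : a = (() :: l₁) ++ () :: l₂)
    (h₂ : r = (() :: l₁) ++ b ++ l₂) (ω' : Lab r ()) :
    ∃ (μ μ' : Lab a ()) (ν : Lab b ()) (ω : Lab r ()),
      Lab.Split (() :: l₁) μ ν ω ∧ Lab.Split l₁ μ' ν ω' ∧
      Matches (rot a) (μ.z :: μ.L) (μ'.z :: μ'.L) ∧
      Matches (rot r) (ω.z :: ω.L) (ω'.z :: ω'.L) := by
  obtain ⟨ω, hω, hωm⟩ := exists_rot_symm ω'
  obtain ⟨⟨μ, ν⟩, hs⟩ := Fam.exists_split' h₁ h₂ ω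
  obtain ⟨μ', hμ', hμ⟩ := exists_rot μ
  have hs' := hs
  obtain ⟨W₁, W₂, hz, hμL, hωL, h1, hk⟩ := hs'
  obtain ⟨y, W₁, rfl, -, h1⟩ := List.map_eq_cons_iff.1 h1
  dsimp only at *
  rw [hμL] at hμ'
  rw [hωL] at hω
  simp only [List.cons_append, List.cons.injEq] at hμ' hω
  refine ⟨μ, μ', ν, ω, hs, ⟨W₁, W₂ ++ [ω.z], hμ'.1.trans hω.1.symm, ?_, ?_, h1, ?_⟩, hμ, hωm⟩
  · rw [hμ'.2, hz]
    simp
  · rw [hω.2]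
    simp
  · exact fun h => hk ((hωm.mem_iff (by simpa using congrArg List.length ω.hL)
      (by simpa using congrArg List.length ω'.hL) _).1 h)

theorem perm_rot_val {d : Unit} (φ : Fam H a d) {μ μ' : Lab a d}
    (h : Matches (rot a) (μ.z :: μ.L) (μ'.z :: μ'.L)) :
    (Fam.perm (K := P.kind) (rot a) φ).val μ' = φ.val μ :=
  Fam.perm_val (K := P.kind) (rot a) φ h

/-- In terms of names both sides glue the same class with the same labelled operation along the same
edge. The axiom is only a change of numbering, and the other rotation axioms are treated in the same
way. -/
theorem perm_plug_first (hH : GlueLaws H) {l₂ m₁ : List Unit}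
    (h₁ : a = [] ++ () :: l₂) (h₂ : r = [] ++ b ++ l₂)
    (h₃ : b = m₁ ++ () :: []) (h₄ : r = m₁ ++ a ++ []) (q : P.Op b ()) (φ : Fam H a ()) :
    Fam.perm (K := P.kind) (rot r) (Fam.plug hH h₁ h₂ q φ) =
      Fam.graft hH h₃ h₄ (P.cact (rot b) q) (Fam.perm (K := P.kind) (rot a) φ) := by
  ext1
  funext ω'
  obtain ⟨μ, μ', ν, ν', ω, hs, hs', hz, hμ, hν, hω⟩ := exists_split_first h₁ h₂ h₃ ω'
  rw [perm_rot_val _ hω, Fam.plug_val hH h₁ h₂ _ _ hs, Fam.graft_val hH h₃ h₄ _ _ hs',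
    perm_rot_val _ hμ, hz]
  exact glue_congr (op_rot_equiv hν q)

theorem perm_graft_first (hH : GlueLaws H) {l₂ m₁ : List Unit}
    (h₁ : a = [] ++ () :: l₂) (h₂ : r = [] ++ b ++ l₂)
    (h₃ : b = m₁ ++ () :: []) (h₄ : r = m₁ ++ a ++ []) (p : P.Op a ()) (φ : Fam H b ()) :
    Fam.perm (K := P.kind) (rot r) (Fam.graft hH h₁ h₂ p φ) =
      Fam.plug hH h₃ h₄ (P.cact (rot a) p) (Fam.perm (K := P.kind) (rot b) φ) := by
  ext1
  funext ω'
  obtain ⟨μ, μ', ν, ν', ω, hs, hs', hz, hμ, hν, hω⟩ := exists_split_first h₁ h₂ h₃ ω'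
  rw [perm_rot_val _ hω, Fam.graft_val hH h₁ h₂ _ _ hs, Fam.plug_val hH h₃ h₄ _ _ hs',
    perm_rot_val _ hν, hz]
  exact glue_congr (op_rot_equiv hμ p)

theorem perm_plug_nullary (hH : GlueLaws H) {l₂ m₁ : List Unit}
    (h₁ : a = [] ++ () :: l₂) (h₂ : r = [] ++ [] ++ l₂)
    (h₃ : a = m₁ ++ () :: []) (h₄ : r = m₁ ++ [] ++ []) (q : P.Op [] ()) (φ : Fam H a ()) :
    Fam.perm (K := P.kind) (rot r) (Fam.plug hH h₁ h₂ q φ) =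
      Fam.plug hH h₃ h₄ q
        (Fam.perm (K := P.kind) (rot a) (Fam.perm (K := P.kind) (rot a) φ)) := by
  ext1
  funext ω'
  obtain ⟨μ, μ', μ'', ν, ω, hs, hs', hμ, hμ', hω⟩ := exists_split_nullary h₁ h₂ h₄ ω'
  rw [perm_rot_val _ hω, Fam.plug_val hH h₁ h₂ _ _ hs, Fam.plug_val hH h₃ h₄ _ _ hs',
    perm_rot_val _ hμ', perm_rot_val _ hμ]

theorem perm_graft_nullary (hH : GlueLaws H) {l₂ m₁ : List Unit}
    (h₁ : a = [] ++ () :: l₂) (h₂ : r = [] ++ [] ++ l₂)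
    (h₃ : a = m₁ ++ () :: []) (h₄ : r = m₁ ++ [] ++ []) (p : P.Op a ()) (φ : Fam H [] ()) :
    Fam.perm (K := P.kind) (rot r) (Fam.graft hH h₁ h₂ p φ) =
      Fam.graft hH h₃ h₄ (P.cact (rot a) (P.cact (rot a) p)) φ := by
  ext1
  funext ω'
  obtain ⟨μ, μ', μ'', ν, ω, hs, hs', hμ, hμ', hω⟩ := exists_split_nullary h₁ h₂ h₄ ω'
  rw [perm_rot_val _ hω, Fam.graft_val hH h₁ h₂ _ _ hs, Fam.graft_val hH h₃ h₄ _ _ hs']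
  exact glue_congr (Setoid.trans (op_rot_equiv hμ p) (op_rot_equiv hμ' _))

theorem perm_plug_other (hH : GlueLaws H) {l₁ l₂ : List Unit}
    (h₁ : a = (() :: l₁) ++ () :: l₂) (h₂ : r = (() :: l₁) ++ b ++ l₂)
    (h₃ : a = l₁ ++ () :: (l₂ ++ [()])) (h₄ : r = l₁ ++ b ++ (l₂ ++ [()])) (q : P.Op b ())
    (φ : Fam H a ()) :
    Fam.perm (K := P.kind) (rot r) (Fam.plug hH h₁ h₂ q φ) =
      Fam.plug hH h₃ h₄ q (Fam.perm (K := P.kind) (rot a) φ) := by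
  ext1
  funext ω'
  obtain ⟨μ, μ', ν, ω, hs, hs', hμ, hω⟩ := exists_split_other h₁ h₂ ω'
  rw [perm_rot_val _ hω, Fam.plug_val hH h₁ h₂ _ _ hs, Fam.plug_val hH h₃ h₄ _ _ hs',
    perm_rot_val _ hμ]

theorem perm_graft_other (hH : GlueLaws H) {l₁ l₂ : List Unit}
    (h₁ : a = (() :: l₁) ++ () :: l₂) (h₂ : r = (() :: l₁) ++ b ++ l₂)
    (h₃ : a = l₁ ++ () :: (l₂ ++ [()])) (h₄ : r = l₁ ++ b ++ (l₂ ++ [()])) (p : P.Op a ())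
    (φ : Fam H b ()) :
    Fam.perm (K := P.kind) (rot r) (Fam.graft hH h₁ h₂ p φ) =
      Fam.graft hH h₃ h₄ (P.cact (rot a) p) φ := by
  ext1
  funext ω'
  obtain ⟨μ, μ', ν, ω, hs, hs', hμ, hω⟩ := exists_split_other h₁ h₂ ω'
  rw [perm_rot_val _ hω, Fam.graft_val hH h₁ h₂ _ _ hs, Fam.graft_val hH h₃ h₄ _ _ hs']
  exact glue_congr (op_rot_equiv hμ p)

end Fam

theorem paths_rel {H : Kind.Act.{0, v, w} P.kind}
    (s t : Paths (Sig P.toPlanarOperad CycPerms)) (f g : s ⟶ t)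
    (h : P.rel f g) : (Fam.paths (P.glueLaws H)).map f = (Fam.paths (P.glueLaws H)).map g := by
  cases h with
  | planar _ _ h => exact Fam.paths_planarRel (P.glueLaws H) (P.glueLaws _) s t f g h
  | act_one a =>
    rw [CategoryTheory.Functor.map_id]
    refine ConcreteCategory.hom_ext _ _ fun φ => ?_
    exact Fam.perm_refl (K := P.kind) (CycPerms.refl a) rfl φ
  | act_act σ τ =>
    rw [Functor.map_comp]
    refine ConcreteCategory.hom_ext _ _ fun φ => ?_
    exact Fam.perm_perm (K := P.kind) σ τ _ rfl φ
  | act_comp_fst l₁ l₂ l₁' l₂' h₁ h₂ h₁' h₂' σ τ ρ h q =>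
    rw [Functor.map_comp, Functor.map_comp, ← P.cact_ext]
    refine ConcreteCategory.hom_ext _ _ fun φ => ?_
    exact P.blockLaws.plug_perm (hH := P.glueLaws H) h₁ h₂ h₁' h₂' σ τ ρ h q φ
  | act_comp_snd l₁ l₂ l₁' l₂' h₁ h₂ h₁' h₂' σ τ ρ h p =>
    rw [Functor.map_comp, Functor.map_comp, ← P.cact_ext]
    refine ConcreteCategory.hom_ext _ _ fun φ => ?_
    exact P.blockLaws.graft_perm (hH := P.glueLaws H) h₁ h₂ h₁' h₂' σ τ ρ h p φ
  | rot_comp_first_fst _ _ h₁ h₂ h₃ h₄ q =>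
    simp only [Functor.map_comp]
    refine ConcreteCategory.hom_ext _ _ fun φ => ?_
    exact perm_plug_first (P.glueLaws H) h₁ h₂ h₃ h₄ q φ
  | rot_comp_first_snd _ _ h₁ h₂ h₃ h₄ p =>
    simp only [Functor.map_comp]
    refine ConcreteCategory.hom_ext _ _ fun φ => ?_
    exact perm_graft_first (P.glueLaws H) h₁ h₂ h₃ h₄ p φ
  | rot_comp_first_nullary_fst _ _ h₁ h₂ h₃ h₄ q =>
    simp only [Functor.map_comp]
    refine ConcreteCategory.hom_ext _ _ fun φ => ?_
    exact perm_plug_nullary (P.glueLaws H) h₁ h₂ h₃ h₄ q φ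
  | rot_comp_first_nullary_snd _ _ h₁ h₂ h₃ h₄ p =>
    simp only [Functor.map_comp]
    refine ConcreteCategory.hom_ext _ _ fun φ => ?_
    exact perm_graft_nullary (P.glueLaws H) h₁ h₂ h₃ h₄ p φ
  | rot_comp_other_fst _ _ h₁ h₂ h₃ h₄ q =>
    simp only [Functor.map_comp]
    refine ConcreteCategory.hom_ext _ _ fun φ => ?_
    exact perm_plug_other (P.glueLaws H) h₁ h₂ h₃ h₄ q φ
  | rot_comp_other_snd _ _ h₁ h₂ h₃ h₄ p =>
    simp only [Functor.map_comp]
    refine ConcreteCategory.hom_ext _ _ fun φ => ?_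
    exact perm_graft_other (P.glueLaws H) h₁ h₂ h₃ h₄ p φ

end CyclicOperad

end EnvReedy

namespace EnvReedy

variable {C : Type u} {K : Kind.{u, v} C}

/-! ### Consequences of gluing -/

/-- Induction on the number of elementary expressions. -/
theorem Kind.hom_induction {X : K.Env} {motive : ∀ {Y : K.Env}, (X ⟶ Y) → Prop}
    (id : motive (𝟙 X))
    (plug : ∀ {a b r : List C} {c d : C} (l₁ l₂ : List C) (ha : a = l₁ ++ c :: l₂)
      (hr : r = l₁ ++ b ++ l₂) (q : K.P.Op b c) (f : X ⟶ K.ob a d), motive f →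
        motive (f ≫ K.mPlug l₁ l₂ ha hr q d))
    (graft : ∀ {a b r : List C} {c d : C} (l₁ l₂ : List C) (ha : a = l₁ ++ c :: l₂)
      (hr : r = l₁ ++ b ++ l₂) (p : K.P.Op a d) (f : X ⟶ K.ob b c), motive f →
        motive (f ≫ K.mGraft l₁ l₂ ha hr p))
    (perm : ∀ {a b : List C} {d : C} (σ : K.G a b) (f : X ⟶ K.ob a d), motive f →
        motive (f ≫ K.mPerm σ d))
    {Y : K.Env} (f : X ⟶ Y) : motive f := by
  obtain ⟨X⟩ := X
  obtain ⟨Y⟩ := Y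
  obtain ⟨f, rfl⟩ := (CategoryTheory.Quotient.functor K.rel).map_surjective f
  suffices h : ∀ (Z : Sig K.P K.G) (f : Quiver.Path (V := Sig K.P K.G) X Z),
      motive ((CategoryTheory.Quotient.functor K.rel).map
        (X := (X : Paths (Sig K.P K.G))) (Y := (Z : Paths (Sig K.P K.G))) f) from h Y f
  intro Z f
  induction f with
  | nil =>
    have h := (CategoryTheory.Quotient.functor K.rel).map_id X
    exact Eq.mpr (congrArg motive h) id
  | cons y e ih =>
    change Move K.P K.G _ _ at e
    cases e with
    | plug l₁ l₂ ha hr q => exact plug l₁ l₂ ha hr q _ ih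
    | graft l₁ l₂ ha hr x => exact graft l₁ l₂ ha hr x _ ih
    | perm σ => exact perm σ _ ih

/-- Families of classes of labelled operations and morphisms are acted on by the enveloping
category. -/
structure Kind.Coherent (K : Kind.{u, v} C) : Prop where
  op : GlueLaws K.opAct
  hom (X : K.Env) : GlueLaws (K.homAct X)
  rel_op (s t : Paths (Sig K.P K.G)) (f g : s ⟶ t) : K.rel f g →
    (Fam.paths op).map f = (Fam.paths op).map g
  rel_hom (X : K.Env) (s t : Paths (Sig K.P K.G)) (f g : s ⟶ t) : K.rel f g →
    (Fam.paths (hom X)).map f = (Fam.paths (hom X)).map g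

theorem PlanarOperad.coherent (P : PlanarOperad.{u, v} C) : P.kind.Coherent :=
  ⟨P.glueLaws _, fun _ => P.glueLaws _, P.paths_rel, fun _ => P.paths_rel⟩

theorem SymmetricOperad.coherent (P : SymmetricOperad.{u, v} C) : P.kind.Coherent :=
  ⟨P.glueLaws _, fun _ => P.glueLaws _, P.paths_rel, fun _ => P.paths_rel⟩

theorem CyclicOperad.coherent (P : CyclicOperad.{v}) : P.kind.Coherent :=
  ⟨P.glueLaws _, fun _ => P.glueLaws _, P.paths_rel, fun _ => P.paths_rel⟩

namespace Lab

variable {H : K.Act.{u, v, w}} {a b r : List C} {c d : C}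

/-- An element with labels. -/
def state (μ : Lab a d) (x : H.obj a d) : LState H :=
  ⟨μ.z, μ.L, a, d, μ.hL.symm, μ.hz.symm, μ.nodup, x⟩

theorem Split.map_eq {l₁ l₂ : List C} {μ : Lab a d} {W₁ W₂ : List (ℕ × C)} {k : ℕ × C}
    (ha : a = l₁ ++ c :: l₂) (h : μ.L = W₁ ++ k :: W₂) (h1 : W₁.map Prod.snd = l₁) :
    W₂.map Prod.snd = l₂ := by
  have := μ.hL
  rw [h, ha, List.map_append, List.map_cons] at this
  exact (List.cons.inj (List.append_inj this (by rw [h1])).2).2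

theorem Split.plug_state {l₁ l₂ : List C} {μ : Lab a d} {ν : Lab b c} {ρ : Lab r d}
    (h : Split l₁ μ ν ρ) (ha : a = l₁ ++ c :: l₂) (hr : r = l₁ ++ b ++ l₂) (x : H.obj a d)
    (q : K.P.Op b c) :
    GlueRel ν.z (μ.state x) (ν.op q) (ρ.state (H.map (K.mPlug l₁ l₂ ha hr q d) x)) := by
  obtain ⟨W₁, W₂, hz, hμ, hρ, h1, hk⟩ := h
  have h2 := Split.map_eq ha hμ h1
  have := GlueRel.plug (μ.state x) (ν.op q) W₁ W₂ ρ.L hμ rfl hρ l₁ l₂ r h1.symm h2.symm ha hr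
    ρ.hL.symm (by simpa [state, hz] using ρ.nodup) _ rfl
  simpa [state, op, hz] using this

theorem Split.graft_state {l₁ l₂ : List C} {μ : Lab a d} {ν : Lab b c} {ρ : Lab r d}
    (h : Split l₁ μ ν ρ) (ha : a = l₁ ++ c :: l₂) (hr : r = l₁ ++ b ++ l₂) (x : H.obj b c)
    (p : K.P.Op a d) :
    GlueRel ν.z (ν.state x) (μ.op p) (ρ.state (H.map (K.mGraft l₁ l₂ ha hr p) x)) := by
  obtain ⟨W₁, W₂, hz, hμ, hρ, h1, hk⟩ := h
  have h2 := Split.map_eq ha hμ h1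
  have := GlueRel.graft (ν.state x) (μ.op p) W₁ W₂ ρ.L hμ rfl hρ l₁ l₂ r h1.symm h2.symm ha hr
    ρ.hL.symm (by simpa [op, hz] using ρ.nodup) _ rfl
  simpa [state, op, hz] using this

end Lab

theorem Cls.adm_cls {H : K.Act.{u, v, w}} {a : List C} {d : C} {μ : Lab a d} {S : LState H}
    (h1 : ∀ l ∈ S.z :: S.L, l ∈ μ.z :: μ.L ∨ l.1 = 0)
    (h2 : K.Rooted → (S.z = μ.z ∨ S.z.1 = 0) ∧ ∀ l ∈ S.L, l ∈ μ.L ∨ l.1 = 0) :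
    S.cls.Adm μ := by
  intro S' h
  rw [LState.cls_eq] at h
  refine ⟨fun l hl => h1 l ((LState.mem_iff_of_equiv h l).2 hl), fun hK => ?_⟩
  obtain ⟨hz, hL⟩ := LState.equiv_rooted hK h
  rw [← hz]
  exact ⟨(h2 hK).1, fun l hl => (h2 hK).2 l ((hL l).2 hl)⟩

namespace Fam

variable {H : K.Act.{u, v, w}} {a b r : List C} {c d : C}

/-- The family of the labellings of an element. -/
def unit (x : H.obj a d) : Fam H a d where
  val μ := (μ.state x).cls
  val_relabel _ _ _ _ := rfl
  adm _ := Cls.adm_cls (fun _ hl => Or.inl hl) fun _ => ⟨Or.inl rfl, fun _ hl => Or.inl hl⟩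

/-- One naming is enough to recover the element, since a class with fixed distinct labels determines
it. -/
theorem unit_injective : Function.Injective (unit (H := H) (a := a) (d := d)) := by
  intro x y h
  obtain ⟨μ⟩ := Lab.exists_lab a d
  exact LState.eq_of_equiv (LState.cls_eq.1 (congrArg (fun φ : Fam H a d => φ.val μ) h))

variable {hH : GlueLaws H}
  {hrel : ∀ (s t : Paths (Sig K.P K.G)) (f g : s ⟶ t), K.rel f g →
    (paths hH).map f = (paths hH).map g}

theorem plug_unit {l₁ l₂ : List C} (ha : a = l₁ ++ c :: l₂) (hr : r = l₁ ++ b ++ l₂)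
    (q : K.P.Op b c) (x : H.obj a d) :
    plug hH ha hr q (unit x) = unit (H.map (K.mPlug l₁ l₂ ha hr q d) x) := by
  ext1
  funext ρ
  obtain ⟨⟨μ, ν⟩, hs⟩ := exists_split' ha hr ρ
  rw [plug_val hH ha hr _ _ hs]
  exact hH.glue_eq (Setoid.refl _) (Setoid.refl _) (hs.plug_state ha hr x q)

theorem graft_unit {l₁ l₂ : List C} (ha : a = l₁ ++ c :: l₂) (hr : r = l₁ ++ b ++ l₂)
    (p : K.P.Op a d) (x : H.obj b c) :
    graft hH ha hr p (unit x) = unit (H.map (K.mGraft l₁ l₂ ha hr p) x) := by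
  ext1
  funext ρ
  obtain ⟨⟨μ, ν⟩, hs⟩ := exists_split' ha hr ρ
  rw [graft_val hH ha hr _ _ hs]
  exact hH.glue_eq (Setoid.refl _) (Setoid.refl _) (hs.graft_state ha hr x p)

theorem perm_unit (σ : K.G a b) (x : H.obj a d) :
    perm σ (unit x) = unit (H.map (K.mPerm σ d) x) := by
  ext1
  funext ρ
  obtain ⟨μ, hμ⟩ := Lab.exists_permute σ ρ
  rw [perm_val σ _ hμ]
  exact LState.cls_eq.2 (LState.Step.mk _ _ _ _ _ _ x σ hμ).equiv

/-- Naturality of the embedding of elements into families. For morphisms with a fixed source, the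
action on the family of the identity thus recovers any morphism. -/
theorem act_unit {X : K.Env} {Y : K.Env} (g : X ⟶ Y) (x : H.obj X.as.1 X.as.2) :
    (act hH hrel).map (a := X.as.1) (d := X.as.2) (b := Y.as.1) (e := Y.as.2) g (unit x) =
      unit (H.map (a := X.as.1) (d := X.as.2) (b := Y.as.1) (e := Y.as.2) g x) := by
  induction g using Kind.hom_induction with
  | id => exact ((act hH hrel).map_id _).trans (congrArg unit (H.map_id x).symm)
  | plug l₁ l₂ ha hr q f ih =>
    refine ((act hH hrel).map_comp _ _ _).trans ?_
    refine Eq.trans ?_ (congrArg unit (H.map_comp _ _ _)).symm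
    refine (congrArg _ ih).trans ?_
    exact (act_plug hH hrel ha hr q _).trans (plug_unit ha hr q _)
  | graft l₁ l₂ ha hr p f ih =>
    refine ((act hH hrel).map_comp _ _ _).trans ?_
    refine Eq.trans ?_ (congrArg unit (H.map_comp _ _ _)).symm
    refine (congrArg _ ih).trans ?_
    exact (act_graft hH hrel ha hr p _).trans (graft_unit ha hr p _)
  | perm σ f ih =>
    refine ((act hH hrel).map_comp _ _ _).trans ?_
    refine Eq.trans ?_ (congrArg unit (H.map_comp _ _ _)).symm
    refine (congrArg _ ih).trans ?_
    exact (act_perm hH hrel σ _).trans (perm_unit σ _)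

/-- The family of labellings of an element, with one input of the profile ignored. -/
def skip {l₁ l₂ : List C} (ha : a = l₁ ++ c :: l₂) (hr : r = l₁ ++ [] ++ l₂) (x : H.obj r d) :
    Fam H a d where
  val μ := LState.cls (⟨μ.z, μ.L.eraseIdx l₁.length, r, d, by
    rw [← List.eraseIdx_map, μ.hL, hr, ha, List.eraseIdx_append_of_length_le (le_refl _)]
    simp, μ.hz.symm, μ.nodup.sublist ((List.eraseIdx_sublist _ _).cons_cons _), x⟩ : LState H)
  val_relabel f hf h0 μ := by
    rw [Cls.relabel_cls]
    congr 1
    simp [LState.relabel, Lab.relabel, List.eraseIdx_map]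
  adm μ := by
    have h : ∀ l ∈ μ.L.eraseIdx l₁.length, l ∈ μ.L := fun l hl => List.mem_of_mem_eraseIdx hl
    refine Cls.adm_cls (fun l hl => Or.inl ?_) fun _ =>
      ⟨Or.inl rfl, fun l hl => Or.inl (h l hl)⟩
    dsimp only at hl
    rw [List.mem_cons] at hl ⊢
    exact hl.imp_right (h l)

/-- The class does not contain the edge at which `u` is to be glued, so `u` leaves it unchanged;
only the indexing by namings changes. -/
theorem plug_skip {l₁ l₂ : List C} (ha : a = l₁ ++ c :: l₂) (hr : r = l₁ ++ [] ++ l₂)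
    (u : K.P.Op [] c) (x : H.obj r d) : plug hH ha hr u (skip ha hr x) = unit x := by
  ext1
  funext ρ
  obtain ⟨⟨μ, ν⟩, hs⟩ := exists_split' ha hr ρ
  rw [plug_val hH ha hr _ _ hs]
  obtain ⟨W₁, W₂, hz, hμ, hρ, h1, hk⟩ := hs
  have hν : ν.L = [] := List.map_eq_nil_iff.1 ν.hL
  dsimp only at *
  have hL : μ.L.eraseIdx l₁.length = ρ.L := by
    have hl : l₁.length = W₁.length := by rw [← h1]; simp
    rw [hμ, hρ, hν, hl, List.eraseIdx_append_of_length_le (le_refl _)]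
    simp
  have : (skip ha hr x).val μ = (unit x).val ρ := by
    simp only [skip, unit, Lab.state]
    simp only [hL, hz]
  rw [this, glue_of_not_has]
  exact fun h => hk (Cls.has_cls.1 h)

end Fam

/-- The family that ignores the plugged input lets the morphism after `u` act as if it acted on its
own source. Hence this morphism is determined by its composite with the plugging. -/
theorem Kind.Coherent.epi_plug (hK : K.Coherent) {a r : List C} {c d : C} {l₁ l₂ : List C}
    (ha : a = l₁ ++ c :: l₂) (hr : r = l₁ ++ [] ++ l₂) (u : K.P.Op [] c) :
    Epi (K.mPlug l₁ l₂ ha hr u d) := by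
  constructor
  intro Z f g h
  -- The composite acts on a fixed family and yields the unit family of `f`, from which `f` is
  -- recovered.
  have key : ∀ f : K.ob r d ⟶ Z,
      (Fam.act (hK.hom _) (hK.rel_hom _)).map (b := Z.as.1) (e := Z.as.2)
        (K.mPlug l₁ l₂ ha hr u d ≫ f) (Fam.skip ha hr (𝟙 (K.ob r d))) =
      Fam.unit (H := K.homAct (K.ob r d)) (a := Z.as.1) (d := Z.as.2) f := by
    intro f
    refine ((Fam.act (hK.hom _) (hK.rel_hom _)).map_comp (c := Z.as.1) (f := Z.as.2) _ _ _).trans ?_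
    rw [Fam.act_plug, Fam.plug_skip]
    refine (Fam.act_unit (H := K.homAct (K.ob r d)) (X := K.ob r d) (Y := Z) f (𝟙 (K.ob r d))).trans ?_
    exact congrArg Fam.unit (Category.id_comp f)
  refine Fam.unit_injective ((key f).symm.trans (Eq.trans ?_ (key g)))
  exact congrArg (fun e => (Fam.act (hK.hom _) (hK.rel_hom _)).map (b := Z.as.1) (e := Z.as.2) e
    (Fam.skip ha hr (𝟙 (K.ob r d)))) h

end EnvReedy

namespace EnvReedy

variable {C : Type u} {K : Kind.{u, v} C}

/-! ### Tracking of edges -/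

theorem ne_dead {l : ℕ × C} (h : l.1 ≠ 0) : l ≠ (0, l.2) := fun h' => h (congrArg Prod.fst h')

open Classical in
/-- The class of the identity operation with one of its edges labelled by `l`, and the other one by
a label with the reserved name. -/
noncomputable def Cls.wire (z l : ℕ × C) : Cls K.opAct :=
  if h : l.1 = 0 then none
  else if l = z then (idState l (0, l.2) (ne_dead h) rfl).cls
  else (idState (0, l.2) l (ne_dead h).symm rfl).cls

namespace Cls

theorem wire_of_ne {z l : ℕ × C} (h : l.1 ≠ 0) (hz : l ≠ z) :
    (wire z l : Cls K.opAct) = (idState (0, l.2) l (ne_dead h).symm rfl).cls := by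
  rw [wire, dif_neg h, if_neg hz]

theorem wire_of_free (hO : GlueLaws K.opAct) (hK : K.Free) {z l : ℕ × C} (h : l.1 ≠ 0) :
    (wire z l : Cls K.opAct) = (idState (0, l.2) l (ne_dead h).symm rfl).cls := by
  rw [wire, dif_neg h]
  split_ifs
  · exact LState.cls_eq.2 (hO.id_equiv hK l (0, l.2) (ne_dead h) rfl)
  · rfl

theorem has_wire {z l t : ℕ × C} (h : (wire z l : Cls K.opAct).Has t) : t = l ∨ t.1 = 0 := by
  unfold wire at h
  split_ifs at h
  · exact absurd h (not_has_none _)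
  · rw [has_cls] at h
    simp only [idState, List.mem_cons, List.not_mem_nil, or_false] at h
    exact h.imp id fun h => by rw [h]
  · rw [has_cls] at h
    simp only [idState, List.mem_cons, List.not_mem_nil, or_false] at h
    exact h.symm.imp id fun h => by rw [h]

theorem idState_relabel (f : ℕ × C ≃ ℕ × C) (hf : ∀ l, (f l).2 = l.2) {k m k' m' : ℕ × C}
    (h : k ≠ m) (hc : k.2 = m.2) (hk : f k = k') (hm : f m = m') (h' : k' ≠ m')
    (hc' : k'.2 = m'.2) :
    (idState k m h hc : LState K.opAct).relabel f hf = idState k' m' h' hc' := by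
  subst hk hm
  have e := hf k
  simp only [idState, LState.relabel, List.map_cons, List.map_nil, LState.mk.injEq, true_and]
  rw [e]
  simp

theorem wire_relabel (f : ℕ × C ≃ ℕ × C) (hf : ∀ l, (f l).2 = l.2) (h0 : ∀ l, l.1 = 0 → f l = l)
    (z l : ℕ × C) : (wire (f z) (f l) : Cls K.opAct) = (wire z l).relabel f hf := by
  have key : (f l).1 = 0 ↔ l.1 = 0 := by
    refine ⟨fun h => ?_, fun h => by rw [h0 l h, h]⟩
    have := f.injective (h0 _ h)
    rwa [this] at h
  unfold wire
  split_ifs with h1 h2 h3 h4 h5 h6 h7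
  all_goals first
    | rfl
    | (exfalso; simp_all; done)
    | (rw [relabel_cls, idState_relabel]
       · rfl
       · simp [h0, hf])
    | (rw [relabel_cls, idState_relabel]
       · simp [h0, hf]
       · rfl)

end Cls

namespace Fam

variable {a b r : List C} {c d : C}

/-- The family of the classes that represent the `i`-th edge. -/
noncomputable def track (i : ℕ) : Fam K.opAct a d where
  val ω := (ω.z :: ω.L)[i]?.bind (Cls.wire ω.z)
  val_relabel f hf h0 ω := by
    have : ((ω.relabel f hf h0).z :: (ω.relabel f hf h0).L)[i]? = (ω.z :: ω.L)[i]?.map f := by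
      rw [← List.getElem?_map]; rfl
    rw [this]
    rcases (ω.z :: ω.L)[i]? with _ | l
    · rfl
    · exact Cls.wire_relabel f hf h0 ω.z l
  adm ω := by
    rcases h : (ω.z :: ω.L)[i]? with _ | l
    · intro S hS
      cases hS
    · have hl : l ∈ ω.z :: ω.L := List.mem_of_getElem? h
      have h0 := ω.pos l hl
      change (Cls.wire ω.z l : Cls K.opAct).Adm ω
      unfold Cls.wire
      rw [dif_neg h0]
      split_ifs with hz
      · refine Cls.adm_cls (fun t ht => ?_) fun _ => ⟨Or.inl hz, fun t ht => ?_⟩ <;>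
          simp only [idState, List.mem_cons, List.not_mem_nil, or_false] at ht
        · rcases ht with rfl | rfl
          exacts [Or.inl hl, Or.inr rfl]
        · rw [ht]
          exact Or.inr rfl
      · refine Cls.adm_cls (fun t ht => ?_) fun _ => ⟨Or.inr rfl, fun t ht => ?_⟩ <;>
          simp only [idState, List.mem_cons, List.not_mem_nil, or_false] at ht
        · rcases ht with rfl | rfl
          exacts [Or.inr rfl, Or.inl hl]
        · rw [ht]
          exact Or.inl ((List.mem_cons.1 hl).resolve_left hz)

/-- The constant family of the class of an operation of arity `0`. -/
def const (x : K.P.Op [] c) : Fam K.opAct a d where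
  val _ := LState.cls ⟨(0, c), [], [], c, rfl, rfl, List.nodup_singleton _, x⟩
  val_relabel f hf h0 μ := by
    rw [Cls.relabel_cls]
    simp only [LState.relabel, h0 (0, c) rfl]
    rfl
  adm μ := Cls.adm_cls (fun t ht => Or.inr (by rw [List.mem_singleton.1 ht])) fun _ =>
    ⟨Or.inr rfl, fun t ht => absurd ht List.not_mem_nil⟩

theorem not_has_const {x : K.P.Op [] c} {μ : Lab a d} {l : ℕ × C} (hl : l.1 ≠ 0) :
    ¬ ((const x : Fam K.opAct a d).val μ).Has l := by
  intro h
  rw [const, Cls.has_cls] at h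
  exact hl (by rw [List.mem_singleton.1 h])

theorem const_injective : Function.Injective (const (K := K) (a := a) (c := c) (d := d)) := by
  intro x y h
  obtain ⟨μ⟩ := Lab.exists_lab a d
  exact LState.eq_of_equiv
    (LState.cls_eq.1 (congrArg (fun φ : Fam K.opAct a d => φ.val μ) h))

/-- The only edge has the reserved name, and inner edges never do. So a constant, once it has
appeared, survives everything that follows. -/
theorem plug_const (hO : GlueLaws K.opAct) {l₁ l₂ : List C} (ha : a = l₁ ++ c :: l₂)
    (hr : r = l₁ ++ b ++ l₂) {e : C} (x : K.P.Op [] e) (q : K.P.Op b c) :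
    plug hO ha hr q (const x : Fam K.opAct a d) = const x := by
  ext1
  funext ρ
  obtain ⟨⟨μ, ν⟩, hs⟩ := exists_split' ha hr ρ
  rw [plug_val hO ha hr _ _ hs]
  exact glue_of_not_has (not_has_const (ν.pos _ List.mem_cons_self))

theorem graft_const (hO : GlueLaws K.opAct) {l₁ l₂ : List C} (ha : a = l₁ ++ c :: l₂)
    (hr : r = l₁ ++ b ++ l₂) {e : C} (x : K.P.Op [] e) (p : K.P.Op a d) :
    graft hO ha hr p (const x : Fam K.opAct b c) = const x := by
  ext1
  funext ρ
  obtain ⟨⟨μ, ν⟩, hs⟩ := exists_split' ha hr ρ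
  rw [graft_val hO ha hr _ _ hs]
  exact glue_of_not_has (not_has_const (ν.pos _ List.mem_cons_self))

/-- The tracked label is the same on both sides. The wire is directed by whether this label is the
output; a rooted permutation preserves this, and in a free kind the direction does not matter. -/
theorem perm_track (hO : GlueLaws K.opAct) (σ : K.G a b) (j : Fin (b.length + 1)) :
    perm σ (track (K.edge σ j) : Fam K.opAct a d) = track j := by
  ext1
  funext ρ
  obtain ⟨μ, hμ⟩ := Lab.exists_permute σ ρ
  rw [perm_val σ _ hμ]
  have hj := hμ j
  simp only [track]
  rw [← hj]
  rcases h : (ρ.z :: ρ.L)[(j : ℕ)]? with _ | l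
  · rfl
  · have h0 := ρ.pos l (List.mem_of_getElem? h)
    change Cls.wire μ.z l = Cls.wire ρ.z l
    rcases hO.kind with hK | hK
    · have hz := hμ 0
      rw [hK] at hz
      have : ρ.z = μ.z := by simpa using hz
      rw [this]
    · rw [Cls.wire_of_free hO hK h0, Cls.wire_of_free hO hK h0]

/-- The edge $0$ and the inputs before the plugged one keep their numbers, and their wires do not
contain the inner edge. -/
theorem plug_track_of_le (hO : GlueLaws K.opAct) {l₁ l₂ : List C} (ha : a = l₁ ++ c :: l₂)
    (hr : r = l₁ ++ b ++ l₂) (q : K.P.Op b c) {i : ℕ} (hi : i ≤ l₁.length) :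
    plug hO ha hr q (track i : Fam K.opAct a d) = track i := by
  ext1
  funext ρ
  obtain ⟨⟨μ, ν⟩, hs⟩ := exists_split' ha hr ρ
  rw [plug_val hO ha hr _ _ hs]
  obtain ⟨W₁, W₂, hz, hμ, hρ, h1, hk⟩ := hs
  dsimp only at *
  have hW : i < (ρ.z :: W₁).length := by
    have : W₁.length = l₁.length := by rw [← h1]; simp
    simp only [List.length_cons]
    omega
  have e1 : (μ.z :: μ.L)[i]? = (ρ.z :: W₁)[i]? := by
    rw [hμ, hz, ← List.cons_append, List.getElem?_append_left hW]
  have e2 : (ρ.z :: ρ.L)[i]? = (ρ.z :: W₁)[i]? := by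
    rw [hρ, List.append_assoc, ← List.cons_append, List.getElem?_append_left hW]
  simp only [track]
  rw [e1, e2, List.getElem?_eq_getElem hW, hz]
  have hm : (ρ.z :: W₁)[i] ∈ ρ.z :: ρ.L := List.mem_of_getElem? (e2.trans
    (List.getElem?_eq_getElem hW))
  refine glue_of_not_has fun h => ?_
  rcases Cls.has_wire h with h | h
  · exact hk (h ▸ hm)
  · exact ν.pos ν.z List.mem_cons_self h

/-- The live end of the wire is closed by `q`, which leaves $id\circ q=q$ with its output under the
reserved name. The index is one more than the number of preceding inputs because $0$ is the output.
-/
theorem plug_track_nullary (hO : GlueLaws K.opAct) {l₁ l₂ : List C} (ha : a = l₁ ++ c :: l₂)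
    (hr : r = l₁ ++ [] ++ l₂) (q : K.P.Op [] c) :
    plug hO ha hr q (track (l₁.length + 1) : Fam K.opAct a d) = const q := by
  ext1
  funext ρ
  obtain ⟨⟨μ, ν⟩, hs⟩ := exists_split' ha hr ρ
  rw [plug_val hO ha hr _ _ hs]
  have hn := μ.nodup
  have h0 := ν.pos ν.z List.mem_cons_self
  obtain ⟨W₁, W₂, hz, hμ, hρ, h1, hk⟩ := hs
  obtain ⟨k, L, rfl, hL, hν, hp⟩ := ν
  obtain rfl := List.map_eq_nil_iff.1 hL
  dsimp only at *
  have e1 : (μ.z :: μ.L)[l₁.length + 1]? = some k := by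
    rw [hμ, ← h1]
    simp
  simp only [track]
  rw [e1]
  have hkz : k ≠ μ.z := by
    rintro rfl
    rw [hμ] at hn
    simp at hn
  change glue k (Cls.wire μ.z k) _ = _
  rw [Cls.wire_of_ne h0 hkz]
  have := GlueRel.plug (H := K.opAct) (k := k) (idState (0, k.2) k (ne_dead h0).symm rfl)
    (Lab.op ⟨k, [], rfl, hL, hν, hp⟩ q) [] [] [] rfl rfl rfl [] [] [] rfl rfl rfl rfl rfl
    (by simp) q ((K.opAct_plug [] [] rfl rfl q _).trans (K.P.id_comp rfl rfl q))
  exact hO.glue_eq (Setoid.refl _) (Setoid.refl _) this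

variable {ψ : NiceGrading K.P}

/-- All classes in the family are represented by operations of grading at least `0`. -/
def Nonneg (ψ : NiceGrading K.P) (φ : Fam K.opAct a d) : Prop :=
  ∀ ρ S, φ.val ρ = LState.cls S → 0 ≤ ψ.deg S.x

theorem nonneg_of_const {q : K.P.Op [] c} (h : (const q : Fam K.opAct a d).Nonneg ψ) :
    0 ≤ ψ.deg q := by
  obtain ⟨μ⟩ := Lab.exists_lab a d
  exact h μ _ rfl

/-- The grading is preserved by the allowed permutations. -/
abbrev _root_.EnvReedy.Kind.Invariant (ψ : NiceGrading K.P) : Prop :=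
  ∀ {a b : List C} {d : C} (σ : K.G a b) (x : K.P.Op a d), ψ.deg (K.act σ x) = ψ.deg x

theorem _root_.EnvReedy.LState.deg_eq (hψ : Kind.Invariant ψ) {S S' : LState K.opAct}
    (h : S ≈ S') : ψ.deg S.x = ψ.deg S'.x := by
  rcases h with rfl | ⟨ha, ha', hd, hd', hn, hn', x, σ, hm⟩
  · rfl
  · exact ((congrArg ψ.deg (K.opAct_perm σ _ x)).trans (hψ σ x)).symm

theorem _root_.EnvReedy.GlueRel.deg_eq {k : ℕ × C} {S Q W : LState K.opAct}
    (h : GlueRel k S Q W) : ψ.deg W.x = ψ.deg S.x + ψ.deg Q.x := by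
  cases h with
  | plug L₁ L₂ N hL hz hN l₁ l₂ r hl₁ hl₂ h₁ h₂ hr hn x hx =>
    subst hx
    exact (congrArg ψ.deg (K.opAct_plug _ _ _ _ _ _)).trans (ψ.deg_comp _ _ _ _ _ _)
  | graft L₁ L₂ N hL hz hN l₁ l₂ r hl₁ hl₂ h₁ h₂ hr hn x hx =>
    subst hx
    exact (congrArg ψ.deg (K.opAct_graft _ _ _ _ _ _)).trans
      ((ψ.deg_comp _ _ _ _ _ _).trans (add_comm _ _))

theorem nonneg_glue (hψ : Kind.Invariant ψ) {k : ℕ × C} {s : Cls K.opAct} {Q W : LState K.opAct}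
    (hs : ∀ S, s = LState.cls S → 0 ≤ ψ.deg S.x) (hQ : 0 ≤ ψ.deg Q.x)
    (h : glue k s Q = W.cls) : 0 ≤ ψ.deg W.x := by
  by_cases hk : s.Has k
  · rcases glue_cases k s Q hk with h' | ⟨W', S, Q', h1, h2, h3, h4⟩
    · rw [h'] at h
      cases h
    · rw [h4, LState.cls_eq] at h
      rw [← LState.deg_eq hψ h, h3.deg_eq, LState.deg_eq hψ h2]
      exact add_nonneg (hs _ h1) hQ
  · rw [glue_of_not_has hk] at h
    exact hs _ h

theorem Nonneg.plug (hψ : Kind.Invariant ψ) (hO : GlueLaws K.opAct) {l₁ l₂ : List C}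
    {φ : Fam K.opAct a d} (h : φ.Nonneg ψ) (ha : a = l₁ ++ c :: l₂) (hr : r = l₁ ++ b ++ l₂)
    {q : K.P.Op b c} (hq : 0 ≤ ψ.deg q) : (Fam.plug hO ha hr q φ).Nonneg ψ := by
  intro ρ S hS
  obtain ⟨⟨μ, ν⟩, hs⟩ := exists_split' ha hr ρ
  rw [plug_val hO ha hr _ _ hs] at hS
  exact nonneg_glue hψ (h μ) hq hS

theorem Nonneg.graft (hψ : Kind.Invariant ψ) (hO : GlueLaws K.opAct) {l₁ l₂ : List C}
    {φ : Fam K.opAct b c} (h : φ.Nonneg ψ) (ha : a = l₁ ++ c :: l₂) (hr : r = l₁ ++ b ++ l₂)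
    {p : K.P.Op a d} (hp : 0 ≤ ψ.deg p) : (Fam.graft hO ha hr p φ).Nonneg ψ := by
  intro ρ S hS
  obtain ⟨⟨μ, ν⟩, hs⟩ := exists_split' ha hr ρ
  rw [graft_val hO ha hr _ _ hs] at hS
  exact nonneg_glue hψ (h ν) hp hS

theorem Nonneg.perm {φ : Fam K.opAct a d} (h : φ.Nonneg ψ) (σ : K.G a b) :
    (Fam.perm σ φ).Nonneg ψ := fun _ S hS => h _ S hS

theorem nonneg_track (hψ : Kind.Invariant ψ) (i : ℕ) :
    (track i : Fam K.opAct a d).Nonneg ψ := by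
  intro ω S hS
  simp only [track] at hS
  rcases h : (ω.z :: ω.L)[i]? with _ | l
  · rw [h] at hS
    cases hS
  · rw [h] at hS
    change Cls.wire ω.z l = S.cls at hS
    unfold Cls.wire at hS
    split_ifs at hS
    · cases hS
    all_goals
      rw [LState.cls_eq] at hS
      rw [← LState.deg_eq hψ hS]
      exact (ψ.deg_id _).ge

end Fam

namespace Kind.Coherent

variable (hK : K.Coherent) {a b r : List C} {c d e f : C}

/-- The action of a morphism on families. -/
noncomputable def push (g : K.ob a d ⟶ K.ob b e) (φ : Fam K.opAct a d) : Fam K.opAct b e :=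
  (Fam.act hK.op hK.rel_op).map g φ

theorem push_id (φ : Fam K.opAct a d) : hK.push (𝟙 _) φ = φ := (Fam.act _ _).map_id φ

theorem push_comp (g : K.ob a d ⟶ K.ob b e) (h : K.ob b e ⟶ K.ob r f) (φ : Fam K.opAct a d) :
    hK.push (g ≫ h) φ = hK.push h (hK.push g φ) := (Fam.act _ _).map_comp g h φ

theorem push_plug {l₁ l₂ : List C} (ha : a = l₁ ++ c :: l₂) (hr : r = l₁ ++ b ++ l₂)
    (q : K.P.Op b c) (φ : Fam K.opAct a d) :
    hK.push (K.mPlug l₁ l₂ ha hr q d) φ = Fam.plug hK.op ha hr q φ := Fam.act_plug _ _ ha hr q φ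

theorem push_graft {l₁ l₂ : List C} (ha : a = l₁ ++ c :: l₂) (hr : r = l₁ ++ b ++ l₂)
    (p : K.P.Op a d) (φ : Fam K.opAct b c) :
    hK.push (K.mGraft l₁ l₂ ha hr p) φ = Fam.graft hK.op ha hr p φ := Fam.act_graft _ _ ha hr p φ

theorem push_perm (σ : K.G a b) (φ : Fam K.opAct a d) :
    hK.push (K.mPerm σ d) φ = Fam.perm σ φ := Fam.act_perm _ _ σ φ

theorem push_const (g : K.ob a d ⟶ K.ob b e) (q : K.P.Op [] c) :
    hK.push g (Fam.const q) = Fam.const q := by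
  suffices h : ∀ {Y : K.Env} (g : K.ob a d ⟶ Y), hK.push (b := Y.as.1) (e := Y.as.2) g
      (Fam.const q) = Fam.const q from h (Y := K.ob b e) g
  intro Y g
  induction g using Kind.hom_induction with
  | id => exact hK.push_id _
  | plug l₁ l₂ ha hr q f ih =>
    refine (hK.push_comp _ _ _).trans ((congrArg _ ih).trans ?_)
    exact (hK.push_plug ha hr q _).trans (Fam.plug_const hK.op ha hr _ q)
  | graft l₁ l₂ ha hr p f ih =>
    refine (hK.push_comp _ _ _).trans ((congrArg _ ih).trans ?_)
    exact (hK.push_graft ha hr p _).trans (Fam.graft_const hK.op ha hr _ p)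
  | perm σ f ih =>
    exact (hK.push_comp _ _ _).trans ((congrArg _ ih).trans (hK.push_perm σ _))

end Kind.Coherent

end EnvReedy

/-! ### Vertices of grading $-1$ read off by tracking, and recovery of inverse operations. -/

namespace EnvReedy

variable {C : Type u} {K : Kind.{u, v} C}

theorem plug_id' {a : List C} {c d : C} (l₁ l₂ : List C) (h₁ : a = l₁ ++ c :: l₂)
    (h₂ : a = l₁ ++ [c] ++ l₂) : plug K.P K.G K.rel l₁ l₂ h₁ h₂ (K.P.id c) d = 𝟙 (K.ob a d) :=
  K.mPlug_id l₁ l₂ h₁ h₂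

namespace Kind.Coherent

variable (hK : K.Coherent) {a b r t : List C} {c d e f : C} {ψ : NiceGrading K.P}

/-- All vertices of such a tree are attached after the inputs in `pre`, so the output and these
inputs are tracked without change. -/
theorem push_upper {Φ : ∀ (b : List C) (c : C), K.P.Op b c → Prop} {pre todo : List C}
    {g : K.ob a d ⟶ K.ob t d} (hg : Upper K.P K.G K.rel Φ d pre todo g) {i : ℕ}
    (hi : i ≤ pre.length) : hK.push g (Fam.track i) = Fam.track i := by
  induction hg with
  | nil pre => exact hK.push_id _
  | cons pre todo q hq ha ha' g hg ih =>
    rw [push_comp, push_plug, Fam.plug_track_of_le hK.op ha ha' q hi]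
    refine ih ?_
    rw [List.length_append]
    omega

/-- The operation at the first unprocessed input is visible in any composite that begins with the
tree, because constants are preserved by all that follows. -/
theorem push_upper_cons {pre todo : List C}
    (ha : a = pre ++ c :: todo) (ha' : b = pre ++ [] ++ todo) (u : K.P.Op [] c)
    (g : K.ob b d ⟶ K.ob t d) (s : K.ob t d ⟶ K.ob r e) :
    hK.push ((plug K.P K.G K.rel pre todo ha ha' u d ≫ g) ≫ s) (Fam.track (pre.length + 1)) =
      Fam.const u := by
  rw [push_comp, push_comp, push_plug, Fam.plug_track_nullary, push_const, push_const]

/-- A vertex of grading $-1$ would appear as a constant family of negative grading in the composite.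
Only inputs need tracking, since these trees have no vertex at the output. -/
theorem upper_eqToHom {pre todo : List C} {l : K.ob a d ⟶ K.ob t d}
    (hl : Upper K.P K.G K.rel ψ.NegOneOrId d pre todo l) (s : K.ob t d ⟶ K.ob r e)
    (hs : ∀ i, 1 ≤ i → (hK.push (l ≫ s) (Fam.track i)).Nonneg ψ) :
    ∃ h : K.ob a d = K.ob t d, l = eqToHom h := by
  induction hl with
  | nil pre => exact ⟨rfl, rfl⟩
  | cons pre todo q hq ha ha' g hg ih =>
    rcases hq with ⟨⟨c⟩⟩ | hq
    · obtain rfl := ha.trans (ha'.trans (by simp)).symm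
      obtain ⟨h, rfl⟩ := ih s (fun i hi => by
        have := hs i hi
        rwa [plug_id', Category.id_comp] at this)
      exact ⟨h, by rw [plug_id', Category.id_comp]⟩
    · obtain rfl := List.length_eq_zero_iff.1 (ψ.arity_eq_zero q hq)
      have := hs (pre.length + 1) (by omega)
      rw [hK.push_upper_cons ha ha' q g s] at this
      have := Fam.nonneg_of_const this
      omega

/-- The two trees are compared input by input. The composite shows whether an input carries an
operation of grading $-1$, and which one; equal vertices are then cancelled as epimorphisms. -/
theorem upper_unique {pre todo t' : List C} {l : K.ob a d ⟶ K.ob t d}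
    {l' : K.ob a d ⟶ K.ob t' d} (hl : Upper K.P K.G K.rel ψ.NegOneOrId d pre todo l)
    (hl' : Upper K.P K.G K.rel ψ.NegOneOrId d pre todo l')
    (s : K.ob t d ⟶ K.ob r e) (s' : K.ob t' d ⟶ K.ob r e)
    (hs : ∀ i, 1 ≤ i → (hK.push s (Fam.track i)).Nonneg ψ)
    (hs' : ∀ i, 1 ≤ i → (hK.push s' (Fam.track i)).Nonneg ψ) (h : l ≫ s = l' ≫ s') :
    ∃ h : K.ob t d = K.ob t' d, l ≫ eqToHom h = l' := by
  induction hl generalizing t' with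
  | nil pre =>
    cases hl'
    exact ⟨rfl, by simp⟩
  | @cons a a' b t c pre todo q hq ha ha' g hg ih =>
    cases hl' with
    | @cons _ a₂ b₂ _ _ _ _ q₂ hq₂ ha₂ ha₂' g₂ hg₂ =>
    rcases hq with hq | hq <;> rcases hq₂ with hq₂ | hq₂
    · cases hq
      cases hq₂
      obtain rfl := ha.trans (ha'.trans (by simp)).symm
      obtain rfl := ha.trans (ha₂'.trans (by simp)).symm
      rw [plug_id', Category.id_comp, Category.id_comp] at h
      rw [plug_id', Category.id_comp, Category.id_comp]
      exact ih hg₂ s s' hs hs' h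
    · cases hq
      obtain rfl := List.length_eq_zero_iff.1 (ψ.arity_eq_zero q₂ hq₂)
      obtain rfl := ha.trans (ha'.trans (by simp)).symm
      rw [plug_id', Category.id_comp] at h
      -- Only the second tree has a vertex here. The first passes this edge on unchanged, so its
      -- right factor alone would produce the negative constant.
      have h1 := hK.push_upper_cons ha ha₂' q₂ g₂ s'
      rw [← h, push_comp, hK.push_upper hg (by simp)] at h1
      have h2 := hs (pre.length + 1) (by omega)
      rw [h1] at h2
      have := Fam.nonneg_of_const h2
      omega
    · cases hq₂
      obtain rfl := List.length_eq_zero_iff.1 (ψ.arity_eq_zero q hq)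
      obtain rfl := ha.trans (ha₂'.trans (by simp)).symm
      rw [plug_id', Category.id_comp] at h
      have h1 := hK.push_upper_cons ha ha' q g s
      rw [h, push_comp, hK.push_upper hg₂ (by simp)] at h1
      have h2 := hs' (pre.length + 1) (by omega)
      rw [h1] at h2
      have := Fam.nonneg_of_const h2
      omega
    · obtain rfl := List.length_eq_zero_iff.1 (ψ.arity_eq_zero q hq)
      obtain rfl := List.length_eq_zero_iff.1 (ψ.arity_eq_zero q₂ hq₂)
      have h1 := hK.push_upper_cons ha ha' q g s
      rw [h, hK.push_upper_cons ha ha₂' q₂ g₂ s'] at h1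
      obtain rfl := Fam.const_injective h1
      obtain rfl := ha'.trans ha₂'.symm
      have := hK.epi_plug (d := d) ha ha' q₂
      rw [Category.assoc, Category.assoc, cancel_epi] at h
      obtain ⟨h3, h4⟩ := ih hg₂ s s' hs hs' h
      exact ⟨h3, by rw [Category.assoc, h4]⟩

include hK in
-- The inverse morphism turns the wire tracking the first input into a class which `p` turns back
-- into this wire. The class must be a unary operation with one dead end, and it is a one-sided
-- inverse of `p`.
theorem exists_comp_eq_id {p : K.P.Op a d} {h₁ : [d] = [] ++ d :: []} {h₂ : a = [] ++ a ++ []}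
    [IsIso (K.mPlug [] [] h₁ h₂ p d)] :
    ∃ (c : C) (x : K.P.Op [d] c) (hr : [c] = [] ++ a ++ []),
      K.P.comp [] [] h₁ hr x p = K.P.id c := by
  set s : K.ob a d ⟶ K.ob [d] d := CategoryTheory.inv (K.mPlug [] [] h₁ h₂ p d) with hs
  rcases a with _ | ⟨c, a'⟩
  · exfalso
    -- If `p` had arity $0$, the tracked input would be closed and become a constant, which no
    -- morphism can turn back into a live wire.
    have h1 : hK.push (K.mPlug [] [] h₁ h₂ p d ≫ s) (Fam.track 1) =
        (Fam.track 1 : Fam K.opAct [d] d) := by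
      rw [IsIso.hom_inv_id, push_id]
    rw [push_comp, push_plug, show (1 : ℕ) = ([] : List C).length + 1 from rfl,
      Fam.plug_track_nullary, push_const] at h1
    obtain ⟨⟨z, L, hz, hL, hn, hp⟩⟩ := Lab.exists_lab [d] d
    obtain ⟨l, rfl, hl⟩ := List.map_eq_singleton_iff.1 hL
    have h2 := congrArg (fun φ : Fam K.opAct [d] d => φ.val ⟨z, [l], hz, hL, hn, hp⟩) h1
    have h0 : l.1 ≠ 0 := hp l (by simp)
    refine Fam.not_has_const (x := p) (μ := ⟨z, [l], hz, hL, hn, hp⟩) h0 ?_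
    rw [h2]
    change Cls.Has (Cls.wire z l) l
    rw [Cls.wire_of_ne h0 (by rintro rfl; simp at hn), Cls.has_cls]
    simp [idState]
  · have h1 : Fam.plug hK.op h₁ h₂ p (hK.push s (Fam.track 1)) =
        (Fam.track 1 : Fam K.opAct (c :: a') d) := by
      rw [← hK.push_plug, ← hK.push_comp, IsIso.inv_hom_id, hK.push_id]
    generalize hK.push s (Fam.track 1) = A at h1
    obtain ⟨ρ⟩ := Lab.exists_lab (c :: a') d
    obtain ⟨⟨μ, ν⟩, hsp⟩ := Fam.exists_split' h₁ h₂ ρ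
    have h2 := (Fam.plug_val hK.op h₁ h₂ p A hsp).symm.trans
      (congrArg (fun φ : Fam K.opAct (c :: a') d => φ.val ρ) h1)
    have hA := A.adm μ
    have hμn := μ.nodup
    have hμp := μ.pos
    have hρn := ρ.nodup
    have hρp := ρ.pos
    obtain ⟨z, L, hz, hL, hn, hp⟩ := ρ
    obtain ⟨l, L', rfl, rfl, hL'⟩ := List.map_eq_cons_iff.1 hL
    obtain ⟨W₁, W₂, hμz, hμ, hρ, hW₁, hk⟩ := hsp
    obtain rfl := List.map_eq_nil_iff.1 hW₁
    obtain ⟨k, M, rfl, hM, hνn, hνp⟩ := ν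
    dsimp only at *
    have hW₂ : W₂ = [] := by
      have := congrArg List.length μ.hL
      rw [hμ] at this
      simpa using this
    subst hW₂
    simp only [List.nil_append, List.append_nil] at hμ hρ
    subst hρ
    have h0 : l.1 ≠ 0 := hp l (by simp)
    have hlz : l ≠ z := by rintro rfl; simp at hn
    change _ = Cls.wire z l at h2
    rw [Cls.wire_of_ne h0 hlz] at h2
    have hlμ : ¬ l ∈ μ.z :: μ.L := by
      rw [hμz, hμ]
      simp only [List.mem_cons, List.not_mem_nil, or_false] at hk ⊢
      grind
    have hAk : (A.val μ).Has k := by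
      by_contra hAk
      rw [glue_of_not_has hAk] at h2
      have : (A.val μ).Has l := by
        rw [h2, Cls.has_cls]
        simp [idState]
      rcases Cls.Adm.has hA this with h | h
      · exact hlμ h
      · exact h0 h
    rcases glue_cases k (A.val μ) _ hAk with h | ⟨W, S, Q, hS, hQ, hW, hg⟩
    · exact absurd (h.symm.trans h2) (by rintro ⟨⟩)
    have hWe := LState.cls_eq.1 (hg.symm.trans h2)
    have hmem := fun t => (hW.mem_iff hW.disjoint t).symm.trans (LState.mem_iff_of_equiv hWe t)
    simp only [LState.mem_iff_of_equiv hQ, idState, Lab.op] at hmem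
    -- A further input of `p` would survive the gluing, but the wire has only one end with a live
    -- name.
    have hL'n : L' = [] := by
      rw [List.eq_nil_iff_forall_not_mem]
      intro m hm
      have h3 := (hmem m).1 ⟨Or.inr (by simp [hm]), fun h => hk (by simp [← h, hm])⟩
      have h4 : m.1 ≠ 0 := hp m (by simp [hm])
      simp only [List.mem_cons, List.not_mem_nil, or_false] at h3
      rcases h3 with rfl | rfl
      · exact h4 rfl
      · simp [hm] at hn
    subst hL'n
    obtain rfl : a' = [] := hL'.symm
    have hkl : k ≠ l := by rintro rfl; simp at hk
    have hk0 : k.1 ≠ 0 := hνp k (by simp)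
    have hkS : k ∈ S.z :: S.L := hS ▸ hAk |> Cls.has_cls.1
    -- The edges of the class are those of the wire without the input of `p`, together with the
    -- inner edge.
    have hmS : ∀ t, t ∈ S.z :: S.L ↔ t ∈ [(0, l.2), k] := by
      intro t
      have h3 := hmem t
      simp only [List.mem_cons, List.not_mem_nil, or_false] at h3 ⊢
      constructor
      · intro ht
        by_cases htk : t = k
        · exact Or.inr htk
        · rcases h3.1 ⟨Or.inl ht, htk⟩ with h | h
          · exact Or.inl h
          · subst h
            rcases Cls.Adm.has hA ⟨S, hS, List.mem_cons.2 ht⟩ with h | h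
            · exact absurd h hlμ
            · exact absurd h h0
      · rintro (rfl | rfl)
        · rcases (h3.2 (Or.inl rfl)).1 with h | h | h
          · exact h
          · exact absurd (congrArg Prod.fst h).symm hk0
          · exact absurd (congrArg Prod.fst h).symm h0
        · exact List.mem_cons.1 hkS
    have hdk : ((0, l.2) : ℕ × C) ≠ k := fun h => hk0 (congrArg Prod.fst h).symm
    -- The dead end must be the output for the class to be composed with `p` at its input.
    -- Admissibility forces this in a rooted kind, and in a free kind it is a choice.
    obtain ⟨S', hS', hz', hL'⟩ : ∃ S' : LState K.opAct, S' ≈ S ∧ S'.z = (0, l.2) ∧ S'.L = [k] := by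
      rcases hK.op.kind with hR | hF
      · have hSn := S.nodup
        have hSz : S.z = (0, l.2) := by
          have h3 := (hmS S.z).1 List.mem_cons_self
          simp only [List.mem_cons, List.not_mem_nil, or_false] at h3
          rcases h3 with h | h
          · exact h
          · rcases (hA S hS).2 hR |>.1 with h4 | h4
            · rw [h, hμz] at h4
              simp [h4] at hk
            · exact absurd (h ▸ h4) hk0
        refine ⟨S, Setoid.refl _, hSz, ?_⟩
        rw [hSz] at hSn hmS
        rw [List.nodup_cons] at hSn
        have h5 : ∀ t ∈ S.L, t = k := fun t ht => by
          have := (hmS t).1 (List.mem_cons_of_mem _ ht)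
          simp only [List.mem_cons, List.not_mem_nil, or_false] at this
          rcases this with rfl | rfl
          · exact absurd ht hSn.1
          · rfl
        have h6 : k ∈ S.L := by
          have := (hmS k).2 (by simp)
          exact (List.mem_cons.1 this).resolve_left hdk.symm
        rw [List.eq_replicate_of_mem h5] at hSn h6 ⊢
        rcases h7 : S.L.length with _ | _ | n
        · simp [h7] at h6
        · rfl
        · simp [h7, List.replicate_succ] at hSn
      · exact LState.exists_rep hF S (by simpa using hdk) fun t => (hmS t).symm
    obtain ⟨z', L'', a'', d'', ha'', hd'', hn'', x⟩ := S'
    dsimp only at hz' hL'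
    subst hz' hL' hd''
    have hrel := GlueRel.plug (H := K.opAct) (k := k) ⟨(0, l.2), [k], a'', l.2, ha'', rfl, hn'', x⟩
      (Lab.op ⟨k, [l], rfl, rfl, hνn, hνp⟩ p) [] [] [l] rfl rfl rfl [] [] _ rfl rfl ha'' rfl rfl
      (idState (0, l.2) l (ne_dead h0).symm rfl : LState K.opAct).nodup _ rfl
    obtain rfl : a'' = [k.2] := ha''
    have h8 := hK.op.glue_eq hS' (Setoid.refl _) hrel
    rw [← hS, h2] at h8
    have h9 := LState.eq_of_equiv (LState.cls_eq.1 h8)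
    exact ⟨l.2, x, rfl, (K.opAct_plug _ _ _ _ _ _).symm.trans h9.symm⟩

include hK in
theorem exists_comp_id_of_isIso {ψ : NiceGrading K.P}
    (h : ∀ {a : List C} {d : C} (p : K.P.Op a d) (h₁ : [d] = [] ++ d :: [])
      (h₂ : a = [] ++ a ++ []), ψ.deg p = 0 → IsIso (K.mPlug [] [] h₁ h₂ p d))
    {c d : GrZero ψ} (f : c ⟶ d) : ∃ g : d ⟶ c, f ≫ g = 𝟙 c := by
  obtain ⟨c⟩ := c
  obtain ⟨d⟩ := d
  obtain ⟨p, hp⟩ := f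
  have := h p rfl (by simp) hp
  obtain ⟨c', x, hr, e⟩ := hK.exists_comp_eq_id (p := p) (h₁ := rfl) (h₂ := rfl)
  obtain rfl : c' = c := by simpa using hr
  have hx : ψ.deg x = 0 := by
    have := congrArg ψ.deg e
    rw [ψ.deg_comp, ψ.deg_id, hp] at this
    simpa using this
  exact ⟨⟨x, hx⟩, Subtype.ext e⟩

include hK in
-- A one-sided inverse for every operation of grading $0$ suffices: the inverse has grading $0$ as
-- well and has its own one-sided inverse, so both are invertible.
theorem isGroupoidal_of_isIso {ψ : NiceGrading K.P}
    (h : ∀ {a : List C} {d : C} (p : K.P.Op a d) (h₁ : [d] = [] ++ d :: [])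
      (h₂ : a = [] ++ a ++ []), ψ.deg p = 0 → IsIso (K.mPlug [] [] h₁ h₂ p d)) :
    ψ.IsGroupoidal := by
  refine ⟨fun {a d} p hp => ?_, ⟨fun {c d} f => ?_⟩⟩
  · have := h p rfl (by simp) hp
    obtain ⟨c', x, hr, e⟩ := hK.exists_comp_eq_id (p := p)
    have := congrArg List.length hr
    simpa using this.symm
  · obtain ⟨g, hg⟩ := hK.exists_comp_id_of_isIso h f
    obtain ⟨f', hf'⟩ := hK.exists_comp_id_of_isIso h g
    have : f = f' := by
      rw [← Category.comp_id f, ← hf', ← Category.assoc, hg, Category.id_comp]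
    exact ⟨g, hg, this ▸ hf'⟩

/-- The morphism sends families of classes of operations of grading at least `0` to such
families. -/
def KeepsNonneg (ψ : NiceGrading K.P) (g : K.ob a d ⟶ K.ob b e) : Prop :=
  ∀ φ : Fam K.opAct a d, φ.Nonneg ψ → (hK.push g φ).Nonneg ψ

variable {hK}

theorem KeepsNonneg.comp {g : K.ob a d ⟶ K.ob b e} {h : K.ob b e ⟶ K.ob r f}
    (hg : hK.KeepsNonneg ψ g) (hh : hK.KeepsNonneg ψ h) : hK.KeepsNonneg ψ (g ≫ h) := by
  intro φ hφ
  rw [push_comp]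
  exact hh _ (hg _ hφ)

theorem KeepsNonneg.track (hψ : Kind.Invariant ψ) {g : K.ob a d ⟶ K.ob b e}
    (hg : hK.KeepsNonneg ψ g) (i : ℕ) : (hK.push g (Fam.track i)).Nonneg ψ :=
  hg _ (Fam.nonneg_track hψ i)

theorem keepsNonneg_id : hK.KeepsNonneg ψ (𝟙 (K.ob a d)) := by
  intro φ hφ
  rwa [push_id]

theorem keepsNonneg_plug (hψ : Kind.Invariant ψ) {l₁ l₂ : List C} (ha : a = l₁ ++ c :: l₂)
    (hr : r = l₁ ++ b ++ l₂) {q : K.P.Op b c} (hq : 0 ≤ ψ.deg q) :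
    hK.KeepsNonneg ψ (K.mPlug l₁ l₂ ha hr q d) := by
  intro φ hφ
  rw [push_plug]
  exact hφ.plug hψ hK.op ha hr hq

theorem keepsNonneg_graft (hψ : Kind.Invariant ψ) {l₁ l₂ : List C} (ha : a = l₁ ++ c :: l₂)
    (hr : r = l₁ ++ b ++ l₂) {p : K.P.Op a d} (hp : 0 ≤ ψ.deg p) :
    hK.KeepsNonneg ψ (K.mGraft l₁ l₂ ha hr p) := by
  intro φ hφ
  rw [push_graft]
  exact hφ.graft hψ hK.op ha hr hp

theorem keepsNonneg_perm (σ : K.G a b) : hK.KeepsNonneg ψ (K.mPerm σ d) := by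
  intro φ hφ
  rw [push_perm]
  exact hφ.perm σ

theorem keepsNonneg_upper (hψ : Kind.Invariant ψ) {pre todo : List C} {g : K.ob a d ⟶ K.ob t d}
    (hg : Upper K.P K.G K.rel ψ.Nonneg d pre todo g) : hK.KeepsNonneg ψ g := by
  induction hg with
  | nil pre => exact keepsNonneg_id
  | cons pre todo q hq ha ha' g hg ih => exact (keepsNonneg_plug hψ ha ha' hq).comp ih

theorem keepsNonneg_rooted (hψ : Kind.Invariant ψ) {X Y : K.Env} {g : X ⟶ Y}
    (hg : RootedTree K.P K.G K.rel ψ.Nonneg g) :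
    hK.KeepsNonneg ψ (a := X.as.1) (d := X.as.2) (b := Y.as.1) (e := Y.as.2) g := by
  cases hg with
  | mk f hf l₁ l₂ h₁ h₂ p hp => exact (keepsNonneg_upper hψ hf).comp (keepsNonneg_graft hψ h₁ h₂ hp)

theorem keepsNonneg_permuted (hψ : Kind.Invariant ψ) {X Y : K.Env} {g : X ⟶ Y}
    (hg : PermutedRootedTree K.P K.G K.rel ψ.Nonneg g) :
    hK.KeepsNonneg ψ (a := X.as.1) (d := X.as.2) (b := Y.as.1) (e := Y.as.2) g := by
  cases hg with
  | mk f hf σ => exact (keepsNonneg_rooted hψ hf).comp (keepsNonneg_perm σ)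

end Kind.Coherent

end EnvReedy

namespace EnvReedy

variable {C : Type u} {K : Kind.{u, v} C}

/-! ### Trees -/

/-- A class of operations that contains identities and is closed under compositions. -/
structure Kind.Closed (K : Kind.{u, v} C) (Φ : ∀ (b : List C) (c : C), K.P.Op b c → Prop) :
    Prop where
  id (c : C) : Φ [c] c (K.P.id c)
  comp {a b r : List C} {c d : C} (l₁ l₂ : List C) (ha : a = l₁ ++ c :: l₂)
    (hr : r = l₁ ++ b ++ l₂) (p : K.P.Op a d) (q : K.P.Op b c) :
    Φ a d p → Φ b c q → Φ r d (K.P.comp l₁ l₂ ha hr p q)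

theorem Kind.closed_true : K.Closed fun _ _ _ => True := ⟨fun _ => trivial, fun _ _ _ _ _ _ _ _ =>
  trivial⟩

theorem Kind.closed_nonneg (ψ : NiceGrading K.P) : K.Closed ψ.Nonneg where
  id c := (ψ.deg_id c).ge
  comp _ _ _ _ p q hp hq := by
    simp only [NiceGrading.Nonneg, ψ.deg_comp] at *
    omega

/-- An operation of grading $-1$ has no inputs, so only an identity can be the lower operation of a
composition. -/
theorem Kind.closed_negOneOrId (ψ : NiceGrading K.P) : K.Closed ψ.NegOneOrId where
  id c := Or.inl ⟨c⟩
  comp l₁ l₂ ha hr p q hp hq := by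
    rcases hp with ⟨⟨c⟩⟩ | hp
    · obtain ⟨rfl, rfl⟩ : l₁ = [] ∧ l₂ = [] := by
        have := congrArg List.length ha
        simp only [List.length_append, List.length_cons, List.length_nil] at this
        exact ⟨List.length_eq_zero_iff.1 (by omega), List.length_eq_zero_iff.1 (by omega)⟩
      obtain rfl := (List.cons.inj ha).1
      obtain rfl := hr.trans (List.append_nil _)
      rwa [K.P.id_comp]
    · have := ψ.arity_eq_zero p hp
      simp [ha] at this

namespace Upper

variable {Φ Ψ : ∀ (b : List C) (c : C), K.P.Op b c → Prop} {a b t r s pre todo : List C} {c d e : C}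

theorem source {g : K.ob a d ⟶ K.ob t d} (hg : Upper K.P K.G K.rel Φ d pre todo g) :
    a = pre ++ todo := by
  cases hg with
  | nil pre => simp
  | cons pre todo q hq ha ha' g hg => exact ha

theorem target {g : K.ob a d ⟶ K.ob t d} (hg : Upper K.P K.G K.rel Φ d pre todo g) :
    ∃ t', t = pre ++ t' := by
  induction hg with
  | nil pre => exact ⟨[], by simp⟩
  | @cons _ _ b _ _ pre todo q hq ha ha' g hg ih =>
    obtain ⟨t', rfl⟩ := ih
    exact ⟨b ++ t', by simp⟩

theorem refl (hΦ : K.Closed Φ) (ha : a = pre ++ todo) :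
    Upper K.P K.G K.rel Φ d pre todo (𝟙 (K.ob a d)) := by
  induction todo generalizing pre with
  | nil =>
    obtain rfl := ha.trans (List.append_nil _)
    exact .nil a
  | cons c todo ih =>
    have h1 : a = pre ++ [c] ++ todo := by simp [ha]
    have := Upper.cons (G := K.G) (rel := K.rel) pre todo _ (hΦ.id c) ha h1 _ (ih h1)
    rwa [plug_id', Category.comp_id] at this

/-- Vertices that are grafted to different inputs can be added in any order. -/
theorem slide {g : K.ob a d ⟶ K.ob t d} (hg : Upper K.P K.G K.rel Φ d pre todo g)
    {l₁ m l₂ : List C} (hpre : pre = l₁ ++ c :: m) (q : K.P.Op b c) (ht : t = l₁ ++ c :: l₂)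
    (hr : r = l₁ ++ b ++ l₂) :
    ∃ (a' : List C) (ha : a = l₁ ++ c :: (m ++ todo)) (ha' : a' = l₁ ++ b ++ (m ++ todo))
      (g' : K.ob a' d ⟶ K.ob r d), Upper K.P K.G K.rel Φ d (l₁ ++ b ++ m) todo g' ∧
        g ≫ K.mPlug l₁ l₂ ht hr q d = K.mPlug l₁ (m ++ todo) ha ha' q d ≫ g' := by
  induction hg generalizing m with
  | nil pre =>
    obtain rfl : m = l₂ := by
      have := hpre.symm.trans ht
      simpa using this
    obtain rfl := hr
    exact ⟨_, by simpa using ht, by simp, 𝟙 _, .nil _, by simp⟩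
  | @cons a a' b' t c' pre todo q' hq' ha ha' g hg ih =>
    obtain ⟨a₂, h1, h2, g', hg', e⟩ := ih (m := m ++ b') (by simp [hpre]) ht
    rw [← List.append_assoc] at hg'
    have h3 : a = l₁ ++ c :: (m ++ c' :: todo) := by simp [ha, hpre]
    refine ⟨_, h3, rfl, _, .cons _ todo q' hq' (by simp) (by simp [h2]) g' hg', ?_⟩
    have h := K.plug_plug_par (d := d) l₁ m todo h3 rfl (by simp) (z := a₂) (by simp [h2])
      (by simpa using h3) (y := a') (by simp [ha', hpre]) (by simp [ha', hpre]) (by simp [h2]) q q'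
    refine (Category.assoc _ _ _).trans ((congrArg _ e).trans ?_)
    refine (Category.assoc _ _ _).symm.trans (Eq.trans ?_ (Category.assoc _ _ _))
    refine congrArg (· ≫ g') ?_
    subst hpre
    exact h.symm

theorem slide_symm {a' : List C} {g' : K.ob a' d ⟶ K.ob r d}
    (hg : Upper K.P K.G K.rel Φ d pre todo g') {l₁ m : List C} (hpre : pre = l₁ ++ b ++ m)
    (q : K.P.Op b c) :
    ∃ (a t l₂ : List C) (ht : t = l₁ ++ c :: l₂) (hr : r = l₁ ++ b ++ l₂)
      (ha : a = l₁ ++ c :: (m ++ todo)) (ha' : a' = l₁ ++ b ++ (m ++ todo))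
      (g : K.ob a d ⟶ K.ob t d), Upper K.P K.G K.rel Φ d (l₁ ++ c :: m) todo g ∧
        g ≫ K.mPlug l₁ l₂ ht hr q d = K.mPlug l₁ (m ++ todo) ha ha' q d ≫ g' := by
  induction hg generalizing m with
  | nil pre =>
    refine ⟨_, _, m, rfl, hpre, by simp, by simp [hpre], 𝟙 _, .nil _, ?_⟩
    simp
  | @cons a a' b' t c' pre todo q' hq' ha ha' g hg ih =>
    obtain ⟨a₂, t, l₂, h1, h2, h3, h4, g', hg', e⟩ := ih (m := m ++ b') (by simp [hpre])
    rw [show l₁ ++ c :: (m ++ b') = (l₁ ++ c :: m) ++ b' by simp] at hg'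
    subst hpre
    refine ⟨_, t, l₂, h1, h2, rfl, by simp [ha], _,
      .cons _ todo q' hq' (by simp) (by simp [h3]) g' hg', ?_⟩
    have h := K.plug_plug_par (d := d) l₁ m todo rfl (by simp [ha]) ha (z := a') (by simp [ha'])
      (by simp) (y := a₂) (by simp [h3]) (by simp [h3]) (by simp [h4]) q q'
    refine (Category.assoc _ _ _).trans ((congrArg _ e).trans ?_)
    refine (Category.assoc _ _ _).symm.trans (Eq.trans ?_ (Category.assoc _ _ _))
    exact congrArg (· ≫ g) h.symm

/-- The new operation sits on a leaf of some vertex. It is slid back past the vertices attached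
after that one and composed with it, so each input keeps exactly one vertex. -/
theorem plug (hΦ : K.Closed Φ) {g : K.ob a d ⟶ K.ob t d}
    (hg : Upper K.P K.G K.rel Φ d pre todo g) {l₁ l₂ : List C} (hl : pre.length ≤ l₁.length)
    (q : K.P.Op b c) (hq : Φ b c q) (ht : t = l₁ ++ c :: l₂) (hr : r = l₁ ++ b ++ l₂) :
    Upper K.P K.G K.rel Φ d pre todo (g ≫ K.mPlug l₁ l₂ ht hr q d) := by
  induction hg with
  | nil pre =>
    rw [ht] at hl
    simp at hl
  | @cons a a' b' t c' pre todo q' hq' ha ha' g hg ih =>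
    rw [Category.assoc]
    -- The leaf lies either beyond those of the first vertex, which is the inductive case, or on the
    -- first vertex itself.
    by_cases hl' : (pre ++ b').length ≤ l₁.length
    · exact .cons pre todo q' hq' ha ha' _ (ih hl' ht)
    · obtain ⟨t', rfl⟩ := hg.target
      clear ih
      obtain ⟨m₁, rfl⟩ : ∃ m₁, l₁ = pre ++ m₁ := by
        rw [List.append_assoc] at ht
        exact (List.append_eq_append_iff.1 ht).elim (fun ⟨m, h, _⟩ => ⟨m, h⟩) fun ⟨m, h, _⟩ => by
          have := congrArg List.length h
          simp only [List.length_append] at this hl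
          obtain rfl : m = [] := List.length_eq_zero_iff.1 (by omega)
          exact ⟨[], by simp [h]⟩
      rw [List.append_assoc, List.append_assoc, List.append_right_inj] at ht
      obtain ⟨m₂, hm₂, rfl⟩ : ∃ m₂, b' = m₁ ++ c :: m₂ ∧ l₂ = m₂ ++ t' := by
        rcases List.append_eq_append_iff.1 ht with ⟨m, h, -⟩ | ⟨m, h1, h2⟩
        · exfalso
          rw [h] at hl'
          simp at hl'
        · rcases m with _ | ⟨c₂, m⟩
          · rw [h1] at hl'
            simp at hl'
          · obtain ⟨rfl, rfl⟩ := List.cons.inj h2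
            exact ⟨m, h1, rfl⟩
      obtain ⟨a₂, h1, h2, g', hg', e⟩ := hg.slide (l₁ := pre ++ m₁) (m := m₂) (by simp [hm₂]) q
        (by simp [hm₂]) hr
      have h := K.plug_plug_seq (d := d) pre todo m₁ m₂ ha ha' h1 h2 hm₂ rfl (by simp [h2]) q' q
      have := Upper.cons (G := K.G) (rel := K.rel) pre todo _ (hΦ.comp m₁ m₂ hm₂ rfl q' q hq' hq)
        ha (by simp [h2]) g' (by simpa using hg')
      refine Eq.mp (congrArg _ ?_) this
      refine Eq.trans ?_ (congrArg _ e).symm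
      exact (congrArg (· ≫ g') h.symm).trans (Category.assoc _ _ _)

theorem comp (hΦ : K.Closed Φ) {g : K.ob a d ⟶ K.ob t d} {g' : K.ob t d ⟶ K.ob r d}
    {pre' todo' : List C} (hg : Upper K.P K.G K.rel Φ d pre todo g)
    (hg' : Upper K.P K.G K.rel Φ d pre' todo' g') (hl : pre.length ≤ pre'.length) :
    Upper K.P K.G K.rel Φ d pre todo (g ≫ g') := by
  induction hg' with
  | nil => rwa [Category.comp_id]
  | cons pre' todo' q hq ha ha' g' hg' ih =>
    rw [← Category.assoc]
    exact ih (hg.plug hΦ hl q hq ha ha') (hl.trans (by simp))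

/-- Each input carries one vertex, of grading $-1$ or at least $0$. Vertices of the second sort are
exchanged with the left factor of the rest and replaced there by identities. -/
theorem exists_fac (ψ : NiceGrading K.P) {g : K.ob a d ⟶ K.ob t d}
    (hg : Upper K.P K.G K.rel Φ d pre todo g) :
    ∃ (s s' : List C) (l : K.ob a d ⟶ K.ob s d) (r : K.ob s d ⟶ K.ob t d),
      Upper K.P K.G K.rel ψ.NegOneOrId d pre todo l ∧ Upper K.P K.G K.rel ψ.Nonneg d pre s' r ∧
        l ≫ r = g := by
  induction hg with
  | nil pre => exact ⟨_, _, 𝟙 _, 𝟙 _, .nil _, .nil _, by simp⟩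
  | @cons a a' b t c pre todo q hq ha ha' g hg ih =>
    obtain ⟨s, s', l, r, hl, hr, rfl⟩ := ih
    rcases (ψ.neg_one_le q).lt_or_eq with h | h
    · obtain ⟨a₂, t₂, l₂, h1, h2, h3, h4, g', hg', e⟩ := hl.slide_symm (l₁ := pre) (m := [])
        (by simp) q
      obtain rfl := h3.trans ha.symm
      obtain rfl : s' = l₂ := by
        have := hr.source.symm.trans h2
        simpa using this
      refine ⟨_, _, g', _, ?_, .cons pre s' q (show 0 ≤ ψ.deg q by omega) h1 h2 r hr, ?_⟩
      · have h5 : a₂ = pre ++ [c] ++ todo := by simp [ha]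
        have := Upper.cons (G := K.G) (rel := K.rel) pre todo _ (Or.inl ⟨c⟩ : ψ.NegOneOrId _ _ _)
          ha h5 _ hg'
        rwa [plug_id', Category.id_comp] at this
      · exact (Category.assoc _ _ _).symm.trans ((congrArg (· ≫ r) e).trans (Category.assoc _ _ _))
    · obtain rfl := List.length_eq_zero_iff.1 (ψ.arity_eq_zero q h.symm)
      rw [List.append_nil] at hr
      exact ⟨s, s', _, r, .cons pre todo q (Or.inr h.symm) ha ha' l hl, hr, Category.assoc _ _ _⟩

end Upper

end EnvReedy

namespace EnvReedy

variable {C : Type u} {K : Kind.{u, v} C}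

/-! ### Trees as gluings -/

section

variable {Φ : ∀ (b : List C) (c : C), K.P.Op b c → Prop} {X : K.Env} {a b r : List C} {c d : C}

theorem UpperTree.plug (hΦ : K.Closed Φ) {f : X ⟶ K.ob a d} (hf : UpperTree K.P K.G K.rel Φ f)
    {l₁ l₂ : List C} (ha : a = l₁ ++ c :: l₂) (hr : r = l₁ ++ b ++ l₂) (q : K.P.Op b c)
    (hq : Φ b c q) : UpperTree K.P K.G K.rel Φ (f ≫ K.mPlug l₁ l₂ ha hr q d) := by
  cases hf with
  | mk f hf => exact .mk _ (hf.plug hΦ (by simp) q hq ha hr)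

theorem RootedTree.of_upper {f : X ⟶ K.ob a c} (hf : UpperTree K.P K.G K.rel Φ f)
    {l₁ l₂ : List C} (h₁ : b = l₁ ++ c :: l₂) (h₂ : r = l₁ ++ a ++ l₂) (p : K.P.Op b d)
    (hp : Φ b d p) : RootedTree K.P K.G K.rel Φ (f ≫ K.mGraft l₁ l₂ h₁ h₂ p) := by
  cases hf with
  | mk f hf => exact .mk f hf l₁ l₂ h₁ h₂ p hp

/-- Invariance under the allowed permutations. -/
abbrev Kind.Symm (Φ : ∀ (b : List C) (c : C), K.P.Op b c → Prop) : Prop :=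
  ∀ {a b : List C} {d : C} (σ : K.G a b) (x : K.P.Op a d), Φ a d x → Φ b d (K.act σ x)

theorem LState.of_equiv (hΦ : Kind.Symm Φ) {S S' : LState K.opAct} (h : S ≈ S')
    (hS : Φ S.a S.d S.x) : Φ S'.a S'.d S'.x := by
  rcases h with rfl | ⟨ha, ha', hd, hd', hn, hn', x, σ, hm⟩
  · exact hS
  · have := hΦ σ x hS
    rwa [← K.opAct_perm σ] at this

theorem GlueRel.of_closed (hΦ : K.Closed Φ) {k : ℕ × C} {S Q W : LState K.opAct}
    (h : GlueRel k S Q W) (hS : Φ S.a S.d S.x) (hQ : Φ Q.a Q.d Q.x) : Φ W.a W.d W.x := by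
  cases h with
  | plug L₁ L₂ N hL hz hN l₁ l₂ r hl₁ hl₂ h₁ h₂ hr hn x hx =>
    subst hx
    have := hΦ.comp l₁ l₂ h₁ h₂ S.x Q.x hS hQ
    rwa [← K.opAct_plug] at this
  | graft L₁ L₂ N hL hz hN l₁ l₂ r hl₁ hl₂ h₁ h₂ hr hn x hx =>
    subst hx
    have := hΦ.comp l₁ l₂ h₁ h₂ Q.x S.x hQ hS
    rwa [← K.opAct_graft] at this

/-- The labelled morphism is obtained by gluing an operation from the class to the output of a
morphism represented by a tree without the lowest vertex. -/
def IsTree (Φ : ∀ (b : List C) (c : C), K.P.Op b c → Prop) (W : LState (K.homAct X)) : Prop :=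
  ∀ T : List (ℕ × C), ∃ (S : LState (K.homAct X)) (Q : LState K.opAct),
    UpperTree K.P K.G K.rel Φ (Y := K.ob S.a S.d) S.x ∧ Φ Q.a Q.d Q.x ∧ S.z ∈ Q.z :: Q.L ∧
      (∀ l ∈ S.z :: S.L, l ∈ Q.z :: Q.L → l = S.z) ∧ S.z ∉ T ∧ glue S.z S.cls Q = W.cls

namespace IsTree

theorem congr {W W' : LState (K.homAct X)} (h : W ≈ W') (hW : IsTree Φ W) : IsTree Φ W' := by
  intro T
  obtain ⟨S, Q, h1, h2, h3, h4, h5, h6⟩ := hW T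
  exact ⟨S, Q, h1, h2, h3, h4, h5, h6.trans (LState.cls_eq.2 h)⟩

theorem out_eq (hK : K.Rooted) {S W : LState (K.homAct X)} {Q : LState K.opAct}
    (h : glue S.z S.cls Q = W.cls) : W.z = Q.z ∧ S.z ∈ Q.L := by
  have hn := S.nodup
  rcases glue_cases S.z S.cls Q (Cls.has_cls.2 List.mem_cons_self) with h' | ⟨V, S', Q', h1, h2, h3, h4⟩
  · rw [h'] at h
    cases h
  · have h5 := LState.equiv_rooted hK (LState.cls_eq.1 h1)
    have h6 := LState.equiv_rooted hK h2
    have h7 := LState.equiv_rooted hK (LState.cls_eq.1 (h.symm.trans h4))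
    rw [h7.1, ← h6.1]
    have h8 : S.z ∉ S'.L := fun h => (List.nodup_cons.1 hn).1 ((h5.2 _).2 h)
    have h9 : S.z ∈ Q'.L := h3.polarity.elim And.right fun h => absurd h.1 h8
    refine ⟨?_, (h6.2 _).1 h9⟩
    cases h3 with
    | plug L₁ L₂ N hL => exact absurd (by simp [hL]) h8
    | graft => rfl

theorem mem_iff {k : ℕ × C} {S W : LState (K.homAct X)} {Q : LState K.opAct} (hk : k ∈ S.z :: S.L)
    (h : glue k S.cls Q = W.cls) (t : ℕ × C) :
    t ∈ W.z :: W.L ↔ (t ∈ S.z :: S.L ∨ t ∈ Q.z :: Q.L) ∧ t ≠ k := by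
  rcases glue_cases k S.cls Q (Cls.has_cls.2 hk) with h' | ⟨V, S', Q', h1, h2, h3, h4⟩
  · rw [h'] at h
    cases h
  · rw [LState.mem_iff_of_equiv (LState.cls_eq.1 (h.symm.trans h4)) t, h3.mem_iff h3.disjoint,
      ← LState.mem_iff_of_equiv (LState.cls_eq.1 h1) t, LState.mem_iff_of_equiv h2 t]

/-- A further operation is attached either to a leaf of the upper part or to the lowest vertex, and
is absorbed there by composition. The two cases are the two laws of gluing. -/
theorem glue (hK : K.Coherent) (hΦ : K.Closed Φ) (hΦ' : Kind.Symm Φ) {e : ℕ × C}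
    {W V : LState (K.homAct X)} {R : LState K.opAct} (hW : IsTree Φ W) (hR : Φ R.a R.d R.x)
    (h : GlueRel e W R V) : IsTree Φ V := by
  intro T
  -- The freedom to avoid a given list keeps the name of the inner edge apart from the names of the
  -- new operation.
  obtain ⟨S, Q, h1, h2, h3, h4, h5, h6⟩ := hW (T ++ (R.z :: R.L))
  rw [List.mem_append, not_or] at h5
  have hd := h.disjoint
  have hWm := mem_iff List.mem_cons_self h6
  have he := h.mem_left
  have heR := h.mem_right
  have hke : S.z ≠ e := fun h => h5.2 (h ▸ heR)
  have hV : EnvReedy.glue e (EnvReedy.glue S.z S.cls Q) R = V.cls := by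
    rw [h6]
    exact (hK.hom X).glue_eq (Setoid.refl _) (Setoid.refl _) h
  rcases ((hWm e).1 he).1 with heS | heQ
  · have heQ : e ∉ Q.z :: Q.L := fun h => hke (h4 e heS h).symm
    -- The edge `e` belongs to the upper part and is an input there, so the new operation has to be
    -- attached by its output.
    obtain ⟨R', hR', hz⟩ : ∃ R' : LState K.opAct, R' ≈ R ∧ R'.z = e := by
      rcases (hK.hom X).kind with hR | hF
      · have := out_eq hR h6
        refine ⟨R, Setoid.refl _, (h.polarity.resolve_left fun h' => heQ ?_).2⟩
        rw [← h'.1, this.1]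
        exact List.mem_cons_self
      · obtain ⟨R', h7, h8, -⟩ := LState.exists_rep_out hF R heR
        exact ⟨R', h7, h8⟩
    have hRm := LState.mem_iff_of_equiv hR'
    have hSR : ∀ l ∈ S.z :: S.L, l ∈ R.z :: R.L → l = e := fun l hl hl' => by
      by_cases hlk : l = S.z
      · exact absurd (hlk ▸ hl') h5.2
      · exact hd l ((hWm l).2 ⟨Or.inl hl, hlk⟩) hl'
    have heSL : e ∈ S.L := (List.mem_cons.1 heS).resolve_left hke.symm
    obtain ⟨S₂, hS₂⟩ := GlueRel.exists_of_polarity (S := S) (Q := R') (k := e) (Or.inr ⟨heSL, hz⟩)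
      fun l hl hl' => hSR l hl ((hRm l).1 hl')
    have hg : EnvReedy.glue e S.cls R = S₂.cls :=
      (hK.hom X).glue_eq (Setoid.refl _) hR' hS₂
    have hR₂ := LState.of_equiv hΦ' (Setoid.symm hR') hR
    obtain ⟨hz₂, hu₂⟩ : S₂.z = S.z ∧ UpperTree K.P K.G K.rel Φ (Y := K.ob S₂.a S₂.d) S₂.x := by
      cases hS₂ with
      | plug L₁ L₂ N hL hz hN l₁ l₂ r hl₁ hl₂ h₁ h₂ hr hn x hx =>
        subst hx
        exact ⟨rfl, h1.plug hΦ h₁ h₂ R'.x hR₂⟩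
      | graft L₁ L₂ N hL hz => exact absurd hz hke
    have hm₂ := mem_iff heS hg
    refine ⟨S₂, Q, hu₂, h2, hz₂ ▸ h3, fun l hl hl' => ?_, hz₂ ▸ h5.1, ?_⟩
    · rw [hz₂]
      rcases ((hm₂ l).1 hl).1 with hl | hl
      · exact h4 l hl hl'
      · by_contra hlk
        have := hd l ((hWm l).2 ⟨Or.inr hl', hlk⟩) hl
        exact heQ (this ▸ hl')
    · rw [hz₂, ← hg, ← hV]
      symm
      refine (hK.hom X).glue_glue_comm h3 heR hke ?_ ?_ ?_
      · simpa only [Cls.has_cls] using h4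
      · simpa only [Cls.has_cls] using hSR
      · intro l hl hl'
        by_cases hlk : l = S.z
        · exact h5.2 (hlk ▸ hl')
        · have := hd l ((hWm l).2 ⟨Or.inr hl, hlk⟩) hl'
          exact heQ (this ▸ hl)
  -- The edge `e` belongs to the lowest vertex, which is replaced by its composition with the new
  -- operation.
  · have heS : e ∉ S.z :: S.L := fun h => hke (h4 e h heQ).symm
    have hQR : ∀ l ∈ Q.z :: Q.L, l ∈ R.z :: R.L → l = e := fun l hl hl' => by
      by_cases hlk : l = S.z
      · exact absurd (hlk ▸ hl') h5.2
      · exact hd l ((hWm l).2 ⟨Or.inr hl, hlk⟩) hl'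
    obtain ⟨Q', R', hQ', hR', hp⟩ : ∃ Q' R' : LState K.opAct, Q' ≈ Q ∧ R' ≈ R ∧
        ((Q'.z = e ∧ e ∈ R'.L) ∨ (e ∈ Q'.L ∧ R'.z = e)) := by
      rcases (hK.hom X).kind with hR | hF
      · have hz := (out_eq hR h6).1
        have hn := W.nodup
        refine ⟨Q, R, Setoid.refl _, Setoid.refl _, ?_⟩
        refine h.polarity.imp (And.imp_left fun h => hz ▸ h) (And.imp_left fun h => ?_)
        refine (List.mem_cons.1 heQ).resolve_left fun h' => ?_
        rw [hz, ← h'] at hn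
        exact (List.nodup_cons.1 hn).1 h
      · obtain ⟨Q', h7, h8, h9⟩ := LState.exists_rep_out hF Q h3
        obtain ⟨R', h10, h11, -⟩ := LState.exists_rep_out hF R heR
        exact ⟨Q', R', h7, h10, Or.inr ⟨h9 e heQ hke.symm, h11⟩⟩
    have hQm := LState.mem_iff_of_equiv hQ'
    have hRm := LState.mem_iff_of_equiv hR'
    obtain ⟨QR, hQR'⟩ := GlueRel.exists_of_polarity hp
      fun l hl hl' => hQR l ((hQm l).1 hl) ((hRm l).1 hl')
    have hQRm := hQR'.mem_iff hQR'.disjoint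
    refine ⟨S, QR, h1, hQR'.of_closed hΦ (LState.of_equiv hΦ' (Setoid.symm hQ') h2)
      (LState.of_equiv hΦ' (Setoid.symm hR') hR), (hQRm _).2 ⟨Or.inl ((hQm _).2 h3), hke⟩,
      fun l hl hl' => ?_, h5.1, ?_⟩
    · rcases ((hQRm l).1 hl').1 with h' | h'
      · exact h4 l hl ((hQm l).1 h')
      · by_contra hlk
        have := hd l ((hWm l).2 ⟨Or.inl hl, hlk⟩) ((hRm l).1 h')
        exact heS (this ▸ hl)
    · rw [← hV, ← glue_congr hQ', ← glue_congr hR']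
      symm
      refine (hK.hom X).glue_glue_seq hK.op hQR' ((hQm _).2 h3) ?_ hke ?_ ?_
      · rwa [Cls.has_cls]
      · intro l hl hl'
        rw [Cls.has_cls] at hl
        exact h4 l hl ((hQm l).1 hl')
      · intro l hl hl'
        rw [Cls.has_cls] at hl
        by_cases hlk : l = S.z
        · exact h5.2 ((hRm _).1 (hlk ▸ hl'))
        · have := hd l ((hWm l).2 ⟨Or.inl hl, hlk⟩) ((hRm l).1 hl')
          exact heS (this ▸ hl)

/-- Either the lowest vertex has an input to which the source vertex is grafted, or it is grafted to
the output of the source vertex and has arity `0`. -/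
theorem cases (hK : K.Coherent) (hΦ' : Kind.Symm Φ) {W : LState (K.homAct X)} (hW : IsTree Φ W) :
    (RootedTree K.P K.G K.rel Φ (Y := K.ob W.a W.d) W.x ∨
      PermutedRootedTree K.P K.G K.rel Φ (Y := K.ob W.a W.d) W.x) ∨
    (K.Free ∧ ∃ (S : LState (K.homAct X)) (Q : LState K.opAct),
      UpperTree K.P K.G K.rel Φ (Y := K.ob S.a S.d) S.x ∧ Φ Q.a Q.d Q.x ∧ Q.z = S.z ∧ Q.L = [] ∧
        EnvReedy.glue S.z S.cls Q = W.cls) := by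
  obtain ⟨S, Q, h1, h2, h3, h4, -, h6⟩ := hW []
  have key : ∀ Q', Q' ≈ Q → S.z ∈ Q'.L → RootedTree K.P K.G K.rel Φ (Y := K.ob W.a W.d) W.x ∨
      PermutedRootedTree K.P K.G K.rel Φ (Y := K.ob W.a W.d) W.x := by
    intro Q' hQ' hk
    obtain ⟨V, hV⟩ := GlueRel.exists_of_polarity (S := S) (Q := Q') (Or.inl ⟨rfl, hk⟩)
      fun l hl hl' => h4 l hl ((LState.mem_iff_of_equiv hQ' l).1 hl')
    have h7 := LState.cls_eq.1
      (((hK.hom X).glue_eq (Setoid.refl S) hQ' hV).symm.trans h6)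
    have h8 : RootedTree K.P K.G K.rel Φ (Y := K.ob V.a V.d) V.x := by
      have hn := S.nodup
      cases hV with
      | plug L₁ L₂ N hL => exact absurd (by simp [hL]) (List.nodup_cons.1 hn).1
      | graft L₁ L₂ N hL hz hN l₁ l₂ r hl₁ hl₂ h₁ h₂ hr hn x hx =>
        subst hx
        exact RootedTree.of_upper h1 h₁ h₂ _ (LState.of_equiv hΦ' (Setoid.symm hQ') h2)
    rcases h7 with rfl | ⟨ha, ha', hd, hd', hn, hn', x, σ, hm⟩
    · exact Or.inl h8
    · exact Or.inr (.mk _ h8 σ)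
  rcases (hK.hom X).kind with hR | hF
  · exact Or.inl (key Q (Setoid.refl _) (out_eq hR h6).2)
  · by_cases hL : ∃ l ∈ Q.z :: Q.L, l ≠ S.z
    · obtain ⟨l, hl, hlk⟩ := hL
      obtain ⟨Q', h7, h8, h9⟩ := LState.exists_rep_out hF Q hl
      exact Or.inl (key Q' h7 (h9 _ h3 hlk.symm))
    -- The lowest vertex has no edge besides the inner one, so this edge is necessarily its output
    -- and cannot be turned into an input.
    · push Not at hL
      refine Or.inr ⟨hF, S, Q, h1, h2, hL _ List.mem_cons_self, ?_, h6⟩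
      rw [List.eq_nil_iff_forall_not_mem]
      intro l hl
      have hn := Q.nodup
      rw [hL _ List.mem_cons_self, ← hL l (List.mem_cons_of_mem _ hl)] at hn
      exact (List.nodup_cons.1 hn).1 hl

end IsTree

/-- The morphism is represented by a tree with the vertices marked by operations from the class. -/
def TreeHom (Φ : ∀ (b : List C) (c : C), K.P.Op b c → Prop) (f : X ⟶ K.ob a d) : Prop :=
  ∀ μ : Lab a d, IsTree Φ (μ.state (H := K.homAct X) f)

namespace TreeHom

theorem plug (hK : K.Coherent) (hΦ : K.Closed Φ) (hΦ' : Kind.Symm Φ) {f : X ⟶ K.ob a d}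
    (hf : TreeHom Φ f) {l₁ l₂ : List C} (ha : a = l₁ ++ c :: l₂) (hr : r = l₁ ++ b ++ l₂)
    {q : K.P.Op b c} (hq : Φ b c q) : TreeHom Φ (f ≫ K.mPlug l₁ l₂ ha hr q d) := by
  intro ρ
  obtain ⟨⟨μ, ν⟩, hs⟩ := Fam.exists_split' ha hr ρ
  exact (hf μ).glue hK hΦ hΦ' (R := ν.op q) hq (hs.plug_state (H := K.homAct X) ha hr f q)

theorem graft (hK : K.Coherent) (hΦ : K.Closed Φ) (hΦ' : Kind.Symm Φ) {f : X ⟶ K.ob b c}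
    (hf : TreeHom Φ f) {l₁ l₂ : List C} (ha : a = l₁ ++ c :: l₂) (hr : r = l₁ ++ b ++ l₂)
    {p : K.P.Op a d} (hp : Φ a d p) : TreeHom Φ (f ≫ K.mGraft l₁ l₂ ha hr p) := by
  intro ρ
  obtain ⟨⟨μ, ν⟩, hs⟩ := Fam.exists_split' ha hr ρ
  exact (hf ν).glue hK hΦ hΦ' (R := μ.op p) hp (hs.graft_state (H := K.homAct X) ha hr f p)

theorem perm {f : X ⟶ K.ob a d} (hf : TreeHom Φ f) (σ : K.G a b) :
    TreeHom Φ (f ≫ K.mPerm σ d) := by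
  intro ρ
  obtain ⟨μ, hμ⟩ := Lab.exists_permute σ ρ
  exact (hf μ).congr (LState.Step.mk (H := K.homAct X) _ _ _ _ _ _ f σ hμ).equiv

theorem of_rooted (hK : K.Coherent) {f : X ⟶ K.ob a c} (hf : UpperTree K.P K.G K.rel Φ f)
    {l₁ l₂ : List C} (h₁ : b = l₁ ++ c :: l₂) (h₂ : r = l₁ ++ a ++ l₂) {p : K.P.Op b d}
    (hp : Φ b d p) : TreeHom Φ (f ≫ K.mGraft l₁ l₂ h₁ h₂ p) := by
  intro ρ T
  obtain ⟨k, hk0, hkc, hk⟩ := Lab.exists_fresh c (ρ.z :: ρ.L ++ T)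
  rw [List.mem_append, not_or] at hk
  obtain ⟨μ, ν, hνk, hs⟩ := Lab.exists_split h₁ h₂ ρ k hk0 hkc hk.1
  exact ⟨ν.state f, μ.op p, hf, hp, List.mem_cons_of_mem _ hs.mem_left,
    fun l hl hl' => hs.disjoint l hl' hl, fun h => hk.2 (hνk ▸ h),
    (hK.hom X).glue_eq (Setoid.refl _) (Setoid.refl _) (hs.graft_state (H := K.homAct X) h₁ h₂ f p)⟩

theorem of_upper (hK : K.Coherent) (hΦ : K.Closed Φ) {f : X ⟶ K.ob a d}
    (hf : UpperTree K.P K.G K.rel Φ f) : TreeHom Φ f := by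
  have := of_rooted hK hf (r := a) (l₁ := []) (l₂ := []) rfl (by simp) (hΦ.id d)
  rwa [K.mGraft_id, Category.comp_id] at this

theorem id (hK : K.Coherent) (hΦ : K.Closed Φ) : TreeHom Φ (𝟙 (K.ob a d)) :=
  of_upper hK hΦ (.mk _ (.refl hΦ rfl))

theorem of_rootedTree (hK : K.Coherent) {Y : K.Env} {f : X ⟶ Y} (hf : RootedTree K.P K.G K.rel Φ f) :
    TreeHom (a := Y.as.1) (d := Y.as.2) Φ f := by
  cases hf with
  | mk f hf l₁ l₂ h₁ h₂ p hp => exact of_rooted hK (.mk f hf) h₁ h₂ hp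

theorem of_permuted (hK : K.Coherent) {Y : K.Env} {f : X ⟶ Y}
    (hf : PermutedRootedTree K.P K.G K.rel Φ f) : TreeHom (a := Y.as.1) (d := Y.as.2) Φ f := by
  cases hf with
  | mk f hf σ => exact (of_rootedTree hK hf).perm σ

theorem upper (hK : K.Coherent) (hΦ : K.Closed Φ) (hΦ' : Kind.Symm Φ) {f : X ⟶ K.ob a d}
    (hf : TreeHom Φ f) {pre todo : List C} {g : K.ob a d ⟶ K.ob b d}
    (hg : Upper K.P K.G K.rel Φ d pre todo g) : TreeHom Φ (f ≫ g) := by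
  induction hg with
  | nil => rwa [Category.comp_id]
  | cons pre todo q hq ha ha' g hg ih =>
    rw [← Category.assoc]
    exact ih (hf.plug hK hΦ hΦ' ha ha' hq)

theorem rootedTree (hK : K.Coherent) (hΦ : K.Closed Φ) (hΦ' : Kind.Symm Φ) {Y : K.Env}
    {f : X ⟶ K.ob a d} (hf : TreeHom Φ f) {g : K.ob a d ⟶ Y}
    (hg : RootedTree K.P K.G K.rel Φ g) : TreeHom (a := Y.as.1) (d := Y.as.2) Φ (f ≫ g) := by
  have : ∀ (Z : K.Env) (f : X ⟶ Z) (hf : TreeHom (a := Z.as.1) (d := Z.as.2) Φ f) (g : Z ⟶ Y)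
      (hg : RootedTree K.P K.G K.rel Φ g), TreeHom (a := Y.as.1) (d := Y.as.2) Φ (f ≫ g) := by
    intro Z f hf g hg
    cases hg with
    | mk g₀ hg₀ l₁ l₂ h₁ h₂ p hp =>
      exact Eq.mp (congrArg (TreeHom Φ) (Category.assoc _ _ _))
        ((hf.upper hK hΦ hΦ' hg₀).graft hK hΦ hΦ' h₁ h₂ hp)
  exact this _ f hf g hg

theorem permuted (hK : K.Coherent) (hΦ : K.Closed Φ) (hΦ' : Kind.Symm Φ) {Y : K.Env}
    {f : X ⟶ K.ob a d} (hf : TreeHom Φ f) {g : K.ob a d ⟶ Y}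
    (hg : PermutedRootedTree K.P K.G K.rel Φ g) :
    TreeHom (a := Y.as.1) (d := Y.as.2) Φ (f ≫ g) := by
  cases hg with
  | mk g hg σ =>
    exact Eq.mp (congrArg (TreeHom Φ) (Category.assoc _ _ _))
      ((hf.rootedTree hK hΦ hΦ' hg).perm σ)

/-- All morphisms are represented by trees. -/
theorem of_true (hK : K.Coherent) {Y : K.Env} (f : X ⟶ Y) :
    TreeHom (a := Y.as.1) (d := Y.as.2) (fun (b : List C) (c : C) (_ : K.P.Op b c) => True) f := by
  have h1 := Kind.closed_true (K := K)
  have h2 : Kind.Symm (fun (b : List C) (c : C) (_ : K.P.Op b c) => True) := fun _ _ _ => trivial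
  induction f using Kind.hom_induction with
  | id => exact id hK h1
  | plug l₁ l₂ ha hr q f ih => exact ih.plug hK h1 h2 ha hr trivial
  | graft l₁ l₂ ha hr p f ih => exact ih.graft hK h1 h2 ha hr trivial
  | perm σ f ih => exact ih.perm σ

/-- In a rooted kind the source vertex is attached to an input of the lowest vertex, so an operation
of arity $0$ cannot occur there. -/
theorem rooted_or (hK : K.Coherent) (hΦ' : Kind.Symm Φ) (hR : K.Rooted) {Y : K.Env} {f : X ⟶ Y}
    (hf : TreeHom (a := Y.as.1) (d := Y.as.2) Φ f) :
    RootedTree K.P K.G K.rel Φ f ∨ PermutedRootedTree K.P K.G K.rel Φ f := by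
  obtain ⟨μ⟩ := Lab.exists_lab Y.as.1 Y.as.2
  exact ((hf μ).cases hK hΦ').resolve_right fun h => by
    obtain ⟨hF, S, Q, -, -, h3, h4, h5⟩ := h
    have := (IsTree.out_eq hR h5).2
    rw [h4] at this
    simp at this

end TreeHom

end

end EnvReedy

namespace EnvReedy

variable {C : Type u} {K : Kind.{u, v} C}

/-! ### Gradings and morphisms -/

namespace Kind

variable {a b r t : List C} {c d e f : C} {ψ : NiceGrading K.P}

theorem mPlug_congr {l l' m m' : List C} (h : l = l') (h' : m = m') (ha : a = l ++ c :: m)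
    (hr : r = l ++ b ++ m) (q : K.P.Op b c) :
    K.mPlug l m ha hr q d = K.mPlug l' m' (h ▸ h' ▸ ha) (h ▸ h' ▸ hr) q d := by
  subst h h'
  rfl

theorem plug_comp {l₁ l₂ : List C} (ha : a = l₁ ++ c :: l₂) (hr : r = l₁ ++ [e] ++ l₂)
    (hr' : r = l₁ ++ e :: l₂) (ht : t = l₁ ++ b ++ l₂) (h₁ : [e] = [] ++ e :: [])
    (h₂ : b = [] ++ b ++ []) (q : K.P.Op [e] c) (q' : K.P.Op b e) :
    K.mPlug l₁ l₂ ha hr q d ≫ K.mPlug l₁ l₂ hr' ht q' d =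
      K.mPlug l₁ l₂ ha ht (K.P.comp [] [] h₁ h₂ q q') d := by
  have := K.plug_plug_seq (d := d) l₁ l₂ [] [] ha hr (by simpa using hr') (by simpa using ht) h₁ h₂
    ht q q'
  rwa [mPlug_congr (List.append_nil l₁) (List.nil_append l₂)] at this

theorem exists_inverse (hG : ψ.IsGroupoidal) (q : K.P.Op b c) (hq : ψ.deg q = 0) :
    ∃ (e : C) (_ : b = [e]) (q' : K.P.Op [c] e) (h₁ : [c] = [] ++ c :: []) (_ : b = [] ++ b ++ [])
      (h₃ : b = [] ++ e :: []) (h₄ : [c] = [] ++ [c] ++ []) (h₅ : [e] = [] ++ b ++ []),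
      K.P.comp [] [] h₁ h₅ q' q = K.P.id e ∧ K.P.comp [] [] h₃ h₄ q q' = K.P.id c := by
  obtain ⟨e, rfl⟩ := List.length_eq_one_iff.1 (hG.1 q hq)
  have := hG.2
  let f : (⟨e⟩ : GrZero ψ) ⟶ ⟨c⟩ := ⟨q, hq⟩
  exact ⟨e, rfl, (CategoryTheory.inv f).1, rfl, rfl, rfl, rfl, rfl,
    congrArg Subtype.val (IsIso.hom_inv_id f), congrArg Subtype.val (IsIso.inv_hom_id f)⟩

theorem isIso_plug (hG : ψ.IsGroupoidal) {l₁ l₂ : List C} (ha : a = l₁ ++ c :: l₂)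
    (hr : r = l₁ ++ b ++ l₂) (q : K.P.Op b c) (hq : ψ.deg q = 0) :
    IsIso (K.mPlug l₁ l₂ ha hr q d) := by
  obtain ⟨e, rfl, q', h₁, h₂, h₃, h₄, h₅, h6, h7⟩ := exists_inverse hG q hq
  have hr' : r = l₁ ++ e :: l₂ := by simpa using hr
  have ha' : a = l₁ ++ [c] ++ l₂ := by simpa using ha
  refine ⟨K.mPlug l₁ l₂ hr' ha' q' d, ?_, ?_⟩
  · rw [plug_comp ha hr hr' ha' h₃ h₄, h7, K.mPlug_id]
  · rw [plug_comp hr' ha' ha hr h₁ h₂, h6, K.mPlug_id]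

theorem isIso_graft (hG : ψ.IsGroupoidal) {l₁ l₂ : List C} (ha : a = l₁ ++ c :: l₂)
    (hr : r = l₁ ++ b ++ l₂) (p : K.P.Op a d) (hp : ψ.deg p = 0) :
    IsIso (K.mGraft l₁ l₂ ha hr p) := by
  obtain ⟨e, rfl, q', h₁, h₂, h₃, h₄, h₅, h6, h7⟩ := exists_inverse hG p hp
  -- Grading $0$ forces arity $1$, so the grafting has no neighbouring inputs.
  obtain ⟨rfl, rfl⟩ : l₁ = [] ∧ l₂ = [] := by
    have := congrArg List.length ha
    simp only [List.length_append, List.length_cons, List.length_nil] at this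
    exact ⟨List.length_eq_zero_iff.1 (by omega), List.length_eq_zero_iff.1 (by omega)⟩
  obtain rfl := (List.cons.inj ha).1
  have hb : b = [] ++ r ++ [] := by rw [hr]; simp
  refine ⟨K.mGraft [] [] h₁ hb q', ?_, ?_⟩
  · have := K.graft_graft_seq [] [] [] [] h₁ h₅ rfl (by simp : b = _) ha hr hb q' p
    exact this.symm.trans (by rw [h6]; exact K.mGraft_id _ _)
  · have := K.graft_graft_seq [] [] [] [] h₃ h₄ rfl (by simp : r = _) h₁ hb hr p q'
    exact this.symm.trans (by rw [h7]; exact K.mGraft_id _ _)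

theorem isIso_perm (σ : K.G a b) : IsIso (K.mPerm σ d) := by
  refine ⟨K.mPerm (K.inv σ) d, LState.mPerm_inv σ d, ?_⟩
  rw [LState.mPerm_comp]
  apply LState.mPerm_refl
  rw [K.edge_comp, K.edge_inv]
  simp

/-- The morphism does not decrease gradings, and in the groupoidal case it is an isomorphism if it
preserves the grading of an operation. -/
def Raises (ψ : NiceGrading K.P) (g : K.ob a d ⟶ K.ob b e) : Prop :=
  (∀ p, ψ.deg p ≤ ψ.deg (K.opAct.map g p)) ∧
    (ψ.IsGroupoidal → ∀ p, ψ.deg p = ψ.deg (K.opAct.map g p) → IsIso g)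

theorem Raises.comp {g : K.ob a d ⟶ K.ob b e} {h : K.ob b e ⟶ K.ob r f} (hg : Raises ψ g)
    (hh : Raises ψ h) : Raises ψ (g ≫ h) := by
  refine ⟨fun p => ?_, fun hG p hp => ?_⟩
  · rw [K.opAct.map_comp]
    exact (hg.1 p).trans (hh.1 _)
  · rw [K.opAct.map_comp] at hp
    have h1 := hg.1 p
    have h2 := hh.1 (K.opAct.map g p)
    have := hg.2 hG p (by omega)
    have := hh.2 hG (K.opAct.map g p) (by omega)
    exact IsIso.comp_isIso

theorem raises_id : Raises ψ (𝟙 (K.ob a d)) :=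
  ⟨fun p => by rw [K.opAct.map_id], fun _ _ _ => inferInstance⟩

theorem deg_plug {l₁ l₂ : List C} (ha : a = l₁ ++ c :: l₂) (hr : r = l₁ ++ b ++ l₂)
    (q : K.P.Op b c) (p : K.P.Op a d) :
    ψ.deg (K.opAct.map (K.mPlug l₁ l₂ ha hr q d) p) = ψ.deg p + ψ.deg q :=
  (congrArg ψ.deg (K.opAct_plug l₁ l₂ ha hr q p)).trans (ψ.deg_comp l₁ l₂ ha hr p q)

theorem deg_graft {l₁ l₂ : List C} (ha : a = l₁ ++ c :: l₂) (hr : r = l₁ ++ b ++ l₂)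
    (q : K.P.Op b c) (p : K.P.Op a d) :
    ψ.deg (K.opAct.map (K.mGraft l₁ l₂ ha hr p) q) = ψ.deg p + ψ.deg q :=
  (congrArg ψ.deg (K.opAct_graft l₁ l₂ ha hr p q)).trans (ψ.deg_comp l₁ l₂ ha hr p q)

theorem raises_plug {l₁ l₂ : List C} (ha : a = l₁ ++ c :: l₂) (hr : r = l₁ ++ b ++ l₂)
    {q : K.P.Op b c} (hq : 0 ≤ ψ.deg q) : Raises ψ (K.mPlug l₁ l₂ ha hr q d) := by
  refine ⟨fun p => ?_, fun hG p hp => isIso_plug hG ha hr q ?_⟩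
  · rw [deg_plug]
    omega
  · rw [deg_plug] at hp
    omega

theorem raises_graft {l₁ l₂ : List C} (ha : a = l₁ ++ c :: l₂) (hr : r = l₁ ++ b ++ l₂)
    {p : K.P.Op a d} (hp : 0 ≤ ψ.deg p) : Raises ψ (K.mGraft l₁ l₂ ha hr p) := by
  refine ⟨fun q => ?_, fun hG q hq => isIso_graft hG ha hr p ?_⟩
  · rw [deg_graft]
    omega
  · rw [deg_graft] at hq
    omega

theorem raises_perm (hψ : Invariant ψ) (σ : K.G a b) : Raises ψ (K.mPerm σ d) := by
  refine ⟨fun p => ?_, fun _ _ _ => isIso_perm σ⟩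
  have := (congrArg ψ.deg (K.opAct_perm σ d p)).trans (hψ σ p)
  exact this.ge

theorem raises_upper {pre todo : List C} {g : K.ob a d ⟶ K.ob t d}
    (hg : Upper K.P K.G K.rel ψ.Nonneg d pre todo g) : Raises ψ g := by
  induction hg with
  | nil pre => exact raises_id
  | cons pre todo q hq ha ha' g hg ih => exact (raises_plug ha ha' hq).comp ih

theorem raises_rooted {X Y : K.Env} {g : X ⟶ Y} (hg : RootedTree K.P K.G K.rel ψ.Nonneg g) :
    Raises (a := X.as.1) (d := X.as.2) (b := Y.as.1) (e := Y.as.2) ψ g := by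
  cases hg with
  | mk f hf l₁ l₂ h₁ h₂ p hp => exact (raises_upper hf).comp (raises_graft h₁ h₂ hp)

theorem raises_permuted (hψ : Invariant ψ) {X Y : K.Env} {g : X ⟶ Y}
    (hg : PermutedRootedTree K.P K.G K.rel ψ.Nonneg g) :
    Raises (a := X.as.1) (d := X.as.2) (b := Y.as.1) (e := Y.as.2) ψ g := by
  cases hg with
  | mk f hf σ => exact (raises_rooted hf).comp (raises_perm hψ σ)

/-- A tree with vertices of grading `-1` decreases gradings. -/
theorem deg_upper {pre todo : List C} {l : K.ob a d ⟶ K.ob t d}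
    (hl : Upper K.P K.G K.rel ψ.NegOneOrId d pre todo l) :
    IsIso l ∧ (∀ p, ψ.deg (K.opAct.map l p) = ψ.deg p) ∨
      ∀ p, ψ.deg (K.opAct.map l p) < ψ.deg p := by
  induction hl with
  | nil pre => exact Or.inl ⟨inferInstance, fun p => by rw [K.opAct.map_id]⟩
  | cons pre todo q hq ha ha' g hg ih =>
    rcases hq with hq | hq
    · cases hq
      obtain rfl := ha.trans (ha'.trans (by simp)).symm
      rwa [plug_id', Category.id_comp]
    · right
      intro p
      have h1 : ψ.deg (K.opAct.map (plug K.P K.G K.rel pre todo ha ha' q d) p) =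
        ψ.deg p + ψ.deg q := deg_plug ha ha' q p
      rw [K.opAct.map_comp]
      rcases ih with ⟨-, h⟩ | h
      · exact (h _).trans_lt (h1.trans_lt (by omega))
      · exact (h _).trans (h1.trans_lt (by omega))

theorem Coherent.epi_upper (hK : K.Coherent) {pre todo : List C} {l : K.ob a d ⟶ K.ob t d}
    (hl : Upper K.P K.G K.rel ψ.NegOneOrId d pre todo l) : Epi l := by
  induction hl with
  | nil pre => infer_instance
  | cons pre todo q hq ha ha' g hg ih =>
    rcases hq with hq | hq
    · cases hq
      obtain rfl := ha.trans (ha'.trans (by simp)).symm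
      rwa [plug_id', Category.id_comp]
    · obtain rfl := List.length_eq_zero_iff.1 (ψ.arity_eq_zero q hq)
      have := hK.epi_plug (d := d) ha ha' q
      exact epi_comp _ _

end Kind

namespace UpperTree

variable {Φ : ∀ (b : List C) (c : C), K.P.Op b c → Prop} {X Y Z : K.Env}

/-- Provides the profile of the target for a tree with an abstract target, so that two composable
trees can be compared over a common middle object. -/
theorem elim {f : X ⟶ Y} (hf : UpperTree K.P K.G K.rel Φ f) :
    ∃ (t : List C) (h : Y = K.ob t X.as.2),
      Upper K.P K.G K.rel Φ (a := X.as.1) (t := t) X.as.2 [] X.as.1 (f ≫ eqToHom h) := by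
  cases hf with
  | mk f hf =>
    refine ⟨_, rfl, ?_⟩
    exact Eq.mpr (congrArg (Upper K.P K.G K.rel Φ _ [] _) (Category.comp_id f)) hf

theorem comp (hΦ : K.Closed Φ) {f : X ⟶ Y} {g : Y ⟶ Z} (hf : UpperTree K.P K.G K.rel Φ f)
    (hg : UpperTree K.P K.G K.rel Φ g) : UpperTree K.P K.G K.rel Φ (f ≫ g) := by
  obtain ⟨t, rfl, hf'⟩ := hf.elim
  obtain ⟨s, rfl, hg'⟩ := hg.elim
  rw [eqToHom_refl] at hf' hg'
  have hf := Eq.mp (congrArg (Upper K.P K.G K.rel Φ _ [] _) (Category.comp_id f)) hf'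
  have hg := Eq.mp (congrArg (Upper K.P K.G K.rel Φ _ [] _) (Category.comp_id g)) hg'
  exact .mk _ (hf.comp hΦ hg (le_refl _))

end UpperTree

end EnvReedy

namespace EnvReedy

variable {C : Type u} {K : Kind.{u, v} C}

/-! ### Factorizations -/

section

variable {Φ : ∀ (b : List C) (c : C), K.P.Op b c → Prop} {X Y Z : K.Env} {ψ : NiceGrading K.P}

/-- This is why the lowest vertex of a rooted tree always goes to the right factor. -/
theorem NiceGrading.nonneg_of_input {a l₁ l₂ : List C} {c d : C} (ψ : NiceGrading K.P)
    (p : K.P.Op a d) (ha : a = l₁ ++ c :: l₂) : 0 ≤ ψ.deg p := by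
  by_contra h
  have h1 := ψ.neg_one_le p
  have h2 := ψ.arity_eq_zero p (by omega)
  rw [ha] at h2
  simp at h2

theorem UpperTree.exists_fac (ψ : NiceGrading K.P) {f : X ⟶ Y} (hf : UpperTree K.P K.G K.rel Φ f) :
    ∃ (Z : K.Env) (l : X ⟶ Z) (r : Z ⟶ Y), UpperTree K.P K.G K.rel ψ.NegOneOrId l ∧
      UpperTree K.P K.G K.rel ψ.Nonneg r ∧ l ≫ r = f := by
  cases hf with
  | mk f hf =>
    obtain ⟨s, s', l, r, hl, hr, rfl⟩ := hf.exists_fac ψ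
    obtain rfl := hr.source
    exact ⟨_, l, r, .mk l hl, .mk r hr, rfl⟩

theorem RootedTree.exists_fac (ψ : NiceGrading K.P) {f : X ⟶ Y}
    (hf : RootedTree K.P K.G K.rel Φ f) :
    ∃ (Z : K.Env) (l : X ⟶ Z) (r : Z ⟶ Y), UpperTree K.P K.G K.rel ψ.NegOneOrId l ∧
      RootedTree K.P K.G K.rel ψ.Nonneg r ∧ l ≫ r = f := by
  cases hf with
  | mk f hf l₁ l₂ h₁ h₂ p hp =>
    obtain ⟨Z, l, r, hl, hr, rfl⟩ := (UpperTree.mk f hf).exists_fac ψ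
    exact ⟨Z, l, r ≫ K.mGraft l₁ l₂ h₁ h₂ p, hl,
      .of_upper hr h₁ h₂ p (ψ.nonneg_of_input p h₁), (Category.assoc _ _ _).symm⟩

theorem PermutedRootedTree.exists_fac (ψ : NiceGrading K.P) {f : X ⟶ Y}
    (hf : PermutedRootedTree K.P K.G K.rel Φ f) :
    ∃ (Z : K.Env) (l : X ⟶ Z) (r : Z ⟶ Y), UpperTree K.P K.G K.rel ψ.NegOneOrId l ∧
      PermutedRootedTree K.P K.G K.rel ψ.Nonneg r ∧ l ≫ r = f := by
  cases hf with
  | mk f hf σ =>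
    obtain ⟨Z, l, r, hl, hr, rfl⟩ := hf.exists_fac ψ
    exact ⟨Z, l, r ≫ K.mPerm σ _, hl, .mk r hr σ, (Category.assoc _ _ _).symm⟩

theorem PermutedRootedTree.of_rooted {f : X ⟶ Y} (hf : RootedTree K.P K.G K.rel Φ f)
    (σ : K.G Y.as.1 Y.as.1) (hσ : K.edge σ = Equiv.refl _) :
    PermutedRootedTree K.P K.G K.rel Φ f := by
  have h1 := (congrArg (f ≫ ·) (K.perm_id σ Y.as.2 hσ)).trans (Category.comp_id f)
  have h2 : PermutedRootedTree K.P K.G K.rel Φ (f ≫ K.mPerm σ Y.as.2) :=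
    .mk (a := Y.as.1) (d := Y.as.2) f hf σ
  exact h1 ▸ h2

end

namespace Kind

/-- The grading, as a map from objects of the twisted arrow category. -/
def onTw (K : Kind.{u, v} C) (ψ : NiceGrading K.P) (p : Tw K.eval) : Degree :=
  ⟨ψ.deg (a := p.1.as.1) (d := p.1.as.2) p.2, ψ.neg_one_le _⟩

theorem symm_nonneg {ψ : NiceGrading K.P} (hψ : Invariant ψ) : Symm (K := K) ψ.Nonneg :=
  fun σ x hx => hx.trans_eq (hψ σ x).symm

/-- An operation of grading $0$ is plugged into a unary variable. This is a tree with nonnegative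
vertices, and its evaluation at the identity preserves the grading, so the hypothesis makes it
invertible. -/
theorem Coherent.isGroupoidal (hK : K.Coherent) {ψ : NiceGrading K.P}
    (h : ∀ ⦃X Y : K.Env⦄ (r : X ⟶ Y) (p : K.eval.obj X), RootedTree K.P K.G K.rel ψ.Nonneg r →
      K.onTw ψ (K.eval.elementsMk X p) = K.onTw ψ (K.eval.elementsMk Y (K.eval.map r p)) →
        IsIso r) : ψ.IsGroupoidal := by
  refine hK.isGroupoidal_of_isIso fun {a d} p h₁ h₂ hp => ?_
  have h3 : K.mPlug [] [] h₁ h₂ p d = (K.mPlug [] [] h₁ h₂ p d ≫ 𝟙 _) ≫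
      K.mGraft [] [] h₁ h₂ (K.P.id d) := by
    rw [K.mGraft_id, Category.comp_id, Category.comp_id]
  have h4 : RootedTree K.P K.G K.rel ψ.Nonneg ((K.mPlug [] [] h₁ h₂ p d ≫ 𝟙 _) ≫
      K.mGraft [] [] h₁ h₂ (K.P.id d)) :=
    .mk _ (.cons [] [] p hp.ge h₁ h₂ _ (.refl (closed_nonneg ψ) h₂)) [] [] h₁ h₂ _
      (ψ.deg_id d).ge
  refine h _ (K.P.id d) (h3 ▸ h4) (Subtype.ext ?_)
  have := deg_plug (ψ := ψ) (l₁ := []) (l₂ := []) h₁ h₂ p (K.P.id d)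
  rw [hp, add_zero] at this
  exact this.symm

/-- The classes of morphisms of the enveloping category of a rooted operad. -/
theorem reedyData (hK : K.Coherent) (hR : K.Rooted) {ψ : NiceGrading K.P} (hψ : Invariant ψ)
    (hD : ψ.DependsOnColours) :
    ReedyData K.eval (K.onTw ψ) (UpperTree K.P K.G K.rel ψ.NegOneOrId)
      (fun _ _ f => RootedTree K.P K.G K.rel ψ.Nonneg f ∨
        PermutedRootedTree K.P K.G K.rel ψ.Nonneg f) ψ.IsGroupoidal := by
  have keeps : ∀ ⦃X Y : K.Env⦄ (r : X ⟶ Y), (RootedTree K.P K.G K.rel ψ.Nonneg r ∨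
      PermutedRootedTree K.P K.G K.rel ψ.Nonneg r) →
      hK.KeepsNonneg (a := X.as.1) (d := X.as.2) (b := Y.as.1) (e := Y.as.2) ψ r :=
    fun X Y r hr => hr.elim (Coherent.keepsNonneg_rooted hψ) (Coherent.keepsNonneg_permuted hψ)
  have raises : ∀ ⦃X Y : K.Env⦄ (r : X ⟶ Y), (RootedTree K.P K.G K.rel ψ.Nonneg r ∨
      PermutedRootedTree K.P K.G K.rel ψ.Nonneg r) →
      Raises (a := X.as.1) (d := X.as.2) (b := Y.as.1) (e := Y.as.2) ψ r :=
    fun X Y r hr => hr.elim raises_rooted (raises_permuted hψ)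
  refine
    { id_left := fun X => .mk _ (.refl (closed_negOneOrId ψ) rfl)
      comp_left := fun X Y Z f g hf hg => hf.comp (closed_negOneOrId ψ) hg
      comp_right := fun X Y Z f g hf hg => ?_
      exists_fac := fun X Y f => ?_
      epi_left := fun X Y f hf => ?_
      left_unique := fun X Y Z Z' l r l' r' hl hr hl' hr' h => ?_
      left_split := fun X Y l s hl h => ?_
      deg_left := fun X Y l hl p => ?_
      deg_right := fun X Y r hr p => (raises r hr).1 p
      isIso_of_deg_eq := fun X Y r hG hr p hp => (raises r hr).2 hG p (congrArg Subtype.val hp)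
      gpd_of_isIso := fun h => hK.isGroupoidal fun X Y r p hr => h r p (Or.inl hr)
      deg_congr := fun X p q => Subtype.ext (hD _ _ rfl) }
  · have hΦ : Symm (K := K) ψ.Nonneg := symm_nonneg hψ
    have hf' : TreeHom (a := Y.as.1) (d := Y.as.2) ψ.Nonneg f :=
      hf.elim (TreeHom.of_rootedTree hK) (TreeHom.of_permuted hK)
    exact TreeHom.rooted_or hK hΦ hR (hg.elim (hf'.rootedTree hK (closed_nonneg ψ) hΦ)
      (hf'.permuted hK (closed_nonneg ψ) hΦ))
  · rcases TreeHom.rooted_or hK (fun _ _ _ => trivial) hR (TreeHom.of_true hK f) with hf | hf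
    · obtain ⟨Z, l, r, hl, hr, h⟩ := hf.exists_fac ψ
      exact ⟨Z, l, r, hl, Or.inl hr, h⟩
    · obtain ⟨Z, l, r, hl, hr, h⟩ := hf.exists_fac ψ
      exact ⟨Z, l, r, hl, Or.inr hr, h⟩
  · cases hf with
    | mk f hf => exact hK.epi_upper hf
  · cases hl with
    | mk l hl =>
      obtain ⟨t, rfl, hl'⟩ := hl'.elim
      have hl' := Eq.mp (congrArg (Upper K.P K.G K.rel _ _ [] _) (Category.comp_id l')) hl'
      exact hK.upper_unique hl hl' r r' (fun i _ => (keeps r hr).track hψ i)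
        (fun i _ => (keeps r' hr').track hψ i) h
  · cases hl with
    | mk l hl =>
      refine hK.upper_eqToHom hl s fun i _ => ?_
      rw [h, hK.push_id]
      exact Fam.nonneg_track hψ i
  · cases hl with
    | mk l hl => exact (deg_upper hl).imp (fun h => h.1) fun h => h p

end Kind

/-- Without permutations, even identical ones, the second alternative in the right class is empty.
-/
theorem PlanarOperad.reedyData (P : PlanarOperad.{u, v} C) (ψ : NiceGrading P)
    (hD : ψ.DependsOnColours) :
    ReedyData P.eval ψ.onTw (P.rNeg ψ) (P.rNonneg ψ) ψ.IsGroupoidal := by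
  have h := P.kind.reedyData P.coherent P.rooted (ψ := ψ) (fun σ => Empty.elim σ) hD
  have h1 : P.rNonneg ψ = fun _ _ f => RootedTree P NoPerms P.rel ψ.Nonneg f ∨
      PermutedRootedTree P NoPerms P.rel ψ.Nonneg f := by
    funext X Y f
    refine propext ⟨Or.inl, fun h => h.elim (fun h => h) fun h => ?_⟩
    cases h with
    | mk f hf σ => exact Empty.elim σ
  rw [h1]
  exact h

/-- The identity permutation makes the first alternative in the right class a special case of the
second. -/
theorem SymmetricOperad.reedyData (P : SymmetricOperad.{u, v} C) (ψ : SymNiceGrading P)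
    (hD : ψ.DependsOnColours) :
    ReedyData P.eval ψ.onTw (P.rNeg ψ) (P.rNonneg ψ) ψ.IsGroupoidal := by
  have h := P.kind.reedyData P.coherent P.rooted (ψ := ψ.toNiceGrading) (fun σ => ψ.deg_act σ) hD
  have h1 : P.rNonneg ψ = fun _ _ f => RootedTree P.toPlanarOperad Perms P.rel ψ.Nonneg f ∨
      PermutedRootedTree P.toPlanarOperad Perms P.rel ψ.Nonneg f := by
    funext X Y f
    exact propext ⟨Or.inr, fun h => h.elim (fun h => PermutedRootedTree.of_rooted (K := P.kind) h
      (Perms.refl _) (Perms.edge_refl _)) fun h => h⟩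
  rw [h1]
  exact h

end EnvReedy

namespace EnvReedy

/-! ### Operations of arity zero at the edge zero -/

namespace CyclicOperad

variable {P : CyclicOperad.{v}} {a a₀ b r s l₁ l₂ m₁ : List Unit}

theorem exists_snoc (h : a ≠ []) : ∃ s, a = s ++ () :: [] :=
  ⟨a.tail, eq_of_length_eq (by simp; have := List.length_pos_iff.2 h; omega)⟩

theorem plug_rot_first_nullary {l₂ m₁ : List Unit}
    (h₁ : a = [] ++ () :: l₂) (h₂ : r = [] ++ [] ++ l₂)
    (h₃ : a = m₁ ++ () :: []) (h₄ : r = m₁ ++ [] ++ []) (q : P.Op [] ()) :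
    P.kind.mPlug [] l₂ h₁ h₂ q () ≫ P.kind.mPerm (rot r) () =
      P.kind.mPerm (rot a) () ≫ P.kind.mPerm (rot a) () ≫ P.kind.mPlug m₁ [] h₃ h₄ q () :=
  ((CategoryTheory.Quotient.functor P.rel).map_comp _ _).symm.trans
    ((CategoryTheory.Quotient.sound _ (.rot_comp_first_nullary_fst l₂ m₁ h₁ h₂ h₃ h₄ q)).trans
      (((CategoryTheory.Quotient.functor P.rel).map_comp _ _).trans
        (congrArg _ ((CategoryTheory.Quotient.functor P.rel).map_comp _ _))))

/-- The rotation lowers the number of the input by one, after which the two operations are plugged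
at different inputs and commute. -/
theorem plug_cap_other (h₁ : a = (() :: l₁) ++ () :: l₂) (h₂ : r = (() :: l₁) ++ b ++ l₂)
    (hr : r = s ++ () :: []) (hs : s = s ++ [] ++ []) (ha : a = a₀ ++ () :: [])
    (ha₀ : a₀ = a₀ ++ [] ++ []) (h₃ : a₀ = l₁ ++ () :: l₂) (h₄ : s = l₁ ++ b ++ l₂)
    (u : P.Op b ()) (q : P.Op [] ()) :
    P.kind.mPlug (() :: l₁) l₂ h₁ h₂ u () ≫ P.cap hr hs q =
      P.cap ha ha₀ q ≫ P.kind.mPlug l₁ l₂ h₃ h₄ u () := by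
  subst h₃ h₄
  have h5 : a = l₁ ++ () :: (l₂ ++ [()]) := by simp [ha]
  have h6 : r = l₁ ++ b ++ (l₂ ++ [()]) := by simp [hr]
  have h7 := P.kind.plug_plug_par (d := ()) l₁ l₂ [] h5 h6 hr hs ha ha₀ (by simp)
    (by simp) u q
  rw [Kind.mPlug_congr rfl (show l₂ ++ [] ++ [] = l₂ by simp)] at h7
  calc
    _ = (P.kind.mPlug (() :: l₁) l₂ h₁ h₂ u () ≫ P.kind.mPerm (rot r) ()) ≫
          P.kind.mPlug _ [] hr hs q () := (Category.assoc _ _ _).symm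
    _ = P.kind.mPerm (rot a) () ≫ P.kind.mPlug l₁ (l₂ ++ [()]) h5 h6 u () ≫
          P.kind.mPlug _ [] hr hs q () := by
      rw [plug_rot_other h₁ h₂ h5 h6, Category.assoc]
    _ = _ := (congrArg _ h7).trans (Category.assoc _ _ _).symm

/-- Once the edge $0$ is closed, the first input becomes the new edge $0$, and its operation of
arity $0$ becomes a cap. This is where the special axiom for arity $0$ enters. -/
theorem plug_cap_nullary (h₁ : a = [] ++ () :: l₂) (h₂ : r = [] ++ [] ++ l₂)
    (hr : r = s ++ () :: []) (hs : s = s ++ [] ++ []) (ha : a = a₀ ++ () :: [])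
    (ha₀ : a₀ = a₀ ++ [] ++ []) (h₃ : a₀ = s ++ () :: []) (u q : P.Op [] ()) :
    P.kind.mPlug [] l₂ h₁ h₂ u () ≫ P.cap hr hs q = P.cap ha ha₀ q ≫ P.cap h₃ hs u := by
  subst h₃
  have h4 : r = (s ++ () :: []) ++ [] ++ [] := by rw [hr]; simp
  have h5 : a = s ++ () :: ([] ++ () :: []) := by simp [ha]
  have h6 : s ++ () :: [] = s ++ [] ++ ([] ++ () :: []) := by simp
  subst hr
  have hr : s ++ () :: [] = s ++ () :: [] := rfl
  have h7 := P.kind.plug_plug_par (d := ()) s [] [] h5 h6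
    (by simp : s ++ () :: [] = (s ++ [] ++ []) ++ () :: []) (by simp : s = (s ++ [] ++ []) ++ [] ++ [])
    ha h4 (by simp) (by simp) q u
  rw [Kind.mPlug_congr (show s ++ [] ++ [] = s by simp) rfl,
    Kind.mPlug_congr (l := s) rfl (show ([] : List Unit) ++ [] ++ [] = [] from rfl)] at h7
  have h8 : a = (() :: s) ++ () :: [] := eq_of_length_eq (by simp [ha])
  have h9 : s ++ () :: [] = (() :: s) ++ [] ++ [] := eq_of_length_eq (by simp)
  have h10 := plug_rot_other (P := P) h8 h9 h5 h6 q
  have h11 : P.kind.mPlug (() :: s) [] h8 h9 q () =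
      P.kind.mPlug (s ++ () :: []) [] ha ha₀ q () :=
    Kind.mPlug_congr (eq_of_length_eq (by simp)) rfl _ _ _
  calc
    _ = (P.kind.mPlug [] l₂ h₁ h₂ u () ≫ P.kind.mPerm (rot _) ()) ≫
          P.kind.mPlug _ [] hr hs q () := (Category.assoc _ _ _).symm
    _ = P.kind.mPerm (rot a) () ≫ P.kind.mPerm (rot a) () ≫
          P.kind.mPlug (s ++ () :: []) [] ha h4 u () ≫ P.kind.mPlug s [] hr hs q () := by
      rw [plug_rot_first_nullary h₁ h₂ ha h4, Category.assoc, Category.assoc]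
    _ = P.kind.mPerm (rot a) () ≫ (P.kind.mPerm (rot a) () ≫
          P.kind.mPlug s ([] ++ () :: []) h5 h6 q ()) ≫ P.kind.mPlug s [] hr hs u () := by
      rw [← h7, Category.assoc]
    _ = _ := by
      refine (congrArg (fun x => P.kind.mPerm (rot a) () ≫ x ≫ P.kind.mPlug s [] hr hs u ())
        (h10.symm.trans (congrArg (· ≫ P.kind.mPerm (rot _) ()) h11))).trans ?_
      simp only [Category.assoc]

/-- The first input again becomes the edge $0$, but now its operation has an input. Rotated, it
becomes the lowest vertex of the tree. -/
theorem plug_cap_first (h₁ : a = [] ++ () :: l₂) (h₂ : r = [] ++ b ++ l₂) (h₃ : b = m₁ ++ () :: [])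
    (hr : r = s ++ () :: []) (hs : s = s ++ [] ++ []) (ha : a = a₀ ++ () :: [])
    (ha₀ : a₀ = a₀ ++ [] ++ []) (h₄ : s = m₁ ++ a₀ ++ []) (u : P.Op b ()) (q : P.Op [] ()) :
    P.kind.mPlug [] l₂ h₁ h₂ u () ≫ P.cap hr hs q =
      P.cap ha ha₀ q ≫ P.kind.mGraft m₁ [] h₃ h₄ (P.cact (rot b) u) := by
  have h5 : r = m₁ ++ a ++ [] := eq_of_length_eq (by rw [hr, ha, h₄]; simp)
  have h6 : s = m₁ ++ a₀ := by simp [h₄]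
  subst h6
  have h7 := P.kind.graft_plug_seq m₁ [] a₀ [] h₃ h5 hr hs ha ha₀ h₄ (P.cact (rot b) u) q
  calc
    _ = (P.kind.mPlug [] l₂ h₁ h₂ u () ≫ P.kind.mPerm (rot r) ()) ≫
          P.kind.mPlug _ [] hr hs q () := (Category.assoc _ _ _).symm
    _ = P.kind.mPerm (rot a) () ≫ P.kind.mGraft m₁ [] h₃ h5 (P.cact (rot b) u) ≫
          P.kind.mPlug _ [] hr hs q () := by
      rw [plug_rot_first h₁ h₂ h₃ h5, Category.assoc]
    _ = _ := (congrArg _ h7).trans (Category.assoc _ _ _).symm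

theorem exists_plug_cap (h₁ : a = l₁ ++ () :: l₂) (h₂ : r = l₁ ++ b ++ l₂)
    (hr : r = s ++ () :: []) (hs : s = s ++ [] ++ []) (u : P.Op b ()) (q : P.Op [] ()) :
    ∃ (a₀ : List Unit) (ha : a = a₀ ++ () :: []) (ha₀ : a₀ = a₀ ++ [] ++ [])
      (m : P.kind.ob a₀ () ⟶ P.kind.ob s ()),
      P.kind.mPlug l₁ l₂ h₁ h₂ u () ≫ P.cap hr hs q = P.cap ha ha₀ q ≫ m := by
  obtain ⟨a₀, ha⟩ := exists_snoc (a := a) (by rw [h₁]; simp)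
  have hl := congrArg List.length (hr.symm.trans h₂)
  have hl' := congrArg List.length (ha.symm.trans h₁)
  simp only [List.length_append, List.length_cons, List.length_nil] at hl hl'
  refine ⟨a₀, ha, by simp, ?_⟩
  rcases l₁ with _ | ⟨⟨⟩, l₁⟩
  · by_cases hb : b = []
    · subst hb
      simp only [List.length_nil] at hl hl'
      exact ⟨_, plug_cap_nullary h₁ h₂ hr hs ha _ (eq_of_length_eq (by simp; omega)) u q⟩
    · obtain ⟨m₁, h₃⟩ := exists_snoc hb
      have := congrArg List.length h₃
      simp only [List.length_append, List.length_cons, List.length_nil] at this hl hl'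
      exact ⟨_, plug_cap_first h₁ h₂ h₃ hr hs ha _ (eq_of_length_eq (by simp; omega)) u q⟩
  · simp only [List.length_cons] at hl hl'
    exact ⟨_, plug_cap_other h₁ h₂ hr hs ha _ (eq_of_length_eq (by simp; omega))
      (eq_of_length_eq (by simp; omega)) u q⟩

/-- A cap can be applied before all other vertices. The remainder `m` need not be an upper tree,
since a vertex may have moved to the edge $0$; it is factored anew in the induction that uses this.
-/
theorem exists_upper_cap {Φ : ∀ (b : List Unit) (c : Unit), P.Op b c → Prop} {pre todo : List Unit}
    {f : P.kind.ob a () ⟶ P.kind.ob r ()}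
    (hf : Upper P.toPlanarOperad CycPerms P.rel Φ () pre todo f) (hr : r = s ++ () :: [])
    (hs : s = s ++ [] ++ []) (q : P.Op [] ()) :
    ∃ (a₀ : List Unit) (ha : a = a₀ ++ () :: []) (ha₀ : a₀ = a₀ ++ [] ++ [])
      (m : P.kind.ob a₀ () ⟶ P.kind.ob s ()), f ≫ P.cap hr hs q = P.cap ha ha₀ q ≫ m := by
  induction hf with
  | nil pre => exact ⟨s, hr, hs, 𝟙 _, (Category.id_comp _).trans (Category.comp_id _).symm⟩
  | cons pre todo u hu h₁ h₂ g hg ih =>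
    obtain ⟨r₀, hr₀, hr₁, m, hm⟩ := ih hr
    obtain ⟨a₀, ha, ha₀, m', hm'⟩ := exists_plug_cap h₁ h₂ hr₀ hr₁ u q
    refine ⟨a₀, ha, ha₀, m' ≫ m, ?_⟩
    calc
      _ = P.kind.mPlug pre todo h₁ h₂ u () ≫ g ≫ P.cap hr hs q := Category.assoc _ _ _
      _ = (P.kind.mPlug pre todo h₁ h₂ u () ≫ P.cap hr₀ hr₁ q) ≫ m :=
        (congrArg _ hm).trans (Category.assoc _ _ _).symm
      _ = _ := (congrArg (· ≫ m) hm').trans (Category.assoc _ _ _)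

end CyclicOperad

end EnvReedy

namespace EnvReedy

/-! ### Trees for cyclic operads -/

section

variable {P : CyclicOperad.{v}} {Φ Ψ : ∀ (b : List Unit) (c : Unit), P.Op b c → Prop}
  {X Y Z : P.kind.Env} {a r : List Unit}

theorem CyclicOperad.exists_perm {H : Kind.Act.{0, v, w} P.kind} {S S' : LState H} (h : S ≈ S') :
    ∃ σ : CycPerms S.a S'.a, H.map (P.kind.mPerm σ ()) S.x = S'.x := by
  rcases h with rfl | ⟨ha, ha', hd, hd', hn, hn', x, σ, hm⟩
  · refine ⟨CycPerms.refl _, ?_⟩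
    have := LState.mPerm_refl (K := P.kind) (CycPerms.refl S.a) () rfl
    exact (congrArg (fun g => H.map g S.x) this).trans (H.map_id _)
  · exact ⟨σ, rfl⟩

/-- The morphism is represented by a tree with the vertices marked by operations from the class, so
that the vertex grafted to the edge `0` of the source vertex has arity `0`. -/
def CapTree (Φ : ∀ (b : List Unit) (c : Unit), P.Op b c → Prop) (f : X ⟶ Y) : Prop :=
  ∃ (a r : List Unit) (f₀ : X ⟶ P.kind.ob a ()) (ha : a = r ++ () :: []) (hr : r = r ++ [] ++ [])
    (q : P.Op [] ()) (σ : CycPerms r Y.as.1),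
    UpperTree P.kind.P P.kind.G P.kind.rel Φ f₀ ∧ Φ [] () q ∧
      f = f₀ ≫ P.cap ha hr q ≫ P.kind.mPerm σ ()

namespace TreeHom

theorem upperTree (hΦ : P.kind.Closed Φ) (hΦ' : Kind.Symm (K := P.kind) Φ) {f : X ⟶ Y}
    (hf : TreeHom (K := P.kind) (a := Y.as.1) (d := Y.as.2) Φ f) {g : Y ⟶ Z}
    (hg : UpperTree P.kind.P P.kind.G P.kind.rel Φ g) :
    TreeHom (K := P.kind) (a := Z.as.1) (d := Z.as.2) Φ (f ≫ g) := by
  cases hg with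
  | mk g hg => exact hf.upper P.coherent hΦ hΦ' hg

theorem cap (hΦ : P.kind.Closed Φ) (hΦ' : Kind.Symm (K := P.kind) Φ)
    {f : X ⟶ P.kind.ob a ()} (hf : TreeHom Φ f) (ha : a = r ++ () :: []) (hr : r = r ++ [] ++ [])
    {q : P.Op [] ()} (hq : Φ [] () q) : TreeHom (K := P.kind) Φ (f ≫ P.cap ha hr q) :=
  Eq.mp (congrArg (TreeHom (K := P.kind) Φ) (Category.assoc _ _ _))
    ((hf.perm (rot a)).plug P.coherent hΦ hΦ' ha hr hq)

theorem capTree (hΦ : P.kind.Closed Φ) (hΦ' : Kind.Symm (K := P.kind) Φ) {f : X ⟶ Y}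
    (hf : TreeHom (K := P.kind) (a := Y.as.1) (d := Y.as.2) Φ f) {g : Y ⟶ Z}
    (hg : CapTree Φ g) : TreeHom (K := P.kind) (a := Z.as.1) (d := Z.as.2) Φ (f ≫ g) := by
  obtain ⟨a, r, g₀, ha, hr, q, σ, hg₀, hq, rfl⟩ := hg
  have := ((hf.upperTree hΦ hΦ' hg₀).cap hΦ hΦ' ha hr hq).perm σ
  refine Eq.mp (congrArg (TreeHom (K := P.kind) Φ) ?_) this
  exact (Category.assoc _ _ _).trans (Category.assoc _ _ _)

/-- In the exceptional case an operation of arity $0$ sits at the output of the upper part. One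
rotation turns this output into the last input, where the operation is plugged, and a permutation of
leaves remains. -/
theorem cyclic_or (hΦ' : Kind.Symm (K := P.kind) Φ) {f : X ⟶ Y}
    (hf : TreeHom (K := P.kind) (a := Y.as.1) (d := Y.as.2) Φ f) :
    (RootedTree P.kind.P P.kind.G P.kind.rel Φ f ∨
      PermutedRootedTree P.kind.P P.kind.G P.kind.rel Φ f) ∨ CapTree Φ f := by
  obtain ⟨μ⟩ := Lab.exists_lab Y.as.1 Y.as.2
  refine ((hf μ).cases P.coherent hΦ').imp_right ?_
  rintro ⟨-, S, Q, hS, hQ, hz, hL, h⟩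
  have hm := IsTree.mem_iff List.mem_cons_self h μ.z
  obtain ⟨k, L, b, d, hb, hd, hn, q⟩ := Q
  dsimp only at hz hL hQ
  subst hz hL hb
  -- The upper part has an input, since the result of gluing needs an output that is not the glued
  -- edge.
  obtain ⟨y, A, hA⟩ : ∃ y A, S.L = y :: A := by
    rcases hSL : S.L with _ | ⟨y, A⟩
    · rw [hSL] at hm
      obtain ⟨h1, h2⟩ := hm.1 List.mem_cons_self
      simp only [List.mem_singleton, or_self] at h1
      exact absurd h1 h2
    · exact ⟨y, A, rfl⟩
  have hn := (CyclicOperad.rotState S y A hA).nodup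
  have hr : A.map Prod.snd = A.map Prod.snd ++ [] ++ [] := by simp
  have ha : S.a = A.map Prod.snd ++ () :: [] :=
    eq_of_length_eq (by simp [S.ha, hA])
  have hV := GlueRel.plug (H := P.kind.homAct X) (k := S.z) (CyclicOperad.rotState S y A hA)
    ⟨S.z, [], [], d, rfl, hd, List.nodup_singleton _, q⟩ A [] A rfl rfl (by simp)
    (A.map Prod.snd) [] (A.map Prod.snd) rfl rfl ha hr rfl
    (by
      have := hn
      simp only [CyclicOperad.rotState] at this ⊢
      rw [← List.cons_append] at this
      exact (List.nodup_append'.1 this).1) _ rfl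
  have h2 := (P.coherent.hom X).glue_eq (Setoid.symm (CyclicOperad.rotState_equiv S y A hA))
    (Setoid.refl _) hV
  obtain ⟨σ, hσ⟩ := CyclicOperad.exists_perm (LState.cls_eq.1 (h2.symm.trans h))
  refine ⟨S.a, A.map Prod.snd, S.x, ha, hr, q, σ, hS, hQ, ?_⟩
  refine hσ.symm.trans ?_
  exact (Category.assoc _ _ _).trans (Category.assoc _ _ _)

end TreeHom

end

end EnvReedy

/-! ### Tracking of edges past a vertex at the edge $0$. -/

namespace EnvReedy

variable {C : Type u} {K : Kind.{u, v} C}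

namespace Fam

variable {a b r : List C} {c d : C}

theorem track_val_of_lt {i : ℕ} (hi : a.length < i) (μ : Lab a d) :
    (track i : Fam K.opAct a d).val μ = none := by
  have : (μ.z :: μ.L)[i]? = none := by
    rw [List.getElem?_eq_none]
    have := congrArg List.length μ.hL
    simp at this ⊢
    omega
  simp only [track]
  rw [this]
  rfl

/-- Tracking beyond the arity gives undefined classes, for every such index. Rules for shifting
indices then hold without bounds. -/
theorem plug_track_of_lt (hO : GlueLaws K.opAct) {l₁ l₂ : List C} (ha : a = l₁ ++ c :: l₂)
    (hr : r = l₁ ++ b ++ l₂) (q : K.P.Op b c) {i j : ℕ} (hi : a.length < i) (hj : r.length < j) :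
    plug hO ha hr q (track i : Fam K.opAct a d) = track j := by
  ext1
  funext ρ
  obtain ⟨⟨μ, ν⟩, hs⟩ := exists_split' ha hr ρ
  rw [plug_val hO ha hr _ _ hs, track_val_of_lt hi, track_val_of_lt hj]
  exact glue_of_not_has (Cls.not_has_none _)

theorem perm_track_of_lt (σ : K.G a b) {i j : ℕ} (hi : a.length < i) (hj : b.length < j) :
    perm σ (track i : Fam K.opAct a d) = track j := by
  ext1
  funext ρ
  obtain ⟨μ, hμ⟩ := Lab.exists_permute σ ρ
  rw [perm_val σ _ hμ, track_val_of_lt hi, track_val_of_lt hj]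

end Fam

namespace CyclicOperad

variable {P : CyclicOperad.{v}} {a r : List Unit}

theorem push_cap (ha : a = r ++ () :: []) (hr : r = r ++ [] ++ []) (q : P.Op [] ())
    (φ : Fam P.kind.opAct a ()) : P.coherent.push (P.cap ha hr q) φ =
      Fam.plug P.coherent.op ha hr q (Fam.perm (K := P.kind) (rot a) φ) := by
  refine (P.coherent.push_comp (P.kind.mPerm (rot a) ()) (P.kind.mPlug r [] ha hr q ()) φ).trans ?_
  rw [P.coherent.push_perm]
  exact P.coherent.push_plug _ _ _ _

/-- The rotation carries the edge $0$ to the last position, where the cap is plugged, so this edge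
reveals the cap. -/
theorem push_cap_zero (ha : a = r ++ () :: []) (hr : r = r ++ [] ++ []) (q : P.Op [] ()) :
    P.coherent.push (P.cap ha hr q) (Fam.track 0) = Fam.const q := by
  have h := Fam.perm_track (K := P.kind) (d := ()) P.coherent.op (rot a) (Fin.last a.length)
  have h1 : finRotate (a.length + 1) (Fin.last a.length) = 0 := finRotate_last
  rw [push_cap]
  refine Eq.trans ?_ (Fam.plug_track_nullary (d := ()) P.coherent.op ha hr q)
  refine congrArg _ (Eq.trans ?_ (h.trans ?_))
  · exact congrArg (fun j : Fin (a.length + 1) => Fam.perm (K := P.kind) (rot a)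
      (Fam.track (j : ℕ) : Fam P.kind.opAct a ())) h1.symm
  · exact congrArg Fam.track (by simp [ha])

/-- The other edges survive with numbers lowered by one, so the first input is the new edge $0$. -/
theorem push_cap_succ (ha : a = r ++ () :: []) (hr : r = r ++ [] ++ []) (q : P.Op [] ()) (j : ℕ) :
    P.coherent.push (P.cap ha hr q) (Fam.track (j + 1)) = Fam.track j := by
  have hl : a.length = r.length + 1 := by simp [ha]
  rw [push_cap]
  by_cases hj : j < a.length
  · have h := Fam.perm_track (K := P.kind) (d := ()) P.coherent.op (rot a) (Fin.castSucc ⟨j, hj⟩)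
    have h1 : finRotate (a.length + 1) (Fin.castSucc ⟨j, hj⟩) = Fin.succ ⟨j, hj⟩ := finRotate_of_lt hj
    refine Eq.trans (congrArg _ (Eq.trans ?_ h))
      (Fam.plug_track_of_le (d := ()) P.coherent.op ha hr q (i := j) (by omega))
    exact congrArg (fun j : Fin (a.length + 1) => Fam.perm (K := P.kind) (rot a)
      (Fam.track (j : ℕ) : Fam P.kind.opAct a ())) h1.symm
  · rw [Fam.perm_track_of_lt (K := P.kind) (d := ()) (rot a) (i := j + 1) (j := j + 1) (by omega)
      (by omega)]
    exact Fam.plug_track_of_lt (K := P.kind) P.coherent.op ha hr q (i := j + 1) (j := j) (by omega)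
      (by omega)

end CyclicOperad

end EnvReedy

namespace EnvReedy

/-! ### Classes of morphisms for cyclic operads -/

namespace CyclicOperad

variable {P : CyclicOperad.{v}} {ψ : SymNiceGrading P.toSymmetricOperad} {X Y Z : P.kind.Env}
  {a b r t l₁ l₂ : List Unit}

/-- Invariance under the action of $S_{n+1}$ is not part of a nice grading. It follows from the
dependence on arity alone, as a permutation relates lists of the same length over one colour. -/
theorem invariant (hD : ψ.DependsOnColours) : Kind.Invariant (K := P.kind) ψ.toNiceGrading := by
  intro a b d σ x
  have e : (show Type from CycPerms a b) = (Fin (b.length + 1) ≃ Fin (a.length + 1)) := rfl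
  have h := Fin.equiv_iff_eq.1 ⟨cast e σ⟩
  obtain rfl : a = b := eq_of_length_eq (by omega)
  exact hD _ _ rfl

namespace RNeg

theorem of_eq {f g : X ⟶ Y} (hf : P.RNeg ψ f) (h : f = g) : P.RNeg ψ g := h ▸ hf

/-- A vertex added after a cap is moved in front of it. Its input number increases by one, so it is
never the first input, and it stays a vertex of the upper tree. -/
theorem plug {f : X ⟶ P.kind.ob a ()} (hf : P.RNeg ψ f) (ha : a = l₁ ++ () :: l₂)
    (hr : r = l₁ ++ b ++ l₂) (u : P.Op b ()) (hu : ψ.NegOneOrId b () u) :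
    P.RNeg ψ (f ≫ P.kind.mPlug l₁ l₂ ha hr u ()) := by
  have hΦ := Kind.closed_negOneOrId (K := P.kind) ψ.toNiceGrading
  cases hf with
  | upper f hf => exact .upper _ (UpperTree.plug (K := P.kind) hΦ hf ha hr u hu)
  | cap f hf hb hs q hq =>
    have h1 := eq_of_length_eq (a := (() :: l₁) ++ () :: l₂) (b := a ++ [()])
      (by simp [ha]; omega)
    have h2 := eq_of_length_eq (a := (() :: l₁) ++ b ++ l₂) (b := r ++ [()])
      (by simp [hr]; omega)
    have h3 : r = r ++ [] ++ [] := by simp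
    have h4 := plug_cap_other (P := P) (hb.trans h1.symm) rfl h2 h3 hb hs ha hr u q
    have h5 := RNeg.cap (ψ := ψ) _
      (UpperTree.plug (K := P.kind) hΦ hf (hb.trans h1.symm) rfl u hu) h2 h3 q hq
    refine h5.of_eq ?_
    exact (Category.assoc _ _ _).trans ((congrArg _ h4).trans (Category.assoc _ _ _).symm)

theorem upper_comp {f : X ⟶ P.kind.ob a ()} (hf : P.RNeg ψ f) {pre todo : List Unit}
    {g : P.kind.ob a () ⟶ P.kind.ob t ()}
    (hg : Upper P.toPlanarOperad CycPerms P.rel ψ.NegOneOrId () pre todo g) :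
    P.RNeg ψ (f ≫ g) := by
  induction hg with
  | nil => rwa [Category.comp_id]
  | cons pre todo q hq ha ha' g hg ih =>
    exact (ih (hf.plug ha ha' q hq)).of_eq (Category.assoc _ _ _)

/-- A second cap closes what was the first input before the first cap, so it becomes an ordinary
vertex there and only one cap remains. -/
theorem cap_comp {f : X ⟶ P.kind.ob a ()} (hf : P.RNeg ψ f) (ha : a = r ++ () :: [])
    (hr : r = r ++ [] ++ []) (q : P.Op [] ()) (hq : ψ.deg q = -1) :
    P.RNeg ψ (f ≫ P.cap ha hr q) := by
  have hΦ := Kind.closed_negOneOrId (K := P.kind) ψ.toNiceGrading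
  cases hf with
  | upper f hf => exact .cap f hf ha hr q hq
  | @cap a₁ _ f hf hb hs q₀ hq₀ =>
    have h1 : a₁ = [] ++ () :: a := eq_of_length_eq (by simp [hb])
    have h2 : a = [] ++ [] ++ a := rfl
    have h4 := plug_cap_nullary (P := P) h1 h2 ha hr hb hs ha q q₀
    have h5 := RNeg.cap (ψ := ψ) _
      (UpperTree.plug (K := P.kind) hΦ hf h1 h2 q (Or.inr hq)) ha hr q₀ hq₀
    refine h5.of_eq ?_
    exact (Category.assoc _ _ _).trans ((congrArg _ h4).trans (Category.assoc _ _ _).symm)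

theorem upperTree_comp {f : X ⟶ Y} (hf : P.RNeg ψ f) {g : Y ⟶ Z}
    (hg : UpperTree P.toPlanarOperad CycPerms P.rel ψ.NegOneOrId g) : P.RNeg ψ (f ≫ g) := by
  cases hg with
  | mk g hg => exact hf.upper_comp hg

theorem comp {f : X ⟶ Y} (hf : P.RNeg ψ f) {g : Y ⟶ Z} (hg : P.RNeg ψ g) : P.RNeg ψ (f ≫ g) := by
  cases hg with
  | upper g hg => exact hf.upperTree_comp hg
  | cap g hg ha hr q hq =>
    exact ((hf.upperTree_comp hg).cap_comp ha hr q hq).of_eq (Category.assoc _ _ _)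

theorem id (X : P.kind.Env) : P.RNeg ψ (𝟙 X) :=
  .upper _ (.mk _ (Upper.refl (K := P.kind) (Kind.closed_negOneOrId (K := P.kind) ψ.toNiceGrading)
    (pre := []) rfl))

end RNeg

instance epi_cap (ha : a = r ++ () :: []) (hr : r = r ++ [] ++ []) (q : P.Op [] ()) :
    Epi (P.cap ha hr q) := by
  have h1 := Kind.isIso_perm (K := P.kind) (d := ()) (rot a)
  have h2 := P.coherent.epi_plug (d := ()) ha hr q
  exact epi_comp (C := P.kind.Env) _ _

theorem RNeg.epi {f : X ⟶ Y} (hf : P.RNeg ψ f) : Epi f := by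
  have key : ∀ {X Y : P.kind.Env} {f : X ⟶ Y},
      UpperTree P.toPlanarOperad CycPerms P.rel ψ.NegOneOrId f → Epi f := by
    intro X Y f hf
    cases hf with
    | mk f hf => exact P.coherent.epi_upper hf
  cases hf with
  | upper f hf => exact key hf
  | cap f hf ha hr q hq =>
    have := key hf
    have := P.epi_cap ha hr q
    exact epi_comp (C := P.kind.Env) _ _

theorem rNonneg_iff {f : X ⟶ Y} : P.RNonneg ψ f ↔
    PermutedRootedTree P.toPlanarOperad CycPerms P.rel ψ.Nonneg f ∨
      CapTree (P := P) ψ.Nonneg f := by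
  constructor
  · intro h
    cases h with
    | rooted f hf => exact Or.inl hf
    | cap f hf ha hr q hq σ => exact Or.inr ⟨_, _, f, ha, hr, q, σ, hf, hq, rfl⟩
  · rintro (h | ⟨a, r, f₀, ha, hr, q, σ, hf, hq, rfl⟩)
    · exact .rooted f h
    · exact .cap f₀ hf ha hr q hq σ

theorem permuted_of_rooted {Φ : ∀ (b : List Unit) (c : Unit), P.Op b c → Prop} {f : X ⟶ Y}
    (hf : RootedTree P.toPlanarOperad CycPerms P.rel Φ f) :
    PermutedRootedTree P.toPlanarOperad CycPerms P.rel Φ f :=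
  PermutedRootedTree.of_rooted (K := P.kind) hf (CycPerms.refl _) rfl

theorem rNonneg_of_treeHom (hD : ψ.DependsOnColours) {f : X ⟶ Y}
    (hf : TreeHom (K := P.kind) (a := Y.as.1) (d := Y.as.2) ψ.Nonneg f) : P.RNonneg ψ f :=
  rNonneg_iff.2 ((hf.cyclic_or (Kind.symm_nonneg (invariant hD))).imp_left fun h =>
    h.elim permuted_of_rooted _root_.id)

theorem RNonneg.comp (hD : ψ.DependsOnColours) {f : X ⟶ Y} {g : Y ⟶ Z} (hf : P.RNonneg ψ f)
    (hg : P.RNonneg ψ g) : P.RNonneg ψ (f ≫ g) := by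
  have hΦ := Kind.closed_nonneg (K := P.kind) ψ.toNiceGrading
  have hΦ' : Kind.Symm (K := P.kind) ψ.Nonneg := Kind.symm_nonneg (invariant hD)
  have key : ∀ {X Y Z : P.kind.Env} {f : X ⟶ Y} {g : Y ⟶ Z},
      TreeHom (K := P.kind) (a := Y.as.1) (d := Y.as.2) ψ.Nonneg f → P.RNonneg ψ g →
        TreeHom (K := P.kind) (a := Z.as.1) (d := Z.as.2) ψ.Nonneg (f ≫ g) := by
    intro X Y Z f g hf hg
    exact (rNonneg_iff.1 hg).elim (hf.permuted P.coherent hΦ hΦ') (hf.capTree hΦ hΦ')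
  have h1 := key (TreeHom.id (K := P.kind) (a := X.as.1) (d := X.as.2) P.coherent hΦ) hf
  exact rNonneg_of_treeHom hD (key (Eq.mp (congrArg (TreeHom (K := P.kind) (a := Y.as.1)
    (d := Y.as.2) ψ.Nonneg) (Category.id_comp f)) h1) hg)

/-- Only a cap of grading $-1$ needs more than the rooted argument. It is applied first, and the
rest starts from a profile of smaller arity, to which the induction applies. -/
theorem exists_fac (ψ : SymNiceGrading P.toSymmetricOperad) (n : ℕ) {X Y : P.kind.Env} (f : X ⟶ Y)
    (hn : X.as.1.length = n) :
    ∃ (Z : P.kind.Env) (l : X ⟶ Z) (r : Z ⟶ Y), P.RNeg ψ l ∧ P.RNonneg ψ r ∧ l ≫ r = f := by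
  induction n using Nat.strong_induction_on generalizing X with
  | _ n ih =>
    rcases (TreeHom.of_true P.coherent f).cyclic_or fun _ _ _ => trivial with (hf | hf) | hf
    · obtain ⟨Z, l, r, hl, hr, h⟩ := hf.exists_fac (K := P.kind) ψ.toNiceGrading
      exact ⟨Z, l, r, .upper l hl, .rooted r (permuted_of_rooted hr), h⟩
    · obtain ⟨Z, l, r, hl, hr, h⟩ := hf.exists_fac (K := P.kind) ψ.toNiceGrading
      exact ⟨Z, l, r, .upper l hl, .rooted r hr, h⟩
    · obtain ⟨a, s, f₀, ha, hs, q, σ, hf₀, -, rfl⟩ := hf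
      by_cases hq : 0 ≤ ψ.deg q
      · obtain ⟨Z, l, r, hl, hr, rfl⟩ := hf₀.exists_fac (K := P.kind) ψ.toNiceGrading
        exact ⟨Z, l, r ≫ P.cap ha hs q ≫ P.kind.mPerm σ (), .upper l hl,
          .cap r hr ha hs q hq σ, (Category.assoc _ _ _).symm⟩
      · have hq : ψ.deg q = -1 := by
          have := ψ.neg_one_le q
          omega
        obtain ⟨t, ht, hf₁⟩ := hf₀.elim
        obtain rfl : a = t := congrArg (fun Z : P.kind.Env => Z.as.1) ht
        have hf₁ := Eq.mp (congrArg (Upper P.toPlanarOperad CycPerms P.rel _ () [] X.as.1)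
          (Category.comp_id f₀)) hf₁
        obtain ⟨a₀, ha₀, hs₀, m, hm⟩ := exists_upper_cap hf₁ ha hs q
        -- The cap consumes one edge of the source.
        obtain ⟨Z, l, r, hl, hr, h⟩ := ih a₀.length (by rw [← hn, ha₀]; simp)
          (X := P.kind.ob a₀ ()) (m ≫ P.kind.mPerm σ ()) rfl
        refine ⟨Z, P.cap ha₀ hs₀ q ≫ l, r, ?_, hr, ?_⟩
        · have := (RNeg.id (ψ := ψ) (P.kind.ob X.as.1 ())).cap_comp ha₀ hs₀ q hq
          exact (this.of_eq (Category.id_comp _)).comp hl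
        · refine (Category.assoc _ _ _).trans ((congrArg _ h).trans ?_)
          refine (Category.assoc _ _ _).symm.trans ((congrArg (· ≫ P.kind.mPerm σ ()) hm.symm).trans ?_)
          exact Category.assoc f₀ (P.cap ha hs q) (P.kind.mPerm σ ())

end CyclicOperad

end EnvReedy

namespace EnvReedy

/-! ### Uniqueness of factorizations for cyclic operads -/

namespace CyclicOperad

variable {P : CyclicOperad.{v}} {ψ : SymNiceGrading P.toSymmetricOperad} {a b r s t x : List Unit}

theorem _root_.EnvReedy.UpperTree.upper {Φ : ∀ (b : List Unit) (c : Unit), P.Op b c → Prop}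
    {l : P.kind.ob x () ⟶ P.kind.ob t ()} (hl : UpperTree P.toPlanarOperad CycPerms P.rel Φ l) :
    Upper P.toPlanarOperad CycPerms P.rel Φ () [] x l := by
  obtain ⟨t', h, hl⟩ := UpperTree.elim (K := P.kind) hl
  obtain rfl := congrArg (fun Z : P.kind.Env => Z.as.1) h
  exact Eq.mp (congrArg (Upper P.toPlanarOperad CycPerms P.rel Φ () [] x) (Category.comp_id l)) hl

theorem RNeg.elim {l : P.kind.ob x () ⟶ P.kind.ob s ()} (hl : P.RNeg ψ l) :
    Upper P.toPlanarOperad CycPerms P.rel ψ.NegOneOrId () [] x l ∨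
    ∃ (t : List Unit) (f : P.kind.ob x () ⟶ P.kind.ob t ()) (ht : t = s ++ () :: [])
      (hs : s = s ++ [] ++ []) (q : P.Op [] ()),
      Upper P.toPlanarOperad CycPerms P.rel ψ.NegOneOrId () [] x f ∧ ψ.deg q = -1 ∧
        l = f ≫ P.cap ht hs q := by
  cases hl with
  | upper l hl => exact Or.inl hl.upper
  | cap f hf ht hs q hq => exact Or.inr ⟨_, f, ht, hs, q, hf.upper, hq, rfl⟩

theorem push_upper_zero {f : P.kind.ob a () ⟶ P.kind.ob t ()} {todo : List Unit}
    (hf : Upper P.toPlanarOperad CycPerms P.rel ψ.NegOneOrId () [] todo f)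
    (s : P.kind.ob t () ⟶ P.kind.ob r ()) :
    P.coherent.push (f ≫ s) (Fam.track 0) = P.coherent.push s (Fam.track 0) :=
  (P.coherent.push_comp f s _).trans
    (congrArg _ (P.coherent.push_upper hf (Nat.zero_le _)))

theorem push_cap_comp_zero (ht : t = b ++ () :: []) (hb : b = b ++ [] ++ []) (q : P.Op [] ())
    (s : P.kind.ob b () ⟶ P.kind.ob r ()) :
    P.coherent.push (P.cap ht hb q ≫ s) (Fam.track 0) = Fam.const q :=
  (P.coherent.push_comp (P.cap ht hb q) s _).trans
    ((congrArg _ (push_cap_zero ht hb q)).trans (P.coherent.push_const s q))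

theorem push_cap_comp_succ (ht : t = b ++ () :: []) (hb : b = b ++ [] ++ []) (q : P.Op [] ())
    (s : P.kind.ob b () ⟶ P.kind.ob r ()) (j : ℕ) :
    P.coherent.push (P.cap ht hb q ≫ s) (Fam.track (j + 1)) = P.coherent.push s (Fam.track j) :=
  (P.coherent.push_comp (P.cap ht hb q) s _).trans (congrArg _ (push_cap_succ ht hb q j))

/-- The upper tree leaves the edge $0$ alone, so its track becomes the negative constant given by
the cap. The edge $0$ therefore distinguishes left factors with and without a cap. -/
theorem not_nonneg_of_cap {f : P.kind.ob a () ⟶ P.kind.ob t ()} {todo : List Unit}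
    (hf : Upper P.toPlanarOperad CycPerms P.rel ψ.NegOneOrId () [] todo f) (ht : t = b ++ () :: [])
    (hb : b = b ++ [] ++ []) {q : P.Op [] ()} (hq : ψ.deg q = -1)
    (s : P.kind.ob b () ⟶ P.kind.ob r ()) :
    ¬ (P.coherent.push (f ≫ P.cap ht hb q ≫ s) (Fam.track 0)).Nonneg ψ.toNiceGrading := by
  rw [push_upper_zero hf, push_cap_comp_zero]
  intro h
  have := Fam.nonneg_of_const h
  omega

/-- The edge $0$ decides whether there is a cap and which operation marks it. With equal caps
counted as part of the right factors, the upper trees are compared by the rooted argument. -/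
theorem RNeg.unique {l : P.kind.ob x () ⟶ P.kind.ob s ()} {l' : P.kind.ob x () ⟶ P.kind.ob t ()}
    (hl : P.RNeg ψ l) (hl' : P.RNeg ψ l') (g : P.kind.ob s () ⟶ P.kind.ob r ())
    (g' : P.kind.ob t () ⟶ P.kind.ob r ())
    (hg : ∀ i, (P.coherent.push g (Fam.track i)).Nonneg ψ.toNiceGrading)
    (hg' : ∀ i, (P.coherent.push g' (Fam.track i)).Nonneg ψ.toNiceGrading)
    (h : l ≫ g = l' ≫ g') : ∃ h : P.kind.ob s () = P.kind.ob t (), l ≫ eqToHom h = l' := by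
  rcases hl.elim with hu | ⟨a, f, ht, hb, q, hf, hq, rfl⟩ <;>
    rcases hl'.elim with hu' | ⟨a', f', ht', hb', q', hf', hq', rfl⟩
  · exact P.coherent.upper_unique hu hu' g g' (fun i _ => hg i) (fun i _ => hg' i) h
  · refine absurd ?_ (not_nonneg_of_cap hf' ht' hb' hq' g')
    have h2 : l ≫ g = f' ≫ P.cap ht' hb' q' ≫ g' := h.trans (Category.assoc _ _ _)
    rw [← h2, push_upper_zero hu]
    exact hg 0
  · refine absurd ?_ (not_nonneg_of_cap hf ht hb hq g)
    have h2 : l' ≫ g' = f ≫ P.cap ht hb q ≫ g := h.symm.trans (Category.assoc _ _ _)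
    rw [← h2, push_upper_zero hu']
    exact hg' 0
  · have h1 : f ≫ P.cap ht hb q ≫ g = f' ≫ P.cap ht' hb' q' ≫ g' :=
      (Category.assoc _ _ _).symm.trans (h.trans (Category.assoc _ _ _))
    have h2 : q = q' := by
      have := congrArg (fun g => P.coherent.push g (Fam.track 0)) h1
      rw [push_upper_zero hf, push_upper_zero hf', push_cap_comp_zero, push_cap_comp_zero] at this
      exact Fam.const_injective this
    subst h2
    -- These right factors have a negative constant at the edge $0$. The comparison of upper trees
    -- asks for nonnegativity only from the edge $1$ on, and there the cap shifts edges to those of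
    -- `g` and `g'`.
    obtain ⟨h3, h4⟩ := P.coherent.upper_unique hf hf' (P.cap ht hb q ≫ g) (P.cap ht' hb' q ≫ g')
      (fun i hi => by
        obtain ⟨i, rfl⟩ := Nat.exists_eq_add_of_le' hi
        rw [push_cap_comp_succ]
        exact hg i)
      (fun i hi => by
        obtain ⟨i, rfl⟩ := Nat.exists_eq_add_of_le' hi
        rw [push_cap_comp_succ]
        exact hg' i) h1
    obtain rfl : a = a' := congrArg (fun Z : P.kind.Env => Z.as.1) h3
    obtain rfl : s = t := List.append_cancel_right (ht.symm.trans ht')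
    obtain rfl : f = f' := (Category.comp_id f).symm.trans h4
    exact ⟨rfl, Category.comp_id _⟩

/-- The identity morphism tracks every edge by a wire of grading $0$, so neither a cap nor an upper
vertex of grading $-1$ is possible. -/
theorem RNeg.split (hD : ψ.DependsOnColours) {l : P.kind.ob x () ⟶ P.kind.ob s ()}
    (hl : P.RNeg ψ l) (g : P.kind.ob s () ⟶ P.kind.ob x ()) (h : l ≫ g = 𝟙 _) :
    ∃ h : P.kind.ob x () = P.kind.ob s (), l = eqToHom h := by
  have key : ∀ i, (P.coherent.push (𝟙 (P.kind.ob x ())) (Fam.track i)).Nonneg ψ.toNiceGrading := by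
    intro i
    rw [P.coherent.push_id]
    exact Fam.nonneg_track (K := P.kind) (invariant hD) i
  rcases hl.elim with hu | ⟨a, f, ht, hb, q, hf, hq, rfl⟩
  · exact P.coherent.upper_eqToHom hu g fun i _ => h ▸ key i
  · refine absurd ?_ (not_nonneg_of_cap hf ht hb hq g)
    have h2 : f ≫ P.cap ht hb q ≫ g = 𝟙 _ := (Category.assoc _ _ _).symm.trans h
    exact h2 ▸ key 0

theorem deg_cap (hD : ψ.DependsOnColours) (ht : t = s ++ () :: []) (hs : s = s ++ [] ++ [])
    (q : P.Op [] ()) (p : P.Op t ()) :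
    ψ.deg (P.kind.opAct.map (P.cap ht hs q) p) = ψ.deg p + ψ.deg q := by
  have h1 := P.kind.opAct.map_comp (P.kind.mPerm (rot t) ()) (P.kind.mPlug s [] ht hs q ()) p
  have h2 : ψ.deg (P.kind.opAct.map (P.kind.mPerm (rot t) ()) p) = ψ.deg p :=
    (congrArg ψ.deg (P.kind.opAct_perm (rot t) () p)).trans (invariant hD (rot t) p)
  rw [← h2]
  exact (congrArg ψ.deg h1).trans (Kind.deg_plug (K := P.kind) ht hs q _)

theorem RNeg.deg (hD : ψ.DependsOnColours) {l : P.kind.ob x () ⟶ P.kind.ob s ()}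
    (hl : P.RNeg ψ l) (p : P.Op x ()) :
    IsIso l ∨ ψ.deg (P.kind.opAct.map l p) < ψ.deg p := by
  rcases hl.elim with hu | ⟨a, f, ht, hb, q, hf, hq, rfl⟩
  · exact (Kind.deg_upper (K := P.kind) hu).imp (fun h => h.1) fun h => h p
  · right
    have h1 := deg_cap hD ht hb q (P.kind.opAct.map f p)
    have h2 := P.kind.opAct.map_comp f (P.cap ht hb q) p
    have h3 : ψ.deg (P.kind.opAct.map f p) ≤ ψ.deg p :=
      (Kind.deg_upper (K := P.kind) hf).elim (fun h => (h.2 p).le) fun h => (h p).le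
    exact ((congrArg ψ.deg h2).trans h1).trans_lt (by omega)

theorem RNonneg.keepsNonneg (hD : ψ.DependsOnColours) {X Y : P.kind.Env} {g : X ⟶ Y}
    (hg : P.RNonneg ψ g) : P.coherent.KeepsNonneg (a := X.as.1) (d := X.as.2) (b := Y.as.1)
      (e := Y.as.2) ψ.toNiceGrading g := by
  have hψ : Kind.Invariant (K := P.kind) ψ.toNiceGrading := invariant hD
  cases hg with
  | rooted g hg => exact Kind.Coherent.keepsNonneg_permuted (K := P.kind) hψ hg
  | cap f hf ha hr q hq σ =>
    cases hf with
    | mk f hf =>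
      exact (Kind.Coherent.keepsNonneg_upper hψ hf).comp (Kind.Coherent.KeepsNonneg.comp
        ((Kind.Coherent.keepsNonneg_perm (hK := P.coherent) (rot _)).comp
          (Kind.Coherent.keepsNonneg_plug hψ ha hr hq))
        (Kind.Coherent.keepsNonneg_perm (K := P.kind) σ))

theorem RNonneg.raises (hD : ψ.DependsOnColours) {X Y : P.kind.Env} {g : X ⟶ Y}
    (hg : P.RNonneg ψ g) : Kind.Raises (K := P.kind) (a := X.as.1) (d := X.as.2) (b := Y.as.1)
      (e := Y.as.2) ψ.toNiceGrading g := by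
  have hψ : Kind.Invariant (K := P.kind) ψ.toNiceGrading := invariant hD
  cases hg with
  | rooted g hg => exact Kind.raises_permuted (K := P.kind) hψ hg
  | cap f hf ha hr q hq σ =>
    cases hf with
    | mk f hf =>
      exact (Kind.raises_upper (K := P.kind) hf).comp (Kind.Raises.comp
        ((Kind.raises_perm hψ (rot _)).comp (Kind.raises_plug ha hr hq)) (Kind.raises_perm hψ σ))

theorem reedyData (P : CyclicOperad.{v}) (ψ : SymNiceGrading P.toSymmetricOperad)
    (hD : ψ.DependsOnColours) :
    ReedyData P.eval (CyclicOperad.onTw ψ) (P.rNeg ψ) (P.rNonneg ψ) ψ.IsGroupoidal where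
  id_left X := .id X
  comp_left _ _ _ _ _ hf hg := RNeg.comp hf hg
  comp_right _ _ _ _ _ hf hg := RNonneg.comp hD hf hg
  exists_fac _ _ f := exists_fac ψ _ f rfl
  epi_left _ _ _ hf := RNeg.epi hf
  left_unique X Y Z Z' l r l' r' hl hr hl' hr' h := by
    have h1 := fun i => (RNonneg.keepsNonneg hD hr).track (invariant hD) i
    have h2 := fun i => (RNonneg.keepsNonneg hD hr').track (invariant hD) i
    exact RNeg.unique (x := X.as.1) (s := Z.as.1) (t := Z'.as.1) (r := Y.as.1) hl hl' r r' h1 h2 h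
  left_split X Y l s hl h := RNeg.split (x := X.as.1) (s := Y.as.1) hD hl s h
  deg_left X Y l hl p := RNeg.deg (x := X.as.1) (s := Y.as.1) hD hl p
  deg_right _ _ _ hr p := (RNonneg.raises hD hr).1 p
  isIso_of_deg_eq _ _ _ hG hr p hp := (RNonneg.raises hD hr).2 hG p (congrArg Subtype.val hp)
  gpd_of_isIso h := P.coherent.isGroupoidal fun _ _ r p hr =>
    h r p (.rooted r (permuted_of_rooted hr))
  deg_congr _ p q := Subtype.ext (hD p q rfl)

end CyclicOperad

end EnvReedy

open EnvReedy in
theorem mainTheorem10 :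
    (∀ (C : Type u) (P : PlanarOperad.{u, v} C) (ψ : NiceGrading P), ψ.DependsOnColours →
      EnvelopingImageReedy P.eval ψ.onTw (P.rNeg ψ) (P.rNonneg ψ) ψ.IsGroupoidal) ∧
    (∀ (C : Type u) (P : SymmetricOperad.{u, v} C) (ψ : SymNiceGrading P), ψ.DependsOnColours →
      EnvelopingImageReedy P.eval ψ.onTw (P.rNeg ψ) (P.rNonneg ψ) ψ.IsGroupoidal) ∧
    (∀ (P : CyclicOperad.{v}) (ψ : SymNiceGrading P.toSymmetricOperad), ψ.DependsOnColours →
      EnvelopingImageReedy P.eval (CyclicOperad.onTw ψ) (P.rNeg ψ) (P.rNonneg ψ)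
        ψ.IsGroupoidal) :=
  ⟨fun _ P ψ h => (P.reedyData ψ h).envelopingImageReedy,
    fun _ P ψ h => (P.reedyData ψ h).envelopingImageReedy,
    fun P ψ h => (P.reedyData ψ h).envelopingImageReedy⟩
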